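/- Let $0<q<1$, $(a;q)_\infty=\prod_{k\ge0}(1-aq^k)$, $(a;q)_k=\prod_{i<k}(1-aq^i)$, $(x;q)_\alpha=(x;q)_\infty/(q^\alpha x;q)_\infty$, with $(a_1,a_2,\dots;q)=\prod_i (a_i;q)$, $$B_q(a,b)=(1-q)\frac{(q,q^{a+b};q)_\infty}{(q^a,q^b;q)_\infty},\qquad \mathcal L_q(\nu;x,y)=(\nu xy,\nu xy^{-1},\nu x^{-1}y,\nu x^{-1}y^{-1};q)_\infty .$$ For $\alpha,\beta\in\mathbb C$ and $r,s\in\mathbb C\setminus\{0\}$ put $(a,b,c,d)=(sq^{\alpha/2},s^{-1}q^{\alpha/2},rq^{\beta/2},r^{-1}q^{\beta/2})$ and let $\Gamma^{rs}_{\alpha\beta}=C_{0,1}+\sum_w(C_{w,\varepsilon}-C_{w^{-1},\varepsilon})$, where $C_{z,\rho}$ is the counter-clockwise circle with centre $z$ and radius $\rho$, $w$ runs over the distinct points $xq^k$ ($x\in\{a,b,c,d\}$, $k\ge0$) with $|w|>1$, and $\varepsilon>0$ is small enough. Call $(\alpha,\beta,r,s)$ generic if $xyq^n\neq1$ and $|xq^n|\ne1$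 for all $x,y\in\{a,b,c,d\}$ and $n\ge0$, and $q^{\alpha+\beta+n}\ne1$ for all $n\ge 0$. Let $\mathrm{Ref}(t)$ be the space of complex Laurent polynomials in $t$ invariant under $t\mapsto t^{-1}$, and for $f\in\mathrm{Ref}(t)$ set $$(K_{\alpha\beta}f)(r,s)=\frac1{2\pi i}\int_{\Gamma^{rs}_{\alpha\beta}}\frac{dt}{t}\,\frac{(t^2,t^{-2};q)_\infty}{\mathcal L_q(q^{\alpha/2};s,t)\,\mathcal L_q(q^{\beta/2};r,t)}\,f(t),\qquad M_{\alpha\beta}=(K_{\alpha\beta}1)^{-1}\circ K_{\alpha\beta},$$ for generic parameters. Then $M_{\alpha\beta}$ extends continuously, in $(\alpha,\beta,r,s)$, to all parameters with $r,s\neq0$ and $q^{\alpha+\beta+n}\neq1$ for $n\ge0$, and for fixed $r$ it gives a linear operator $M^r_{\alpha\beta}:\mathrm{Ref}(t)\to\mathrm{Ref}(s)$. (1) If $r\ne0$ and $q^{\beta+n}\neq1$, $q^{\alpha+\beta+n}\ne1$ for all $n\ge0$, then $M^r_{\alpha\beta}$ is invertible and $$(M^r_{\alpha\beta})^{-1}=M^r_{-\alpha,\alpha+\beta}.$$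 Whenever $(-\alpha,\alpha+\beta,r,t)$ is generic, the inverse is $F\mapsto\frac1{2\pi i}\int_{\Gamma^{rt}_{-\alpha,\alpha+\beta}}\frac{ds}{s}\tilde{\mathcal M}^r_{\alpha\beta}(t|s)F(s)$ with $$\tilde{\mathcal M}^r_{\alpha\beta}(t|s)=\frac{(1-q)(q;q)_\infty^2(s^2,s^{-2};q)_\infty\,\mathcal L_q(q^{\beta/2};r,t)}{2B_q(-\alpha,\alpha+\beta)\,\mathcal L_q(q^{-\alpha/2};s,t)\,\mathcal L_q(q^{(\alpha+\beta)/2};r,s)} .$$ (2) Let $g>0$, $\ell=q^{-g}$, and let $\mathrm{Sym}(t_1,t_2;t_3)$ be the space of Laurent polynomials in $t_1,t_2,t_3$ symmetric in $t_1,t_2$. There is a linear bijection $M:\mathrm{Sym}(t_1,t_2;t_3)\to\mathrm{Sym}(y_1,y_2;x)$ such that, for all nonzero $x,y_+,y_-$, $(M\Psi)(x,y_1,y_2)$ at $y_1=y_+y_-$, $y_2=y_+y_-^{-1}$ equals the value at $s=y_-$ of $M^{r}_{g,2g}$, $r=\ell^{3/2}y_+$, applied to $t_-\mapsto\Psi(\ell^{3/2}xy_+t_-,\ell^{3/2}xy_+t_-^{-1},x)$;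 for generic $(g,2g,r,y_-)$ this is $$\frac1{2\pi i}\int_{\Gamma^{r,y_-}_{g,2g}}\frac{dt_-}{t_-}\,\frac{(1-q)(q;q)_\infty^2(t_-^2,t_-^{-2};q)_\infty\mathcal L_q(\ell^{-3/2};y_-,y_+\ell^{3/2})}{2B_q(g,2g)\mathcal L_q(\ell^{-1/2};y_-,t_-)\mathcal L_q(\ell^{-1};t_-,y_+\ell^{3/2})}\,\Psi(\ell^{3/2}xy_+t_-,\ell^{3/2}xy_+t_-^{-1},x).$$ Its inverse is as follows: for all nonzero $t_3,t_+,t_-$, $(M^{-1}\Phi)(t_1,t_2,t_3)$ at $t_1=t_+t_-t_3$, $t_2=t_+t_-^{-1}t_3$ equals the value at $t_-$ of $M^{t_+}_{-g,3g}$ applied to $y_-\mapsto\Phi(t_3,\ell^{-3/2}t_+y_-,\ell^{-3/2}t_+y_-^{-1})$; for generic $(-g,3g,t_+,t_-)$ (which forces $g\notin\mathbb Z$; for integer $g$ the continuous extension is meant) this is $$\frac1{2\pi i}\int_{\Gamma^{t_+,t_-}_{-g,3g}}\frac{dy_-}{y_-}\,\tilde{\mathcal M}(t_+,t_-|y_-)\,\Phi(t_3,\ell^{-3/2}t_+y_-,\ell^{-3/2}t_+y_-^{-1}),$$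 $$\tilde{\mathcal M}(t_+,t_-|y_-)=\frac{(1-q)(q;q)_\infty^2(y_-^2,y_-^{-2};q)_\infty\mathcal L_q(\ell^{-1};t_-,t_+)}{2B_q(-g,3g)\mathcal L_q(\ell^{1/2};y_-,t_-)\mathcal L_q(\ell^{-3/2};y_-,t_+)}.$$ (3) Let $\lambda_1\le\lambda_2\le\lambda_3$ be integers, $\lambda_{jk}=\lambda_j-\lambda_k$, $|\lambda|=\lambda_1+\lambda_2+\lambda_3$. There is a unique Laurent polynomial $S_\lambda$ such that, for $0<|y|<1$ with $(q^{1-3g}y;q)_\infty\ne0$, $$S_\lambda(y)=y^{\lambda_1}(y;q)_{1-3g}\;{}_3\phi_2\!\left[\begin{matrix}\ell^3q^{1-\lambda_{31}},\ \ell^2q^{1-\lambda_{21}},\ \ell q\\ \ell^2q^{1-\lambda_{31}},\ \ell q^{1-\lambda_{21}}\end{matrix};q,y\right],$$ where the ratios $(bq^\nu;q)_k/(b;q)_k$ in the series (with $(b,\nu)=(\ell^2q^{1-\lambda_{31}},\lambda_{32})$ and $(\ell q^{1-\lambda_{21}},\lambda_{21})$) are read as $(bq^k;q)_\nu/(b;q)_\nu$.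 Let $$c_\lambda=\ell^{4\lambda_1-\lambda_2}\frac{(\ell^{-2};q)_{\lambda_{31}}(\ell^{-2};q)_{\lambda_{32}}(\ell^{-1};q)_{\lambda_{21}}}{(\ell^{-3};q)_{\lambda_{31}}(\ell^{-1};q)_{\lambda_{32}}(\ell^{-2};q)_{\lambda_{21}}} .$$ Then $M^{-1}$ maps $c_\lambda x^{|\lambda|}S_\lambda(y_1)S_\lambda(y_2)$ to the $A_2$ Macdonald polynomial $P_\lambda(t_1,t_2,t_3)$, i.e. to the unique Laurent polynomial of the form $m_\lambda+\sum_{\mu\prec\lambda}\kappa_\mu m_\mu$ ($m_\mu$ the monomial symmetric functions, $\prec$ the dominance order) that satisfies $H_iP_\lambda=h_iP_\lambda$, $i=1,2,3$, where $H_i=\sum_{|J|=i}\prod_{j\in J,k\notin J}\frac{\ell^{-1/2}t_j-\ell^{1/2}t_k}{t_j-t_k}\prod_{j\in J}T_j$ ($J\subset\{1,2,3\}$, $T_j:t_j\mapsto qt_j$) and $h_i$ is the $i$-th elementary symmetric function of $\ell q^{\lambda_1},q^{\lambda_2},\ell^{-1}q^{\lambda_3}$. In particular, for $t_3\ne0$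 and generic $(-g,3g,t_+,t_-)$, $$P_\lambda(t_+t_-t_3,\,t_+t_-^{-1}t_3,\,t_3)=\frac{1}{2\pi i}\int_{\Gamma^{t_+,t_-}_{-g,3g}}\frac{dy_-}{y_-}\,\tilde{\mathcal M}(t_+,t_-|y_-)\,c_\lambda t_3^{|\lambda|}S_\lambda(\ell^{-3/2}t_+y_-)\,S_\lambda(\ell^{-3/2}t_+y_-^{-1}).$$ -/

import Mathlib

open Filter Topology
open scoped LaurentPolynomial

namespace MacdonaldSoV

noncomputable section

/-! ## Formulas from `q`-analysis -/

/-- The infinite `q`-shifted factorial `(a; q)_∞ = ∏_{k ≥ 0} (1 - a q^k)`. -/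
def qInf (q : ℝ) (a : ℂ) : ℂ := ∏' k : ℕ, (1 - a * (q : ℂ) ^ k)

/-- The finite `q`-shifted factorial `(a; q)_k = (1 - a)(1 - aq) ⋯ (1 - aq^{k-1})`. -/
def qPoch (q : ℝ) (a : ℂ) (k : ℕ) : ℂ := ∏ i ∈ Finset.range k, (1 - a * (q : ℂ) ^ i)

/-- The generalized `q`-shifted factorial `(x; q)_α = (x; q)_∞ / (q^α x; q)_∞`. -/
def qPochC (q : ℝ) (x α : ℂ) : ℂ := qInf q x / qInf q ((q : ℂ) ^ α * x)

/-- The `q`-Beta function `B_q(a,b) = (1-q) (q, q^{a+b}; q)_∞ / (q^a, q^b; q)_∞`. -/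
def qBeta (q : ℝ) (a b : ℂ) : ℂ :=
  (1 - q) * (qInf q q * qInf q ((q : ℂ) ^ (a + b))) /
    (qInf q ((q : ℂ) ^ a) * qInf q ((q : ℂ) ^ b))

/-- `L_q(ν; x, y) = (νxy, νxy⁻¹, νx⁻¹y, νx⁻¹y⁻¹; q)_∞`. -/
def Lq (q : ℝ) (ν x y : ℂ) : ℂ :=
  qInf q (ν * x * y) * qInf q (ν * x * y⁻¹) * qInf q (ν * x⁻¹ * y) * qInf q (ν * x⁻¹ * y⁻¹)

/-- The basic hypergeometric series `₃φ₂[a₁,a₂,a₃; b₁,b₂; q, y]`. -/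
def phi32 (q : ℝ) (a₁ a₂ a₃ b₁ b₂ y : ℂ) : ℂ :=
  ∑' k : ℕ, qPoch q a₁ k * qPoch q a₂ k * qPoch q a₃ k /
    (qPoch q q k * qPoch q b₁ k * qPoch q b₂ k) * y ^ k

/-! ## The Askey–Wilson weight and contour -/

/-- The Askey–Wilson weight `w(a,b,c,d;t)`. -/
def awWeight (q : ℝ) (a b c d t : ℂ) : ℂ :=
  qInf q (t ^ 2) * qInf q (t ^ 2)⁻¹ /
    (qInf q (a * t) * qInf q (a * t⁻¹) * qInf q (b * t) * qInf q (b * t⁻¹) *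
      qInf q (c * t) * qInf q (c * t⁻¹) * qInf q (d * t) * qInf q (d * t⁻¹))

/-- The poles `x q^k` (`x ∈ {a,b,c,d}`, `k ≥ 0`) of the weight outside of the closed unit disc. -/
def awOuterPoles (q : ℝ) (a b c d : ℂ) : Set ℂ :=
  {w | (∃ x ∈ ({a, b, c, d} : Set ℂ), ∃ k : ℕ, w = x * (q : ℂ) ^ k) ∧ 1 < ‖w‖}

/-- The parameters for which the Askey–Wilson cycle is defined: no pole lies on the unit circle
and no pole of the form `x q^j` coincides with a pole of the form `y⁻¹ q^{-k}`. -/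
def AWGeneric (q : ℝ) (a b c d : ℂ) : Prop :=
  (∀ x ∈ ({a, b, c, d} : Set ℂ), ∀ y ∈ ({a, b, c, d} : Set ℂ), ∀ n : ℕ,
    x * y * (q : ℂ) ^ n ≠ 1) ∧
  ∀ x ∈ ({a, b, c, d} : Set ℂ), ∀ k : ℕ, ‖x * (q : ℂ) ^ k‖ ≠ 1

/-- `(1 / 2πi) ∫_Γ h(t) dt / t` over the Askey–Wilson cycle
`Γ_{abcd} = C_{0,1} + ∑ (C_{w,ε} - C_{w⁻¹,ε})`, the (finite) sum being over the distinct poles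
`w = x q^k` with `x ∈ {a,b,c,d}`, `k ≥ 0` and `|w| > 1`. -/
def awIntegral (q : ℝ) (a b c d : ℂ) (ε : ℝ) (h : ℂ → ℂ) : ℂ :=
  (2 * Real.pi * Complex.I)⁻¹ *
    ((∮ t in C(0, 1), h t / t) +
      ∑ᶠ w ∈ awOuterPoles q a b c d,
        ((∮ t in C(w, ε), h t / t) - ∮ t in C(w⁻¹, ε), h t / t))

/-! ## The operator `M_{αβ}` -/

/-- The kernel `K_{αβ}(r,s|t)`: the Askey–Wilson weight with
`a = s q^{α/2}`, `b = s⁻¹ q^{α/2}`, `c = r q^{β/2}`, `d = r⁻¹ q^{β/2}`. -/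
def kernelK (q : ℝ) (α β r s t : ℂ) : ℂ :=
  awWeight q (s * (q : ℂ) ^ (α / 2)) (s⁻¹ * (q : ℂ) ^ (α / 2))
    (r * (q : ℂ) ^ (β / 2)) (r⁻¹ * (q : ℂ) ^ (β / 2)) t

/-- `(1 / 2πi) ∫ h(t) dt / t` over the cycle `Γ_{αβ}^{rs}`. -/
def cycleInt (q : ℝ) (α β r s : ℂ) (ε : ℝ) (h : ℂ → ℂ) : ℂ :=
  awIntegral q (s * (q : ℂ) ^ (α / 2)) (s⁻¹ * (q : ℂ) ^ (α / 2))
    (r * (q : ℂ) ^ (β / 2)) (r⁻¹ * (q : ℂ) ^ (β / 2)) ε h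

/-- The parameters for which the integral defining `M_{αβ}` makes sense: the cycle `Γ_{αβ}^{rs}`
is defined and `α + β` is not a pole of `M_{αβ}`. -/
def Generic (q : ℝ) (α β r s : ℂ) : Prop :=
  r ≠ 0 ∧ s ≠ 0 ∧ (∀ n : ℕ, (q : ℂ) ^ (α + β) * (q : ℂ) ^ n ≠ 1) ∧
  AWGeneric q (s * (q : ℂ) ^ (α / 2)) (s⁻¹ * (q : ℂ) ^ (α / 2))
    (r * (q : ℂ) ^ (β / 2)) (r⁻¹ * (q : ℂ) ^ (β / 2))

/-- The operator `K_{αβ}` with the kernel `K_{αβ}(r,s|t)` and the cycle `Γ_{αβ}^{rs}`. -/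
def opK (q : ℝ) (α β r s : ℂ) (ε : ℝ) (f : ℂ → ℂ) : ℂ :=
  cycleInt q α β r s ε fun t => kernelK q α β r s t * f t

/-- Evaluation of a Laurent polynomial in one variable. -/
def ev (f : ℂ[T;T⁻¹]) (z : ℂ) : ℂ := f.coeff.sum fun n a => a * z ^ n

/-- The space `Ref(t)` of reflexive (invariant under `t ↦ t⁻¹`) Laurent polynomials. -/
def Ref : Submodule ℂ ℂ[T;T⁻¹] where
  carrier := {f | LaurentPolynomial.invert f = f}
  add_mem' := by
    intro f g hf hg
    simp only [Set.mem_ofPred_eq] at hf hg ⊢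
    rw [map_add, hf, hg]
  zero_mem' := by simp
  smul_mem' := by
    intro c f hf
    simp only [Set.mem_ofPred_eq] at hf ⊢
    rw [map_smul, hf]

/-- `M α β r` is the operator `M_{αβ}^r = (K_{αβ} · 1)⁻¹ ∘ K_{αβ} : Ref(t) → Ref(s)`
with `r` as a parameter. At generic parameters it is given by the contour integral, for all
sufficiently small radii `ε` of the small circles in the cycle; for the exceptional values of the
parameters (where the cycle is pinched, e.g. for `α ∈ {0, -1, -2, …}`) it is understood as the
continuous extension from the generic ones, which are dense in the domain below. -/
structure IsOperatorM (q : ℝ) (M : ℂ → ℂ → ℂ → (Ref →ₗ[ℂ] Ref)) : Prop where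
  integral : ∀ (f : Ref) (α β r s : ℂ), Generic q α β r s →
    ∀ᶠ ε in 𝓝[>] (0 : ℝ),
      ev (M α β r f) s = opK q α β r s ε (ev f) / opK q α β r s ε (fun _ => 1)
  continuousOn : ∀ f : Ref,
    ContinuousOn (fun p : ℂ × ℂ × ℂ × ℂ => ev (M p.1 p.2.1 p.2.2.1 f) p.2.2.2)
      {p | p.2.2.1 ≠ 0 ∧ p.2.2.2 ≠ 0 ∧
        ∀ n : ℕ, (q : ℂ) ^ (p.1 + p.2.1) * (q : ℂ) ^ n ≠ 1}

/-- The integral kernel of the inverse operator, as a function of the output variable `t`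
and the integration variable `s`. -/
def kernelInv (q : ℝ) (α β r t s : ℂ) : ℂ :=
  (1 - q) * qInf q q ^ 2 * (qInf q (s ^ 2) * qInf q (s ^ 2)⁻¹) *
      Lq q ((q : ℂ) ^ (β / 2)) r t /
    (2 * qBeta q (-α) (α + β) *
      Lq q ((q : ℂ) ^ (-α / 2)) s t * Lq q ((q : ℂ) ^ ((α + β) / 2)) r s)

/-! ## The operator `M` for `α = g`, `β = 2g` -/

/-- `ℓ = q^{-g}`. -/
def ell (q g : ℝ) : ℝ := q ^ (-g)

/-- The power `ℓ^e`, `e` real. -/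
def ellPow (q g e : ℝ) : ℂ := ((ell q g ^ e : ℝ) : ℂ)

/-- The kernel of `M`. -/
def kernelM (q g : ℝ) (yp ym tm : ℂ) : ℂ :=
  (1 - q) * qInf q q ^ 2 * (qInf q (tm ^ 2) * qInf q (tm ^ 2)⁻¹) *
      Lq q (ellPow q g (-(3 / 2))) ym (yp * ellPow q g (3 / 2)) /
    (2 * qBeta q g (2 * g) * Lq q (ellPow q g (-(1 / 2))) ym tm *
      Lq q (ellPow q g (-1)) tm (yp * ellPow q g (3 / 2)))

/-- The kernel of `M⁻¹`. -/
def kernelMInv (q g : ℝ) (tp tm ym : ℂ) : ℂ :=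
  (1 - q) * qInf q q ^ 2 * (qInf q (ym ^ 2) * qInf q (ym ^ 2)⁻¹) *
      Lq q (ellPow q g (-1)) tm tp /
    (2 * qBeta q (-g) (3 * g) * Lq q (ellPow q g (1 / 2)) ym tm *
      Lq q (ellPow q g (-(3 / 2))) ym tp)

/-- Laurent polynomials in three variables. -/
abbrev Laurent3 : Type := AddMonoidAlgebra ℂ (Fin 3 → ℤ)

/-- Evaluation of a Laurent polynomial in three variables at `(u, v, w)`. -/
def ev3 (F : Laurent3) (u v w : ℂ) : ℂ :=
  F.coeff.sum fun n a => a * (u ^ n 0 * v ^ n 1 * w ^ n 2)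

/-- The Laurent polynomials in three variables which are symmetric in the first two of them.
This is `Sym(t₁,t₂;t₃)`, and also `Sym(y₁,y₂;x)` with the variables in the order
`(y₁, y₂, x)`. -/
def Sym12 : Submodule ℂ Laurent3 where
  carrier := {F | ∀ n : Fin 3 → ℤ, F.coeff (n ∘ Equiv.swap 0 1) = F.coeff n}
  add_mem' := by
    intro F G hF hG n
    have h1 := hF n
    have h2 := hG n
    simp [h1, h2]
  zero_mem' := by intro n; simp
  smul_mem' := by
    intro c F hF n
    have h1 := hF n
    simp [h1]

/-! ## Macdonald polynomials for `A₂` -/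

/-- `v_{jk} = (ℓ^{-1/2} t_j - ℓ^{1/2} t_k) / (t_j - t_k)`. -/
def vCoef (q g : ℝ) (t : Fin 3 → ℂ) (j k : Fin 3) : ℂ :=
  (ellPow q g (-(1 / 2)) * t j - ellPow q g (1 / 2) * t k) / (t j - t k)

/-- The Hamiltonian `H_i = ∑_{|J| = i} (∏_{j ∈ J, k ∉ J} v_{jk}) ∏_{j ∈ J} T_j`, where `T_j` is
the shift `t_j ↦ q t_j`. -/
def hamiltonian (q g : ℝ) (i : ℕ) (f : (Fin 3 → ℂ) → ℂ) (t : Fin 3 → ℂ) : ℂ :=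
  ∑ J ∈ Finset.powersetCard i (Finset.univ : Finset (Fin 3)),
    (∏ j ∈ J, ∏ k ∈ Jᶜ, vCoef q g t j k) * f (fun j => if j ∈ J then (q : ℂ) * t j else t j)

/-- The eigenvalue `h_i = ∑_{j₁ < ⋯ < j_i} μ_{j₁} ⋯ μ_{j_i}`, where
`(μ₁, μ₂, μ₃) = (ℓ q^{λ₁}, q^{λ₂}, ℓ⁻¹ q^{λ₃})`. -/
def eigenvalue (q g : ℝ) (i : ℕ) (lam : Fin 3 → ℤ) : ℂ :=
  ∑ J ∈ Finset.powersetCard i (Finset.univ : Finset (Fin 3)),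
    ∏ j ∈ J, (q : ℂ) ^ lam j * (ell q g : ℂ) ^ (1 - ((j : ℕ) : ℤ))

/-- The monomial symmetric function `m_λ`. -/
def monomialSym (lam : Fin 3 → ℤ) : Laurent3 :=
  ∑ ν ∈ (Finset.univ : Finset (Equiv.Perm (Fin 3))).image
      (fun σ : Equiv.Perm (Fin 3) => lam ∘ (σ : Fin 3 → Fin 3)),
    AddMonoidAlgebra.single ν 1

/-- The dominance order `μ ≼ λ` on the dominant weights `λ₁ ≤ λ₂ ≤ λ₃`. -/
def DomLE (μ lam : Fin 3 → ℤ) : Prop :=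
  ∑ j, μ j = ∑ j, lam j ∧ ∀ k : Fin 3, ∑ j ∈ Finset.Ici k, μ j ≤ ∑ j ∈ Finset.Ici k, lam j

/-- `P` is the Macdonald polynomial `P_λ^{(ℓ;q)}(t₁,t₂,t₃)`: a joint eigenvector of the
Hamiltonians of the form `m_λ + ∑_{μ ≺ λ} κ_μ m_μ`. -/
structure IsMacdonald (q g : ℝ) (lam : Fin 3 → ℤ) (P : Laurent3) : Prop where
  triangular : ∃ κ : (Fin 3 → ℤ) →₀ ℂ,
    (∀ μ ∈ κ.support, Monotone μ ∧ DomLE μ lam) ∧ κ lam = 1 ∧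
      P = κ.sum fun μ a => a • monomialSym μ
  eigen : ∀ i : ℕ, 1 ≤ i → i ≤ 3 → ∀ t : Fin 3 → ℂ, (∀ j, t j ≠ 0) → Function.Injective t →
    hamiltonian q g i (fun u => ev3 P (u 0) (u 1) (u 2)) t =
      eigenvalue q g i lam * ev3 P (t 0) (t 1) (t 2)

/-! ## The separated polynomials -/

/-- The ratio `(b q^ν; q)_k / (b; q)_k`, written as `(b q^k; q)_ν / (b; q)_ν`. -/
def pochRatio (q : ℝ) (b : ℂ) (ν k : ℕ) : ℂ :=
  qPoch q (b * (q : ℂ) ^ k) ν / qPoch q b ν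

/-- The parameter `b₁ = ℓ² q^{1-λ₃₁}`. -/
def sepB₁ (q g : ℝ) (lam : Fin 3 → ℤ) : ℂ :=
  (ell q g : ℂ) ^ 2 * (q : ℂ) ^ (1 - (lam 2 - lam 0))

/-- The parameter `b₂ = ℓ q^{1-λ₂₁}`. -/
def sepB₂ (q g : ℝ) (lam : Fin 3 → ℤ) : ℂ :=
  (ell q g : ℂ) * (q : ℂ) ^ (1 - (lam 1 - lam 0))

/-- The parameter `a₁ = ℓ³ q^{1-λ₃₁}`. -/
def sepA₁ (q g : ℝ) (lam : Fin 3 → ℤ) : ℂ :=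
  (ell q g : ℂ) ^ 3 * (q : ℂ) ^ (1 - (lam 2 - lam 0))

/-- The series `₃φ₂[ℓ³q^{1-λ₃₁}, ℓ²q^{1-λ₂₁}, ℓq; ℓ²q^{1-λ₃₁}, ℓq^{1-λ₂₁}; q, y]`. Since
`ℓ²q^{1-λ₂₁} = b₁ q^{λ₃₂}` and `ℓq = b₂ q^{λ₂₁}`, the ratios of the factorials are polynomials in
`q^k`; in this form the series makes sense for all `g > 0`, also where the factorials in the
denominators vanish (see `sepSeries_eq_phi32`). -/
def sepSeries (q g : ℝ) (lam : Fin 3 → ℤ) (y : ℂ) : ℂ :=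
  ∑' k : ℕ, qPoch q (sepA₁ q g lam) k / qPoch q q k *
    (pochRatio q (sepB₁ q g lam) (lam 2 - lam 1).toNat k *
      pochRatio q (sepB₂ q g lam) (lam 1 - lam 0).toNat k) * y ^ k

theorem qPoch_add (q : ℝ) (b : ℂ) (m n : ℕ) :
    qPoch q b (m + n) = qPoch q b m * qPoch q (b * (q : ℂ) ^ m) n := by
  unfold qPoch
  rw [Finset.prod_range_add]
  congr 1
  refine Finset.prod_congr rfl fun i _ => ?_
  rw [pow_add]; ring

theorem qPoch_ne_zero {q : ℝ} {b : ℂ} (hb : ∀ n : ℕ, b * (q : ℂ) ^ n ≠ 1) (k : ℕ) :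
    qPoch q b k ≠ 0 := by
  unfold qPoch
  exact Finset.prod_ne_zero_iff.2 fun i _ => sub_ne_zero.2 (hb i).symm

theorem pochRatio_eq {q : ℝ} {b : ℂ} (hb : ∀ n : ℕ, b * (q : ℂ) ^ n ≠ 1) (ν k : ℕ) :
    pochRatio q b ν k = qPoch q (b * (q : ℂ) ^ ν) k / qPoch q b k := by
  unfold pochRatio
  rw [div_eq_div_iff (qPoch_ne_zero hb ν) (qPoch_ne_zero hb k)]
  have h1 := qPoch_add q b k ν
  have h2 := qPoch_add q b ν k
  rw [add_comm k ν, h2] at h1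
  linear_combination -h1

theorem sepSeries_eq_phi32 {q g : ℝ} (hq : 0 < q) {lam : Fin 3 → ℤ} (hlam : Monotone lam)
    (h₁ : ∀ n : ℕ, sepB₁ q g lam * (q : ℂ) ^ n ≠ 1)
    (h₂ : ∀ n : ℕ, sepB₂ q g lam * (q : ℂ) ^ n ≠ 1) (y : ℂ) :
    sepSeries q g lam y =
      phi32 q ((ell q g : ℂ) ^ 3 * (q : ℂ) ^ (1 - (lam 2 - lam 0)))
        ((ell q g : ℂ) ^ 2 * (q : ℂ) ^ (1 - (lam 1 - lam 0))) ((ell q g : ℂ) * q)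
        ((ell q g : ℂ) ^ 2 * (q : ℂ) ^ (1 - (lam 2 - lam 0)))
        ((ell q g : ℂ) * (q : ℂ) ^ (1 - (lam 1 - lam 0))) y := by
  have hq' : (q : ℂ) ≠ 0 := by exact_mod_cast hq.ne'
  have e₁ : lam 1 ≤ lam 2 := hlam (by decide)
  have e₀ : lam 0 ≤ lam 1 := hlam (by decide)
  have c₁ : sepB₁ q g lam * (q : ℂ) ^ (lam 2 - lam 1).toNat =
      (ell q g : ℂ) ^ 2 * (q : ℂ) ^ (1 - (lam 1 - lam 0)) := by
    unfold sepB₁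
    rw [mul_assoc, ← zpow_natCast (q : ℂ) (lam 2 - lam 1).toNat, ← zpow_add₀ hq']
    congr 2
    omega
  have c₂ : sepB₂ q g lam * (q : ℂ) ^ (lam 1 - lam 0).toNat = (ell q g : ℂ) * q := by
    unfold sepB₂
    rw [mul_assoc, ← zpow_natCast (q : ℂ) (lam 1 - lam 0).toNat, ← zpow_add₀ hq']
    have : (1 - (lam 1 - lam 0) + ((lam 1 - lam 0).toNat : ℤ)) = 1 := by omega
    rw [this, zpow_one]
  unfold sepSeries phi32
  refine tsum_congr fun k => ?_
  rw [pochRatio_eq h₁, pochRatio_eq h₂, c₁, c₂]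
  unfold sepA₁ sepB₁ sepB₂
  rw [div_mul_div_comm, div_mul_div_comm]
  congr 2 <;> ring

/-- `S` is the Laurent polynomial `S_λ^{(ℓ;q)}(y)`, given for `0 < |y| < 1` (away from the
removable singularities of the right-hand side) by
`S_λ(y) = y^{λ₁} (y;q)_{1-3g} ₃φ₂[ℓ³q^{1-λ₃₁}, ℓ²q^{1-λ₂₁}, ℓq; ℓ²q^{1-λ₃₁}, ℓq^{1-λ₂₁}; q, y]`. -/
def IsSepPoly (q g : ℝ) (lam : Fin 3 → ℤ) (S : ℂ[T;T⁻¹]) : Prop :=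
  ∀ y : ℂ, y ≠ 0 → ‖y‖ < 1 → qInf q ((q : ℂ) ^ (1 - 3 * g : ℂ) * y) ≠ 0 →
    ev S y = y ^ lam 0 * qPochC q y (1 - 3 * g) * sepSeries q g lam y

/-- The normalization coefficient `c_λ`. -/
def cCoef (q g : ℝ) (lam : Fin 3 → ℤ) : ℂ :=
  (ell q g : ℂ) ^ (4 * lam 0 - lam 1) *
    (qPoch q (ellPow q g (-2)) (lam 2 - lam 0).toNat *
      qPoch q (ellPow q g (-2)) (lam 2 - lam 1).toNat *
      qPoch q (ellPow q g (-1)) (lam 1 - lam 0).toNat) /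
    (qPoch q (ellPow q g (-3)) (lam 2 - lam 0).toNat *
      qPoch q (ellPow q g (-1)) (lam 2 - lam 1).toNat *
      qPoch q (ellPow q g (-2)) (lam 1 - lam 0).toNat)

end

end MacdonaldSoV

open MacdonaldSoV

/-!
The operator `M^r_{αβ}` is diagonal in a suitable pair of bases. With `c = r q^{β/2}` and
`c' = r q^{(α+β)/2}` it maps `(ct, c/t; q)_n` to `(q^β; q)_n / (q^{α+β}; q)_n` times
`(c's, c'/s; q)_n`. This is taken as the definition of `opM`, through the Newton expansion of a
polynomial in `t + t⁻¹` with the nodes `c q^k + (c q^k)⁻¹`; see `opM_refEquiv_awPoly`. Replacing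
`(α, β)` by `(-α, α + β)` exchanges the two bases and inverts the factor, which gives the inversion
formula (`opM_comp`, `opM_inverse`). The Newton coefficients are continuous in the parameters, which
gives `continuousOn_ev_opM`.

That `opM` is the normalized integral operator (`isOperatorM_opM`, `ev_opM_eventually_eq`) is the
Askey–Wilson integral: multiplying the weight by `(ct, c/t; q)_n` shifts the parameter `c` to
`c q^n` (`cycleFunctional_qPoch`). The integral itself is evaluated by the residue theorem in an
annulus, which shows that the Askey–Wilson cycle is invariant under `t ↦ qt` as long as no poles are
met (`cycleFunctional_comp_mul`). Applied to a suitable function this yields the first moment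
(`cycleFunctional_moment`), hence the behaviour of the integral under multiplication of the
parameters by `q`. Iteration moves all parameters to zero (`awRatio_eq`), and the remaining constant
is read off from a special choice of parameters (`awConst_eq`).

The operator `M` in three variables is first considered as a relation, the linear space `relM` of
the pairs `(Ψ, Φ)` which are related by `M^r_{g,2g}` on each line. It contains explicit pairs of
basis elements (`symBasis_mem_relM`), and is therefore the graph of a linear bijection
(`relM_bijective`, `symM`).

The separation of variables rests on the values of `M Ψ` at `y₁ = q^{-m}`. These are finite sums of
values of `Ψ` (`symM_discrete`, from the summation formula `sum_nodeW`). If `Ψ` is a joint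
eigenfunction of the Hamiltonians, the three eigenvalue equations, taken at these nodes, combine to
a four-term recurrence in `m` with coefficients independent of `y₂` (`nodeSum_recurrence`). The
`q`-difference equation of `S_λ` gives the same recurrence for its values at `q^{-m}`
(`sepX_difference`, `isNodeRec_sepNode`). A solution is determined up to a factor
(`IsNodeRec.proportional`), so `M Ψ` is a multiple of `S_λ(y₁)` for fixed `y₂` and `x`, and by
symmetry it factorizes (`symM_eigen`). The case `m = 0` identifies the other factor with the
restriction of `Ψ` to the line `(ℓ, ℓ²y, 1)`, and comparing the lowest coefficients in `y` there,
with the help of the `q`-Vandermonde sum, gives the constant `c_λ` (`IsMacdonald.line_factor`,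
`cCoef_eq`).

Macdonald polynomials exist because the Hamiltonians are triangular on orbit sums (`hamAct_symSum`),
the eigenvalues of `H₁` separate a weight from those below it (`eigenvalue_one_ne`), and `H₁` and
`H₂` commute (`HamAct.comm`); see `exists_isMacdonald`. Their uniqueness follows from the separation
of variables and the injectivity of `M` (`isMacdonald_iff_eq_symM_symm`).
-/

namespace MacdonaldSoV

noncomputable section

/-! ### Infinite `q`-shifted factorials -/

theorem norm_ofReal_lt_one {q : ℝ} (hq0 : 0 < q) (hq1 : q < 1) : ‖(q : ℂ)‖ < 1 := by
  rw [Complex.norm_real, Real.norm_of_nonneg hq0.le]; exact hq1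

theorem ofReal_ne_zero_of_pos {q : ℝ} (hq0 : 0 < q) : (q : ℂ) ≠ 0 := by
  exact_mod_cast hq0.ne'

theorem qpow_ne_one {q : ℝ} (hq0 : 0 < q) (hq1 : q < 1) (n : ℕ) : 1 - (q : ℂ) ^ (n + 1) ≠ 0 := by
  intro h
  have h1 : (q : ℂ) ^ (n + 1) = 1 := (sub_eq_zero.1 h).symm
  have h2 : q ^ (n + 1) = 1 := by exact_mod_cast h1
  exact (pow_lt_one₀ hq0.le hq1 n.succ_ne_zero).ne h2

section
variable {q : ℝ} (hq0 : 0 < q) (hq1 : q < 1)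

theorem summable_norm_qInf (a : ℂ) (hq0 : 0 < q) (hq1 : q < 1) :
    Summable fun k : ℕ => ‖-(a * (q : ℂ) ^ k)‖ := by
  have := (summable_geometric_of_lt_one (norm_nonneg _) (norm_ofReal_lt_one hq0 hq1)).mul_left ‖a‖
  simpa [norm_mul, norm_pow] using this

theorem multipliable_qInf (hq0 : 0 < q) (hq1 : q < 1) (a : ℂ) :
    Multipliable fun k : ℕ => (1 - a * (q : ℂ) ^ k) := by
  simpa [sub_eq_add_neg] using multipliable_one_add_of_summable (summable_norm_qInf a hq0 hq1)

theorem qInf_step (hq0 : 0 < q) (hq1 : q < 1) (a : ℂ) :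
    qInf q a = (1 - a) * qInf q (a * q) := by
  unfold qInf
  have h : (fun k : ℕ => 1 - a * q * (q : ℂ) ^ k) = fun k => 1 - a * (q : ℂ) ^ (k + 1) := by
    ext k; ring
  rw [h, tprod_eq_zero_mul' (f := fun k : ℕ => 1 - a * (q : ℂ) ^ k)]
  · simp
  · rw [← h]; exact multipliable_qInf hq0 hq1 _

theorem qInf_zero (q : ℝ) : qInf q 0 = 1 := by simp [qInf]

theorem qInf_eq_qPoch_mul (hq0 : 0 < q) (hq1 : q < 1) (a : ℂ) (n : ℕ) :
    qInf q a = qPoch q a n * qInf q (a * (q : ℂ) ^ n) := by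
  induction n with
  | zero => simp [qPoch]
  | succ n ih =>
    rw [ih, qInf_step hq0 hq1 (a * (q : ℂ) ^ n)]
    unfold qPoch
    rw [Finset.prod_range_succ, pow_succ]
    ring_nf

theorem qInf_eq_zero_iff (hq0 : 0 < q) (hq1 : q < 1) (a : ℂ) :
    qInf q a = 0 ↔ ∃ k : ℕ, a * (q : ℂ) ^ k = 1 := by
  constructor
  · intro h
    by_contra! h'
    refine tprod_one_add_ne_zero_of_summable (f := fun k : ℕ => -(a * (q : ℂ) ^ k)) ?_
      (summable_norm_qInf a hq0 hq1) ?_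
    · intro i
      rw [← sub_eq_add_neg]
      exact sub_ne_zero.2 (h' i).symm
    · simpa [qInf, sub_eq_add_neg] using h
  · rintro ⟨k, hk⟩
    rw [qInf_eq_qPoch_mul hq0 hq1 a (k + 1)]
    unfold qPoch
    rw [Finset.prod_range_succ, hk]
    ring

theorem differentiable_qInf (hq0 : 0 < q) (hq1 : q < 1) : Differentiable ℂ (qInf q) := by
  intro x
  have hloc : HasProdLocallyUniformlyOn (fun (i : ℕ) (a : ℂ) ↦ 1 + -(a * (q : ℂ) ^ i))
      (fun a ↦ ∏' i : ℕ, (1 + -(a * (q : ℂ) ^ i))) (Metric.ball 0 (‖x‖ + 1)) := by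
    refine Summable.hasProdLocallyUniformlyOn_nat_one_add (u := fun k => (‖x‖ + 1) * ‖(q : ℂ)‖ ^ k)
      Metric.isOpen_ball
      ((summable_geometric_of_lt_one (norm_nonneg _) (norm_ofReal_lt_one hq0 hq1)).mul_left _)
      ?_ (fun n => by fun_prop)
    refine Eventually.of_forall fun n a ha => ?_
    rw [norm_neg, norm_mul, norm_pow]
    gcongr
    exact (mem_ball_zero_iff.1 ha).le
  rw [hasProdLocallyUniformlyOn_iff_tendstoLocallyUniformlyOn] at hloc
  have hd := hloc.differentiableOn (Eventually.of_forall fun s => by fun_prop) Metric.isOpen_ball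
  have h : qInf q = fun a => ∏' i : ℕ, (1 + -(a * (q : ℂ) ^ i)) := by
    ext a; simp [qInf, sub_eq_add_neg]
  rw [h]
  exact hd.differentiableAt (x := x) (Metric.isOpen_ball.mem_nhds (by simp))

theorem continuous_qInf (hq0 : 0 < q) (hq1 : q < 1) : Continuous (qInf q) :=
  (differentiable_qInf hq0 hq1).continuous

theorem qInf_mul_neg (hq0 : 0 < q) (hq1 : q < 1) (a : ℂ) :
    qInf q a * qInf q (-a) = qInf (q ^ 2) (a ^ 2) := by
  unfold qInf
  rw [← (multipliable_qInf hq0 hq1 a).tprod_mul (multipliable_qInf hq0 hq1 (-a))]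
  refine tprod_congr fun k => ?_
  push_cast
  ring

theorem qInf_sq_mul (hq0 : 0 < q) (hq1 : q < 1) (a : ℂ) :
    qInf (q ^ 2) a * qInf (q ^ 2) (a * q) = qInf q a := by
  have h0 : 0 < q ^ 2 := by positivity
  have h1 : q ^ 2 < 1 := pow_lt_one₀ hq0.le hq1 two_ne_zero
  have e1 := multipliable_qInf h0 h1 a
  have e2 := multipliable_qInf h0 h1 (a * q)
  unfold qInf
  rw [← tprod_even_mul_odd (f := fun k : ℕ => 1 - a * (q : ℂ) ^ k)]
  · congr 1 <;> refine tprod_congr fun k => ?_ <;> push_cast <;> ring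
  · convert e1 using 2 with k; push_cast; ring
  · convert e2 using 2 with k; push_cast; ring

/-- Euler's identity `(-q; q)_∞ (q; q²)_∞ = 1`. -/
theorem qInf_euler (hq0 : 0 < q) (hq1 : q < 1) : qInf q (-q) * qInf (q ^ 2) q = 1 := by
  have h0 : 0 < q ^ 2 := by positivity
  have h1 : q ^ 2 < 1 := pow_lt_one₀ hq0.le hq1 two_ne_zero
  have e1 := qInf_mul_neg hq0 hq1 q
  have e2 := qInf_sq_mul hq0 hq1 q
  have hne : qInf (q ^ 2) ((q : ℂ) ^ 2) ≠ 0 := by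
    rw [Ne, qInf_eq_zero_iff h0 h1]
    rintro ⟨k, hk⟩
    refine qpow_ne_one h0 h1 k ?_
    rw [← hk]; push_cast; ring
  rw [← pow_two] at e2
  rw [← e2] at e1
  apply mul_left_cancel₀ hne
  linear_combination e1

theorem qPoch_zero (q : ℝ) (a : ℂ) : qPoch q a 0 = 1 := by simp [qPoch]

theorem qPoch_succ (q : ℝ) (a : ℂ) (n : ℕ) :
    qPoch q a (n + 1) = qPoch q a n * (1 - a * (q : ℂ) ^ n) := by
  unfold qPoch; rw [Finset.prod_range_succ]

theorem qPoch_succ' (q : ℝ) (a : ℂ) (n : ℕ) :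
    qPoch q a (n + 1) = (1 - a) * qPoch q (a * q) n := by
  have := qPoch_add q a 1 n
  rw [add_comm 1 n] at this
  rw [this]; simp [qPoch]

theorem qPoch_self_ne_zero (hq0 : 0 < q) (hq1 : q < 1) (n : ℕ) : qPoch q q n ≠ 0 := by
  refine qPoch_ne_zero (fun k h => qpow_ne_one hq0 hq1 k ?_) n
  rw [← h]; ring

/-- The coefficients of the `q`-binomial series grow subgeometrically. -/
theorem summable_qBinomial (hq0 : 0 < q) (hq1 : q < 1) (a : ℂ) {z : ℂ} (hz : ‖z‖ < 1) :
    Summable fun k : ℕ => ‖qPoch q a k / qPoch q q k * z ^ k‖ := by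
  by_cases hz0 : z = 0
  · refine summable_of_ne_finset_zero (s := {0}) fun k hk => ?_
    have : k ≠ 0 := by simpa using hk
    simp [hz0, this]
  by_cases ha : ∀ n : ℕ, a * (q : ℂ) ^ n ≠ 1
  -- the ratio test if no coefficient vanishes; otherwise the series terminates
  · refine summable_of_ratio_test_tendsto_lt_one hz
      (Eventually.of_forall fun n => ?_) ?_
    · exact norm_ne_zero_iff.2 (mul_ne_zero (div_ne_zero (qPoch_ne_zero ha n)
        (qPoch_self_ne_zero hq0 hq1 n)) (pow_ne_zero _ hz0))
    · have hlim : Tendsto (fun n : ℕ => (q : ℂ) ^ n) atTop (𝓝 0) :=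
        tendsto_pow_atTop_nhds_zero_of_norm_lt_one (norm_ofReal_lt_one hq0 hq1)
      have : Tendsto (fun n : ℕ => ‖(1 - a * (q : ℂ) ^ n) / (1 - q * (q : ℂ) ^ n) * z‖) atTop
          (𝓝 ‖(1 - a * 0) / (1 - q * 0) * z‖) := by
        refine (Tendsto.mul_const _ (Tendsto.div ?_ ?_ (by simp))).norm
        · exact tendsto_const_nhds.sub (hlim.const_mul a)
        · exact tendsto_const_nhds.sub (hlim.const_mul (q : ℂ))
      simp only [mul_zero, sub_zero, div_one, one_mul] at this
      refine this.congr fun n => ?_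
      rw [norm_norm, norm_norm, ← norm_div]
      congr 1
      have h1 := qPoch_ne_zero ha n
      have h2 := qPoch_self_ne_zero hq0 hq1 n
      have h3 := qPoch_self_ne_zero hq0 hq1 (n + 1)
      rw [qPoch_succ] at h3
      have h4 := (mul_ne_zero_iff.1 h3).2
      rw [qPoch_succ, qPoch_succ, pow_succ]
      field_simp
  · push Not at ha
    obtain ⟨n, hn⟩ := ha
    refine summable_of_ne_finset_zero (s := Finset.range (n + 1)) fun k hk => ?_
    have hk' : n < k := by simpa [Nat.lt_succ_iff] using hk
    have : qPoch q a k = 0 := Finset.prod_eq_zero (Finset.mem_range.2 hk') (by rw [hn]; ring)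
    simp [this]

/-- A power series summable at the points of the unit disc is continuous at the origin. -/
theorem tendsto_tsum_mul_pow {u : ℕ → ℂ} {r : ℝ} (hr : 0 < r)
    (hu : Summable fun k => ‖u k‖ * r ^ k) {z : ℕ → ℂ} (hz : Tendsto z atTop (𝓝 0)) :
    Tendsto (fun n => ∑' k, u k * z n ^ k) atTop (𝓝 (u 0)) := by
  have key := tendsto_tsum_of_dominated_convergence (𝓕 := atTop)
    (f := fun n k => u k * z n ^ k) (g := fun k => u k * 0 ^ k) hu
    (fun k => (hz.pow k).const_mul (u k)) ?_
  · convert key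
    rw [tsum_eq_single 0]
    · simp
    · intro k hk; simp [hk]
  · filter_upwards [hz.norm.eventually (gt_mem_nhds (by simpa using hr))] with n hn k
    rw [norm_mul, norm_pow]
    gcongr

/-- The `q`-binomial theorem. -/
theorem qBinomial (hq0 : 0 < q) (hq1 : q < 1) (a : ℂ) {z : ℂ} (hz : ‖z‖ < 1) :
    ∑' k : ℕ, qPoch q a k / qPoch q q k * z ^ k = qInf q (a * z) / qInf q z := by
  obtain ⟨u, hu⟩ : ∃ u : ℕ → ℂ, u = fun k => qPoch q a k / qPoch q q k := ⟨_, rfl⟩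
  obtain ⟨G, hG⟩ : ∃ G : ℂ → ℂ, G = fun z => ∑' k, u k * z ^ k := ⟨_, rfl⟩
  have hGz : ∑' k : ℕ, qPoch q a k / qPoch q q k * z ^ k = G z := by rw [hG, hu]
  rw [hGz]
  have hsum : ∀ z : ℂ, ‖z‖ < 1 → Summable fun k => u k * z ^ k := fun z hz => by
    rw [hu]; exact (summable_qBinomial hq0 hq1 a hz).of_norm
  have hqn := norm_ofReal_lt_one hq0 hq1
  have hqz : ∀ z : ℂ, ‖z‖ < 1 → ‖z * q‖ < 1 := fun z hz => by
    rw [norm_mul]; exact mul_lt_one_of_nonneg_of_lt_one_left (norm_nonneg _) hz hqn.le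
  -- the `q`-difference equation of the series; iterating it moves the argument to `0`
  have hstep : ∀ z : ℂ, ‖z‖ < 1 → (1 - z) * G z = (1 - a * z) * G (z * q) := by
    intro z hz
    have s1 := hsum z hz
    have s2 := hsum (z * q) (hqz z hz)
    have s1' : Summable fun k => u (k + 1) * z ^ (k + 1) :=
      (summable_nat_add_iff (f := fun k => u k * z ^ k) 1).2 s1
    have s2' : Summable fun k => u (k + 1) * (z * q) ^ (k + 1) :=
      (summable_nat_add_iff (f := fun k => u k * (z * q) ^ k) 1).2 s2
    have e1 : G z = u 0 + ∑' k, u (k + 1) * z ^ (k + 1) := by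
      rw [hG]
      have := s1.tsum_eq_zero_add
      simp only [pow_zero, mul_one] at this
      exact this
    have e2 : G (z * q) = u 0 + ∑' k, u (k + 1) * (z * q) ^ (k + 1) := by
      rw [hG]
      have := s2.tsum_eq_zero_add
      simp only [pow_zero, mul_one] at this
      exact this
    have e3 : G z - G (z * q) = z * G z - a * z * G (z * q) := by
      rw [e1, e2, add_sub_add_left_eq_sub, ← s1'.tsum_sub s2', ← e1, ← e2, hG]
      simp only
      rw [← tsum_mul_left, ← tsum_mul_left, ← (s1.mul_left z).tsum_sub (s2.mul_left (a * z))]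
      refine tsum_congr fun k => ?_
      have h2 := qPoch_self_ne_zero hq0 hq1 k
      have h3 := qPoch_self_ne_zero hq0 hq1 (k + 1)
      rw [qPoch_succ] at h3
      have h4 := (mul_ne_zero_iff.1 h3).2
      simp only [hu, qPoch_succ, pow_succ, mul_pow]
      generalize (q : ℂ) ^ k = w at h4 ⊢
      have h5 : 1 - w * (q : ℂ) ≠ 0 := by rwa [mul_comm]
      field_simp
    linear_combination e3
  have hne : ∀ z : ℂ, ‖z‖ < 1 → 1 - z ≠ 0 := by
    intro z hz h
    rw [← sub_eq_zero.1 h] at hz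
    simp at hz
  have hzn : ∀ n : ℕ, ‖z * (q : ℂ) ^ n‖ < 1 := fun n => by
    rw [norm_mul, norm_pow]
    exact mul_lt_one_of_nonneg_of_lt_one_left (norm_nonneg _) hz (pow_le_one₀ (norm_nonneg _) hqn.le)
  have hiter : ∀ n : ℕ, qPoch q z n * G z = qPoch q (a * z) n * G (z * (q : ℂ) ^ n) := by
    intro n
    induction n with
    | zero => simp [qPoch]
    | succ n ih =>
      have := hstep _ (hzn n)
      rw [qPoch_succ, qPoch_succ, pow_succ, ← mul_assoc z]
      linear_combination (1 - z * (q : ℂ) ^ n) * ih + qPoch q (a * z) n * this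
  have hlim : Tendsto (fun n : ℕ => z * (q : ℂ) ^ n) atTop (𝓝 0) := by
    simpa using (tendsto_pow_atTop_nhds_zero_of_norm_lt_one hqn).const_mul z
  have hpoch : ∀ b : ℂ, Tendsto (fun n => qPoch q b n) atTop (𝓝 (qInf q b)) := fun b =>
    (multipliable_qInf hq0 hq1 b).hasProd.tendsto_prod_nat
  have hG0 : Tendsto (fun n : ℕ => G (z * (q : ℂ) ^ n)) atTop (𝓝 1) := by
    have := tendsto_tsum_mul_pow (u := u) (r := 1 / 2) (by norm_num) ?_ hlim
    · rw [hG]; simpa [hu, qPoch] using this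
    · have := summable_qBinomial hq0 hq1 a (z := ((1 / 2 : ℝ) : ℂ)) (by
        rw [Complex.norm_real]; norm_num)
      rw [hu]
      simpa [norm_mul, norm_pow] using this
  have hfin := tendsto_nhds_unique (((hpoch z).mul_const (G z)).congr hiter)
    ((hpoch (a * z)).mul hG0)
  have hz' : qInf q z ≠ 0 := by
    rw [Ne, qInf_eq_zero_iff hq0 hq1]
    rintro ⟨k, hk⟩
    have := hzn k
    rw [hk] at this
    simp at this
  rw [eq_div_iff hz']
  linear_combination hfin

end

/-! ### Integrals over small circles, and the residue theorem in an annulus -/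

/-- The integral of `h` over an infinitesimal circle around `p`, that is `2πi` times the residue of
`h` at `p` when `p` is an isolated singularity. -/
def circleRes (h : ℂ → ℂ) (p : ℂ) : ℂ := limUnder (𝓝[>] (0 : ℝ)) fun ε => ∮ t in C(p, ε), h t

theorem exists_punctured_ball {P : ℂ → Prop} {p : ℂ} (h : ∀ᶠ z in 𝓝[≠] p, P z) :
    ∃ δ > 0, ∀ z, z ≠ p → dist z p < δ → P z := by
  rw [eventually_nhdsWithin_iff, Metric.eventually_nhds_iff] at h
  obtain ⟨δ, hδ, H⟩ := h
  exact ⟨δ, hδ, fun z hz hd => H hd hz⟩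

theorem eventually_sphere {P : ℂ → Prop} {p : ℂ} (h : ∀ᶠ z in 𝓝[≠] p, P z) :
    ∀ᶠ ε in 𝓝[>] (0 : ℝ), ∀ z ∈ Metric.sphere p ε, P z := by
  obtain ⟨δ, hδ, H⟩ := exists_punctured_ball h
  filter_upwards [Ioo_mem_nhdsGT hδ] with ε hε z hz
  have hz' : dist z p = ε := hz
  refine H z ?_ (hz'.trans_lt hε.2)
  rintro rfl
  rw [dist_self] at hz'
  exact hε.1.ne hz'

theorem circleRes_eq_of_eventually {h : ℂ → ℂ} {p ρ : ℂ}
    (H : ∀ᶠ ε in 𝓝[>] (0 : ℝ), (∮ t in C(p, ε), h t) = ρ) : circleRes h p = ρ :=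
  (tendsto_const_nhds.congr' (H.mono fun _ h => h.symm)).limUnder_eq

theorem circleIntegral_eventually_eq_circleRes {h : ℂ → ℂ} {p : ℂ}
    (hd : ∀ᶠ z in 𝓝[≠] p, DifferentiableAt ℂ h z) :
    ∀ᶠ ε in 𝓝[>] (0 : ℝ), (∮ t in C(p, ε), h t) = circleRes h p := by
  obtain ⟨δ, hδ, H⟩ := exists_punctured_ball hd
  have key : ∀ᶠ ε in 𝓝[>] (0 : ℝ), (∮ t in C(p, ε), h t) = ∮ t in C(p, δ / 2), h t := by
    filter_upwards [Ioo_mem_nhdsGT (half_pos hδ)] with ε hε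
    have hdiff : ∀ z ∈ Metric.closedBall p (δ / 2) \ Metric.ball p ε, DifferentiableAt ℂ h z := by
      intro z hz
      have h1 : dist z p ≤ δ / 2 := hz.1
      refine H z ?_ (by linarith)
      rintro rfl
      exact hz.2 (by simpa using hε.1)
    refine (Complex.circleIntegral_eq_of_differentiable_on_annulus_off_countable hε.1 hε.2.le
      Set.countable_empty (fun z hz => (hdiff z hz).continuousAt.continuousWithinAt)
      fun z hz => hdiff z ⟨Metric.ball_subset_closedBall hz.1.1, fun h' =>
        hz.1.2 (Metric.ball_subset_closedBall h')⟩).symm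
  rwa [circleRes_eq_of_eventually key]

theorem circleRes_congr {h h' : ℂ → ℂ} {p : ℂ} (H : ∀ᶠ z in 𝓝[≠] p, h z = h' z) :
    circleRes h p = circleRes h' p := by
  have : ∀ᶠ ε in 𝓝[>] (0 : ℝ), (∮ t in C(p, ε), h t) = ∮ t in C(p, ε), h' t := by
    filter_upwards [eventually_sphere H, self_mem_nhdsWithin] with ε hε h0
    exact circleIntegral.integral_congr (le_of_lt h0) hε
  unfold circleRes limUnder
  rw [Filter.map_congr this]

theorem circleRes_eq_zero {h : ℂ → ℂ} {p : ℂ} (hd : ∀ᶠ z in 𝓝 p, DifferentiableAt ℂ h z) :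
    circleRes h p = 0 := by
  refine circleRes_eq_of_eventually ?_
  obtain ⟨δ, hδ, H⟩ := Metric.eventually_nhds_iff.1 hd
  filter_upwards [Ioo_mem_nhdsGT hδ] with ε hε
  refine Complex.circleIntegral_eq_zero_of_differentiable_on_off_countable hε.1.le
    Set.countable_empty (fun z hz => (H ?_).continuousAt.continuousWithinAt) fun z hz => H ?_
  · exact lt_of_le_of_lt hz hε.2
  · exact lt_trans hz.1 hε.2

theorem eventually_circleIntegrable {h : ℂ → ℂ} {p : ℂ}
    (hd : ∀ᶠ z in 𝓝[≠] p, DifferentiableAt ℂ h z) :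
    ∀ᶠ ε in 𝓝[>] (0 : ℝ), CircleIntegrable h p ε := by
  filter_upwards [eventually_sphere hd, self_mem_nhdsWithin] with ε hε h0
  exact ContinuousOn.circleIntegrable (le_of_lt h0)
    fun z hz => (hε z hz).continuousAt.continuousWithinAt

theorem circleRes_add {h h' : ℂ → ℂ} {p : ℂ} (hd : ∀ᶠ z in 𝓝[≠] p, DifferentiableAt ℂ h z)
    (hd' : ∀ᶠ z in 𝓝[≠] p, DifferentiableAt ℂ h' z) :
    circleRes (fun z => h z + h' z) p = circleRes h p + circleRes h' p := by
  refine circleRes_eq_of_eventually ?_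
  filter_upwards [eventually_circleIntegrable hd, eventually_circleIntegrable hd',
    circleIntegral_eventually_eq_circleRes hd, circleIntegral_eventually_eq_circleRes hd']
    with ε h1 h2 h3 h4
  rw [circleIntegral.integral_add h1 h2, h3, h4]

theorem circleRes_const_mul {h : ℂ → ℂ} {p : ℂ} (c : ℂ)
    (hd : ∀ᶠ z in 𝓝[≠] p, DifferentiableAt ℂ h z) :
    circleRes (fun z => c * h z) p = c * circleRes h p := by
  refine circleRes_eq_of_eventually ?_
  filter_upwards [circleIntegral_eventually_eq_circleRes hd] with ε h3
  rw [circleIntegral.integral_const_mul, h3]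

theorem circleIntegral_comp_mul (h : ℂ → ℂ) (q : ℝ) (p : ℂ) (ε : ℝ) :
    (∮ t in C(p, ε), q * h (q * t)) = ∮ t in C(q * p, q * ε), h t := by
  simp only [circleIntegral, deriv_circleMap, circleMap, smul_eq_mul]
  refine intervalIntegral.integral_congr fun θ _ => ?_
  push_cast
  ring_nf

theorem circleRes_comp_mul {h : ℂ → ℂ} {q : ℝ} (hq : 0 < q) {p : ℂ}
    (hd : ∀ᶠ z in 𝓝[≠] ((q : ℂ) * p), DifferentiableAt ℂ h z) :
    circleRes (fun t => q * h (q * t)) p = circleRes h (q * p) := by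
  refine circleRes_eq_of_eventually ?_
  have hlim : Tendsto (fun ε : ℝ => q * ε) (𝓝[>] 0) (𝓝[>] 0) := by
    refine tendsto_nhdsWithin_of_tendsto_nhds_of_eventually_within _ ?_ ?_
    · have : Tendsto (fun ε : ℝ => q * ε) (𝓝 0) (𝓝 (q * 0)) := by
        exact (continuous_const.mul continuous_id).tendsto 0
      rw [mul_zero] at this
      exact this.mono_left nhdsWithin_le_nhds
    · filter_upwards [self_mem_nhdsWithin] with ε hε
      exact mul_pos hq hε
  filter_upwards [hlim.eventually (circleIntegral_eventually_eq_circleRes hd)] with ε h1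
  rw [circleIntegral_comp_mul, h1]

/-- The Laurent expansion at a pole of unspecified order: the residue term `c 0 * (z - p)⁻¹` is kept
apart from the higher principal part, which has a primitive. -/
theorem MeromorphicAt.exists_principal_part {h : ℂ → ℂ} {p : ℂ} (hm : MeromorphicAt h p) :
    ∃ (n : ℕ) (c : ℕ → ℂ) (g : ℂ → ℂ), AnalyticAt ℂ g p ∧
      ∀ᶠ z in 𝓝[≠] p, h z = c 0 * (z - p)⁻¹ +
        ∑ j ∈ Finset.range n, c (j + 1) * (z - p) ^ (-((j : ℤ) + 2)) + g z := by
  obtain ⟨n, hn⟩ := hm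
  -- divided differences split off the coefficients of `G` one at a time
  have key : ∀ (n : ℕ) (G : ℂ → ℂ), AnalyticAt ℂ G p → ∃ (c : ℕ → ℂ) (g : ℂ → ℂ),
      AnalyticAt ℂ g p ∧ ∀ z, z ≠ p → ((z - p) ^ n)⁻¹ * G z =
        ∑ j ∈ Finset.range n, c j * (z - p) ^ (-((j : ℤ) + 1)) + g z := by
    intro n
    induction n with
    | zero =>
      intro G hG
      exact ⟨fun _ => 0, G, hG, fun z hz => by simp⟩
    | succ n ih =>
      intro G hG
      have hG' : AnalyticAt ℂ (dslope G p) p := by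
        obtain ⟨P, hP⟩ := hG
        exact ⟨_, hP.has_fpower_series_dslope_fslope⟩
      obtain ⟨c, g, hg, H⟩ := ih _ hG'
      have hsplit : ∀ z, z ≠ p → ((z - p) ^ (n + 1))⁻¹ * G z =
          G p * (z - p) ^ (-((n : ℤ) + 1)) + ((z - p) ^ n)⁻¹ * dslope G p z := by
        intro z hz
        have h0 : z - p ≠ 0 := sub_ne_zero.2 hz
        rw [dslope_of_ne _ hz, slope_def_field, zpow_neg]
        have : (z - p) ^ ((n : ℤ) + 1) = (z - p) ^ (n + 1) := by exact_mod_cast rfl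
        rw [this]
        field_simp
        ring
      refine ⟨Function.update c n (G p), g, hg, fun z hz => ?_⟩
      rw [hsplit z hz, H z hz, Finset.sum_range_succ, Function.update_self]
      have hc : ∑ j ∈ Finset.range n, Function.update c n (G p) j * (z - p) ^ (-((j : ℤ) + 1)) =
          ∑ j ∈ Finset.range n, c j * (z - p) ^ (-((j : ℤ) + 1)) :=
        Finset.sum_congr rfl fun j hj => by
          rw [Function.update_of_ne (Finset.mem_range.1 hj).ne]
      rw [hc]
      ring
  obtain ⟨c, g, hg, H⟩ := key n _ hn
  refine ⟨n, Function.update c n 0, g, hg, ?_⟩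
  filter_upwards [self_mem_nhdsWithin] with z hz
  have e1 : ((z - p) ^ n)⁻¹ * (z - p) ^ n • h z = h z := by
    rw [smul_eq_mul, ← mul_assoc, inv_mul_cancel₀, one_mul]
    exact pow_ne_zero _ (sub_ne_zero.2 hz)
  have e2 : ∑ j ∈ Finset.range n, c j * (z - p) ^ (-((j : ℤ) + 1)) =
      ∑ j ∈ Finset.range (n + 1), Function.update c n 0 j * (z - p) ^ (-((j : ℤ) + 1)) := by
    rw [Finset.sum_range_succ, Function.update_self, zero_mul, add_zero]
    refine Finset.sum_congr rfl fun j hj => ?_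
    rw [Function.update_of_ne (Finset.mem_range.1 hj).ne]
  rw [← e1, H z hz, e2, Finset.sum_range_succ', add_comm (∑ _ ∈ _, _)]
  congr 2
  simp

/-- Only the residue term of a principal part contributes to an integral over a circle. -/
theorem circleIntegral_principal_part {c : ℕ → ℂ} (n : ℕ) {p a : ℂ} {R : ℝ} (hR : 0 ≤ R)
    (hp : p ∉ Metric.sphere a R) :
    (∮ z in C(a, R), (c 0 * (z - p)⁻¹ +
      ∑ j ∈ Finset.range n, c (j + 1) * (z - p) ^ (-((j : ℤ) + 2)))) =
    c 0 * ∮ z in C(a, R), (z - p)⁻¹ := by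
  have hne : ∀ z ∈ Metric.sphere a R, z - p ≠ 0 := fun z hz h => hp (sub_eq_zero.1 h ▸ hz)
  have hi : ∀ (k : ℤ) (b : ℂ), CircleIntegrable (fun z => b * (z - p) ^ k) a R := fun k b =>
    ContinuousOn.circleIntegrable hR (continuousOn_const.mul
      (ContinuousOn.zpow₀ (by fun_prop) k fun z hz => Or.inl (hne z hz)))
  have hi1 : CircleIntegrable (fun z => c 0 * (z - p)⁻¹) a R := by simpa using hi (-1) (c 0)
  rw [circleIntegral.integral_add hi1, circleIntegral.integral_const_mul,
    circleIntegral.integral_fun_sum fun j _ => hi _ _, Finset.sum_eq_zero, add_zero]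
  · intro j _
    rw [circleIntegral.integral_const_mul, circleIntegral.integral_sub_zpow_of_ne (by omega),
      mul_zero]
  · have := CircleIntegrable.sum (Finset.range n)
      (f := fun j z => c (j + 1) * (z - p) ^ (-((j : ℤ) + 2))) fun j _ => hi _ _
    convert this using 1
    ext z; simp

/-- The residue theorem in an annulus: principal parts at the singularities are split off one at a
time. -/
theorem circleIntegral_sub_eq_sum_circleRes {r : ℝ} (hr0 : 0 < r) (hr1 : r < 1) (S : Finset ℂ) :
    ∀ h : ℂ → ℂ, (∀ p ∈ S, r < ‖p‖ ∧ ‖p‖ < 1) →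
    (∀ z, r ≤ ‖z‖ → ‖z‖ ≤ 1 → z ∉ S → DifferentiableAt ℂ h z) →
    (∀ p ∈ S, MeromorphicAt h p) →
    (∮ z in C(0, 1), h z) - (∮ z in C(0, r), h z) = ∑ p ∈ S, circleRes h p := by
  classical
  induction S using Finset.induction_on with
  | empty =>
    intro h _ hd _
    rw [Finset.sum_empty, sub_eq_zero]
    refine Complex.circleIntegral_eq_of_differentiable_on_annulus_off_countable hr0 hr1.le
      Set.countable_empty (fun z hz => ?_) fun z hz => hd z ?_ ?_ (by simp)
    · refine (hd z ?_ ?_ (by simp)).continuousAt.continuousWithinAt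
      · simpa using hz.2
      · simpa using hz.1
    · have : r < ‖z‖ := by simpa using hz.1.2
      exact this.le
    · have : ‖z‖ < 1 := by simpa using hz.1.1
      exact this.le
  | insert p S hpS ih =>
    intro h hS hd hm
    obtain ⟨n, c, g, hg, hsplit⟩ := MeromorphicAt.exists_principal_part (hm p (by simp))
    -- `R` is the principal part at `p`, and `k` is `h - R` with the singularity at `p` removed
    obtain ⟨R, hR⟩ : ∃ R : ℂ → ℂ, R = fun z => c 0 * (z - p)⁻¹ +
      ∑ j ∈ Finset.range n, c (j + 1) * (z - p) ^ (-((j : ℤ) + 2)) := ⟨_, rfl⟩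
    obtain ⟨hp1, hp2⟩ := hS p (by simp)
    have hRd : ∀ z, z ≠ p → DifferentiableAt ℂ R z := by
      intro z hz
      have hz' : z - p ≠ 0 := sub_ne_zero.2 hz
      rw [hR]
      refine DifferentiableAt.add ?_ (DifferentiableAt.fun_sum fun j _ => ?_)
      · exact ((differentiableAt_id.sub_const p).inv hz').const_mul _
      · exact ((differentiableAt_id.sub_const p).zpow (Or.inl hz')).const_mul _
    set k : ℂ → ℂ := Function.update (fun z => h z - R z) p (g p) with hk
    have hk1 : ∀ z, z ≠ p → k z = h z - R z := fun z hz => Function.update_of_ne hz _ _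
    have hk1' : ∀ z, z ≠ p → k =ᶠ[𝓝 z] fun z => h z - R z := fun z hz =>
      (eventually_ne_nhds hz).mono hk1
    have hk2 : k =ᶠ[𝓝 p] g := by
      rw [eventually_nhdsWithin_iff] at hsplit
      filter_upwards [hsplit] with z hz
      by_cases hzp : z = p
      · subst hzp; simp [hk]
      · rw [hk1 z hzp, hz hzp, hR]; ring
    have hkS : ∀ p' ∈ S, p' ≠ p := fun p' hp' h' => hpS (h' ▸ hp')
    have hpS' : ∀ᶠ z in 𝓝[≠] p, DifferentiableAt ℂ h z := by
      have h1 : ∀ᶠ z in 𝓝 p, r < ‖z‖ := continuous_norm.continuousAt.eventually (lt_mem_nhds hp1)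
      have h2 : ∀ᶠ z in 𝓝 p, ‖z‖ < 1 := continuous_norm.continuousAt.eventually (gt_mem_nhds hp2)
      have h3 : ∀ᶠ z in 𝓝 p, z ∉ S := S.finite_toSet.isClosed.isOpen_compl.mem_nhds hpS
      rw [eventually_nhdsWithin_iff]
      filter_upwards [h1, h2, h3] with z e1 e2 e3 e4
      refine hd z e1.le e2.le ?_
      simp only [Finset.mem_insert, not_or]
      exact ⟨e4, e3⟩
    have hsame : ∀ p' ∈ S, circleRes k p' = circleRes h p' := by
      intro p' hp'
      have hne := hkS p' hp'
      obtain ⟨e1, e2⟩ := hS p' (by simp [hp'])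
      have h1 : ∀ᶠ z in 𝓝 p', r < ‖z‖ := continuous_norm.continuousAt.eventually (lt_mem_nhds e1)
      have h2 : ∀ᶠ z in 𝓝 p', ‖z‖ < 1 := continuous_norm.continuousAt.eventually (gt_mem_nhds e2)
      have h3 : ∀ᶠ z in 𝓝 p', z ∉ (insert p S).erase p' :=
        ((insert p S).erase p').finite_toSet.isClosed.isOpen_compl.mem_nhds (by simp)
      have hdp : ∀ᶠ z in 𝓝[≠] p', DifferentiableAt ℂ h z := by
        rw [eventually_nhdsWithin_iff]
        filter_upwards [h1, h2, h3] with z e1 e2 e3 e4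
        refine hd z e1.le e2.le fun h' => e3 ?_
        rw [Finset.mem_erase]
        exact ⟨e4, h'⟩
      have hRe : ∀ᶠ z in 𝓝 p', DifferentiableAt ℂ R z :=
        (eventually_ne_nhds hne).mono hRd
      have hRe' : ∀ᶠ z in 𝓝 p', DifferentiableAt ℂ (fun z => -1 * R z) z :=
        hRe.mono fun z hz => hz.const_mul _
      have e5 := circleRes_add hdp (hRe'.filter_mono nhdsWithin_le_nhds)
      rw [circleRes_eq_zero hRe', add_zero] at e5
      rw [← e5]
      refine circleRes_congr (((hk1' p' hne).filter_mono nhdsWithin_le_nhds).mono fun z hz => ?_)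
      rw [hz]; ring
    have hind := ih k (fun p' hp' => hS p' (by simp [hp'])) ?_ ?_
    · rw [Finset.sum_congr rfl hsame] at hind
      rw [Finset.sum_insert hpS, ← hind]
      have hsph : ∀ ρ : ℝ, 0 ≤ ρ → ‖p‖ ≠ ρ → r ≤ ρ → ρ ≤ 1 → (∀ p' ∈ S, ‖p'‖ ≠ ρ) →
          (∮ z in C(0, ρ), k z) = (∮ z in C(0, ρ), h z) - c 0 * ∮ z in C(0, ρ), (z - p)⁻¹ := by
        intro ρ h0 hne e1 e2 e3
        have hps : p ∉ Metric.sphere (0 : ℂ) ρ := by simpa using hne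
        rw [← circleIntegral_principal_part n h0 hps, ← circleIntegral.integral_sub]
        · refine circleIntegral.integral_congr h0 fun z hz => ?_
          rw [hk1 z (fun h' => hps (h' ▸ hz)), hR]
        · refine ContinuousOn.circleIntegrable h0 fun z hz => ?_
          have hzρ : ‖z‖ = ρ := by simpa using hz
          refine (hd z (by rwa [hzρ]) (by rwa [hzρ]) ?_).continuousAt.continuousWithinAt
          simp only [Finset.mem_insert, not_or]
          exact ⟨fun h' => hps (h' ▸ hz), fun h' => e3 z h' hzρ⟩
        · rw [← hR]
          exact ContinuousOn.circleIntegrable h0 fun z hz =>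
            (hRd z (fun h' => hps (h' ▸ hz))).continuousAt.continuousWithinAt
      rw [hsph 1 zero_le_one hp2.ne hr1.le le_rfl fun p' hp' => (hS p' (by simp [hp'])).2.ne,
        hsph r hr0.le hp1.ne' le_rfl hr1.le fun p' hp' => (hS p' (by simp [hp'])).1.ne']
      have hi1 : (∮ z in C(0, 1), (z - p)⁻¹) = 2 * Real.pi * Complex.I :=
        circleIntegral.integral_sub_inv_of_mem_ball (by simpa using hp2)
      have hi2 : (∮ z in C(0, r), (z - p)⁻¹) = 0 := by
        have hne : ∀ z ∈ Metric.closedBall (0 : ℂ) r, z - p ≠ 0 := by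
          intro z hz h'
          rw [sub_eq_zero] at h'
          subst h'
          have : ‖z‖ ≤ r := by simpa using hz
          linarith
        refine Complex.circleIntegral_eq_zero_of_differentiable_on_off_countable hr0.le
          Set.countable_empty (ContinuousOn.inv₀ (by fun_prop) hne) fun z hz =>
            DifferentiableAt.inv (by fun_prop) (hne z (Metric.ball_subset_closedBall hz.1))
      have hres : circleRes h p = c 0 * (2 * Real.pi * Complex.I) := by
        refine circleRes_eq_of_eventually ?_
        have hgd : ∀ᶠ z in 𝓝 p, DifferentiableAt ℂ g z :=
          hg.eventually_analyticAt.mono fun z hz => hz.differentiableAt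
        have hgr := circleRes_eq_zero hgd
        filter_upwards [eventually_sphere hsplit, self_mem_nhdsWithin,
          circleIntegral_eventually_eq_circleRes (hgd.filter_mono nhdsWithin_le_nhds),
          eventually_circleIntegrable (hgd.filter_mono nhdsWithin_le_nhds)] with ε e1 e2 e3 e4
        have hε : (0 : ℝ) < ε := e2
        have hps : p ∉ Metric.sphere p ε := by simpa using hε.ne
        rw [circleIntegral.integral_congr hε.le e1, circleIntegral.integral_add _ e4,
          circleIntegral_principal_part n hε.le hps, e3, hgr,
          circleIntegral.integral_sub_center_inv _ hε.ne', add_zero]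
        rw [← hR]
        exact ContinuousOn.circleIntegrable hε.le fun z hz =>
            (hRd z (fun h' => hps (h' ▸ hz))).continuousAt.continuousWithinAt
      rw [hi1, hi2, hres]
      ring
    · intro z e1 e2 e3
      by_cases hzp : z = p
      · subst hzp
        exact hk2.differentiableAt_iff.2 hg.differentiableAt
      · refine (hk1' z hzp).differentiableAt_iff.2 ((hd z e1 e2 ?_).sub (hRd z hzp))
        simp [hzp, e3]
    · intro p' hp'
      have hne := hkS p' hp'
      have hRa : AnalyticAt ℂ R p' := by
        rw [Complex.analyticAt_iff_eventually_differentiableAt]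
        exact (eventually_ne_nhds hne).mono hRd
      exact ((hm p' (by simp [hp'])).sub hRa.meromorphicAt).congr
        ((hk1' p' hne).filter_mono nhdsWithin_le_nhds).symm

/-! ### The Askey–Wilson cycle -/

/-- The points `x_i q^k`. -/
def poleSet (q : ℝ) (x : Fin 4 → ℂ) : Set ℂ := {w | ∃ (i : Fin 4) (k : ℕ), w = x i * (q : ℂ) ^ k}

/-- `AWGeneric` for a family of parameters. -/
def GenericParams (q : ℝ) (x : Fin 4 → ℂ) : Prop :=
  (∀ i j, ∀ n : ℕ, x i * x j * (q : ℂ) ^ n ≠ 1) ∧ ∀ i, ∀ k : ℕ, ‖x i * (q : ℂ) ^ k‖ ≠ 1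

/-- The points of `poleSet` outside of the closed unit disc. -/
def outerSet (q : ℝ) (x : Fin 4 → ℂ) : Set ℂ := {w | w ∈ poleSet q x ∧ 1 < ‖w‖}

/-- `h` is holomorphic on `ℂ ∖ {0}`, except possibly at the points `x_i q^k` and their inverses. -/
def HoloOffPoles (q : ℝ) (x : Fin 4 → ℂ) (h : ℂ → ℂ) : Prop :=
  ∀ t, t ≠ 0 → t ∉ poleSet q x → t⁻¹ ∉ poleSet q x → DifferentiableAt ℂ h t

/-- `(1 / 2πi) ∫ h(t) dt / t` over the Askey–Wilson cycle with infinitesimal circles around the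
poles. -/
def cycleFunctional (q : ℝ) (x : Fin 4 → ℂ) (h : ℂ → ℂ) : ℂ :=
  (2 * Real.pi * Complex.I)⁻¹ *
    ((∮ t in C(0, 1), h t / t) +
      ∑ᶠ w ∈ outerSet q x,
        (circleRes (fun t => h t / t) w - circleRes (fun t => h t / t) w⁻¹))

theorem finite_poleSet_inter {q : ℝ} (hq0 : 0 < q) (hq1 : q < 1) (x : Fin 4 → ℂ) {δ : ℝ}
    (hδ : 0 < δ) : {w | w ∈ poleSet q x ∧ δ < ‖w‖}.Finite := by
  have hlim : ∀ i, ∀ᶠ k : ℕ in atTop, ‖x i * (q : ℂ) ^ k‖ < δ := by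
    intro i
    have : Tendsto (fun k : ℕ => ‖x i * (q : ℂ) ^ k‖) atTop (𝓝 ‖x i * 0‖) :=
      ((tendsto_pow_atTop_nhds_zero_of_norm_lt_one (norm_ofReal_lt_one hq0 hq1)).const_mul _).norm
    rw [mul_zero, norm_zero] at this
    exact this.eventually (gt_mem_nhds hδ)
  obtain ⟨N, hN⟩ := eventually_atTop.1 (eventually_all.2 hlim)
  refine ((Set.finite_univ (α := Fin 4)).prod (Set.finite_Iio N)).image
    (fun p : Fin 4 × ℕ => x p.1 * (q : ℂ) ^ p.2) |>.subset ?_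
  rintro w ⟨⟨i, k, rfl⟩, hw⟩
  refine ⟨(i, k), ⟨trivial, ?_⟩, rfl⟩
  by_contra hk
  exact absurd (hN k (not_lt.1 hk) i) (not_lt.2 hw.le)

theorem finite_outerSet {q : ℝ} (hq0 : 0 < q) (hq1 : q < 1) (x : Fin 4 → ℂ) :
    (outerSet q x).Finite := finite_poleSet_inter hq0 hq1 x one_pos

theorem eventually_not_mem_poleSet {q : ℝ} (hq0 : 0 < q) (hq1 : q < 1) (x : Fin 4 → ℂ) {p : ℂ}
    (hp : p ≠ 0) : ∀ᶠ z in 𝓝[≠] p, z ∉ poleSet q x := by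
  have hp' : 0 < ‖p‖ := norm_pos_iff.2 hp
  have hfin := finite_poleSet_inter hq0 hq1 x (half_pos hp')
  have h1 : ∀ᶠ z in 𝓝 p, ‖p‖ / 2 < ‖z‖ :=
    continuous_norm.continuousAt.eventually (lt_mem_nhds (half_lt_self hp'))
  have h2 : ∀ᶠ z in 𝓝 p, z ∉ {w | w ∈ poleSet q x ∧ ‖p‖ / 2 < ‖w‖} \ {p} :=
    (hfin.subset Set.sdiff_subset).isClosed.isOpen_compl.mem_nhds (by simp)
  rw [eventually_nhdsWithin_iff]
  filter_upwards [h1, h2] with z e1 e2 e3 e4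
  exact e2 ⟨⟨e4, e1⟩, e3⟩

theorem eventually_off_poles {q : ℝ} (hq0 : 0 < q) (hq1 : q < 1) (x : Fin 4 → ℂ) {p : ℂ}
    (hp : p ≠ 0) : ∀ᶠ z in 𝓝[≠] p, z ≠ 0 ∧ z ∉ poleSet q x ∧ z⁻¹ ∉ poleSet q x := by
  have h3 : Tendsto (fun z : ℂ => z⁻¹) (𝓝[≠] p) (𝓝[≠] p⁻¹) := by
    refine tendsto_nhdsWithin_of_tendsto_nhds_of_eventually_within _ ?_ ?_
    · exact (continuousAt_inv₀ hp).tendsto.mono_left nhdsWithin_le_nhds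
    · filter_upwards [self_mem_nhdsWithin] with z hz h
      exact hz (inv_injective h)
  filter_upwards [eventually_not_mem_poleSet hq0 hq1 x hp,
    h3.eventually (eventually_not_mem_poleSet hq0 hq1 x (inv_ne_zero hp)),
    (eventually_ne_nhds hp).filter_mono nhdsWithin_le_nhds] with z e1 e2 e3
  exact ⟨e3, e1, e2⟩

theorem HoloOffPoles.eventually {q : ℝ} (hq0 : 0 < q) (hq1 : q < 1) {x : Fin 4 → ℂ}
    {h : ℂ → ℂ} (hh : HoloOffPoles q x h) {p : ℂ} (hp : p ≠ 0) :
    ∀ᶠ z in 𝓝[≠] p, DifferentiableAt ℂ (fun t => h t / t) z := by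
  filter_upwards [eventually_off_poles hq0 hq1 x hp] with z hz
  exact (hh z hz.1 hz.2.1 hz.2.2).div differentiableAt_id hz.1

theorem GenericParams.not_mem_of_norm_eq_one {q : ℝ} {x : Fin 4 → ℂ} (hx : GenericParams q x)
    {t : ℂ} (ht : ‖t‖ = 1) : t ∉ poleSet q x ∧ t⁻¹ ∉ poleSet q x := by
  constructor
  · rintro ⟨i, k, h⟩
    exact hx.2 i k (by rw [← h, ht])
  · rintro ⟨i, k, h⟩
    exact hx.2 i k (by rw [← h, norm_inv, ht, inv_one])

theorem ne_zero_of_mem_outerSet {q : ℝ} {x : Fin 4 → ℂ} {w : ℂ} (hw : w ∈ outerSet q x) :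
    w ≠ 0 := by
  rintro rfl
  have := hw.2
  simp at this
  linarith

theorem HoloOffPoles.circleIntegrable {q : ℝ} {x : Fin 4 → ℂ} (hx : GenericParams q x)
    {h : ℂ → ℂ} (hh : HoloOffPoles q x h) : CircleIntegrable (fun t => h t / t) 0 1 := by
  refine ContinuousOn.circleIntegrable zero_le_one fun z hz => ?_
  have hz1 : ‖z‖ = 1 := by simpa using hz
  have hz0 : z ≠ 0 := by rintro rfl; simp at hz1
  obtain ⟨h1, h2⟩ := hx.not_mem_of_norm_eq_one hz1
  exact ((hh z hz0 h1 h2).div differentiableAt_id hz0).continuousAt.continuousWithinAt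

theorem awOuterPoles_eq (q : ℝ) (x : Fin 4 → ℂ) :
    awOuterPoles q (x 0) (x 1) (x 2) (x 3) = outerSet q x := by
  ext w
  simp [awOuterPoles, outerSet, poleSet, Fin.exists_fin_succ]

theorem awIntegral_eventually_eq {q : ℝ} (hq0 : 0 < q) (hq1 : q < 1) {x : Fin 4 → ℂ}
    {h : ℂ → ℂ} (hh : HoloOffPoles q x h) :
    ∀ᶠ ε in 𝓝[>] (0 : ℝ),
      awIntegral q (x 0) (x 1) (x 2) (x 3) ε h = cycleFunctional q x h := by
  have hfin := finite_outerSet hq0 hq1 x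
  have key : ∀ᶠ ε in 𝓝[>] (0 : ℝ), ∀ w ∈ outerSet q x,
      ((∮ t in C(w, ε), h t / t) - ∮ t in C(w⁻¹, ε), h t / t) =
        circleRes (fun t => h t / t) w - circleRes (fun t => h t / t) w⁻¹ := by
    rw [eventually_all_finite hfin]
    intro w hw
    have hw0 := ne_zero_of_mem_outerSet hw
    filter_upwards [circleIntegral_eventually_eq_circleRes (hh.eventually hq0 hq1 hw0),
      circleIntegral_eventually_eq_circleRes (hh.eventually hq0 hq1 (inv_ne_zero hw0))]
      with ε e1 e2
    rw [e1, e2]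
  filter_upwards [key] with ε hε
  unfold awIntegral cycleFunctional
  rw [awOuterPoles_eq, finsum_mem_congr rfl hε]

theorem cycleFunctional_congr {q : ℝ} (hq0 : 0 < q) (hq1 : q < 1) {x : Fin 4 → ℂ}
    (hx : GenericParams q x) {h h' : ℂ → ℂ}
    (H : ∀ t, t ≠ 0 → t ∉ poleSet q x → t⁻¹ ∉ poleSet q x → h t = h' t) :
    cycleFunctional q x h = cycleFunctional q x h' := by
  have hres : ∀ p, p ≠ 0 → circleRes (fun t => h t / t) p = circleRes (fun t => h' t / t) p := by
    intro p hp
    refine circleRes_congr ?_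
    filter_upwards [eventually_off_poles hq0 hq1 x hp] with z hz
    rw [H z hz.1 hz.2.1 hz.2.2]
  unfold cycleFunctional
  congr 2
  · refine circleIntegral.integral_congr zero_le_one fun z hz => ?_
    have hz1 : ‖z‖ = 1 := by simpa using hz
    have hz0 : z ≠ 0 := by rintro rfl; simp at hz1
    obtain ⟨h1, h2⟩ := hx.not_mem_of_norm_eq_one hz1
    simp only [H z hz0 h1 h2]
  · refine finsum_mem_congr rfl fun w hw => ?_
    have hw0 := ne_zero_of_mem_outerSet hw
    rw [hres w hw0, hres _ (inv_ne_zero hw0)]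

theorem cycleFunctional_add {q : ℝ} (hq0 : 0 < q) (hq1 : q < 1) {x : Fin 4 → ℂ}
    (hx : GenericParams q x) {h h' : ℂ → ℂ} (hh : HoloOffPoles q x h)
    (hh' : HoloOffPoles q x h') :
    cycleFunctional q x (fun t => h t + h' t) =
      cycleFunctional q x h + cycleFunctional q x h' := by
  unfold cycleFunctional
  have hres : ∀ p, p ≠ 0 → circleRes (fun t => (h t + h' t) / t) p =
      circleRes (fun t => h t / t) p + circleRes (fun t => h' t / t) p := by
    intro p hp
    simp only [add_div]
    exact circleRes_add (hh.eventually hq0 hq1 hp) (hh'.eventually hq0 hq1 hp)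
  have hsum : (∮ t in C(0, 1), (h t + h' t) / t) =
      (∮ t in C(0, 1), h t / t) + ∮ t in C(0, 1), h' t / t := by
    simp only [add_div]
    exact circleIntegral.integral_add (hh.circleIntegrable hx) (hh'.circleIntegrable hx)
  rw [hsum, ← mul_add, add_add_add_comm, ← finsum_mem_add_distrib (finite_outerSet hq0 hq1 x)]
  congr 2
  refine finsum_mem_congr rfl fun w hw => ?_
  have hw0 := ne_zero_of_mem_outerSet hw
  rw [hres w hw0, hres _ (inv_ne_zero hw0)]
  ring

theorem cycleFunctional_const_mul {q : ℝ} (hq0 : 0 < q) (hq1 : q < 1) {x : Fin 4 → ℂ}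
    (c : ℂ) {h : ℂ → ℂ} (hh : HoloOffPoles q x h) :
    cycleFunctional q x (fun t => c * h t) = c * cycleFunctional q x h := by
  unfold cycleFunctional
  have hres : ∀ p, p ≠ 0 → circleRes (fun t => c * h t / t) p =
      c * circleRes (fun t => h t / t) p := by
    intro p hp
    simp only [mul_div_assoc]
    exact circleRes_const_mul c (hh.eventually hq0 hq1 hp)
  have hsum : (∮ t in C(0, 1), c * h t / t) = c * ∮ t in C(0, 1), h t / t := by
    simp only [mul_div_assoc]
    exact circleIntegral.integral_const_mul _ _ _ _
  have hfs : (∑ᶠ w ∈ outerSet q x,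
      (circleRes (fun t => c * h t / t) w - circleRes (fun t => c * h t / t) w⁻¹)) =
      c * ∑ᶠ w ∈ outerSet q x,
        (circleRes (fun t => h t / t) w - circleRes (fun t => h t / t) w⁻¹) := by
    rw [finsum_mem_eq_finite_toFinset_sum _ (finite_outerSet hq0 hq1 x),
      finsum_mem_eq_finite_toFinset_sum _ (finite_outerSet hq0 hq1 x), Finset.mul_sum]
    refine Finset.sum_congr rfl fun w hw => ?_
    have hw0 := ne_zero_of_mem_outerSet ((Set.Finite.mem_toFinset _).1 hw)
    rw [hres w hw0, hres _ (inv_ne_zero hw0)]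
    ring
  rw [hsum, hfs]
  ring

/-- Invariance of the cycle under the substitution `t ↦ qt`, for functions whose poles are among the
`x_i q^{k+1}` and the `x_i⁻¹ q^{-k}`: the poles crossed when the unit circle shrinks to radius `q`
are those which enter or leave the sum over small circles. -/
theorem cycleFunctional_comp_mul {q : ℝ} (hq0 : 0 < q) (hq1 : q < 1) {x : Fin 4 → ℂ}
    (hx : GenericParams q x) {F : ℂ → ℂ}
    (hF : ∀ t, t ≠ 0 → (∀ i, ∀ k : ℕ, t ≠ x i * (q : ℂ) ^ (k + 1)) → t⁻¹ ∉ poleSet q x →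
      DifferentiableAt ℂ F t) (hm : ∀ t, t ≠ 0 → MeromorphicAt F t) :
    cycleFunctional q x (fun t => F (q * t)) = cycleFunctional q x F := by
  classical
  have hqc : (q : ℂ) ≠ 0 := ofReal_ne_zero_of_pos hq0
  have hqn : ‖(q : ℂ)‖ = q := by rw [Complex.norm_real, Real.norm_of_nonneg hq0.le]
  obtain ⟨H, hH⟩ : ∃ H : ℂ → ℂ, H = fun t => F t / t := ⟨_, rfl⟩
  have hFh : HoloOffPoles q x F := fun t h1 h2 h3 =>
    hF t h1 (fun i k h => h2 ⟨i, k + 1, h⟩) h3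
  have hHd : ∀ p, p ≠ 0 → ∀ᶠ z in 𝓝[≠] p, DifferentiableAt ℂ H z := fun p hp => by
    rw [hH]; exact hFh.eventually hq0 hq1 hp
  have hfun : (fun t => F (q * t) / t) = fun t => q * H (q * t) := by
    rw [hH]; ext t
    by_cases ht : t = 0
    · simp [ht]
    · field_simp
  have hres0 : ∀ p, p ≠ 0 → (∀ i, ∀ k : ℕ, p ≠ x i * (q : ℂ) ^ (k + 1)) → p⁻¹ ∉ poleSet q x →
      circleRes H p = 0 := by
    intro p hp h1 h2
    refine circleRes_eq_zero ?_
    have h3 := hHd p hp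
    rw [eventually_nhdsWithin_iff] at h3
    filter_upwards [h3] with z hz
    by_cases hzp : z = p
    · subst hzp
      rw [hH]
      exact (hF z hp h1 h2).div differentiableAt_id hp
    · exact hz hzp
  have hfin := finite_outerSet hq0 hq1 x
  -- `W` are the poles encircled on the outside, `V = W⁻¹` those encircled on the inside, and `Q`, `U`
  -- are their images under `t ↦ qt`
  obtain ⟨W, hW⟩ : ∃ W : Finset ℂ, W = hfin.toFinset := ⟨_, rfl⟩
  have hmem : ∀ w, w ∈ W ↔ w ∈ poleSet q x ∧ 1 < ‖w‖ := fun w => by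
    rw [hW, Set.Finite.mem_toFinset]; rfl
  have hW0 : ∀ w ∈ W, w ≠ 0 := fun w hw => ne_zero_of_mem_outerSet ((hmem w).1 hw)
  have hinj : Function.Injective fun w : ℂ => (q : ℂ) * w := mul_right_injective₀ hqc
  obtain ⟨Q, hQ⟩ : ∃ Q : Finset ℂ, Q = W.image fun w => (q : ℂ) * w := ⟨_, rfl⟩
  obtain ⟨V, hV⟩ : ∃ V : Finset ℂ, V = W.image fun w => w⁻¹ := ⟨_, rfl⟩
  obtain ⟨U, hU⟩ : ∃ U : Finset ℂ, U = V.image fun w => (q : ℂ) * w := ⟨_, rfl⟩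
  have hQm : ∀ v, v ∈ Q ↔ ∃ i, ∃ k : ℕ, v = x i * (q : ℂ) ^ (k + 1) ∧ q < ‖v‖ := by
    intro v
    rw [hQ, Finset.mem_image]
    constructor
    · rintro ⟨w, hw, rfl⟩
      obtain ⟨⟨i, k, rfl⟩, h2⟩ := (hmem w).1 hw
      refine ⟨i, k, by ring, ?_⟩
      rw [norm_mul, hqn]
      nlinarith
    · rintro ⟨i, k, rfl, h⟩
      refine ⟨x i * (q : ℂ) ^ k, (hmem _).2 ⟨⟨i, k, rfl⟩, ?_⟩, by ring⟩
      have e : x i * (q : ℂ) ^ (k + 1) = q * (x i * (q : ℂ) ^ k) := by ring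
      rw [e, norm_mul, hqn] at h
      exact lt_of_mul_lt_mul_left (by linarith) hq0.le
  have hVm : ∀ v, v ∈ V ↔ v⁻¹ ∈ poleSet q x ∧ v ≠ 0 ∧ ‖v‖ < 1 := by
    intro v
    rw [hV, Finset.mem_image]
    constructor
    · rintro ⟨w, hw, rfl⟩
      obtain ⟨h1, h2⟩ := (hmem w).1 hw
      refine ⟨by rwa [inv_inv], inv_ne_zero (hW0 w hw), ?_⟩
      rw [norm_inv]
      exact inv_lt_one_of_one_lt₀ h2
    · rintro ⟨h1, h2, h3⟩
      refine ⟨v⁻¹, (hmem _).2 ⟨h1, ?_⟩, inv_inv v⟩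
      rw [norm_inv]
      exact (one_lt_inv₀ (norm_pos_iff.2 h2)).2 h3
  have hUm : ∀ u, u ∈ U → (u / q)⁻¹ ∈ poleSet q x ∧ u ≠ 0 ∧ ‖u‖ < q := by
    intro u hu
    rw [hU, Finset.mem_image] at hu
    obtain ⟨v, hv, rfl⟩ := hu
    obtain ⟨h1, h2, h3⟩ := (hVm v).1 hv
    refine ⟨by rwa [mul_div_cancel_left₀ _ hqc], mul_ne_zero hqc h2, ?_⟩
    rw [norm_mul, hqn]; nlinarith
  -- in both sums, the points which belong to only one of the sets are either in the annulus
  -- `q < ‖t‖ < 1` or have residue zero; here for the poles `x_i q^{k+1}`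
  have c1 : (∑ w ∈ W, circleRes H w) + ∑ w ∈ Q with ‖w‖ < 1, circleRes H w =
      ∑ w ∈ Q, circleRes H w := by
    rw [← Finset.sum_filter_add_sum_filter_not Q (fun w => ‖w‖ < 1), add_comm]
    congr 1
    symm
    refine Finset.sum_subset ?_ ?_
    · intro v hv
      rw [Finset.mem_filter, hQm] at hv
      obtain ⟨⟨i, k, rfl, h1⟩, h2⟩ := hv
      exact (hmem _).2 ⟨⟨i, k + 1, rfl⟩, lt_of_le_of_ne (not_lt.1 h2) (hx.2 i (k + 1)).symm⟩
    · intro w hw hw'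
      obtain ⟨⟨i, k, hik⟩, h2⟩ := (hmem w).1 hw
      refine hres0 w (hW0 w hw) ?_ ?_
      · intro i k h
        refine hw' ?_
        rw [Finset.mem_filter, hQm]
        exact ⟨⟨i, k, h, by linarith⟩, by linarith⟩
      · rintro ⟨j, l, hjl⟩
        refine hx.1 i j (k + l) ?_
        rw [pow_add]
        calc x i * x j * ((q : ℂ) ^ k * (q : ℂ) ^ l)
            = (x i * (q : ℂ) ^ k) * (x j * (q : ℂ) ^ l) := by ring
          _ = w * w⁻¹ := by rw [← hik, ← hjl]
          _ = 1 := mul_inv_cancel₀ (hW0 w hw)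
  -- the same for the poles `x_i⁻¹ q^{-k}`
  have c2 : ∑ w ∈ V, circleRes H w = (∑ w ∈ V with q < ‖w‖, circleRes H w) +
      ∑ w ∈ U, circleRes H w := by
    rw [← Finset.sum_filter_add_sum_filter_not V (fun w => q < ‖w‖)]
    congr 1
    refine Finset.sum_subset ?_ ?_
    · intro v hv
      rw [Finset.mem_filter, hVm] at hv
      obtain ⟨⟨⟨i, k, h1⟩, h2, h3⟩, h4⟩ := hv
      have e : (v / q)⁻¹ = x i * (q : ℂ) ^ (k + 1) := by
        rw [inv_div, div_eq_mul_inv, h1]; ring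
      have h5 : ‖v‖ < q := by
        refine lt_of_le_of_ne (not_lt.1 h4) fun h => hx.2 i (k + 1) ?_
        rw [← e, norm_inv, norm_div, h, hqn, div_self hq0.ne', inv_one]
      rw [hU, Finset.mem_image]
      refine ⟨v / q, (hVm _).2 ⟨⟨i, k + 1, e⟩, div_ne_zero h2 hqc, ?_⟩, mul_div_cancel₀ _ hqc⟩
      rw [norm_div, hqn]
      exact (div_lt_one hq0).2 h5
    · intro u hu hu'
      obtain ⟨⟨i, k, h1⟩, h2, h3⟩ := hUm u hu
      refine hres0 u h2 ?_ ?_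
      · intro j l h
        refine hx.1 i j (k + l) ?_
        rw [pow_add]
        calc x i * x j * ((q : ℂ) ^ k * (q : ℂ) ^ l)
            = (x i * (q : ℂ) ^ k) * (x j * (q : ℂ) ^ (l + 1)) / q := by field_simp; ring
          _ = (u / q)⁻¹ * u / q := by rw [← h1, ← h]
          _ = 1 := by field_simp
      · intro h
        refine hu' ?_
        rw [Finset.mem_filter, hVm]
        exact ⟨⟨h, h2, by linarith⟩, by linarith⟩
  have hdisj : Disjoint (Q.filter fun w => ‖w‖ < 1) (V.filter fun w => q < ‖w‖) := by
    rw [Finset.disjoint_left]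
    intro v h1 h2
    rw [Finset.mem_filter, hQm] at h1
    rw [Finset.mem_filter, hVm] at h2
    obtain ⟨⟨i, k, hik, _⟩, _⟩ := h1
    obtain ⟨⟨⟨j, l, hjl⟩, hv0, _⟩, _⟩ := h2
    refine hx.1 i j (k + 1 + l) ?_
    rw [pow_add]
    calc x i * x j * ((q : ℂ) ^ (k + 1) * (q : ℂ) ^ l)
        = (x i * (q : ℂ) ^ (k + 1)) * (x j * (q : ℂ) ^ l) := by ring
      _ = v * v⁻¹ := by rw [← hik, ← hjl]
      _ = 1 := mul_inv_cancel₀ hv0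
  have c3 := circleIntegral_sub_eq_sum_circleRes hq0 hq1
    ((Q.filter fun w => ‖w‖ < 1) ∪ (V.filter fun w => q < ‖w‖)) H ?_ ?_ ?_
  · rw [Finset.sum_union hdisj] at c3
    have e1 : ∑ w ∈ W, circleRes (fun t => q * H (q * t)) w = ∑ w ∈ Q, circleRes H w := by
      rw [hQ, Finset.sum_image fun a _ b _ h => hinj h]
      exact Finset.sum_congr rfl fun w hw =>
        circleRes_comp_mul hq0 (hHd _ (mul_ne_zero hqc (hW0 w hw)))
    have e2 : ∑ w ∈ W, circleRes (fun t => q * H (q * t)) w⁻¹ = ∑ w ∈ U, circleRes H w := by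
      rw [hU, Finset.sum_image fun a _ b _ h => hinj h, hV,
        Finset.sum_image fun a _ b _ h => inv_injective h]
      exact Finset.sum_congr rfl fun w hw =>
        circleRes_comp_mul hq0 (hHd _ (mul_ne_zero hqc (inv_ne_zero (hW0 w hw))))
    have e3 : ∑ w ∈ W, circleRes H w⁻¹ = ∑ w ∈ V, circleRes H w := by
      rw [hV, Finset.sum_image fun a _ b _ h => inv_injective h]
    have e4 : (∮ t in C(0, 1), (q : ℂ) * H (q * t)) = ∮ t in C(0, q), H t := by
      rw [circleIntegral_comp_mul]; simp
    have hs : ∀ f : ℂ → ℂ, ∑ᶠ w ∈ outerSet q x, f w = ∑ w ∈ W, f w := fun f => by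
      rw [hW]; exact finsum_mem_eq_finite_toFinset_sum f hfin
    unfold cycleFunctional
    rw [hfun, ← hH, hs, hs, Finset.sum_sub_distrib, Finset.sum_sub_distrib, e1, e2, e3, e4]
    congr 1
    linear_combination c2 - c1 - c3
  · intro p hp
    rw [Finset.mem_union, Finset.mem_filter, Finset.mem_filter, hQm, hVm] at hp
    rcases hp with ⟨⟨i, k, _, h1⟩, h2⟩ | ⟨⟨_, _, h1⟩, h2⟩
    · exact ⟨h1, h2⟩
    · exact ⟨h2, h1⟩
  · intro z h1 h2 h3
    have hz0 : z ≠ 0 := by rintro rfl; simp at h1; linarith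
    rw [Finset.mem_union, Finset.mem_filter, Finset.mem_filter, hQm, hVm, not_or] at h3
    rw [hH]
    refine (hF z hz0 ?_ ?_).div differentiableAt_id hz0
    · intro i k hik
      refine h3.1 ⟨⟨i, k, hik, lt_of_le_of_ne h1 fun h => hx.2 i k ?_⟩,
        lt_of_le_of_ne h2 fun h => hx.2 i (k + 1) (by rw [← hik, h])⟩
      have e : x i * (q : ℂ) ^ (k + 1) = q * (x i * (q : ℂ) ^ k) := by ring
      rw [hik, e, norm_mul, hqn] at h
      exact (mul_right_cancel₀ hq0.ne' (by linarith)).symm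
    · rintro ⟨i, k, hik⟩
      refine h3.2 ⟨⟨⟨i, k, hik⟩, hz0, lt_of_le_of_ne h2 fun h => hx.2 i k ?_⟩,
        lt_of_le_of_ne h1 fun h => hx.2 i (k + 1) ?_⟩
      · rw [← hik, norm_inv, h, inv_one]
      · have e : x i * (q : ℂ) ^ (k + 1) = q * (x i * (q : ℂ) ^ k) := by ring
        rw [e, ← hik, norm_mul, hqn, norm_inv, ← h, mul_inv_cancel₀ hq0.ne']
  · intro p hp
    have hp0 : p ≠ 0 := by
      rw [Finset.mem_union, Finset.mem_filter, Finset.mem_filter, hQm, hVm] at hp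
      rcases hp with ⟨⟨i, k, _, h1⟩, h2⟩ | ⟨⟨_, h1, _⟩, h2⟩
      · rintro rfl; simp at h1; linarith
      · exact h1
    rw [hH]
    exact (hm p hp0).div (MeromorphicAt.id p)

/-! ### The Askey–Wilson integral -/

/-- `awWeight` for a family of parameters. -/
def awW (q : ℝ) (x : Fin 4 → ℂ) (t : ℂ) : ℂ :=
  qInf q (t ^ 2) * qInf q (t ^ 2)⁻¹ / ∏ i, (qInf q (x i * t) * qInf q (x i * t⁻¹))

/-- Holomorphy on `ℂ ∖ {0}`. -/
def HoloStar (f : ℂ → ℂ) : Prop := ∀ t, t ≠ 0 → DifferentiableAt ℂ f t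

theorem awWeight_eq_awW (q : ℝ) (x : Fin 4 → ℂ) (t : ℂ) :
    awWeight q (x 0) (x 1) (x 2) (x 3) t = awW q x t := by
  unfold awWeight awW
  rw [Fin.prod_univ_four]
  congr 1
  ring

section
variable {q : ℝ} {x : Fin 4 → ℂ}

theorem HoloStar.meromorphicAt {f : ℂ → ℂ} (hf : HoloStar f) {t : ℂ} (ht : t ≠ 0) :
    MeromorphicAt f t := by
  refine AnalyticAt.meromorphicAt ?_
  rw [Complex.analyticAt_iff_eventually_differentiableAt]
  exact (eventually_ne_nhds ht).mono hf

theorem HoloStar.qInf (hq0 : 0 < q) (hq1 : q < 1) {f : ℂ → ℂ} (hf : HoloStar f) :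
    HoloStar fun t => qInf q (f t) := fun t ht =>
  (differentiable_qInf hq0 hq1 (f t)).comp t (hf t ht)

theorem HoloStar.mul {f g : ℂ → ℂ} (hf : HoloStar f) (hg : HoloStar g) :
    HoloStar fun t => f t * g t := fun t ht => (hf t ht).mul (hg t ht)

theorem HoloStar.prod {f : Fin 4 → ℂ → ℂ} (hf : ∀ i, HoloStar (f i)) :
    HoloStar fun t => ∏ i, f i t := fun t ht =>
  DifferentiableAt.fun_finsetProd fun i _ => hf i t ht

theorem holoStar_const_mul (a : ℂ) : HoloStar fun t => a * t := fun t _ => by fun_prop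

theorem holoStar_const_mul_inv (a : ℂ) : HoloStar fun t => a * t⁻¹ := fun _ ht =>
  (differentiableAt_inv ht).const_mul a

theorem holoStar_sq : HoloStar fun t => t ^ 2 := fun t _ => by fun_prop

theorem holoStar_const_mul_sq_inv (a : ℂ) : HoloStar fun t => a * (t ^ 2)⁻¹ := fun t ht =>
  (DifferentiableAt.fun_inv (h := fun s : ℂ => s ^ 2) (by fun_prop) (pow_ne_zero 2 ht)).const_mul a

theorem qInf_ne_zero_of_not_mem (hq0 : 0 < q) (hq1 : q < 1) {t : ℂ} (ht : t ≠ 0)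
    (h1 : t ∉ poleSet q x) (h2 : t⁻¹ ∉ poleSet q x) (i : Fin 4) :
    qInf q (x i * t) ≠ 0 ∧ qInf q (x i * t⁻¹) ≠ 0 := by
  rw [Ne, Ne, qInf_eq_zero_iff hq0 hq1, qInf_eq_zero_iff hq0 hq1]
  constructor
  · rintro ⟨k, hk⟩
    refine h2 ⟨i, k, ?_⟩
    field_simp
    linear_combination -hk
  · rintro ⟨k, hk⟩
    refine h1 ⟨i, k, ?_⟩
    field_simp at hk
    linear_combination -hk

theorem holoStar_awNum (hq0 : 0 < q) (hq1 : q < 1) :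
    HoloStar fun t => qInf q (t ^ 2) * qInf q (t ^ 2)⁻¹ := by
  have h := holoStar_const_mul_sq_inv 1
  simp only [one_mul] at h
  exact (holoStar_sq.qInf hq0 hq1).mul (h.qInf hq0 hq1)

theorem holoOffPoles_awW (hq0 : 0 < q) (hq1 : q < 1) {f : ℂ → ℂ} (hf : HoloStar f) :
    HoloOffPoles q x fun t => awW q x t * f t := by
  intro t ht h1 h2
  unfold awW
  refine DifferentiableAt.mul (DifferentiableAt.div (holoStar_awNum hq0 hq1 t ht) ?_ ?_) (hf t ht)
  · exact HoloStar.prod (fun i => ((holoStar_const_mul (x i)).qInf hq0 hq1).mul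
      ((holoStar_const_mul_inv (x i)).qInf hq0 hq1)) t ht
  · refine Finset.prod_ne_zero_iff.2 fun i _ => ?_
    obtain ⟨e1, e2⟩ := qInf_ne_zero_of_not_mem hq0 hq1 ht h1 h2 i
    exact mul_ne_zero e1 e2

theorem HoloOffPoles.circleRes_eq_zero (hq0 : 0 < q) (hq1 : q < 1) {h : ℂ → ℂ}
    (hh : HoloOffPoles q x h) {p : ℂ} (hp : p ≠ 0) (h1 : p ∉ poleSet q x)
    (h2 : p⁻¹ ∉ poleSet q x) : circleRes (fun t => h t / t) p = 0 := by
  refine MacdonaldSoV.circleRes_eq_zero ?_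
  have h3 := hh.eventually hq0 hq1 hp
  rw [eventually_nhdsWithin_iff] at h3
  filter_upwards [h3] with z hz
  by_cases hzp : z = p
  · subst hzp
    exact (hh z hp h1 h2).div differentiableAt_id hp
  · exact hz hzp

theorem poleSet_update_subset (i : Fin 4) :
    poleSet q (Function.update x i (x i * q)) ⊆ poleSet q x := by
  rintro w ⟨j, k, rfl⟩
  by_cases hj : j = i
  · subst hj
    exact ⟨j, k + 1, by rw [Function.update_self]; ring⟩
  · exact ⟨j, k, by rw [Function.update_of_ne hj]⟩

theorem GenericParams.update (hx : GenericParams q x) (i : Fin 4) :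
    GenericParams q (Function.update x i (x i * q)) := by
  have key : ∀ j, ∃ m : ℕ, Function.update x i (x i * q) j = x j * (q : ℂ) ^ m := by
    intro j
    by_cases hj : j = i
    · subst hj; exact ⟨1, by simp⟩
    · exact ⟨0, by simp [hj]⟩
  constructor
  · intro j l n
    obtain ⟨a, ha⟩ := key j
    obtain ⟨b, hb⟩ := key l
    rw [ha, hb]
    have := hx.1 j l (a + b + n)
    rw [pow_add, pow_add] at this
    intro h
    exact this (by rw [← h]; ring)
  · intro j k
    obtain ⟨a, ha⟩ := key j
    rw [ha, mul_assoc, ← pow_add]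
    exact hx.2 j _

theorem awW_update (hq0 : 0 < q) (hq1 : q < 1) (i : Fin 4) {t : ℂ} (ht : t ≠ 0)
    (h1 : t ∉ poleSet q x) (h2 : t⁻¹ ∉ poleSet q x) :
    awW q x t * ((1 - x i * t) * (1 - x i * t⁻¹)) =
      awW q (Function.update x i (x i * q)) t := by
  unfold awW
  have hne := qInf_ne_zero_of_not_mem hq0 hq1 ht h1 h2 i
  rw [qInf_step hq0 hq1 (x i * t), qInf_step hq0 hq1 (x i * t⁻¹)] at hne
  have e1 := (mul_ne_zero_iff.1 hne.1).1
  have e2 := (mul_ne_zero_iff.1 hne.2).1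
  rw [Fintype.prod_eq_mul_prod_compl i, Fintype.prod_eq_mul_prod_compl i,
    Finset.prod_congr rfl (g := fun j => qInf q (x j * t) * qInf q (x j * t⁻¹))
      (s₁ := ({i} : Finset (Fin 4))ᶜ) (f := fun j => qInf q (Function.update x i (x i * q) j * t) *
        qInf q (Function.update x i (x i * q) j * t⁻¹)), Function.update_self,
    qInf_step hq0 hq1 (x i * t), qInf_step hq0 hq1 (x i * t⁻¹), mul_right_comm (x i) (q : ℂ) t,
    mul_right_comm (x i) (q : ℂ) t⁻¹]
  · rw [show (1 - x i * t) * qInf q (x i * t * q) * ((1 - x i * t⁻¹) * qInf q (x i * t⁻¹ * q)) *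
      (∏ j ∈ ({i} : Finset (Fin 4))ᶜ, qInf q (x j * t) * qInf q (x j * t⁻¹)) =
      ((1 - x i * t) * (1 - x i * t⁻¹)) * (qInf q (x i * t * q) * qInf q (x i * t⁻¹ * q) *
      (∏ j ∈ ({i} : Finset (Fin 4))ᶜ, qInf q (x j * t) * qInf q (x j * t⁻¹))) by ring,
      div_mul_eq_mul_div, mul_comm, mul_div_mul_left _ _ (mul_ne_zero e1 e2)]
  · intro j hj
    have : j ≠ i := by simpa using hj
    rw [Function.update_of_ne this]

/-- Replacing `a` by `aq` amounts to inserting the factor `(1 - at)(1 - a/t)` in the integrand. -/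
theorem cycleFunctional_update (hq0 : 0 < q) (hq1 : q < 1) (hx : GenericParams q x) (i : Fin 4)
    {f : ℂ → ℂ} (hf : HoloStar f) :
    cycleFunctional q x (fun t => awW q x t * ((1 - x i * t) * (1 - x i * t⁻¹) * f t)) =
      cycleFunctional q (Function.update x i (x i * q))
        (fun t => awW q (Function.update x i (x i * q)) t * f t) := by
  obtain ⟨x', hx'⟩ : ∃ x', x' = Function.update x i (x i * q) := ⟨_, rfl⟩
  have hsub : poleSet q x' ⊆ poleSet q x := hx' ▸ poleSet_update_subset i
  have e1 : cycleFunctional q x (fun t => awW q x t * ((1 - x i * t) * (1 - x i * t⁻¹) * f t)) =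
      cycleFunctional q x (fun t => awW q x' t * f t) := by
    refine cycleFunctional_congr hq0 hq1 hx fun t h1 h2 h3 => ?_
    rw [hx', ← awW_update hq0 hq1 i h1 h2 h3]
    ring
  rw [e1, ← hx']
  have hh : HoloOffPoles q x' (fun t => awW q x' t * f t) := holoOffPoles_awW hq0 hq1 hf
  unfold cycleFunctional
  congr 2
  rw [finsum_mem_eq_finite_toFinset_sum _ (finite_outerSet hq0 hq1 x),
    finsum_mem_eq_finite_toFinset_sum _ (finite_outerSet hq0 hq1 x')]
  symm
  refine Finset.sum_subset ?_ ?_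
  · intro w hw
    rw [Set.Finite.mem_toFinset] at hw ⊢
    exact ⟨hsub hw.1, hw.2⟩
  -- the point lost from the set of poles is regular for the new integrand
  · intro w hw hw'
    rw [Set.Finite.mem_toFinset] at hw hw'
    have hw0 := ne_zero_of_mem_outerSet hw
    have n1 : w ∉ poleSet q x' := fun h => hw' ⟨h, hw.2⟩
    have n2 : w⁻¹ ∉ poleSet q x' := by
      intro h
      obtain ⟨j, k, hjk⟩ := hw.1
      obtain ⟨l, m, hlm⟩ := hsub h
      refine hx.1 j l (k + m) ?_
      rw [pow_add]
      calc x j * x l * ((q : ℂ) ^ k * (q : ℂ) ^ m)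
          = (x j * (q : ℂ) ^ k) * (x l * (q : ℂ) ^ m) := by ring
        _ = w * w⁻¹ := by rw [← hjk, ← hlm]
        _ = 1 := mul_inv_cancel₀ hw0
    rw [hh.circleRes_eq_zero hq0 hq1 hw0 n1 n2,
      hh.circleRes_eq_zero hq0 hq1 (inv_ne_zero hw0) n2 (by rwa [inv_inv]), sub_zero]

/-- The first moment of the Askey–Wilson weight: the weight times
`(1 - e₄)(t + t⁻¹) - (e₁ - e₃)` is a difference `F(t) - F(qt)`. -/
theorem cycleFunctional_moment (hq0 : 0 < q) (hq1 : q < 1) (hx : GenericParams q x) :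
    (1 - x 0 * x 1 * x 2 * x 3) * cycleFunctional q x (fun t => awW q x t * (t + t⁻¹)) =
      ((x 0 + x 1 + x 2 + x 3) - (x 0 * x 1 * x 2 + x 0 * x 1 * x 3 + x 0 * x 2 * x 3 +
        x 1 * x 2 * x 3)) * cycleFunctional q x (fun t => awW q x t * 1) := by
  have hqc : (q : ℂ) ≠ 0 := ofReal_ne_zero_of_pos hq0
  -- moving one factor `1 - x_i/t` of each parameter into the numerator makes `F` regular at the `x_i`,
  -- so that its poles are those allowed in `cycleFunctional_comp_mul`
  obtain ⟨D, hD⟩ : ∃ D : ℂ → ℂ, D = fun t => ∏ i, (qInf q (x i * t) * qInf q (x i * q * t⁻¹)) :=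
    ⟨_, rfl⟩
  obtain ⟨F, hF⟩ : ∃ F : ℂ → ℂ, F = fun t => t * (qInf q (t ^ 2) * qInf q (q * (t ^ 2)⁻¹)) / D t :=
    ⟨_, rfl⟩
  have hDh : HoloStar D := hD ▸ HoloStar.prod (fun i => ((holoStar_const_mul (x i)).qInf hq0 hq1).mul
      ((holoStar_const_mul_inv (x i * q)).qInf hq0 hq1))
  have hNh : HoloStar fun t => t * (qInf q (t ^ 2) * qInf q (q * (t ^ 2)⁻¹)) := by
    have := holoStar_const_mul 1
    simp only [one_mul] at this
    exact this.mul ((holoStar_sq.qInf hq0 hq1).mul ((holoStar_const_mul_sq_inv (q : ℂ)).qInf hq0 hq1))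
  have hFd : ∀ t, t ≠ 0 → (∀ i, ∀ k : ℕ, t ≠ x i * (q : ℂ) ^ (k + 1)) → t⁻¹ ∉ poleSet q x →
      DifferentiableAt ℂ F t := by
    intro t ht h1 h2
    rw [hF]
    refine (hNh t ht).div (hDh t ht) ?_
    rw [hD]
    refine Finset.prod_ne_zero_iff.2 fun i _ => mul_ne_zero ?_ ?_
    · rw [Ne, qInf_eq_zero_iff hq0 hq1]
      rintro ⟨k, hk⟩
      refine h2 ⟨i, k, ?_⟩
      field_simp
      linear_combination -hk
    · rw [Ne, qInf_eq_zero_iff hq0 hq1]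
      rintro ⟨k, hk⟩
      refine h1 i k ?_
      field_simp at hk
      rw [pow_succ]
      linear_combination -hk
  have hFm : ∀ t, t ≠ 0 → MeromorphicAt F t := fun t ht => by
    rw [hF]; exact (hNh.meromorphicAt ht).div (hDh.meromorphicAt ht)
  have hinv := cycleFunctional_comp_mul hq0 hq1 hx hFd hFm
  have hFh : HoloOffPoles q x F := fun t h1 h2 h3 =>
    hFd t h1 (fun i k h => h2 ⟨i, k + 1, h⟩) h3
  have hFh' : HoloOffPoles q x fun t => F (q * t) := by
    intro t h1 h2 h3
    refine DifferentiableAt.comp t (hFd _ (mul_ne_zero hqc h1) ?_ ?_) (by fun_prop)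
    · intro i k h
      refine h2 ⟨i, k, mul_left_cancel₀ hqc ?_⟩
      rw [h]; ring
    · rintro ⟨i, k, h⟩
      refine h3 ⟨i, k + 1, ?_⟩
      rw [pow_succ, ← mul_assoc, ← h]
      field_simp
  have hone : HoloStar fun _ => (1 : ℂ) := fun t _ => by fun_prop
  have hz : HoloStar fun t : ℂ => t + t⁻¹ := fun t ht =>
    differentiableAt_id.add (differentiableAt_inv ht)
  have hw1 := holoOffPoles_awW (x := x) hq0 hq1 hone
  have hwz := holoOffPoles_awW (x := x) hq0 hq1 hz
  have hsmul : ∀ (c : ℂ) {h : ℂ → ℂ}, HoloOffPoles q x h → HoloOffPoles q x fun t => c * h t :=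
    fun c h hh t h1 h2 h3 => (hh t h1 h2 h3).const_mul c
  have key : cycleFunctional q x (fun t => F t + -1 * F (q * t)) =
      cycleFunctional q x (fun t => (1 - x 0 * x 1 * x 2 * x 3) * (awW q x t * (t + t⁻¹)) +
        -((x 0 + x 1 + x 2 + x 3) - (x 0 * x 1 * x 2 + x 0 * x 1 * x 3 + x 0 * x 2 * x 3 +
        x 1 * x 2 * x 3)) * (awW q x t * 1)) := by
    refine cycleFunctional_congr hq0 hq1 hx fun t ht h1 h2 => ?_
    have hne := qInf_ne_zero_of_not_mem hq0 hq1 ht h1 h2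
    -- the common factor of all terms
    obtain ⟨N, hN⟩ : ∃ N, N = qInf q (t ^ 2 * q) * qInf q ((t ^ 2)⁻¹ * q) := ⟨_, rfl⟩
    obtain ⟨E, hE⟩ : ∃ E : Fin 4 → ℂ, E = fun i => qInf q (x i * t) * qInf q (x i * t⁻¹) :=
      ⟨_, rfl⟩
    have hE0 : ∀ i, E i ≠ 0 := fun i => by rw [hE]; exact mul_ne_zero (hne i).1 (hne i).2
    have hW : awW q x t = (1 - t ^ 2) * (1 - (t ^ 2)⁻¹) * N / (E 0 * E 1 * E 2 * E 3) := by
      unfold awW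
      rw [Fin.prod_univ_four, qInf_step hq0 hq1 (t ^ 2), qInf_step hq0 hq1 (t ^ 2)⁻¹, hN, hE]
      ring
    have d1 : ∀ i, (1 - x i * t⁻¹) * (qInf q (x i * t) * qInf q (x i * q * t⁻¹)) = E i := by
      intro i
      rw [hE]
      simp only
      rw [qInf_step hq0 hq1 (x i * t⁻¹), mul_right_comm (x i) (q : ℂ)]
      ring
    have d2 : ∀ i, (1 - x i * t) * (qInf q (x i * (q * t)) * qInf q (x i * q * (q * t)⁻¹)) = E i := by
      intro i
      rw [hE]
      simp only
      rw [qInf_step hq0 hq1 (x i * t), show x i * (q * t) = x i * t * q by ring,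
        show x i * q * (q * t)⁻¹ = x i * t⁻¹ by field_simp]
      ring
    have f1 : F t = t * (1 - t ^ 2) * N * ((1 - x 0 * t⁻¹) * (1 - x 1 * t⁻¹) * (1 - x 2 * t⁻¹) *
        (1 - x 3 * t⁻¹)) / (E 0 * E 1 * E 2 * E 3) := by
      have g : ∀ i, qInf q (x i * t) * qInf q (x i * q * t⁻¹) = E i / (1 - x i * t⁻¹) := by
        intro i
        have : 1 - x i * t⁻¹ ≠ 0 := fun h => hE0 i (by rw [← d1, h, zero_mul])
        rw [eq_div_iff this, ← d1 i]; ring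
      rw [hF]
      simp only
      rw [hD]
      simp only
      rw [Fin.prod_univ_four, g, g, g, g, qInf_step hq0 hq1 (t ^ 2), hN, mul_comm (q : ℂ) (t ^ 2)⁻¹,
        ← mul_div_mul_comm, ← mul_div_mul_comm, ← mul_div_mul_comm, div_div_eq_mul_div]
      ring
    have f2 : F (q * t) = -(t⁻¹ * (1 - (t ^ 2)⁻¹)) * N * ((1 - x 0 * t) * (1 - x 1 * t) *
        (1 - x 2 * t) * (1 - x 3 * t)) / (E 0 * E 1 * E 2 * E 3) := by
      have g : ∀ i, qInf q (x i * (q * t)) * qInf q (x i * q * (q * t)⁻¹) = E i / (1 - x i * t) := by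
        intro i
        have : 1 - x i * t ≠ 0 := fun h => hE0 i (by rw [← d2, h, zero_mul])
        rw [eq_div_iff this, ← d2 i]; ring
      have n1 : q * t * (qInf q ((q * t) ^ 2) * qInf q (q * ((q * t) ^ 2)⁻¹)) =
          -(t⁻¹ * (1 - (t ^ 2)⁻¹)) * N := by
        rw [hN, qInf_step hq0 hq1 (t ^ 2 * q), show (q : ℂ) * ((q * t) ^ 2)⁻¹ = (t ^ 2)⁻¹ * (q : ℂ)⁻¹ by
          field_simp, qInf_step hq0 hq1 ((t ^ 2)⁻¹ * (q : ℂ)⁻¹), inv_mul_cancel_right₀ hqc,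
          qInf_step hq0 hq1 (t ^ 2)⁻¹, show t ^ 2 * q * q = (q * t) ^ 2 by ring]
        generalize qInf q ((q * t) ^ 2) = A
        generalize qInf q ((t ^ 2)⁻¹ * q) = B
        field_simp
        ring
      rw [hF]
      simp only
      rw [n1, hD]
      simp only
      rw [Fin.prod_univ_four, g, g, g, g,
        ← mul_div_mul_comm, ← mul_div_mul_comm, ← mul_div_mul_comm, div_div_eq_mul_div]
    rw [f1, f2, hW]
    have hEE : E 0 * E 1 * E 2 * E 3 ≠ 0 :=
      mul_ne_zero (mul_ne_zero (mul_ne_zero (hE0 0) (hE0 1)) (hE0 2)) (hE0 3)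
    generalize E 0 * E 1 * E 2 * E 3 = Z at hEE
    field_simp
    ring
  rw [cycleFunctional_add hq0 hq1 hx hFh (hsmul _ hFh'), cycleFunctional_const_mul hq0 hq1 _ hFh', hinv,
    cycleFunctional_add hq0 hq1 hx (hsmul _ hwz) (hsmul _ hw1),
    cycleFunctional_const_mul hq0 hq1 _ hwz, cycleFunctional_const_mul hq0 hq1 _ hw1] at key
  linear_combination -key

/-- The Askey–Wilson integral divided by the expected product, up to `(abcd; q)_∞`. -/
def awRatio (q : ℝ) (x : Fin 4 → ℂ) : ℂ :=
  cycleFunctional q x (fun t => awW q x t * 1) *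
    (qInf q (x 0 * x 1) * qInf q (x 0 * x 2) * qInf q (x 0 * x 3) * qInf q (x 1 * x 2) *
      qInf q (x 1 * x 3) * qInf q (x 2 * x 3))

/-- Since `(1 - at)(1 - a/t) = 1 + a² - a (t + 1/t)`, the first moment determines the change of the
integral under `a ↦ aq`. -/
theorem awRatio_update (hq0 : 0 < q) (hq1 : q < 1) (hx : GenericParams q x) (i : Fin 4) :
    awRatio q x = (1 - x 0 * x 1 * x 2 * x 3) * awRatio q (Function.update x i (x i * q)) := by
  have hone : HoloStar fun _ => (1 : ℂ) := fun t _ => by fun_prop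
  have hz : HoloStar fun t : ℂ => t + t⁻¹ := fun t ht =>
    differentiableAt_id.add (differentiableAt_inv ht)
  have hw1 := holoOffPoles_awW (x := x) hq0 hq1 hone
  have hwz := holoOffPoles_awW (x := x) hq0 hq1 hz
  have hsmul : ∀ (c : ℂ) {h : ℂ → ℂ}, HoloOffPoles q x h → HoloOffPoles q x fun t => c * h t :=
    fun c h hh t h1 h2 h3 => (hh t h1 h2 h3).const_mul c
  have e1 := cycleFunctional_update hq0 hq1 hx i hone
  have e2 : cycleFunctional q x (fun t => awW q x t * ((1 - x i * t) * (1 - x i * t⁻¹) * 1)) =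
      cycleFunctional q x (fun t => (1 + x i ^ 2) * (awW q x t * 1) +
        -x i * (awW q x t * (t + t⁻¹))) := by
    refine cycleFunctional_congr hq0 hq1 hx fun t ht _ _ => ?_
    field_simp
    ring
  rw [e2, cycleFunctional_add hq0 hq1 hx (hsmul _ hw1) (hsmul _ hwz),
    cycleFunctional_const_mul hq0 hq1 _ hwz, cycleFunctional_const_mul hq0 hq1 _ hw1] at e1
  have e3 := cycleFunctional_moment hq0 hq1 hx
  unfold awRatio
  rw [← e1]
  generalize cycleFunctional q x (fun t => awW q x t * (t + t⁻¹)) = Lz at e3 ⊢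
  generalize cycleFunctional q x (fun t => awW q x t * 1) = L1 at e3 ⊢
  fin_cases i
  · simp [Function.update]
    rw [qInf_step hq0 hq1 (x 0 * x 1), qInf_step hq0 hq1 (x 0 * x 2), qInf_step hq0 hq1 (x 0 * x 3),
      mul_right_comm (x 0) (x 1), mul_right_comm (x 0) (x 2), mul_right_comm (x 0) (x 3)]
    linear_combination (x 0) * (qInf q (x 0 * q * x 1) * qInf q (x 0 * q * x 2) *
      qInf q (x 0 * q * x 3) * qInf q (x 1 * x 2) * qInf q (x 1 * x 3) * qInf q (x 2 * x 3)) * e3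
  · simp [Function.update]
    rw [qInf_step hq0 hq1 (x 0 * x 1), qInf_step hq0 hq1 (x 1 * x 2), qInf_step hq0 hq1 (x 1 * x 3),
      mul_assoc (x 0) (x 1), mul_right_comm (x 1) (x 2), mul_right_comm (x 1) (x 3)]
    linear_combination (x 1) * (qInf q (x 0 * (x 1 * q)) * qInf q (x 0 * x 2) *
      qInf q (x 0 * x 3) * qInf q (x 1 * q * x 2) * qInf q (x 1 * q * x 3) * qInf q (x 2 * x 3)) * e3
  · simp [Function.update]
    rw [qInf_step hq0 hq1 (x 0 * x 2), qInf_step hq0 hq1 (x 1 * x 2), qInf_step hq0 hq1 (x 2 * x 3),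
      mul_assoc (x 0) (x 2), mul_assoc (x 1) (x 2), mul_right_comm (x 2) (x 3)]
    linear_combination (x 2) * (qInf q (x 0 * x 1) * qInf q (x 0 * (x 2 * q)) *
      qInf q (x 0 * x 3) * qInf q (x 1 * (x 2 * q)) * qInf q (x 1 * x 3) * qInf q (x 2 * q * x 3)) * e3
  · simp [Function.update]
    rw [qInf_step hq0 hq1 (x 0 * x 3), qInf_step hq0 hq1 (x 1 * x 3), qInf_step hq0 hq1 (x 2 * x 3),
      mul_assoc (x 0) (x 3), mul_assoc (x 1) (x 3), mul_assoc (x 2) (x 3)]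
    linear_combination (x 3) * (qInf q (x 0 * x 1) * qInf q (x 0 * x 2) *
      qInf q (x 0 * (x 3 * q)) * qInf q (x 1 * x 2) * qInf q (x 1 * (x 3 * q)) *
      qInf q (x 2 * (x 3 * q))) * e3

end

section
variable {q : ℝ} {x : Fin 4 → ℂ}

theorem awRatio_scale (hq0 : 0 < q) (hq1 : q < 1) (hx : GenericParams q x) :
    awRatio q x = qPoch q (x 0 * x 1 * x 2 * x 3) 4 * awRatio q (fun i => x i * q) := by
  have h0 := hx.update 0
  have h1 := h0.update 1
  have h2 := h1.update 2
  have e0 := awRatio_update hq0 hq1 hx 0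
  have e1 := awRatio_update hq0 hq1 h0 1
  have e2 := awRatio_update hq0 hq1 h1 2
  have e3 := awRatio_update hq0 hq1 h2 3
  have e4 : Function.update (Function.update (Function.update (Function.update x 0 (x 0 * q)) 1
      (Function.update x 0 (x 0 * q) 1 * q)) 2 (Function.update (Function.update x 0 (x 0 * q)) 1
      (Function.update x 0 (x 0 * q) 1 * q) 2 * q)) 3 (Function.update (Function.update
      (Function.update x 0 (x 0 * q)) 1 (Function.update x 0 (x 0 * q) 1 * q)) 2
      (Function.update (Function.update x 0 (x 0 * q)) 1
      (Function.update x 0 (x 0 * q) 1 * q) 2 * q) 3 * q) = fun i => x i * q := by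
    funext i; fin_cases i <;> simp [Function.update]
  rw [e4] at e3
  rw [e0, e1, e2, e3]
  simp [Function.update, qPoch, Finset.prod_range_succ]
  ring

theorem GenericParams.scale (hx : GenericParams q x) (n : ℕ) :
    GenericParams q (fun i => x i * (q : ℂ) ^ n) := by
  constructor
  · intro i j m h
    refine hx.1 i j (n + n + m) ?_
    rw [pow_add, pow_add, ← h]; ring
  · intro i k
    rw [mul_assoc, ← pow_add]
    exact hx.2 i _

theorem awRatio_iterate (hq0 : 0 < q) (hq1 : q < 1) (hx : GenericParams q x) (n : ℕ) :
    awRatio q x = qPoch q (x 0 * x 1 * x 2 * x 3) (4 * n) *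
      awRatio q (fun i => x i * (q : ℂ) ^ n) := by
  induction n with
  | zero => simp [qPoch]
  | succ n ih =>
    rw [ih, awRatio_scale hq0 hq1 (hx.scale n), Nat.mul_succ, qPoch_add]
    have e : (x 0 * (q : ℂ) ^ n * (x 1 * (q : ℂ) ^ n) * (x 2 * (q : ℂ) ^ n) * (x 3 * (q : ℂ) ^ n)) =
      x 0 * x 1 * x 2 * x 3 * (q : ℂ) ^ (4 * n) := by ring
    rw [e]
    simp only [pow_succ]
    ring_nf

theorem cycleFunctional_of_norm_lt_one (hq0 : 0 < q) (hq1 : q < 1) (hx : ∀ i, ‖x i‖ < 1)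
    (h : ℂ → ℂ) :
    cycleFunctional q x h = (2 * Real.pi * Complex.I)⁻¹ * ∮ t in C(0, 1), h t / t := by
  have : outerSet q x = ∅ := by
    ext w
    simp only [outerSet, Set.mem_ofPred_eq, Set.mem_empty_iff_false, iff_false, not_and, not_lt]
    rintro ⟨i, k, rfl⟩
    rw [norm_mul, norm_pow]
    exact mul_le_one₀ (hx i).le (pow_nonneg (norm_nonneg _) _)
      (pow_le_one₀ (norm_nonneg _) (norm_ofReal_lt_one hq0 hq1).le)
  unfold cycleFunctional
  rw [this, finsum_mem_empty, add_zero]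

/-- The value of `awRatio` when all parameters vanish. -/
def awConst (q : ℝ) : ℂ :=
  (2 * Real.pi * Complex.I)⁻¹ * ∮ t in C(0, 1), qInf q (t ^ 2) * qInf q (t ^ 2)⁻¹ / t

/-- When all parameters tend to `0`, no poles lie outside of the unit circle, and the integrand
converges uniformly on it. -/
theorem tendsto_awRatio (hq0 : 0 < q) (hq1 : q < 1) (x : Fin 4 → ℂ) :
    Tendsto (fun n : ℕ => awRatio q (fun i => x i * (q : ℂ) ^ n)) atTop (𝓝 (awConst q)) := by
  have hqn : Tendsto (fun n : ℕ => (q : ℂ) ^ n) atTop (𝓝 0) :=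
    tendsto_pow_atTop_nhds_zero_of_norm_lt_one (norm_ofReal_lt_one hq0 hq1)
  have hxn : ∀ i, Tendsto (fun n : ℕ => x i * (q : ℂ) ^ n) atTop (𝓝 0) := fun i => by
    simpa using hqn.const_mul (x i)
  have hcont := continuous_qInf hq0 hq1
  have hpair : ∀ i j, Tendsto (fun n : ℕ => qInf q (x i * (q : ℂ) ^ n * (x j * (q : ℂ) ^ n))) atTop
      (𝓝 1) := by
    intro i j
    have := (hcont.tendsto 0).comp (by simpa using (hxn i).mul (hxn j))
    rwa [qInf_zero] at this
  have hsmall : ∀ δ > 0, ∀ᶠ n : ℕ in atTop, ∀ i, ‖x i * (q : ℂ) ^ n‖ < δ := by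
    intro δ hδ
    rw [eventually_all]
    intro i
    have := (hxn i).norm
    rw [norm_zero] at this
    exact this.eventually (gt_mem_nhds hδ)
  have hmain : Tendsto (fun n : ℕ => cycleFunctional q (fun i => x i * (q : ℂ) ^ n)
      (fun t => awW q (fun i => x i * (q : ℂ) ^ n) t * 1)) atTop (𝓝 (awConst q)) := by
    have h1 : Tendsto (fun n : ℕ => (2 * Real.pi * Complex.I)⁻¹ *
        ∮ t in C(0, 1), awW q (fun i => x i * (q : ℂ) ^ n) t * 1 / t) atTop (𝓝 (awConst q)) := by
      refine Tendsto.const_mul _ ?_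
      have hNc : ContinuousOn (fun t : ℂ => qInf q (t ^ 2) * qInf q (t ^ 2)⁻¹ / t)
          (Metric.sphere 0 1) := fun t ht => by
        have ht0 : t ≠ 0 := by rintro rfl; simp at ht
        exact ((holoStar_awNum hq0 hq1 t ht0).div differentiableAt_id
          ht0).continuousAt.continuousWithinAt
      obtain ⟨C, hC⟩ := (isCompact_sphere (0 : ℂ) 1).exists_bound_of_continuousOn hNc
      have hC0 : 0 ≤ C := (norm_nonneg _).trans (hC 1 (by simp))
      have hP : ContinuousAt (fun u : Fin 4 → ℂ × ℂ =>
          (∏ i, (qInf q (u i).1 * qInf q (u i).2))⁻¹) 0 := by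
        refine ContinuousAt.inv₀ ?_ (by simp [qInf_zero])
        fun_prop
      have huni : ∀ ε > 0, ∀ᶠ n : ℕ in atTop, ∀ t ∈ Metric.sphere (0 : ℂ) 1,
          ‖(∏ i, (qInf q (x i * (q : ℂ) ^ n * t) * qInf q (x i * (q : ℂ) ^ n * t⁻¹)))⁻¹ - 1‖ < ε := by
        intro ε hε
        obtain ⟨δ, hδ, H⟩ := Metric.continuousAt_iff.1 hP ε hε
        filter_upwards [hsmall δ hδ] with n hn t ht
        have ht1 : ‖t‖ = 1 := by simpa using ht
        have := @H (fun i => (x i * (q : ℂ) ^ n * t, x i * (q : ℂ) ^ n * t⁻¹)) ?_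
        · simpa [dist_eq_norm, qInf_zero] using this
        · rw [dist_zero_right, pi_norm_lt_iff hδ]
          intro i
          rw [Prod.norm_def, max_lt_iff, norm_mul _ t, norm_mul _ t⁻¹, norm_inv, ht1]
          simpa using hn i
      refine TendstoUniformlyOn.tendsto_circleIntegral_of_continuousOn zero_le_one ?_ ?_
      · filter_upwards [hsmall 1 one_pos] with n hn t ht
        have ht1 : ‖t‖ = 1 := by simpa using ht
        have ht0 : t ≠ 0 := by rintro rfl; simp at ht1
        have hone : HoloStar fun _ => (1 : ℂ) := fun t _ => by fun_prop
        have hnp : ∀ s : ℂ, ‖s‖ = 1 → s ∉ poleSet q (fun i => x i * (q : ℂ) ^ n) := by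
          rintro s hs ⟨i, k, rfl⟩
          rw [norm_mul, norm_pow] at hs
          have e1 : ‖(q : ℂ)‖ ^ k ≤ 1 :=
            pow_le_one₀ (norm_nonneg _) (norm_ofReal_lt_one hq0 hq1).le
          have e2 := hn i
          have e3 : 0 ≤ ‖(q : ℂ)‖ ^ k := by positivity
          nlinarith [norm_nonneg (x i * (q : ℂ) ^ n)]
        exact ((holoOffPoles_awW hq0 hq1 hone t ht0 (hnp t ht1)
          (hnp _ (by rw [norm_inv, ht1, inv_one]))).div differentiableAt_id
          ht0).continuousAt.continuousWithinAt
      · rw [Metric.tendstoUniformlyOn_iff]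
        intro ε hε
        filter_upwards [huni (ε / (C + 1)) (by positivity)] with n hn t ht
        have h2 := hn t ht
        have h3 := hC t ht
        rw [dist_comm, dist_eq_norm]
        have e : awW q (fun i => x i * (q : ℂ) ^ n) t * 1 / t -
            qInf q (t ^ 2) * qInf q (t ^ 2)⁻¹ / t =
            (qInf q (t ^ 2) * qInf q (t ^ 2)⁻¹ / t) *
            ((∏ i, (qInf q (x i * (q : ℂ) ^ n * t) * qInf q (x i * (q : ℂ) ^ n * t⁻¹)))⁻¹ - 1) := by
          unfold awW; ring
        rw [e, norm_mul]
        calc _ ≤ C * ‖(∏ i, (qInf q (x i * (q : ℂ) ^ n * t) *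
              qInf q (x i * (q : ℂ) ^ n * t⁻¹)))⁻¹ - 1‖ := by gcongr
          _ ≤ C * (ε / (C + 1)) := by gcongr
          _ < ε := by
            rw [mul_div_assoc', div_lt_iff₀ (by positivity)]
            nlinarith
    refine h1.congr' ?_
    filter_upwards [hsmall 1 one_pos] with n hn
    rw [cycleFunctional_of_norm_lt_one hq0 hq1 hn]
  have := hmain.mul ((((((hpair 0 1).mul (hpair 0 2)).mul (hpair 0 3)).mul (hpair 1 2)).mul
    (hpair 1 3)).mul (hpair 2 3))
  simpa [awRatio] using this

/-- The Askey–Wilson integral up to a constant which depends on `q` only: scale all parameters to `0`. -/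
theorem awRatio_eq (hq0 : 0 < q) (hq1 : q < 1) (hx : GenericParams q x) :
    awRatio q x = qInf q (x 0 * x 1 * x 2 * x 3) * awConst q := by
  have h1 : Tendsto (fun n : ℕ => qPoch q (x 0 * x 1 * x 2 * x 3) (4 * n)) atTop
      (𝓝 (qInf q (x 0 * x 1 * x 2 * x 3))) :=
    (multipliable_qInf hq0 hq1 _).hasProd.tendsto_prod_nat.comp
      (tendsto_id.const_mul_atTop' (by norm_num))
  exact tendsto_nhds_unique (tendsto_const_nhds.congr (awRatio_iterate hq0 hq1 hx))
    (h1.mul (tendsto_awRatio hq0 hq1 x))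

theorem genericParams_of_norm_lt_one (hq0 : 0 < q) (hq1 : q < 1) (hx : ∀ i, ‖x i‖ < 1) :
    GenericParams q x := by
  have hp : ∀ k : ℕ, ‖(q : ℂ) ^ k‖ ≤ 1 := fun k => by
    rw [norm_pow]; exact pow_le_one₀ (norm_nonneg _) (norm_ofReal_lt_one hq0 hq1).le
  have h1 : ∀ i, ∀ k : ℕ, ‖x i * (q : ℂ) ^ k‖ < 1 := fun i k => by
    rw [norm_mul]
    nlinarith [hx i, hp k, norm_nonneg (x i), norm_nonneg ((q : ℂ) ^ k)]
  constructor
  · intro i j n h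
    have h2 : ‖x i * x j * (q : ℂ) ^ n‖ = 1 := by rw [h, norm_one]
    rw [mul_assoc, norm_mul] at h2
    nlinarith [hx i, h1 j n, norm_nonneg (x i), norm_nonneg (x j * (q : ℂ) ^ n)]
  · intro i k
    exact (h1 i k).ne

/-- The constant is found from `(a,b,c,d) = (q, -q, q^{1/2}, -q^{1/2})`, where the weight reduces to
`(1 - t²)(1 - t⁻²)`. -/
theorem awConst_eq (hq0 : 0 < q) (hq1 : q < 1) : awConst q = 2 / qInf q q := by
  obtain ⟨p, hp0, hp1, hpq⟩ : ∃ p : ℝ, 0 < p ∧ p < 1 ∧ p ^ 2 = q :=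
    ⟨√q, Real.sqrt_pos.2 hq0, by rw [Real.sqrt_lt' one_pos]; simpa using hq1, Real.sq_sqrt hq0.le⟩
  have hpqc : (p : ℂ) ^ 2 = q := by exact_mod_cast hpq
  have hqc : (q : ℂ) ≠ 0 := ofReal_ne_zero_of_pos hq0
  have h20 : 0 < q ^ 2 := by positivity
  have h21 : q ^ 2 < 1 := pow_lt_one₀ hq0.le hq1 two_ne_zero
  obtain ⟨x, hx⟩ : ∃ x : Fin 4 → ℂ, x = ![(q : ℂ), -q, p, -p] := ⟨_, rfl⟩
  have hn : ∀ i, ‖x i‖ < 1 := by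
    intro i
    rw [hx]
    fin_cases i <;> simp [abs_of_pos, hq0, hq1, hp0, hp1]
  have hgen := genericParams_of_norm_lt_one hq0 hq1 hn
  have hmain := awRatio_eq hq0 hq1 hgen
  have hdouble : ∀ s : ℂ, qInf q (q * s) * qInf q (-(q * s)) * (qInf q (p * s) * qInf q (-(p * s))) =
      qInf q (s ^ 2 * q) := by
    intro s
    rw [qInf_mul_neg hq0 hq1, qInf_mul_neg hq0 hq1, ← qInf_sq_mul hq0 hq1 (s ^ 2 * q), mul_pow, mul_pow,
      hpqc, mul_comm]
    congr 2 <;> ring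
  have hne : ∀ s : ℂ, ‖s‖ = 1 → qInf q (s ^ 2 * q) ≠ 0 := by
    intro s hs h
    rw [qInf_eq_zero_iff hq0 hq1] at h
    obtain ⟨k, hk⟩ := h
    have h2 : ‖s ^ 2 * q * (q : ℂ) ^ k‖ = 1 := by rw [hk, norm_one]
    rw [mul_assoc, ← pow_succ', norm_mul, norm_pow, norm_pow, hs, one_pow, one_mul] at h2
    exact (pow_lt_one₀ (norm_nonneg _) (norm_ofReal_lt_one hq0 hq1) k.succ_ne_zero).ne h2
  have hI : cycleFunctional q x (fun t => awW q x t * 1) = 2 := by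
    rw [cycleFunctional_of_norm_lt_one hq0 hq1 hn]
    have hint : (∮ t in C(0, 1), awW q x t * 1 / t) =
        ∮ t in C(0, 1), (2 * (t - 0)⁻¹ - (t - 0) ^ (1 : ℤ)) - (t - 0) ^ (-3 : ℤ) := by
      refine circleIntegral.integral_congr zero_le_one fun t ht => ?_
      have ht1 : ‖t‖ = 1 := by simpa using ht
      have ht0 : t ≠ 0 := by rintro rfl; simp at ht1
      have n1 := hne t ht1
      have n2 := hne t⁻¹ (by rw [norm_inv, ht1, inv_one])
      have hW : awW q x t = (1 - t ^ 2) * (1 - (t ^ 2)⁻¹) := by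
        unfold awW
        have : ∏ i, (qInf q (x i * t) * qInf q (x i * t⁻¹)) =
            qInf q (t ^ 2 * q) * qInf q (t⁻¹ ^ 2 * q) := by
          rw [← hdouble t, ← hdouble t⁻¹, Fin.prod_univ_four, hx]
          simp
          ring
        rw [this, qInf_step hq0 hq1 (t ^ 2), qInf_step hq0 hq1 (t ^ 2)⁻¹, ← inv_pow]
        rw [div_eq_iff (mul_ne_zero n1 n2)]
        ring
      rw [hW, sub_zero, zpow_one, zpow_neg, show (3 : ℤ) = ((3 : ℕ) : ℤ) from rfl, zpow_natCast]
      field_simp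
      ring
    have hci : ∀ (k : ℤ), CircleIntegrable (fun z : ℂ => (z - 0) ^ k) 0 1 := fun k =>
      circleIntegrable_sub_zpow_iff.2 (Or.inr (Or.inr (by simp)))
    have hci1 : CircleIntegrable (fun z : ℂ => 2 * (z - 0)⁻¹) 0 1 := by
      refine ContinuousOn.circleIntegrable zero_le_one fun t ht => ?_
      have ht0 : t - 0 ≠ 0 := by rintro h; rw [sub_zero] at h; subst h; simp at ht
      exact (((continuousAt_id.sub continuousAt_const).inv₀ ht0).const_mul
        2).continuousWithinAt
    have hci2 : CircleIntegrable (fun z : ℂ => 2 * (z - 0)⁻¹ - (z - 0) ^ (1 : ℤ)) 0 1 :=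
      hci1.sub (hci 1)
    rw [hint, circleIntegral.integral_sub hci2 (hci (-3)),
      circleIntegral.integral_sub hci1 (hci 1), circleIntegral.integral_const_mul,
      circleIntegral.integral_sub_center_inv _ one_ne_zero,
      circleIntegral.integral_sub_zpow_of_ne (by norm_num),
      circleIntegral.integral_sub_zpow_of_ne (by norm_num)]
    have : (2 * Real.pi * Complex.I : ℂ) ≠ 0 := Complex.two_pi_I_ne_zero
    field_simp
    ring
  unfold awRatio at hmain
  rw [hI] at hmain
  -- at the special parameters Euler's identity evaluates the product of the `(x_i x_j; q)_∞`
  have hprod : qInf q (x 0 * x 1) * qInf q (x 0 * x 2) * qInf q (x 0 * x 3) * qInf q (x 1 * x 2) *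
      qInf q (x 1 * x 3) * qInf q (x 2 * x 3) * ((1 - q) * (1 - q ^ 2)) = 1 := by
    have e1 : x 0 * x 1 = -q * q := by simp [hx]
    have e2 : x 0 * x 2 = p * q := by simp [hx]; ring
    have e3 : x 0 * x 3 = -p * q := by simp [hx]; ring
    have e4 : x 1 * x 2 = -p * q := by simp [hx]; ring
    have e5 : x 1 * x 3 = p * q := by simp [hx]; ring
    have e6 : x 2 * x 3 = -q := by simp [hx]; rw [← hpqc]; ring
    rw [e1, e2, e3, e4, e5, e6]
    have E := qInf_euler hq0 hq1
    have s1 := qInf_step hq0 hq1 (-q : ℂ)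
    have s2 := qInf_step hq0 hq1 (p : ℂ)
    have s3 := qInf_step hq0 hq1 (-p : ℂ)
    have s4 := qInf_mul_neg hq0 hq1 (p : ℂ)
    rw [hpqc] at s4
    rw [s2, s3] at s4
    have s5 : (1 - (q : ℂ)) * (qInf q (p * q) * qInf q (-p * q)) = qInf (q ^ 2) q := by
      rw [← s4, ← hpqc]; ring
    calc _ = qInf q (-q) * ((1 - -(q : ℂ)) * qInf q (-q * q)) *
          ((1 - (q : ℂ)) * (qInf q (p * q) * qInf q (-p * q))) *
          ((1 - (q : ℂ)) * (qInf q (p * q) * qInf q (-p * q))) := by ring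
      _ = (qInf q (-q) * qInf (q ^ 2) q) ^ 2 := by rw [← s1, s5]; ring
      _ = 1 := by rw [E]; ring
  have hq3 : qInf q q = (1 - q) * (1 - q ^ 2) * qInf q (x 0 * x 1 * x 2 * x 3) := by
    have e : x 0 * x 1 * x 2 * x 3 = (q : ℂ) * q * q := by
      simp [hx]; rw [← hpqc]; ring
    rw [e, qInf_step hq0 hq1 (q : ℂ), qInf_step hq0 hq1 ((q : ℂ) * q)]
    ring
  have hqq : qInf q q ≠ 0 := by
    rw [Ne, qInf_eq_zero_iff hq0 hq1]
    rintro ⟨k, hk⟩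
    refine qpow_ne_one hq0 hq1 k ?_
    rw [← hk]; ring
  rw [eq_div_iff hqq, hq3]
  linear_combination -((1 - (q : ℂ)) * (1 - q ^ 2)) * hmain + 2 * hprod

end

/-! ### Evaluation of Laurent polynomials -/

/-- Evaluation at a nonzero point as an algebra homomorphism. -/
def evHom (z : ℂˣ) : ℂ[T;T⁻¹] →ₐ[ℂ] ℂ :=
  AddMonoidAlgebra.lift ℂ ℂ ℤ
    { toFun := fun n => ((z ^ n.toAdd : ℂˣ) : ℂ)
      map_one' := by simp
      map_mul' := fun m n => by simp [zpow_add] }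

theorem ev_eq_evHom (f : ℂ[T;T⁻¹]) {z : ℂ} (hz : z ≠ 0) : ev f z = evHom (Units.mk0 z hz) f := by
  unfold ev evHom
  rw [AddMonoidAlgebra.lift_apply]
  simp

theorem ev_add (f g : ℂ[T;T⁻¹]) {z : ℂ} (hz : z ≠ 0) : ev (f + g) z = ev f z + ev g z := by
  simp [ev_eq_evHom _ hz]

theorem ev_sub (f g : ℂ[T;T⁻¹]) {z : ℂ} (hz : z ≠ 0) : ev (f - g) z = ev f z - ev g z := by
  simp [ev_eq_evHom _ hz]

theorem ev_mul (f g : ℂ[T;T⁻¹]) {z : ℂ} (hz : z ≠ 0) : ev (f * g) z = ev f z * ev g z := by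
  simp [ev_eq_evHom _ hz]

theorem ev_smul (c : ℂ) (f : ℂ[T;T⁻¹]) {z : ℂ} (hz : z ≠ 0) : ev (c • f) z = c * ev f z := by
  simp [ev_eq_evHom _ hz]

theorem ev_single (n : ℤ) (c z : ℂ) : ev (AddMonoidAlgebra.single n c) z = c * z ^ n := by
  unfold ev
  rw [AddMonoidAlgebra.coeff_single, Finsupp.sum_single_index (by simp)]

theorem ev_T (n : ℤ) (z : ℂ) : ev (LaurentPolynomial.T n) z = z ^ n := by
  rw [LaurentPolynomial.T, ev_single, one_mul]

theorem ev_toLaurent (p : Polynomial ℂ) {z : ℂ} (hz : z ≠ 0) :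
    ev (Polynomial.toLaurent p) z = p.eval z := by
  induction p using Polynomial.induction_on' with
  | add p r hp hr => rw [map_add, ev_add _ _ hz, hp, hr, Polynomial.eval_add]
  | monomial n a =>
    rw [← Polynomial.C_mul_X_pow_eq_monomial, Polynomial.toLaurent_C_mul_X_pow,
      ← LaurentPolynomial.single_eq_C_mul_T, ev_single]
    simp

/-- A Laurent polynomial is determined by its values on an infinite set. -/
theorem ev_injOn {f g : ℂ[T;T⁻¹]} {s : Set ℂ} (hs : s.Infinite)
    (h : ∀ z ∈ s, z ≠ 0 → ev f z = ev g z) : f = g := by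
  rw [← sub_eq_zero]
  have h' : ∀ z ∈ s, z ≠ 0 → ev (f - g) z = 0 := fun z hz h0 => by
    rw [ev_sub _ _ h0, h z hz h0, sub_self]
  generalize f - g = k at h'
  obtain ⟨n, p, hp⟩ := LaurentPolynomial.exists_T_pow k
  have hp0 : p = 0 := by
    refine Polynomial.eq_zero_of_infinite_isRoot p ((hs.sdiff (Set.finite_singleton 0)).mono ?_)
    rintro z ⟨hz, hz0⟩
    have hz0 : z ≠ 0 := hz0
    have := congrArg (fun k => ev k z) hp
    simp only [ev_toLaurent _ hz0, ev_mul _ _ hz0, h' z hz hz0, zero_mul] at this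
    exact this
  rw [hp0, map_zero] at hp
  have := congrArg (· * LaurentPolynomial.T (-(n : ℤ))) hp
  simp only [zero_mul, LaurentPolynomial.mul_T_assoc] at this
  simpa using this.symm

theorem ev_inj {f g : ℂ[T;T⁻¹]} (h : ∀ z, z ≠ 0 → ev f z = ev g z) : f = g :=
  ev_injOn Set.infinite_univ fun z _ hz => h z hz

theorem differentiableAt_ev (f : ℂ[T;T⁻¹]) : HoloStar (ev f) := by
  intro z hz
  unfold ev Finsupp.sum
  refine DifferentiableAt.fun_sum fun n _ => ?_
  exact (differentiableAt_zpow.2 (Or.inl hz)).const_mul _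

theorem ev_invert (f : ℂ[T;T⁻¹]) {z : ℂ} (hz : z ≠ 0) :
    ev (LaurentPolynomial.invert f) z = ev f z⁻¹ := by
  induction f using LaurentPolynomial.induction_on' with
  | add p r hp hr =>
    rw [map_add, ev_add _ _ hz, hp, hr, ev_add _ _ (inv_ne_zero hz)]
  | C_mul_T n a =>
    rw [map_mul, LaurentPolynomial.invert_C, LaurentPolynomial.invert_T,
      ← LaurentPolynomial.single_eq_C_mul_T, ← LaurentPolynomial.single_eq_C_mul_T, ev_single,
      ev_single]
    simp

/-! ### Reflexive Laurent polynomials as polynomials in `t + t⁻¹` -/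

/-- The algebra homomorphism `p(X) ↦ p(t + t⁻¹)`. -/
def reflexive : Polynomial ℂ →ₐ[ℂ] ℂ[T;T⁻¹] :=
  Polynomial.aeval (LaurentPolynomial.T 1 + LaurentPolynomial.T (-1))

theorem invert_reflexive (p : Polynomial ℂ) :
    LaurentPolynomial.invert (reflexive p) = reflexive p := by
  unfold reflexive
  have h := Polynomial.aeval_algHom_apply (LaurentPolynomial.invert (R := ℂ)).toAlgHom
    (LaurentPolynomial.T 1 + LaurentPolynomial.T (-1)) p
  have h2 : (LaurentPolynomial.invert (R := ℂ)).toAlgHom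
      (LaurentPolynomial.T 1 + LaurentPolynomial.T (-1)) =
      LaurentPolynomial.T 1 + LaurentPolynomial.T (-1) := by
    simp [add_comm]
  rw [h2] at h
  exact h.symm

theorem ev_reflexive (p : Polynomial ℂ) {z : ℂ} (hz : z ≠ 0) :
    ev (reflexive p) z = p.eval (z + z⁻¹) := by
  rw [ev_eq_evHom _ hz, reflexive, ← Polynomial.aeval_algHom_apply, ← ev_eq_evHom _ hz,
    ev_add _ _ hz, ev_T, ev_T]
  simp [Polynomial.aeval_def, Polynomial.eval₂_eq_eval_map]

theorem reflexive_injective : Function.Injective reflexive := by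
  rw [injective_iff_map_eq_zero]
  intro p hp
  refine Polynomial.eq_zero_of_infinite_isRoot p (Set.infinite_univ.mono fun y _ => ?_)
  obtain ⟨z, hz⟩ := IsAlgClosed.exists_root
    (Polynomial.X ^ 2 - Polynomial.C y * Polynomial.X + 1 : Polynomial ℂ) (by
      have : (Polynomial.X ^ 2 - Polynomial.C y * Polynomial.X + 1 : Polynomial ℂ).degree = 2 := by
        compute_degree!
      rw [this]; decide)
  have hz : z ^ 2 - y * z + 1 = 0 := by simpa [Polynomial.IsRoot] using hz
  have hz0 : z ≠ 0 := by rintro rfl; simp at hz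
  have hy : y = z + z⁻¹ := by field_simp; linear_combination -hz
  have h := ev_reflexive p hz0
  rw [hp, ← hy] at h
  simpa [ev] using h.symm

theorem T_add_T_neg_mem_range (n : ℕ) :
    (LaurentPolynomial.T n + LaurentPolynomial.T (-n) : ℂ[T;T⁻¹]) ∈ reflexive.range := by
  induction n using Nat.strong_induction_on with
  | _ n ih =>
    match n with
    | 0 => exact ⟨2, by simpa [one_add_one_eq_two] using map_ofNat reflexive 2⟩
    | 1 => exact ⟨Polynomial.X, by simp [reflexive]⟩
    | m + 2 =>
      have h1 := ih (m + 1) (by omega)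
      have h0 := ih m (by omega)
      have hX : (LaurentPolynomial.T 1 + LaurentPolynomial.T (-1) : ℂ[T;T⁻¹]) ∈
        reflexive.range := ⟨Polynomial.X, by simp [reflexive]⟩
      convert sub_mem (mul_mem hX h1) h0 using 1
      simp only [mul_add, add_mul, ← LaurentPolynomial.T_add]
      push_cast
      ring_nf

theorem mem_range_reflexive {f : ℂ[T;T⁻¹]} (hf : f ∈ Ref) : f ∈ reflexive.range := by
  have hf : LaurentPolynomial.invert f = f := hf
  have key : ∀ k : ℂ[T;T⁻¹], k + LaurentPolynomial.invert k ∈ reflexive.range := by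
    intro k
    induction k using LaurentPolynomial.induction_on' with
    | add p r hp hr =>
      rw [map_add, add_add_add_comm]
      exact add_mem hp hr
    | C_mul_T n a =>
      rw [map_mul, LaurentPolynomial.invert_C, LaurentPolynomial.invert_T, ← mul_add,
        ← LaurentPolynomial.smul_eq_C_mul]
      refine Subalgebra.smul_mem _ ?_ a
      obtain ⟨m, rfl | rfl⟩ := n.eq_nat_or_neg
      · exact T_add_T_neg_mem_range m
      · rw [neg_neg, add_comm]
        exact T_add_T_neg_mem_range m
  have h := Subalgebra.smul_mem _ (key f) (1 / 2 : ℂ)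
  rw [hf, ← two_smul ℂ f, smul_smul] at h
  simpa using h

/-- The reflexive Laurent polynomials are the polynomials in `t + t⁻¹`. -/
def refEquiv : Polynomial ℂ ≃ₗ[ℂ] Ref :=
  LinearEquiv.ofBijective (reflexive.toLinearMap.codRestrict Ref invert_reflexive)
    ⟨fun p r h => reflexive_injective (congrArg Subtype.val h), fun f => by
      obtain ⟨p, hp⟩ := mem_range_reflexive f.2
      exact ⟨p, Subtype.ext hp⟩⟩

theorem ev_refEquiv (p : Polynomial ℂ) {z : ℂ} (hz : z ≠ 0) :
    ev (refEquiv p) z = p.eval (z + z⁻¹) := ev_reflexive p hz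

/-! ### Newton expansion in Askey–Wilson polynomials -/

variable {q : ℝ}

/-- The polynomial `Φ_n` with `Φ_n(t + t⁻¹) = (ct, ct⁻¹; q)_n`. -/
def awPoly (q : ℝ) (c : ℂ) (n : ℕ) : Polynomial ℂ :=
  ∏ i ∈ Finset.range n, (Polynomial.C (1 + (c * (q : ℂ) ^ i) ^ 2) -
    Polynomial.C (c * (q : ℂ) ^ i) * Polynomial.X)

theorem awPoly_succ (q : ℝ) (c : ℂ) (n : ℕ) :
    awPoly q c (n + 1) = awPoly q c n * (Polynomial.C (1 + (c * (q : ℂ) ^ n) ^ 2) -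
      Polynomial.C (c * (q : ℂ) ^ n) * Polynomial.X) :=
  Finset.prod_range_succ _ n

theorem eval_awPoly (q : ℝ) (c : ℂ) (n : ℕ) {z : ℂ} (hz : z ≠ 0) :
    (awPoly q c n).eval (z + z⁻¹) = qPoch q (c * z) n * qPoch q (c * z⁻¹) n := by
  unfold awPoly qPoch
  rw [Polynomial.eval_prod, ← Finset.prod_mul_distrib]
  refine Finset.prod_congr rfl fun i _ => ?_
  simp only [Polynomial.eval_sub, Polynomial.eval_mul, Polynomial.eval_C, Polynomial.eval_X]
  field_simp
  ring

/-- Multiplication by `X` in the coordinates with respect to `(Φ_n)`. -/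
def newtonShift (q : ℝ) (c : ℂ) : Module.End ℂ (ℕ →₀ ℂ) :=
  Finsupp.linearCombination ℂ fun n => (1 / (c * (q : ℂ) ^ n)) •
    ((1 + (c * (q : ℂ) ^ n) ^ 2) • Finsupp.single n 1 - Finsupp.single (n + 1) 1)

theorem newtonShift_single (q : ℝ) (c : ℂ) (n : ℕ) :
    newtonShift q c (Finsupp.single n 1) = (1 / (c * (q : ℂ) ^ n)) •
    ((1 + (c * (q : ℂ) ^ n) ^ 2) • Finsupp.single n 1 - Finsupp.single (n + 1) 1) := by
  unfold newtonShift
  rw [Finsupp.linearCombination_single, one_smul]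

/-- The coordinates of a polynomial with respect to `(Φ_n)`. -/
def newton (q : ℝ) (c : ℂ) : Polynomial ℂ →ₗ[ℂ] (ℕ →₀ ℂ) :=
  LinearMap.applyₗ (Finsupp.single 0 1) ∘ₗ (Polynomial.aeval (newtonShift q c)).toLinearMap

theorem newton_one (q : ℝ) (c : ℂ) : newton q c 1 = Finsupp.single 0 1 := by
  simp [newton]

theorem newton_X_mul (q : ℝ) (c : ℂ) (p : Polynomial ℂ) :
    newton q c (Polynomial.X * p) = newtonShift q c (newton q c p) := by
  simp [newton]

theorem newton_awPoly (hq0 : 0 < q) {c : ℂ} (hc : c ≠ 0) (n : ℕ) :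
    newton q c (awPoly q c n) = Finsupp.single n 1 := by
  induction n with
  | zero => simp [awPoly, newton_one]
  | succ n ih =>
    have hcq : c * (q : ℂ) ^ n ≠ 0 := mul_ne_zero hc (pow_ne_zero n (ofReal_ne_zero_of_pos hq0))
    have h : awPoly q c (n + 1) = (1 + (c * (q : ℂ) ^ n) ^ 2) • awPoly q c n -
        (c * (q : ℂ) ^ n) • (Polynomial.X * awPoly q c n) := by
      rw [awPoly_succ, Polynomial.smul_eq_C_mul, Polynomial.smul_eq_C_mul]; ring
    rw [h, map_sub, map_smul, map_smul, newton_X_mul, ih, newtonShift_single, smul_smul,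
      mul_one_div_cancel hcq, one_smul, sub_sub_cancel]

/-- Every polynomial is the combination of the `Φ_n` with its Newton coefficients. -/
theorem linearCombination_newton (hq0 : 0 < q) {c : ℂ} (hc : c ≠ 0) (p : Polynomial ℂ) :
    Finsupp.linearCombination ℂ (awPoly q c) (newton q c p) = p := by
  have hX : ∀ v, Finsupp.linearCombination ℂ (awPoly q c) (newtonShift q c v) =
      Polynomial.X * Finsupp.linearCombination ℂ (awPoly q c) v := by
    intro v
    induction v using Finsupp.induction_linear with
    | zero => simp
    | add f g hf hg => rw [map_add, map_add, hf, hg, map_add, mul_add]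
    | single n a =>
      have hcq : c * (q : ℂ) ^ n ≠ 0 := mul_ne_zero hc (pow_ne_zero n (ofReal_ne_zero_of_pos hq0))
      rw [← mul_one a, ← smul_eq_mul, ← Finsupp.smul_single, map_smul, map_smul, map_smul,
        mul_smul_comm, newtonShift_single, map_smul, map_sub, map_smul,
        Finsupp.linearCombination_single, Finsupp.linearCombination_single, one_smul, one_smul,
        awPoly_succ]
      congr 1
      rw [Polynomial.smul_eq_C_mul, Polynomial.smul_eq_C_mul]
      have h1 : Polynomial.C (1 / (c * (q : ℂ) ^ n)) * Polynomial.C (c * (q : ℂ) ^ n) = 1 := by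
        rw [← Polynomial.C_mul, one_div_mul_cancel hcq, Polynomial.C_1]
      linear_combination (awPoly q c n * Polynomial.X) * h1
  induction p using Polynomial.induction_on with
  | C a =>
    rw [← mul_one (Polynomial.C a), ← Polynomial.smul_eq_C_mul, map_smul, map_smul, newton_one,
      Finsupp.linearCombination_single]
    simp [awPoly]
  | add p r hp hr => rw [map_add, map_add, hp, hr]
  | monomial n a h =>
    have : Polynomial.C a * Polynomial.X ^ (n + 1) =
      Polynomial.X * (Polynomial.C a * Polynomial.X ^ n) := by ring
    rw [this, newton_X_mul, hX, h]

/-- The `Φ_n` span the polynomials, so a statement compatible with linear combinations need only be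
checked on them. -/
theorem awPoly_induction (hq0 : 0 < q) {c : ℂ} (hc : c ≠ 0) {motive : Polynomial ℂ → Prop}
    (p : Polynomial ℂ) (zero : motive 0) (add : ∀ p r, motive p → motive r → motive (p + r))
    (smul : ∀ (a : ℂ) p, motive p → motive (a • p)) (basis : ∀ n, motive (awPoly q c n)) :
    motive p := by
  rw [← linearCombination_newton hq0 hc p]
  induction newton q c p using Finsupp.induction_linear with
  | zero => simpa using zero
  | add f g hf hg => rw [map_add]; exact add _ _ hf hg
  | single n a => rw [Finsupp.linearCombination_single]; exact smul _ _ (basis n)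

/-- Continuity of the Newton expansion in its node and in the functions attached to the basis
vectors. -/
theorem continuousOn_linearCombination_newton {X : Type*} [TopologicalSpace X] {D : Set X}
    (hq0 : 0 < q) {c : X → ℂ} (hc : ContinuousOn c D) (hc0 : ∀ x ∈ D, c x ≠ 0) {G : ℕ → X → ℂ}
    (hG : ∀ n, ContinuousOn (G n) D) (p : Polynomial ℂ) :
    ContinuousOn (fun x => Finsupp.linearCombination ℂ (fun n => G n x) (newton q (c x) p)) D := by
  -- the matrix of multiplication by `X` depends continuously on the node
  have hpow : ∀ m k : ℕ, ContinuousOn (fun x => Finsupp.linearCombination ℂ (fun n => G n x)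
      ((newtonShift q (c x) ^ m) (Finsupp.single k 1))) D := by
    intro m
    induction m with
    | zero => intro k; simpa using hG k
    | succ m ih =>
      intro k
      have hqk : (q : ℂ) ^ k ≠ 0 := pow_ne_zero k (ofReal_ne_zero_of_pos hq0)
      have : (fun x => Finsupp.linearCombination ℂ (fun n => G n x)
          ((newtonShift q (c x) ^ (m + 1)) (Finsupp.single k 1))) = fun x =>
          (1 / (c x * (q : ℂ) ^ k)) * ((1 + (c x * (q : ℂ) ^ k) ^ 2) *
            Finsupp.linearCombination ℂ (fun n => G n x)
              ((newtonShift q (c x) ^ m) (Finsupp.single k 1)) -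
            Finsupp.linearCombination ℂ (fun n => G n x)
              ((newtonShift q (c x) ^ m) (Finsupp.single (k + 1) 1))) := by
        funext x
        rw [pow_succ, Module.End.mul_apply, newtonShift_single, map_smul, map_sub, map_smul,
          map_smul, map_sub, map_smul]
        simp only [smul_eq_mul]
      rw [this]
      refine ContinuousOn.mul (ContinuousOn.div continuousOn_const
        (hc.mul continuousOn_const) fun x hx => mul_ne_zero (hc0 x hx) hqk)
        (ContinuousOn.sub (ContinuousOn.mul ?_ (ih k)) (ih (k + 1)))
      exact continuousOn_const.add ((hc.mul continuousOn_const).pow 2)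
  induction p using Polynomial.induction_on' with
  | add p r hp hr => simpa only [map_add] using hp.fun_add hr
  | monomial n a =>
    have : (fun x => Finsupp.linearCombination ℂ (fun n => G n x)
        (newton q (c x) (Polynomial.monomial n a))) = fun x =>
        a * Finsupp.linearCombination ℂ (fun n => G n x)
          ((newtonShift q (c x) ^ n) (Finsupp.single 0 1)) := by
      funext x
      simp [newton, Polynomial.aeval_monomial, Module.End.mul_apply]
    rw [this]
    exact continuousOn_const.mul (hpow n 0)

/-! ### The operator `M` -/

/-- The linear map of polynomials with `Φ_n^c ↦ (B; q)_n / (A; q)_n Φ_n^{c'}`. -/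
def polyM (q : ℝ) (A B c c' : ℂ) : Polynomial ℂ →ₗ[ℂ] Polynomial ℂ :=
  Finsupp.linearCombination ℂ (fun n => (qPoch q B n / qPoch q A n) • awPoly q c' n) ∘ₗ
    newton q c

theorem polyM_awPoly (hq0 : 0 < q) (A B : ℂ) {c : ℂ} (hc : c ≠ 0) (c' : ℂ) (n : ℕ) :
    polyM q A B c c' (awPoly q c n) = (qPoch q B n / qPoch q A n) • awPoly q c' n := by
  simp [polyM, newton_awPoly hq0 hc]

theorem polyM_comp (hq0 : 0 < q) {A B c c' : ℂ} (hA : ∀ n : ℕ, A * (q : ℂ) ^ n ≠ 1)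
    (hB : ∀ n : ℕ, B * (q : ℂ) ^ n ≠ 1) (hc : c ≠ 0) (hc' : c' ≠ 0) :
    polyM q B A c' c ∘ₗ polyM q A B c c' = LinearMap.id := by
  ext1 n
  refine LinearMap.ext fun a => ?_
  simp only [LinearMap.comp_apply, LinearMap.id_apply]
  induction Polynomial.monomial n a using awPoly_induction hq0 hc with
  | zero => simp
  | add p r hp hr => rw [map_add, map_add, hp, hr]
  | smul a p hp => rw [map_smul, map_smul, hp]
  | basis n =>
    rw [polyM_awPoly hq0 A B hc, map_smul, polyM_awPoly hq0 B A hc', smul_smul,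
      div_mul_div_cancel₀' (qPoch_ne_zero hB n), div_self (qPoch_ne_zero hA n), one_smul]

/-- The operator `M_{αβ}^r`: it maps `(ct, ct⁻¹; q)_n` with `c = r q^{β/2}` to
`(q^β; q)_n / (q^{α+β}; q)_n (c's, c's⁻¹; q)_n` with `c' = r q^{(α+β)/2}`. -/
def opM (q : ℝ) (α β r : ℂ) : Ref →ₗ[ℂ] Ref :=
  refEquiv.toLinearMap ∘ₗ
    polyM q ((q : ℂ) ^ (α + β)) ((q : ℂ) ^ β) (r * (q : ℂ) ^ (β / 2)) (r * (q : ℂ) ^ ((α + β) / 2))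
    ∘ₗ refEquiv.symm.toLinearMap

theorem cpow_ne_zero_of_pos (hq0 : 0 < q) (a : ℂ) : (q : ℂ) ^ a ≠ 0 := by
  rw [Ne, Complex.cpow_eq_zero_iff]
  exact fun h => ofReal_ne_zero_of_pos hq0 h.1

theorem opM_refEquiv_awPoly (hq0 : 0 < q) (α β : ℂ) {r : ℂ} (hr : r ≠ 0) (n : ℕ) :
    opM q α β r (refEquiv (awPoly q (r * (q : ℂ) ^ (β / 2)) n)) =
      (qPoch q ((q : ℂ) ^ β) n / qPoch q ((q : ℂ) ^ (α + β)) n) •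
        refEquiv (awPoly q (r * (q : ℂ) ^ ((α + β) / 2)) n) := by
  unfold opM
  simp only [LinearMap.comp_apply, LinearEquiv.coe_coe, LinearEquiv.symm_apply_apply]
  rw [polyM_awPoly hq0 _ _ (mul_ne_zero hr (cpow_ne_zero_of_pos hq0 _)), map_smul]

theorem opM_comp (hq0 : 0 < q) {α β r : ℂ} (hr : r ≠ 0)
    (hβ : ∀ n : ℕ, (q : ℂ) ^ β * (q : ℂ) ^ n ≠ 1)
    (hαβ : ∀ n : ℕ, (q : ℂ) ^ (α + β) * (q : ℂ) ^ n ≠ 1) :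
    opM q (-α) (α + β) r ∘ₗ opM q α β r = LinearMap.id := by
  refine LinearMap.ext fun f => ?_
  have h := polyM_comp hq0 hαβ hβ (mul_ne_zero hr (cpow_ne_zero_of_pos hq0 (β / 2)))
    (mul_ne_zero hr (cpow_ne_zero_of_pos hq0 ((α + β) / 2)))
  have h := LinearMap.congr_fun h (refEquiv.symm f)
  simp only [LinearMap.comp_apply, LinearMap.id_apply] at h
  simp only [opM, neg_add_cancel_left, LinearMap.comp_apply, LinearEquiv.coe_coe,
    LinearEquiv.symm_apply_apply, LinearMap.id_apply, h, LinearEquiv.apply_symm_apply]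

theorem ev_opM (α β r : ℂ) (f : Ref) {s : ℂ} (hs : s ≠ 0) :
    ev (opM q α β r f) s = Finsupp.linearCombination ℂ
      (fun n => qPoch q ((q : ℂ) ^ β) n / qPoch q ((q : ℂ) ^ (α + β)) n *
        (qPoch q (r * (q : ℂ) ^ ((α + β) / 2) * s) n *
          qPoch q (r * (q : ℂ) ^ ((α + β) / 2) * s⁻¹) n))
      (newton q (r * (q : ℂ) ^ (β / 2)) (refEquiv.symm f)) := by
  unfold opM polyM
  simp only [LinearMap.comp_apply, LinearEquiv.coe_coe]
  rw [ev_refEquiv _ hs, ← Polynomial.coe_evalRingHom, ← Polynomial.coe_aeval_eq_evalRingHom]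
  simp only [Finsupp.linearCombination_apply, Finsupp.sum, AlgHom.coe_toRingHom, map_sum, map_smul]
  refine Finset.sum_congr rfl fun n _ => ?_
  simp only [smul_eq_mul, Polynomial.coe_aeval_eq_eval, eval_awPoly q _ n hs]

theorem continuous_qPoch (q : ℝ) (n : ℕ) : Continuous fun a => qPoch q a n := by
  unfold qPoch
  fun_prop

theorem continuous_cpow_base (hq0 : 0 < q) : Continuous fun a : ℂ => (q : ℂ) ^ a :=
  continuous_id.const_cpow (Or.inl (ofReal_ne_zero_of_pos hq0))

theorem continuousOn_ev_opM (hq0 : 0 < q) (f : Ref) :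
    ContinuousOn (fun p : ℂ × ℂ × ℂ × ℂ => ev (opM q p.1 p.2.1 p.2.2.1 f) p.2.2.2)
      {p | p.2.2.1 ≠ 0 ∧ p.2.2.2 ≠ 0 ∧
        ∀ n : ℕ, (q : ℂ) ^ (p.1 + p.2.1) * (q : ℂ) ^ n ≠ 1} := by
  have hcp := continuous_cpow_base hq0
  have hc : Continuous fun p : ℂ × ℂ × ℂ × ℂ => p.2.2.1 * (q : ℂ) ^ (p.2.1 / 2) := by fun_prop
  have hc' : Continuous fun p : ℂ × ℂ × ℂ × ℂ => p.2.2.1 * (q : ℂ) ^ ((p.1 + p.2.1) / 2) := by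
    fun_prop
  refine ContinuousOn.congr (continuousOn_linearCombination_newton hq0 hc.continuousOn
    (G := fun n p => qPoch q ((q : ℂ) ^ p.2.1) n / qPoch q ((q : ℂ) ^ (p.1 + p.2.1)) n *
        (qPoch q (p.2.2.1 * (q : ℂ) ^ ((p.1 + p.2.1) / 2) * p.2.2.2) n *
          qPoch q (p.2.2.1 * (q : ℂ) ^ ((p.1 + p.2.1) / 2) * p.2.2.2⁻¹) n))
    (fun p hp => mul_ne_zero hp.1 (cpow_ne_zero_of_pos hq0 _)) (fun n => ?_)
    (refEquiv.symm f)) fun p hp => ev_opM _ _ _ _ hp.2.1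
  have hP := continuous_qPoch q n
  refine ContinuousOn.mul (ContinuousOn.div ?_ ?_ fun p hp => qPoch_ne_zero hp.2.2 n)
    (ContinuousOn.mul ?_ ?_)
  · exact (hP.comp (hcp.comp (by fun_prop))).continuousOn
  · exact (hP.comp (hcp.comp (by fun_prop))).continuousOn
  · exact (hP.comp (hc'.mul (by fun_prop))).continuousOn
  · refine hP.comp_continuousOn (hc'.continuousOn.mul (ContinuousOn.inv₀ (by fun_prop) ?_))
    exact fun p hp => hp.2.1

/-! ### The integral representation of `M` -/

/-- The product of the `(x_i x_j; q)_∞`, `i < j`. -/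
def pairProd (q : ℝ) (x : Fin 4 → ℂ) : ℂ :=
  qInf q (x 0 * x 1) * qInf q (x 0 * x 2) * qInf q (x 0 * x 3) * qInf q (x 1 * x 2) *
    qInf q (x 1 * x 3) * qInf q (x 2 * x 3)

theorem GenericParams.pairProd_ne_zero (hq0 : 0 < q) (hq1 : q < 1) {x : Fin 4 → ℂ}
    (hx : GenericParams q x) : pairProd q x ≠ 0 := by
  have h : ∀ i j, qInf q (x i * x j) ≠ 0 := fun i j => by
    rw [Ne, qInf_eq_zero_iff hq0 hq1]
    rintro ⟨n, hn⟩
    exact hx.1 i j n hn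
  unfold pairProd
  simp [h]

theorem qInf_self_ne_zero (hq0 : 0 < q) (hq1 : q < 1) : qInf q q ≠ 0 := by
  rw [Ne, qInf_eq_zero_iff hq0 hq1]
  rintro ⟨n, hn⟩
  refine qpow_ne_one hq0 hq1 n ?_
  rw [pow_succ', hn, sub_self]

theorem pairProd_update (hq0 : 0 < q) (hq1 : q < 1) (x : Fin 4 → ℂ) :
    pairProd q x = (1 - x 0 * x 2) * (1 - x 1 * x 2) * (1 - x 2 * x 3) *
      pairProd q (Function.update x 2 (x 2 * q)) := by
  have e0 : Function.update x 2 (x 2 * q) 0 = x 0 := Function.update_of_ne (by decide) _ _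
  have e1 : Function.update x 2 (x 2 * q) 1 = x 1 := Function.update_of_ne (by decide) _ _
  have e2 : Function.update x 2 (x 2 * q) 2 = x 2 * q := Function.update_self _ _ _
  have e3 : Function.update x 2 (x 2 * q) 3 = x 3 := Function.update_of_ne (by decide) _ _
  unfold pairProd
  rw [e0, e1, e2, e3, qInf_step hq0 hq1 (x 0 * x 2), qInf_step hq0 hq1 (x 1 * x 2),
    qInf_step hq0 hq1 (x 2 * x 3), ← mul_assoc, ← mul_assoc, mul_right_comm (x 2) (q : ℂ)]
  ring_nf

/-- The Askey–Wilson integral. -/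
theorem cycleFunctional_one_mul_pairProd (hq0 : 0 < q) (hq1 : q < 1) {x : Fin 4 → ℂ}
    (hx : GenericParams q x) :
    cycleFunctional q x (fun t => awW q x t * 1) * pairProd q x =
      qInf q (x 0 * x 1 * x 2 * x 3) * (2 / qInf q q) := by
  rw [← awConst_eq hq0 hq1]
  exact awRatio_eq hq0 hq1 hx

theorem holoStar_qPoch (c : ℂ) (n : ℕ) :
    HoloStar fun t => qPoch q (c * t) n * qPoch q (c * t⁻¹) n := by
  intro t ht
  unfold qPoch
  refine DifferentiableAt.mul (DifferentiableAt.fun_finsetProd fun i _ => by fun_prop)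
    (DifferentiableAt.fun_finsetProd fun i _ => ?_)
  exact (((differentiableAt_inv ht).const_mul c).mul_const _).const_sub 1

/-- The integral of the Askey–Wilson weight against the Newton basis. -/
theorem cycleFunctional_qPoch (hq0 : 0 < q) (hq1 : q < 1) (n : ℕ) : ∀ {x : Fin 4 → ℂ},
    GenericParams q x →
    qPoch q (x 0 * x 1 * x 2 * x 3) n *
      cycleFunctional q x (fun t => awW q x t * (qPoch q (x 2 * t) n * qPoch q (x 2 * t⁻¹) n)) =
    qPoch q (x 0 * x 2) n * qPoch q (x 1 * x 2) n * qPoch q (x 2 * x 3) n *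
      cycleFunctional q x (fun t => awW q x t * 1) := by
  induction n with
  | zero => intro x hx; simp [qPoch_zero]
  | succ n ih =>
    intro x hx
    have hx' := hx.update 2
    have h := ih hx'
    -- the factor `(1 - ct)(1 - c/t)` of the basis function is absorbed by `c ↦ cq`
    have h1 := cycleFunctional_update hq0 hq1 hx 2 (holoStar_qPoch (q := q) (x 2 * q) n)
    have h2 := awRatio_update hq0 hq1 hx 2
    have h3 := pairProd_update hq0 hq1 x
    have h4 := hx'.pairProd_ne_zero hq0 hq1
    change cycleFunctional q x (fun t => awW q x t * 1) * pairProd q x = _ *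
      (cycleFunctional q _ (fun t => awW q _ t * 1) * pairProd q _) at h2
    have e0 : Function.update x 2 (x 2 * q) 0 = x 0 := Function.update_of_ne (by decide) _ _
    have e1 : Function.update x 2 (x 2 * q) 1 = x 1 := Function.update_of_ne (by decide) _ _
    have e2 : Function.update x 2 (x 2 * q) 2 = x 2 * q := Function.update_self _ _ _
    have e3 : Function.update x 2 (x 2 * q) 3 = x 3 := Function.update_of_ne (by decide) _ _
    rw [e0, e1, e2, e3] at h
    have e : (fun t => awW q x t * (qPoch q (x 2 * t) (n + 1) * qPoch q (x 2 * t⁻¹) (n + 1))) =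
        fun t => awW q x t * ((1 - x 2 * t) * (1 - x 2 * t⁻¹) *
          (qPoch q (x 2 * q * t) n * qPoch q (x 2 * q * t⁻¹) n)) := by
      funext t
      rw [qPoch_succ', qPoch_succ', mul_right_comm (x 2) t, mul_right_comm (x 2) t⁻¹]
      ring
    rw [e, h1, qPoch_succ', qPoch_succ', qPoch_succ', qPoch_succ']
    rw [h3] at h2
    have h2' := mul_right_cancel₀ h4 ((mul_assoc _ _ _).trans (h2.trans (mul_assoc _ _ _).symm))
    rw [show x 0 * x 1 * x 2 * x 3 * (q : ℂ) = x 0 * x 1 * (x 2 * q) * x 3 by ring,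
      mul_assoc, h, mul_assoc (x 0) (x 2), mul_assoc (x 1) (x 2), mul_right_comm (x 2) (x 3)]
    linear_combination -(qPoch q (x 0 * (x 2 * q)) n * qPoch q (x 1 * (x 2 * q)) n *
      qPoch q (x 2 * q * x 3) n) * h2'

/-- The parameters of the kernel of `M`. -/
def kernelParams (q : ℝ) (α β r s : ℂ) : Fin 4 → ℂ :=
  ![s * (q : ℂ) ^ (α / 2), s⁻¹ * (q : ℂ) ^ (α / 2),
    r * (q : ℂ) ^ (β / 2), r⁻¹ * (q : ℂ) ^ (β / 2)]

theorem Generic.genericParams {α β r s : ℂ} (h : Generic q α β r s) :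
    GenericParams q (kernelParams q α β r s) := by
  have hm : ∀ i, kernelParams q α β r s i ∈ ({s * (q : ℂ) ^ (α / 2), s⁻¹ * (q : ℂ) ^ (α / 2),
      r * (q : ℂ) ^ (β / 2), r⁻¹ * (q : ℂ) ^ (β / 2)} : Set ℂ) := by
    intro i
    fin_cases i <;> simp [kernelParams]
  exact ⟨fun i j n => h.2.2.2.1 _ (hm i) _ (hm j) n, fun i k => h.2.2.2.2 _ (hm i) k⟩

theorem cycleInt_eventually_eq (hq0 : 0 < q) (hq1 : q < 1) {α β r s : ℂ} {f : ℂ → ℂ}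
    (hf : HoloOffPoles q (kernelParams q α β r s) f) :
    ∀ᶠ ε in 𝓝[>] (0 : ℝ),
      cycleInt q α β r s ε f = cycleFunctional q (kernelParams q α β r s) f := by
  have h := awIntegral_eventually_eq hq0 hq1 hf
  have e : ∀ ε, cycleInt q α β r s ε f = awIntegral q (kernelParams q α β r s 0)
      (kernelParams q α β r s 1) (kernelParams q α β r s 2) (kernelParams q α β r s 3) ε f := by
    intro ε
    simp only [cycleInt, kernelParams, Matrix.cons_val]
  simpa only [e] using h

theorem opK_eventually_eq (hq0 : 0 < q) (hq1 : q < 1) {α β r s : ℂ} {f : ℂ → ℂ}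
    (hf : HoloStar f) :
    ∀ᶠ ε in 𝓝[>] (0 : ℝ), opK q α β r s ε f =
      cycleFunctional q (kernelParams q α β r s) (fun t => awW q (kernelParams q α β r s) t * f t) := by
  filter_upwards [cycleInt_eventually_eq hq0 hq1 (holoOffPoles_awW (x := kernelParams q α β r s)
    hq0 hq1 hf)] with ε hε
  rw [← hε]
  unfold opK
  congr 1
  funext t
  rw [← awWeight_eq_awW]
  rfl

theorem cpow_half_mul_self (hq0 : 0 < q) (a : ℂ) :
    (q : ℂ) ^ (a / 2) * (q : ℂ) ^ (a / 2) = (q : ℂ) ^ a := by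
  rw [← Complex.cpow_add _ _ (ofReal_ne_zero_of_pos hq0), add_halves]

theorem cpow_half_mul_half (hq0 : 0 < q) (a b : ℂ) :
    (q : ℂ) ^ (a / 2) * (q : ℂ) ^ (b / 2) = (q : ℂ) ^ ((a + b) / 2) := by
  rw [← Complex.cpow_add _ _ (ofReal_ne_zero_of_pos hq0), add_div]

theorem kernelParams_mul (hq0 : 0 < q) (α β : ℂ) {r s : ℂ} (hr : r ≠ 0) (hs : s ≠ 0) :
    kernelParams q α β r s 0 * kernelParams q α β r s 1 = (q : ℂ) ^ α ∧
    kernelParams q α β r s 2 * kernelParams q α β r s 3 = (q : ℂ) ^ β ∧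
    kernelParams q α β r s 0 * kernelParams q α β r s 2 = r * (q : ℂ) ^ ((α + β) / 2) * s ∧
    kernelParams q α β r s 1 * kernelParams q α β r s 2 = r * (q : ℂ) ^ ((α + β) / 2) * s⁻¹ ∧
    kernelParams q α β r s 0 * kernelParams q α β r s 3 = r⁻¹ * (q : ℂ) ^ ((α + β) / 2) * s ∧
    kernelParams q α β r s 1 * kernelParams q α β r s 3 = r⁻¹ * (q : ℂ) ^ ((α + β) / 2) * s⁻¹ := by
  rw [← cpow_half_mul_half hq0 α β, ← cpow_half_mul_self hq0 α, ← cpow_half_mul_self hq0 β]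
  simp only [kernelParams, Matrix.cons_val]
  refine ⟨?_, ?_, ?_, ?_, ?_, ?_⟩ <;> field_simp

theorem kernelParams_mul_four (hq0 : 0 < q) (α β : ℂ) {r s : ℂ} (hr : r ≠ 0) (hs : s ≠ 0) :
    kernelParams q α β r s 0 * kernelParams q α β r s 1 * kernelParams q α β r s 2 * kernelParams q α β r s 3 =
      (q : ℂ) ^ (α + β) := by
  have h := kernelParams_mul hq0 α β hr hs
  rw [mul_assoc _ (kernelParams q α β r s 2), h.1, h.2.1,
    Complex.cpow_add _ _ (ofReal_ne_zero_of_pos hq0)]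

/-- The integral of the weight against a reflexive Laurent polynomial in terms of `M`. -/
theorem cycleFunctional_ev (hq0 : 0 < q) (hq1 : q < 1) {α β r s : ℂ} (h : Generic q α β r s)
    (f : Ref) :
    cycleFunctional q (kernelParams q α β r s) (fun t => awW q (kernelParams q α β r s) t * ev f t) =
      ev (opM q α β r f) s *
        cycleFunctional q (kernelParams q α β r s) (fun t => awW q (kernelParams q α β r s) t * 1) := by
  have hr := h.1
  have hs := h.2.1
  have hx := h.genericParams
  have hc : r * (q : ℂ) ^ (β / 2) ≠ 0 := mul_ne_zero hr (cpow_ne_zero_of_pos hq0 _)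
  obtain ⟨p, rfl⟩ := refEquiv.surjective f
  obtain ⟨x, hxd⟩ : ∃ x, x = kernelParams q α β r s := ⟨_, rfl⟩
  have hcongr : ∀ f g : ℂ → ℂ, (∀ t, t ≠ 0 → f t = g t) →
      cycleFunctional q x (fun t => awW q x t * f t) =
        cycleFunctional q x (fun t => awW q x t * g t) := fun f g hfg =>
    cycleFunctional_congr hq0 hq1 (hxd ▸ hx) fun t ht _ _ => by rw [hfg t ht]
  rw [← hxd]
  induction p using awPoly_induction hq0 hc with
  | zero =>
    have h0 := cycleFunctional_const_mul hq0 hq1 0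
      (holoOffPoles_awW (x := x) hq0 hq1 (differentiableAt_ev 0))
    rw [map_zero, map_zero]
    simpa [ev] using h0
  | add p r hp hr =>
    rw [map_add, hcongr (ev (refEquiv p + refEquiv r : Ref))
      (fun t => ev (refEquiv p) t + ev (refEquiv r) t) fun t ht => ev_add _ _ ht, map_add,
      Submodule.coe_add, ev_add _ _ hs, add_mul, ← hp, ← hr]
    simp only [mul_add]
    exact cycleFunctional_add hq0 hq1 (hxd ▸ hx) (holoOffPoles_awW hq0 hq1 (differentiableAt_ev _))
      (holoOffPoles_awW hq0 hq1 (differentiableAt_ev _))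
  | smul a p hp =>
    rw [map_smul, hcongr (ev (a • refEquiv p : Ref)) (fun t => a * ev (refEquiv p) t)
      fun t ht => ev_smul _ _ ht, map_smul, Submodule.coe_smul, ev_smul _ _ hs, mul_assoc, ← hp]
    simp only [mul_left_comm _ a]
    exact cycleFunctional_const_mul hq0 hq1 a
      (holoOffPoles_awW hq0 hq1 (differentiableAt_ev _))
  | basis n =>
    have h1 := cycleFunctional_qPoch hq0 hq1 n hx
    have h2 := kernelParams_mul hq0 α β hr hs
    rw [kernelParams_mul_four hq0 α β hr hs, h2.2.1, h2.2.2.1, h2.2.2.2.1] at h1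
    have h3 := qPoch_ne_zero h.2.2.1 n
    have hx2 : kernelParams q α β r s 2 = r * (q : ℂ) ^ (β / 2) := by simp [kernelParams]
    rw [hx2, ← hxd] at h1
    rw [hcongr _ (fun t => qPoch q (r * (q : ℂ) ^ (β / 2) * t) n *
        qPoch q (r * (q : ℂ) ^ (β / 2) * t⁻¹) n) fun t ht => (ev_refEquiv _ ht).trans
        (eval_awPoly q _ n ht), opM_refEquiv_awPoly hq0 α β hr, Submodule.coe_smul,
      ev_smul _ _ hs, ev_refEquiv _ hs, eval_awPoly q _ n hs]
    rw [div_mul_eq_mul_div, div_mul_eq_mul_div, eq_div_iff h3]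
    linear_combination h1

theorem cycleFunctional_one_ne_zero (hq0 : 0 < q) (hq1 : q < 1) {α β r s : ℂ}
    (h : Generic q α β r s) :
    cycleFunctional q (kernelParams q α β r s) (fun t => awW q (kernelParams q α β r s) t * 1) ≠ 0 := by
  have h1 := cycleFunctional_one_mul_pairProd hq0 hq1 h.genericParams
  rw [kernelParams_mul_four hq0 α β h.1 h.2.1] at h1
  refine left_ne_zero_of_mul (h1.trans_ne ?_)
  refine mul_ne_zero ?_ (div_ne_zero two_ne_zero (qInf_self_ne_zero hq0 hq1))
  rw [Ne, qInf_eq_zero_iff hq0 hq1]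
  rintro ⟨n, hn⟩
  exact h.2.2.1 n hn

/-- The Newton-basis operator `opM` is the operator defined by the integrals, continued to all
admissible parameters. -/
theorem isOperatorM_opM (hq0 : 0 < q) (hq1 : q < 1) : IsOperatorM q (opM q) where
  integral f α β r s h := by
    have hone : HoloStar fun _ => (1 : ℂ) := fun t _ => by fun_prop
    filter_upwards [opK_eventually_eq (α := α) (β := β) (r := r) (s := s) hq0 hq1
      (differentiableAt_ev (f : ℂ[T;T⁻¹])),
      opK_eventually_eq (α := α) (β := β) (r := r) (s := s) hq0 hq1 hone] with ε h1 h2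
    rw [h1, h2, cycleFunctional_ev hq0 hq1 h, mul_div_cancel_right₀]
    exact cycleFunctional_one_ne_zero hq0 hq1 h
  continuousOn := continuousOn_ev_opM hq0

theorem Lq_comm (q : ℝ) (ν x y : ℂ) : Lq q ν x y = Lq q ν y x := by
  unfold Lq
  rw [mul_right_comm ν y x, mul_right_comm ν y x⁻¹, mul_right_comm ν y⁻¹ x,
    mul_right_comm ν y⁻¹ x⁻¹]
  ring

/-- The kernel of `M_{αβ}`, including the normalization. -/
def normKernel (q : ℝ) (α β r s t : ℂ) : ℂ :=
  (1 - q) * qInf q q ^ 2 * (qInf q (t ^ 2) * qInf q (t ^ 2)⁻¹) *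
      Lq q ((q : ℂ) ^ ((α + β) / 2)) r s /
    (2 * qBeta q α β * Lq q ((q : ℂ) ^ (α / 2)) t s * Lq q ((q : ℂ) ^ (β / 2)) r t)

theorem normKernel_eq (hq0 : 0 < q) (hq1 : q < 1) {α β r s : ℂ} (h : Generic q α β r s) (t : ℂ) :
    normKernel q α β r s t = awW q (kernelParams q α β r s) t /
      cycleFunctional q (kernelParams q α β r s) (fun t => awW q (kernelParams q α β r s) t * 1) := by
  have h1 := cycleFunctional_one_mul_pairProd hq0 hq1 h.genericParams
  have hP := h.genericParams.pairProd_ne_zero hq0 hq1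
  rw [kernelParams_mul_four hq0 α β h.1 h.2.1] at h1
  have hK := cycleFunctional_one_ne_zero hq0 hq1 h
  obtain ⟨K, hKd⟩ : ∃ K, K = cycleFunctional q (kernelParams q α β r s)
    (fun t => awW q (kernelParams q α β r s) t * 1) := ⟨_, rfl⟩
  rw [← hKd] at h1 hK ⊢
  obtain ⟨e01, e23, e02, e12, e03, e13⟩ := kernelParams_mul hq0 α β h.1 h.2.1
  have hPe : pairProd q (kernelParams q α β r s) = qInf q ((q : ℂ) ^ α) * qInf q ((q : ℂ) ^ β) *
      Lq q ((q : ℂ) ^ ((α + β) / 2)) r s := by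
    unfold pairProd Lq
    rw [e01, e23, e02, e12, e03, e13, mul_comm r, mul_comm r⁻¹]
    ring
  have hW : awW q (kernelParams q α β r s) t = qInf q (t ^ 2) * qInf q (t ^ 2)⁻¹ /
      (Lq q ((q : ℂ) ^ (α / 2)) t s * Lq q ((q : ℂ) ^ (β / 2)) r t) := by
    rw [Lq_comm q _ t s]
    unfold awW Lq
    rw [Fin.prod_univ_four]
    congr 1
    simp only [kernelParams, Matrix.cons_val, mul_comm s, mul_comm s⁻¹, mul_comm r, mul_comm r⁻¹]
    ring
  have hq := qInf_self_ne_zero hq0 hq1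
  have h1q : (1 : ℂ) - q ≠ 0 := by simpa using qpow_ne_one hq0 hq1 0
  rw [hPe] at h1 hP
  rw [hW]
  unfold normKernel qBeta
  have hα : qInf q ((q : ℂ) ^ α) ≠ 0 := left_ne_zero_of_mul (left_ne_zero_of_mul hP)
  have hβ : qInf q ((q : ℂ) ^ β) ≠ 0 := right_ne_zero_of_mul (left_ne_zero_of_mul hP)
  have hL := right_ne_zero_of_mul hP
  have hA : qInf q ((q : ℂ) ^ (α + β)) = K * (qInf q ((q : ℂ) ^ α) * qInf q ((q : ℂ) ^ β) *
      Lq q ((q : ℂ) ^ ((α + β) / 2)) r s) * qInf q q / 2 := by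
    rw [h1]; field_simp
  rw [hA, div_div, mul_assoc (2 * _)]
  generalize Lq q ((q : ℂ) ^ (α / 2)) t s * Lq q ((q : ℂ) ^ (β / 2)) r t = D
  field_simp

/-- The integral formula for `M` with the explicit kernel. -/
theorem ev_opM_eventually_eq (hq0 : 0 < q) (hq1 : q < 1) {α β r s : ℂ} (h : Generic q α β r s)
    (f : Ref) {F : ℂ → ℂ} (hF : ∀ t, t ≠ 0 → ev f t = F t) :
    ∀ᶠ ε in 𝓝[>] (0 : ℝ), ev (opM q α β r f) s =
      cycleInt q α β r s ε fun t => normKernel q α β r s t * F t := by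
  have hK := cycleFunctional_one_ne_zero hq0 hq1 h
  have h1 := cycleFunctional_ev hq0 hq1 h f
  obtain ⟨K, hKd⟩ : ∃ K, K = cycleFunctional q (kernelParams q α β r s)
    (fun t => awW q (kernelParams q α β r s) t * 1) := ⟨_, rfl⟩
  rw [← hKd] at h1 hK
  have e : (fun t => normKernel q α β r s t * F t) =
      fun t => K⁻¹ * (awW q (kernelParams q α β r s) t * F t) := by
    funext t
    rw [normKernel_eq hq0 hq1 h, ← hKd]
    ring
  have hFs : HoloStar F := fun t ht => (differentiableAt_ev f.1 t ht).congr_of_eventuallyEq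
    ((eventually_ne_nhds ht).mono fun z hz => (hF z hz).symm)
  have hh := holoOffPoles_awW (x := kernelParams q α β r s) hq0 hq1 hFs
  have hh' : HoloOffPoles q (kernelParams q α β r s)
      fun t => K⁻¹ * (awW q (kernelParams q α β r s) t * F t) :=
    fun t h0 h1 h2 => (hh t h0 h1 h2).const_mul _
  have hc : cycleFunctional q (kernelParams q α β r s)
      (fun t => awW q (kernelParams q α β r s) t * ev f t) =
      cycleFunctional q (kernelParams q α β r s)
        (fun t => awW q (kernelParams q α β r s) t * F t) :=
    cycleFunctional_congr hq0 hq1 h.genericParams fun t ht _ _ => by rw [hF t ht]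
  rw [e]
  filter_upwards [cycleInt_eventually_eq hq0 hq1 hh'] with ε hε
  rw [hε, cycleFunctional_const_mul hq0 hq1 _ hh, ← hc, h1]
  field_simp

theorem kernelInv_eq (q : ℝ) (α β r t s : ℂ) :
    kernelInv q α β r t s = normKernel q (-α) (α + β) r t s := by
  unfold kernelInv normKernel
  rw [neg_add_cancel_left]

theorem ell_pos (hq0 : 0 < q) (g : ℝ) : 0 < ell q g := Real.rpow_pos_of_pos hq0 _

theorem ellPow_eq_cpow (hq0 : 0 < q) (g e : ℝ) : ellPow q g e = (q : ℂ) ^ (-(g * e) : ℂ) := by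
  unfold ellPow ell
  rw [← Real.rpow_mul hq0.le, Complex.ofReal_cpow hq0.le]
  push_cast
  ring_nf

theorem kernelM_eq (hq0 : 0 < q) (g : ℝ) (yp ym tm : ℂ) :
    kernelM q g yp ym tm = normKernel q g (2 * g) (yp * ellPow q g (3 / 2)) ym tm := by
  unfold kernelM normKernel
  rw [Lq_comm q _ ym, Lq_comm q _ ym, Lq_comm q _ tm (yp * _), ellPow_eq_cpow hq0 g (-(3 / 2)),
    ellPow_eq_cpow hq0 g (-(1 / 2)), ellPow_eq_cpow hq0 g (-1)]
  push_cast
  ring_nf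

theorem kernelMInv_eq (hq0 : 0 < q) (g : ℝ) (tp tm ym : ℂ) :
    kernelMInv q g tp tm ym = normKernel q (-g) (3 * g) tp tm ym := by
  unfold kernelMInv normKernel
  rw [Lq_comm q _ tm, Lq_comm q _ ym tp, ellPow_eq_cpow hq0 g (-(3 / 2)),
    ellPow_eq_cpow hq0 g (1 / 2), ellPow_eq_cpow hq0 g (-1)]
  push_cast
  ring_nf

/-! ### Laurent polynomials in three variables -/

/-- Evaluation at a point of the torus as an algebra homomorphism. -/
def evHom3 (t : Fin 3 → ℂˣ) : Laurent3 →ₐ[ℂ] ℂ :=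
  AddMonoidAlgebra.lift ℂ ℂ (Fin 3 → ℤ)
    { toFun := fun n => ((∏ j, t j ^ n.toAdd j : ℂˣ) : ℂ)
      map_one' := by simp
      map_mul' := fun m n => by simp [zpow_add, Finset.prod_mul_distrib] }

theorem ev3_units (F : Laurent3) (t : Fin 3 → ℂˣ) : ev3 F (t 0) (t 1) (t 2) = evHom3 t F := by
  unfold ev3 evHom3
  rw [AddMonoidAlgebra.lift_apply]
  simp [Fin.prod_univ_three]

theorem ev3_eq_evHom3 (F : Laurent3) {u v w : ℂ} (hu : u ≠ 0) (hv : v ≠ 0) (hw : w ≠ 0) :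
    ev3 F u v w = evHom3 ![Units.mk0 u hu, Units.mk0 v hv, Units.mk0 w hw] F := by
  rw [← ev3_units]; simp

section
variable {u v w : ℂ} (hu : u ≠ 0) (hv : v ≠ 0) (hw : w ≠ 0)

theorem ev3_add (F G : Laurent3) (hu : u ≠ 0) (hv : v ≠ 0) (hw : w ≠ 0) :
    ev3 (F + G) u v w = ev3 F u v w + ev3 G u v w := by
  simp [ev3_eq_evHom3 _ hu hv hw]

theorem ev3_sub (F G : Laurent3) (hu : u ≠ 0) (hv : v ≠ 0) (hw : w ≠ 0) :
    ev3 (F - G) u v w = ev3 F u v w - ev3 G u v w := by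
  simp [ev3_eq_evHom3 _ hu hv hw]

theorem ev3_mul (F G : Laurent3) (hu : u ≠ 0) (hv : v ≠ 0) (hw : w ≠ 0) :
    ev3 (F * G) u v w = ev3 F u v w * ev3 G u v w := by
  simp [ev3_eq_evHom3 _ hu hv hw]

theorem ev3_smul (c : ℂ) (F : Laurent3) (hu : u ≠ 0) (hv : v ≠ 0) (hw : w ≠ 0) :
    ev3 (c • F) u v w = c * ev3 F u v w := by
  simp [ev3_eq_evHom3 _ hu hv hw]

theorem ev3_one (hu : u ≠ 0) (hv : v ≠ 0) (hw : w ≠ 0) : ev3 1 u v w = 1 := by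
  simp [ev3_eq_evHom3 _ hu hv hw]

theorem ev3_zero (u v w : ℂ) : ev3 0 u v w = 0 := by
  simp [ev3]

theorem ev3_sum {ι : Type*} (s : Finset ι) (F : ι → Laurent3)
    (hu : u ≠ 0) (hv : v ≠ 0) (hw : w ≠ 0) :
    ev3 (∑ i ∈ s, F i) u v w = ∑ i ∈ s, ev3 (F i) u v w := by
  simp [ev3_eq_evHom3 _ hu hv hw]

theorem ev3_prod {ι : Type*} (s : Finset ι) (F : ι → Laurent3)
    (hu : u ≠ 0) (hv : v ≠ 0) (hw : w ≠ 0) :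
    ev3 (∏ i ∈ s, F i) u v w = ∏ i ∈ s, ev3 (F i) u v w := by
  simp [ev3_eq_evHom3 _ hu hv hw]

end

theorem ev3_single (n : Fin 3 → ℤ) (a u v w : ℂ) :
    ev3 (AddMonoidAlgebra.single n a) u v w = a * (u ^ n 0 * v ^ n 1 * w ^ n 2) := by
  unfold ev3
  rw [AddMonoidAlgebra.coeff_single, Finsupp.sum_single_index (by simp)]

/-- A Laurent polynomial is determined by its values on the torus; this is the linear independence
of the characters of the torus. -/
theorem ev3_inj {F G : Laurent3}
    (h : ∀ u v w : ℂ, u ≠ 0 → v ≠ 0 → w ≠ 0 → ev3 F u v w = ev3 G u v w) : F = G := by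
  rw [← sub_eq_zero]
  have h' : ∀ t : Fin 3 → ℂˣ, ev3 (F - G) (t 0) (t 1) (t 2) = 0 := fun t => by
    rw [ev3_sub _ _ (t 0).ne_zero (t 1).ne_zero (t 2).ne_zero,
      h _ _ _ (t 0).ne_zero (t 1).ne_zero (t 2).ne_zero, sub_self]
  generalize F - G = K at h'
  -- the monomials are pairwise different characters, as their values at the powers of `2` show
  let χ : (Fin 3 → ℤ) → ((Fin 3 → ℂˣ) →* ℂ) := fun n =>
    { toFun := fun t => ((∏ j, t j ^ n j : ℂˣ) : ℂ)
      map_one' := by simp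
      map_mul' := fun s t => by simp [mul_zpow, Finset.prod_mul_distrib] }
  have hχ : Function.Injective χ := by
    intro m n hmn
    funext j
    have h1 := DFunLike.congr_fun hmn (Pi.mulSingle j (Units.mk0 2 two_ne_zero))
    have h2 : ∀ k : Fin 3 → ℤ, χ k (Pi.mulSingle j (Units.mk0 2 two_ne_zero)) = (2 : ℂ) ^ k j := by
      intro k
      change ((∏ i, (Pi.mulSingle j (Units.mk0 (2 : ℂ) two_ne_zero) : Fin 3 → ℂˣ) i ^ k i : ℂˣ) : ℂ)
        = _
      rw [Finset.prod_eq_single j]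
      · simp
      · intro i _ hij
        rw [Pi.mulSingle_eq_of_ne hij, one_zpow]
      · simp
    rw [h2, h2] at h1
    have h3 : ((2 : ℝ) ^ m j) = 2 ^ n j := by
      simpa [norm_zpow] using congrArg norm h1
    exact zpow_right_injective₀ (by norm_num) (by norm_num) h3
  have hli := (linearIndependent_monoidHom (Fin 3 → ℂˣ) ℂ).comp χ hχ
  rw [linearIndependent_iff] at hli
  have := hli K.coeff (by
    rw [Finsupp.linearCombination_apply, Finsupp.sum]
    funext t
    rw [Finset.sum_apply]
    have := h' t
    unfold ev3 Finsupp.sum at this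
    simpa [χ, Fin.prod_univ_three] using this)
  exact AddMonoidAlgebra.coeff_injective this

/-- Permutation of the exponents. -/
def permExp (σ : Equiv.Perm (Fin 3)) : (Fin 3 → ℤ) ≃+ (Fin 3 → ℤ) where
  toFun n := n ∘ ⇑(σ⁻¹)
  invFun n := n ∘ σ
  left_inv n := by funext j; simp
  right_inv n := by funext j; simp
  map_add' m n := rfl

/-- The action of permutations on Laurent polynomials. -/
def permAlg (σ : Equiv.Perm (Fin 3)) : Laurent3 ≃ₐ[ℂ] Laurent3 :=
  AddMonoidAlgebra.domCongr ℂ ℂ (permExp σ)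

theorem coeff_permAlg (σ : Equiv.Perm (Fin 3)) (F : Laurent3) (n : Fin 3 → ℤ) :
    (permAlg σ F).coeff n = F.coeff (n ∘ σ) := by
  rw [permAlg, AddMonoidAlgebra.coeff_domCongr]; rfl

theorem evHom3_permAlg (σ : Equiv.Perm (Fin 3)) (F : Laurent3) (t : Fin 3 → ℂˣ) :
    evHom3 t (permAlg σ F) = evHom3 (t ∘ σ) F := by
  induction F using AddMonoidAlgebra.induction_linear with
  | zero => simp
  | add F G hF hG => rw [map_add, map_add, hF, hG, map_add]
  | single n a =>
    rw [permAlg, AddMonoidAlgebra.domCongr_single, evHom3, evHom3,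
      AddMonoidAlgebra.lift_single, AddMonoidAlgebra.lift_single]
    congr 1
    change ((∏ j, t j ^ n (σ⁻¹ j) : ℂˣ) : ℂ) = ((∏ j, t (σ j) ^ n j : ℂˣ) : ℂ)
    rw [← Equiv.prod_comp σ]
    simp

theorem ev3_permAlg (σ : Equiv.Perm (Fin 3)) (F : Laurent3) {t : Fin 3 → ℂ} (ht : ∀ j, t j ≠ 0) :
    ev3 (permAlg σ F) (t 0) (t 1) (t 2) = ev3 F (t (σ 0)) (t (σ 1)) (t (σ 2)) := by
  have h1 := ev3_units (permAlg σ F) fun j => Units.mk0 (t j) (ht j)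
  have h2 := ev3_units F ((fun j => Units.mk0 (t j) (ht j)) ∘ σ)
  simp only [Units.val_mk0, Function.comp] at h1 h2
  rw [h1, h2, evHom3_permAlg]

theorem mem_Sym12_iff {F : Laurent3} : F ∈ Sym12 ↔ permAlg (Equiv.swap 0 1) F = F := by
  rw [← AddMonoidAlgebra.coeff_inj, Finsupp.ext_iff]
  simp only [coeff_permAlg]
  rfl

theorem mem_Sym12_iff_ev3 {F : Laurent3} : F ∈ Sym12 ↔
    ∀ u v w : ℂ, u ≠ 0 → v ≠ 0 → w ≠ 0 → ev3 F v u w = ev3 F u v w := by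
  have key : ∀ u v w : ℂ, u ≠ 0 → v ≠ 0 → w ≠ 0 →
      ev3 (permAlg (Equiv.swap 0 1) F) u v w = ev3 F v u w := by
    intro u v w hu hv hw
    have h := ev3_permAlg (Equiv.swap 0 1) F (t := ![u, v, w]) (by
      intro j; fin_cases j <;> simpa)
    simpa [Equiv.swap_apply_of_ne_of_ne] using h
  rw [mem_Sym12_iff]
  constructor
  · intro h u v w hu hv hw
    rw [← key u v w hu hv hw, h]
  · intro h
    exact ev3_inj fun u v w hu hv hw => by rw [key u v w hu hv hw, h u v w hu hv hw]

/-- The substitution of `(a z^i, b z^j, c z^k)` for the variables. -/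
def substZ (a b c : ℂˣ) (i j k : ℤ) : Laurent3 →ₐ[ℂ] ℂ[T;T⁻¹] :=
  AddMonoidAlgebra.lift ℂ ℂ[T;T⁻¹] (Fin 3 → ℤ)
    { toFun := fun n => AddMonoidAlgebra.single (i * n.toAdd 0 + j * n.toAdd 1 + k * n.toAdd 2)
        ((a ^ n.toAdd 0 * b ^ n.toAdd 1 * c ^ n.toAdd 2 : ℂˣ) : ℂ)
      map_one' := by
        change AddMonoidAlgebra.single _ _ = AddMonoidAlgebra.single 0 1
        congr 1 <;> simp
      map_mul' := fun m n => by
        rw [AddMonoidAlgebra.single_mul_single, ← Units.val_mul]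
        congr 1
        · simp; ring
        · simp only [toAdd_mul, Pi.add_apply, zpow_add]
          congr 1
          ac_rfl }

theorem ev_substZ (a b c : ℂˣ) (i j k : ℤ) (F : Laurent3) {z : ℂ} (hz : z ≠ 0) :
    ev (substZ a b c i j k F) z = ev3 F (a * z ^ i) (b * z ^ j) (c * z ^ k) := by
  have ha : (a : ℂ) * z ^ i ≠ 0 := mul_ne_zero a.ne_zero (zpow_ne_zero _ hz)
  have hb : (b : ℂ) * z ^ j ≠ 0 := mul_ne_zero b.ne_zero (zpow_ne_zero _ hz)
  have hc : (c : ℂ) * z ^ k ≠ 0 := mul_ne_zero c.ne_zero (zpow_ne_zero _ hz)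
  induction F using AddMonoidAlgebra.induction_linear with
  | zero => simp [ev, ev3]
  | add F G hF hG => rw [map_add, ev_add _ _ hz, hF, hG, ev3_add _ _ ha hb hc]
  | single n r =>
    rw [substZ, AddMonoidAlgebra.lift_single, ev_smul _ _ hz, ev3_single]
    change r * ev (AddMonoidAlgebra.single (i * n 0 + j * n 1 + k * n 2) _) z = _
    rw [ev_single, zpow_add₀ hz, zpow_add₀ hz, zpow_mul, zpow_mul, zpow_mul, mul_zpow, mul_zpow,
      mul_zpow]
    push_cast
    simp only [toAdd_ofAdd]
    ring

/-- The reflexive Laurent polynomial `F(A t, A t⁻¹, x)`. -/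
def lineRef (A x : ℂˣ) : Sym12 →ₗ[ℂ] Ref :=
  ((substZ A A x 1 (-1) 0).toLinearMap ∘ₗ Sym12.subtype).codRestrict Ref fun F => by
    change LaurentPolynomial.invert (substZ A A x 1 (-1) 0 (F : Laurent3)) = _
    have hF := mem_Sym12_iff_ev3.1 F.2
    refine ev_inj fun z hz => ?_
    rw [ev_invert _ hz, LinearMap.comp_apply]
    change ev (substZ A A x 1 (-1) 0 (F : Laurent3)) z⁻¹ = ev (substZ A A x 1 (-1) 0 _) z
    rw [ev_substZ _ _ _ _ _ _ _ hz, ev_substZ _ _ _ _ _ _ _ (inv_ne_zero hz)]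
    simp only [zpow_one, zpow_neg, inv_inv, zpow_zero, mul_one]
    exact hF _ _ _ (mul_ne_zero A.ne_zero hz) (mul_ne_zero A.ne_zero (inv_ne_zero hz)) x.ne_zero

theorem ev_lineRef (A x : ℂˣ) (F : Sym12) {z : ℂ} (hz : z ≠ 0) :
    ev (lineRef A x F) z = ev3 F (A * z) (A * z⁻¹) x := by
  have h := ev_substZ A A x 1 (-1) 0 F hz
  simp only [zpow_one, zpow_neg, zpow_zero, mul_one] at h
  exact h

/-! ### Bases of the partially symmetric Laurent polynomials, and the operator `M` on them -/

/-- The monomial `t₁^i t₂^j t₃^k`. -/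
def mono (i j k : ℤ) : Laurent3 := AddMonoidAlgebra.single ![i, j, k] 1

theorem mono_mul (i j k i' j' k' : ℤ) :
    mono i j k * mono i' j' k' = mono (i + i') (j + j') (k + k') := by
  unfold mono
  rw [AddMonoidAlgebra.single_mul_single, mul_one]
  congr 1
  simp

theorem mono_zero : mono 0 0 0 = 1 := by
  unfold mono
  rw [AddMonoidAlgebra.one_def]
  congr 1
  funext j
  fin_cases j <;> rfl

theorem ev3_mono (i j k : ℤ) (u v w : ℂ) : ev3 (mono i j k) u v w = u ^ i * v ^ j * w ^ k := by
  unfold mono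
  rw [ev3_single]
  simp

/-- The product `(t₁t₂)^k t₃^j (a t₁ t₃^e, a t₂ t₃^e; q)_n`. -/
def symBasis (q : ℝ) (a : ℂ) (e k : ℤ) (n : ℕ) (j : ℤ) : Laurent3 :=
  mono k k j * ∏ i ∈ Finset.range n,
    ((1 - (a * (q : ℂ) ^ i) • mono 1 0 e) * (1 - (a * (q : ℂ) ^ i) • mono 0 1 e))

theorem ev3_symBasis (q : ℝ) (a : ℂ) (e k : ℤ) (n : ℕ) (j : ℤ) {u v w : ℂ}
    (hu : u ≠ 0) (hv : v ≠ 0) (hw : w ≠ 0) :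
    ev3 (symBasis q a e k n j) u v w =
      (u * v) ^ k * w ^ j * (qPoch q (a * (u * w ^ e)) n * qPoch q (a * (v * w ^ e)) n) := by
  unfold symBasis qPoch
  rw [ev3_mul _ _ hu hv hw, ev3_prod _ _ hu hv hw, ev3_mono, mul_zpow, ← Finset.prod_mul_distrib]
  congr 1
  refine Finset.prod_congr rfl fun i _ => ?_
  rw [ev3_mul _ _ hu hv hw, ev3_sub _ _ hu hv hw, ev3_sub _ _ hu hv hw, ev3_one hu hv hw,
    ev3_smul _ _ hu hv hw, ev3_smul _ _ hu hv hw, ev3_mono, ev3_mono]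
  simp only [zpow_one, zpow_zero]
  ring

theorem symBasis_mem (q : ℝ) (a : ℂ) (e k : ℤ) (n : ℕ) (j : ℤ) : symBasis q a e k n j ∈ Sym12 := by
  rw [mem_Sym12_iff_ev3]
  intro u v w hu hv hw
  rw [ev3_symBasis q a e k n j hu hv hw, ev3_symBasis q a e k n j hv hu hw, mul_comm v u,
    mul_comm (qPoch q (a * (v * w ^ e)) n)]

theorem mono_mul_symBasis (q : ℝ) (a : ℂ) (e k : ℤ) (n : ℕ) (j k' j' : ℤ) :
    mono k' k' j' * symBasis q a e k n j = symBasis q a e (k' + k) n (j' + j) := by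
  unfold symBasis
  rw [← mul_assoc, mono_mul]

/-- Multiplication by `t₁ + t₂` in terms of the basis, from `(1 - bX)(1 - bY) = 1 - b(X + Y) + b²XY`
with `X = t₁ t₃^e`, `Y = t₂ t₃^e`. -/
theorem symBasis_succ (hq0 : 0 < q) {a : ℂ} (ha : a ≠ 0) (e k : ℤ) (n : ℕ) (j : ℤ) :
    (mono 1 0 0 + mono 0 1 0) * symBasis q a e k n j = (a * (q : ℂ) ^ n)⁻¹ •
      (symBasis q a e k n (-e + j) + (a * (q : ℂ) ^ n) ^ 2 • symBasis q a e (1 + k) n (e + j) -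
        symBasis q a e k (n + 1) (-e + j)) := by
  have hb : a * (q : ℂ) ^ n ≠ 0 := mul_ne_zero ha (pow_ne_zero n (ofReal_ne_zero_of_pos hq0))
  rw [eq_inv_smul_iff₀ hb]
  have e1 : symBasis q a e k (n + 1) (-e + j) = mono 0 0 (-e) * symBasis q a e k n j *
      ((1 - (a * (q : ℂ) ^ n) • mono 1 0 e) * (1 - (a * (q : ℂ) ^ n) • mono 0 1 e)) := by
    rw [mono_mul_symBasis, zero_add]
    unfold symBasis
    rw [Finset.prod_range_succ, mul_assoc]
  rw [e1, show symBasis q a e k n (-e + j) = mono 0 0 (-e) * symBasis q a e k n j by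
      rw [mono_mul_symBasis, zero_add],
    show symBasis q a e (1 + k) n (e + j) = mono 1 1 e * symBasis q a e k n j by
      rw [mono_mul_symBasis]]
  have h1 : mono 1 0 0 = mono 0 0 (-e) * mono 1 0 e := by rw [mono_mul]; congr 1; ring
  have h2 : mono 0 1 0 = mono 0 0 (-e) * mono 0 1 e := by rw [mono_mul]; congr 1; ring
  have h3 : mono 1 1 e = mono 0 0 (-e) * mono 1 0 e * mono 0 1 e := by
    rw [mono_mul, mono_mul]; congr 1; ring
  rw [h1, h2, h3]
  generalize a * (q : ℂ) ^ n = b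
  simp only [Algebra.smul_def, map_pow]
  ring

/-- The span of the products `symBasis`. -/
def symSpan (q : ℝ) (a : ℂ) (e : ℤ) : Submodule ℂ Laurent3 :=
  Submodule.span ℂ (Set.range fun p : ℤ × ℕ × ℤ => symBasis q a e p.1 p.2.1 p.2.2)

theorem symBasis_mem_symSpan (q : ℝ) (a : ℂ) (e k : ℤ) (n : ℕ) (j : ℤ) :
    symBasis q a e k n j ∈ symSpan q a e :=
  Submodule.subset_span ⟨(k, n, j), rfl⟩

theorem mul_mem_symSpan {a : ℂ} {e : ℤ} {X : Laurent3}
    (hX : ∀ k n j, X * symBasis q a e k n j ∈ symSpan q a e) {F : Laurent3}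
    (hF : F ∈ symSpan q a e) : X * F ∈ symSpan q a e := by
  induction hF using Submodule.span_induction with
  | mem F hF => obtain ⟨p, rfl⟩ := hF; exact hX _ _ _
  | zero => simp
  | add F G _ _ hF hG => rw [mul_add]; exact add_mem hF hG
  | smul c F _ hF => rw [mul_smul_comm]; exact Submodule.smul_mem _ c hF

/-- The span contains `1` and is closed under multiplication by `t₁ + t₂`, `(t₁t₂)^{±1}` and `t₃^{±1}`,
which generate the symmetric Laurent polynomials. -/
theorem Sym12_le_symSpan (hq0 : 0 < q) {a : ℂ} (ha : a ≠ 0) (e : ℤ) : Sym12 ≤ symSpan q a e := by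
  have hmono : ∀ k j : ℤ, ∀ F ∈ symSpan q a e, mono k k j * F ∈ symSpan q a e := fun k j F hF =>
    mul_mem_symSpan (fun k' n j' => by
      rw [mono_mul_symBasis]; exact symBasis_mem_symSpan _ _ _ _ _ _) hF
  have hadd : ∀ F ∈ symSpan q a e, (mono 1 0 0 + mono 0 1 0) * F ∈ symSpan q a e := fun F hF =>
    mul_mem_symSpan (fun k n j => by
      rw [symBasis_succ hq0 ha]
      exact Submodule.smul_mem _ _ (sub_mem (add_mem (symBasis_mem_symSpan _ _ _ _ _ _)
        (Submodule.smul_mem _ _ (symBasis_mem_symSpan _ _ _ _ _ _)))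
        (symBasis_mem_symSpan _ _ _ _ _ _))) hF
  have hone : (1 : Laurent3) ∈ symSpan q a e := by
    have h := symBasis_mem_symSpan q a e 0 0 0
    simpa [symBasis, mono_zero] using h
  -- the power sums `t₁^m + t₂^m`
  have hpow : ∀ m : ℕ, mono m 0 0 + mono 0 m 0 ∈ symSpan q a e := by
    intro m
    induction m using Nat.strong_induction_on with
    | _ m ih =>
      match m with
      | 0 =>
        simp only [Nat.cast_zero, mono_zero]
        exact add_mem hone hone
      | 1 => simpa using hadd 1 hone
      | m + 2 =>
        have h1 := hadd _ (ih (m + 1) (by omega))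
        have h0 := hmono 1 0 _ (ih m (by omega))
        convert sub_mem h1 h0 using 1
        simp only [mul_add, add_mul, mono_mul]
        push_cast
        ring_nf
  have hmon : ∀ n : Fin 3 → ℤ, mono (n 0) (n 1) (n 2) + mono (n 1) (n 0) (n 2) ∈
      symSpan q a e := by
    intro n
    obtain ⟨d, hd | hd⟩ := (n 0 - n 1).eq_nat_or_neg
    · have h := hmono (n 1) (n 2) _ (hpow d)
      rw [mul_add, mono_mul, mono_mul, ← hd] at h
      convert h using 3 <;> ring
    · have h := hmono (n 0) (n 2) _ (hpow d)
      rw [mul_add, mono_mul, mono_mul, show (d : ℤ) = n 1 - n 0 by omega, add_comm] at h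
      convert h using 3 <;> ring
  have hsingle : ∀ n : Fin 3 → ℤ, ∀ c : ℂ,
      AddMonoidAlgebra.single n c = c • mono (n 0) (n 1) (n 2) := by
    intro n c
    unfold mono
    rw [AddMonoidAlgebra.smul_single, smul_eq_mul, mul_one]
    congr 1
    funext j
    fin_cases j <;> rfl
  -- symmetrization reduces the claim to the symmetrized monomials
  have key : ∀ F : Laurent3, F + permAlg (Equiv.swap 0 1) F ∈ symSpan q a e := by
    intro F
    induction F using AddMonoidAlgebra.induction_linear with
    | zero => simp
    | add F G hF hG => rw [map_add, add_add_add_comm]; exact add_mem hF hG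
    | single n c =>
      rw [hsingle n c, map_smul, ← smul_add]
      refine Submodule.smul_mem _ c ?_
      convert hmon n using 2
      unfold mono
      rw [permAlg, AddMonoidAlgebra.domCongr_single]
      congr 1
      funext j
      fin_cases j <;> rfl
  intro F hF
  have h := Submodule.smul_mem _ (1 / 2 : ℂ) (key F)
  rw [mem_Sym12_iff.1 hF, ← two_smul ℂ F, smul_smul] at h
  simpa using h

/-- A subspace of `Sym12` which contains all `symBasis q a e k n j` is the whole space. -/
theorem Sym12_induction (hq0 : 0 < q) {a : ℂ} (ha : a ≠ 0) (e : ℤ) (W : Submodule ℂ Sym12)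
    (h : ∀ k n j, (⟨symBasis q a e k n j, symBasis_mem _ _ _ _ _ _⟩ : Sym12) ∈ W) : W = ⊤ := by
  rw [eq_top_iff]
  rintro ⟨F, hF⟩ -
  have h1 : symSpan q a e ≤ W.map Sym12.subtype := by
    refine Submodule.span_le.2 ?_
    rintro _ ⟨p, rfl⟩
    exact ⟨_, h p.1 p.2.1 p.2.2, rfl⟩
  obtain ⟨G, hG, hGF⟩ := h1 (Sym12_le_symSpan hq0 ha e hF)
  have : G = ⟨F, hF⟩ := Subtype.ext hGF
  exact this ▸ hG

/-- `ℓ^e` as a unit. -/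
def ellUnit (q g e : ℝ) (hq0 : 0 < q) : ℂˣ :=
  Units.mk0 (ellPow q g e) (by rw [ellPow_eq_cpow hq0]; exact cpow_ne_zero_of_pos hq0 _)

theorem ellPow_ne_zero (hq0 : 0 < q) (g e : ℝ) : ellPow q g e ≠ 0 := (ellUnit q g e hq0).ne_zero

theorem ellPow_add (hq0 : 0 < q) (g e e' : ℝ) :
    ellPow q g (e + e') = ellPow q g e * ellPow q g e' := by
  rw [ellPow_eq_cpow hq0, ellPow_eq_cpow hq0, ellPow_eq_cpow hq0,
    ← Complex.cpow_add _ _ (ofReal_ne_zero_of_pos hq0)]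
  congr 1
  push_cast
  ring

theorem ellPow_zero (q g : ℝ) : ellPow q g 0 = 1 := by simp [ellPow]

theorem ellPow_intCast (g : ℝ) (k : ℤ) : ellPow q g k = (ell q g : ℂ) ^ k := by
  unfold ellPow
  rw [Real.rpow_intCast]
  push_cast
  rfl

/-- The graph of the operator `M`: the pairs `(Ψ, Φ)` such that on each line
`(y₁, y₂, x) = (y₊y₋, y₊/y₋, x)` the values of `Φ` are obtained from those of `Ψ` by the operator
`M_{g,2g}^r` with `r = ℓ^{3/2} y₊`. -/
def relM (q g : ℝ) (hq0 : 0 < q) : Submodule ℂ (Sym12 × Sym12) where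
  carrier := {p | ∀ x yp ym : ℂˣ, ev3 p.2 (yp * ym) (yp * (ym : ℂ)⁻¹) x =
    ev (opM q g (2 * g) (yp * ellPow q g (3 / 2))
      (lineRef (ellUnit q g (3 / 2) hq0 * x * yp) x p.1)) ym}
  add_mem' {p p'} hp hp' x yp ym := by
    have h := ym.ne_zero
    rw [Prod.fst_add, Prod.snd_add, map_add, map_add, Submodule.coe_add, Submodule.coe_add,
      ev3_add _ _ (mul_ne_zero yp.ne_zero h) (mul_ne_zero yp.ne_zero (inv_ne_zero h)) x.ne_zero,
      ev_add _ _ h, hp, hp']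
  zero_mem' x yp ym := by simp [ev3, ev]
  smul_mem' c p hp x yp ym := by
    have h := ym.ne_zero
    rw [Prod.smul_fst, Prod.smul_snd, map_smul, map_smul, Submodule.coe_smul, Submodule.coe_smul,
      ev3_smul _ _ (mul_ne_zero yp.ne_zero h) (mul_ne_zero yp.ne_zero (inv_ne_zero h)) x.ne_zero,
      ev_smul _ _ h, hp]

theorem norm_cpow_lt_one (hq0 : 0 < q) (hq1 : q < 1) {a : ℝ} (ha : 0 < a) :
    ‖(q : ℂ) ^ (a : ℂ)‖ < 1 := by
  rw [Complex.norm_cpow_eq_rpow_re_of_pos hq0, Complex.ofReal_re]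
  exact Real.rpow_lt_one hq0.le hq1 ha

theorem mul_pow_ne_one_of_norm_lt (hq0 : 0 < q) (hq1 : q < 1) {a : ℂ} (ha : ‖a‖ < 1) (n : ℕ) :
    a * (q : ℂ) ^ n ≠ 1 := by
  intro h
  have h1 := congrArg norm h
  rw [norm_mul, norm_one, norm_pow] at h1
  have h2 : ‖(q : ℂ)‖ ^ n ≤ 1 := pow_le_one₀ (norm_nonneg _) (norm_ofReal_lt_one hq0 hq1).le
  nlinarith [norm_nonneg a]

theorem cpow_mul_pow_ne_one (hq0 : 0 < q) (hq1 : q < 1) {a : ℝ} (ha : 0 < a) (n : ℕ) :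
    (q : ℂ) ^ (a : ℂ) * (q : ℂ) ^ n ≠ 1 :=
  mul_pow_ne_one_of_norm_lt hq0 hq1 (norm_cpow_lt_one hq0 hq1 ha) n

/-- `M` maps `(t₁t₂)^k t₃^j (ℓ⁻¹t₁/t₃, ℓ⁻¹t₂/t₃; q)_n` to a multiple of
`(y₁y₂)^k x^{j+2k} (y₁, y₂; q)_n`. -/
theorem symBasis_mem_relM (hq0 : 0 < q) (g : ℝ) (k : ℤ) (n : ℕ) (j : ℤ) :
    ((⟨symBasis q (ellPow q g (-1)) (-1) k n j, symBasis_mem _ _ _ _ _ _⟩,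
      (qPoch q (ellPow q g (-2)) n / qPoch q (ellPow q g (-3)) n * ellPow q g 3 ^ k) •
        ⟨symBasis q 1 0 k n (j + 2 * k), symBasis_mem _ _ _ _ _ _⟩) : Sym12 × Sym12) ∈
      relM q g hq0 := by
  intro x yp ym
  have hym := ym.ne_zero
  have hyp := yp.ne_zero
  have hx := x.ne_zero
  have hr : (yp : ℂ) * ellPow q g (3 / 2) ≠ 0 := mul_ne_zero hyp (ellPow_ne_zero hq0 _ _)
  have hc : (yp : ℂ) * ellPow q g (3 / 2) * (q : ℂ) ^ ((2 * g : ℂ) / 2) =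
      ellPow q g (1 / 2) * yp := by
    rw [show (1 / 2 : ℝ) = 3 / 2 + (-1) by norm_num, ellPow_add hq0, ellPow_eq_cpow hq0 g (-1)]
    push_cast
    ring_nf
  have hc' : (yp : ℂ) * ellPow q g (3 / 2) * (q : ℂ) ^ (((g : ℂ) + 2 * g) / 2) = yp := by
    rw [show ((g : ℂ) + 2 * g) / 2 = -(g * ((-(3 / 2) : ℝ) : ℂ)) by push_cast; ring,
      ← ellPow_eq_cpow hq0, mul_assoc, ← ellPow_add hq0, show (3 / 2 + -(3 / 2) : ℝ) = 0 by ring,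
      ellPow_zero, mul_one]
  have h23 : (q : ℂ) ^ (2 * g : ℂ) = ellPow q g (-2) ∧
      (q : ℂ) ^ ((g : ℂ) + 2 * g) = ellPow q g (-3) := by
    constructor <;> rw [ellPow_eq_cpow hq0] <;> congr 1 <;> push_cast <;> ring
  obtain ⟨F, hF⟩ : ∃ F : Sym12, F = ⟨symBasis q (ellPow q g (-1)) (-1) k n j,
    symBasis_mem _ _ _ _ _ _⟩ := ⟨_, rfl⟩
  have key : lineRef (ellUnit q g (3 / 2) hq0 * x * yp) x F =
      (ellPow q g 3 ^ k * (x : ℂ) ^ (j + 2 * k) * (yp : ℂ) ^ (2 * k)) •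
        refEquiv (awPoly q (yp * ellPow q g (3 / 2) * (q : ℂ) ^ ((2 * g : ℂ) / 2)) n) := by
    refine Subtype.ext (ev_inj fun z hz => ?_)
    rw [ev_lineRef _ _ _ hz, hF, Submodule.coe_smul, ev_smul _ _ hz, ev_refEquiv _ hz,
      eval_awPoly q _ n hz]
    have hA : ((ellUnit q g (3 / 2) hq0 * x * yp : ℂˣ) : ℂ) = ellPow q g (3 / 2) * x * yp := rfl
    have hA0 : ellPow q g (3 / 2) * x * yp ≠ 0 := (ellUnit q g (3 / 2) hq0 * x * yp).ne_zero
    rw [hA]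
    rw [ev3_symBasis _ _ _ _ _ _ (mul_ne_zero hA0 hz) (mul_ne_zero hA0 (inv_ne_zero hz)) hx, hc]
    have e1 : ∀ s : ℂ, ellPow q g (-1) * (ellPow q g (3 / 2) * x * yp * s * (x : ℂ) ^ (-1 : ℤ)) =
        ellPow q g (1 / 2) * yp * s := by
      intro s
      rw [show (1 / 2 : ℝ) = 3 / 2 + (-1) by norm_num, ellPow_add hq0, zpow_neg_one]
      field_simp
    have e2 : ellPow q g (3 / 2) * x * yp * z * (ellPow q g (3 / 2) * x * yp * z⁻¹) =
        ellPow q g 3 * (x : ℂ) ^ (2 : ℤ) * (yp : ℂ) ^ (2 : ℤ) := by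
      rw [show (3 : ℝ) = 3 / 2 + 3 / 2 by norm_num, ellPow_add hq0]
      norm_num
      field_simp
    rw [e1, e1, e2, mul_zpow, mul_zpow, ← zpow_mul, ← zpow_mul, zpow_add₀ hx]
    ring
  change ev3 _ _ _ _ = ev (opM q g (2 * g) _ (lineRef _ x ⟨_, _⟩)) ym
  rw [← hF, key, map_smul, opM_refEquiv_awPoly hq0 _ _ hr, hc', h23.1, h23.2]
  simp only [Submodule.coe_smul]
  rw [ev_smul _ _ hym, ev_smul _ _ hym, ev_refEquiv _ hym, eval_awPoly q _ n hym,
    ev3_smul _ _ (mul_ne_zero hyp hym) (mul_ne_zero hyp (inv_ne_zero hym)) hx,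
    ev3_symBasis _ _ _ _ _ _ (mul_ne_zero hyp hym) (mul_ne_zero hyp (inv_ne_zero hym)) hx]
  have e3 : (yp : ℂ) * ym * (yp * (ym : ℂ)⁻¹) = (yp : ℂ) ^ (2 : ℤ) := by
    norm_num
    field_simp
  rw [e3, ← zpow_mul, zpow_zero, mul_one, mul_one, one_mul, one_mul]
  ring

/-- The same relation read backwards, by means of the inverse `M_{-g,3g}` of `M_{g,2g}`. -/
theorem relM_inv (hq0 : 0 < q) (hq1 : q < 1) {g : ℝ} (hg : 0 < g) {p : Sym12 × Sym12}
    (hp : p ∈ relM q g hq0) (t₃ tp tm : ℂˣ) :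
    ev3 p.1 (tp * tm * t₃) (tp * (tm : ℂ)⁻¹ * t₃) t₃ =
      ev (opM q (-g) (3 * g) tp (lineRef (ellUnit q g (-(3 / 2)) hq0 * tp) t₃ p.2)) tm := by
  have hl : ellPow q g (-(3 / 2)) * ellPow q g (3 / 2) = 1 := by
    rw [← ellPow_add hq0, neg_add_cancel, ellPow_zero]
  have hr : ((ellUnit q g (-(3 / 2)) hq0 * tp : ℂˣ) : ℂ) * ellPow q g (3 / 2) = tp := by
    change ellPow q g (-(3 / 2)) * tp * _ = _
    linear_combination (tp : ℂ) * hl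
  have key : lineRef (ellUnit q g (-(3 / 2)) hq0 * tp) t₃ p.2 = opM q g (2 * g) tp
      (lineRef (ellUnit q g (3 / 2) hq0 * t₃ * (ellUnit q g (-(3 / 2)) hq0 * tp)) t₃ p.1) := by
    refine Subtype.ext (ev_inj fun z hz => ?_)
    have h := hp t₃ (ellUnit q g (-(3 / 2)) hq0 * tp) (Units.mk0 z hz)
    rw [hr] at h
    rw [ev_lineRef _ _ _ hz]
    exact h
  have h2 : ∀ n : ℕ, (q : ℂ) ^ (2 * g : ℂ) * (q : ℂ) ^ n ≠ 1 := fun n => by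
    simpa using cpow_mul_pow_ne_one hq0 hq1 (show 0 < 2 * g by positivity) n
  have h3 : ∀ n : ℕ, (q : ℂ) ^ ((g : ℂ) + 2 * g) * (q : ℂ) ^ n ≠ 1 := fun n => by
    simpa using cpow_mul_pow_ne_one hq0 hq1 (show 0 < g + 2 * g by positivity) n
  have h4 := opM_comp hq0 tp.ne_zero h2 h3
  have h5 := LinearMap.congr_fun h4
    (lineRef (ellUnit q g (3 / 2) hq0 * t₃ * (ellUnit q g (-(3 / 2)) hq0 * tp)) t₃ p.1)
  rw [LinearMap.comp_apply, ← key, LinearMap.id_apply, show (g : ℂ) + 2 * g = 3 * g by ring] at h5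
  rw [h5, ev_lineRef _ _ _ tm.ne_zero]
  have e : ((ellUnit q g (3 / 2) hq0 * t₃ * (ellUnit q g (-(3 / 2)) hq0 * tp) : ℂˣ) : ℂ) =
      tp * t₃ := by
    change ellPow q g (3 / 2) * t₃ * (ellPow q g (-(3 / 2)) * tp) = _
    linear_combination (tp * t₃ : ℂ) * hl
  rw [e, mul_right_comm, mul_right_comm _ _ (t₃ : ℂ)]

/-- Every pair of nonzero numbers is of the form `(cd, c/d)`. -/
theorem exists_units_mul_div {u v : ℂ} (hu : u ≠ 0) (hv : v ≠ 0) :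
    ∃ c d : ℂˣ, u = c * d ∧ v = c * (d : ℂ)⁻¹ := by
  obtain ⟨d, hd⟩ := IsAlgClosed.exists_pow_nat_eq (u / v) (n := 2) (by norm_num)
  have hd0 : d ≠ 0 := by
    rintro rfl
    exact div_ne_zero hu hv (by simpa using hd.symm)
  refine ⟨Units.mk0 (u / d) (div_ne_zero hu hd0), Units.mk0 d hd0, ?_, ?_⟩
  · simp [hd0]
  · rw [Units.val_mk0, Units.val_mk0]
    field_simp at hd ⊢
    linear_combination hd

/-- The graph `relM` projects bijectively on both factors. It contains the pairs of basis elements of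
`symBasis_mem_relM`, so the projections are onto. They are injective since every point of the torus
is of the form `(cd, c/d, x)`, so that either component determines the values of the other. -/
theorem relM_bijective (hq0 : 0 < q) (hq1 : q < 1) {g : ℝ} (hg : 0 < g) :
    Function.Bijective ((LinearMap.fst ℂ Sym12 Sym12).domRestrict (relM q g hq0)) ∧
    Function.Bijective ((LinearMap.snd ℂ Sym12 Sym12).domRestrict (relM q g hq0)) := by
  have hγ : ∀ e : ℝ, e < 0 → ∀ n, qPoch q (ellPow q g e) n ≠ 0 := by
    intro e he n
    refine qPoch_ne_zero (fun n => ?_) n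
    rw [ellPow_eq_cpow hq0]
    simpa using cpow_mul_pow_ne_one hq0 hq1 (show 0 < -(g * e) by nlinarith) n
  refine ⟨⟨?_, ?_⟩, ?_, ?_⟩
  · refine (injective_iff_map_eq_zero _).2 ?_
    rintro ⟨⟨Ψ, Φ⟩, hp⟩ (rfl : Ψ = 0)
    refine Subtype.ext (Prod.ext rfl (Subtype.ext (ev3_inj fun u v w hu hv hw => ?_)))
    obtain ⟨c, d, rfl, rfl⟩ := exists_units_mul_div hu hv
    have h := hp (Units.mk0 w hw) c d
    change ev3 Φ _ _ _ = ev3 0 _ _ _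
    rw [ev3_zero]
    simpa [ev] using h
  · rw [← LinearMap.range_eq_top]
    refine Sym12_induction hq0 (ellPow_ne_zero hq0 g (-1)) (-1) _ fun k n j => ?_
    exact ⟨⟨_, symBasis_mem_relM hq0 g k n j⟩, rfl⟩
  · refine (injective_iff_map_eq_zero _).2 ?_
    rintro ⟨⟨Ψ, Φ⟩, hp⟩ (rfl : Φ = 0)
    refine Subtype.ext (Prod.ext (Subtype.ext (ev3_inj fun u v w hu hv hw => ?_)) rfl)
    obtain ⟨c, d, hc, hd⟩ := exists_units_mul_div (div_ne_zero hu hw) (div_ne_zero hv hw)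
    have h := relM_inv hq0 hq1 hg hp (Units.mk0 w hw) c d
    rw [← hc, ← hd, Units.val_mk0, div_mul_cancel₀ _ hw, div_mul_cancel₀ _ hw] at h
    change ev3 Ψ _ _ _ = ev3 0 _ _ _
    rw [ev3_zero]
    simpa [ev] using h
  · rw [← LinearMap.range_eq_top]
    refine Sym12_induction hq0 one_ne_zero 0 _ fun k n j => ?_
    have h := symBasis_mem_relM hq0 g k n (j - 2 * k)
    rw [sub_add_cancel] at h
    have hne : qPoch q (ellPow q g (-2)) n / qPoch q (ellPow q g (-3)) n * ellPow q g 3 ^ k ≠ 0 :=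
      mul_ne_zero (div_ne_zero (hγ _ (by norm_num) n) (hγ _ (by norm_num) n))
        (zpow_ne_zero _ (ellPow_ne_zero hq0 _ _))
    have h2 := Submodule.smul_mem _ (qPoch q (ellPow q g (-2)) n /
      qPoch q (ellPow q g (-3)) n * ellPow q g 3 ^ k)⁻¹ h
    refine ⟨⟨_, h2⟩, ?_⟩
    exact inv_smul_smul₀ hne _

/-- The operator `M` on partially symmetric Laurent polynomials. -/
def symM (hq0 : 0 < q) (hq1 : q < 1) {g : ℝ} (hg : 0 < g) : Sym12 ≃ₗ[ℂ] Sym12 :=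
  (LinearEquiv.ofBijective _ (relM_bijective hq0 hq1 hg).1).symm.trans
    (LinearEquiv.ofBijective _ (relM_bijective hq0 hq1 hg).2)

theorem symM_mem_relM (hq0 : 0 < q) (hq1 : q < 1) {g : ℝ} (hg : 0 < g) (Ψ : Sym12) :
    (Ψ, symM hq0 hq1 hg Ψ) ∈ relM q g hq0 := by
  obtain ⟨p, hp⟩ := (relM_bijective hq0 hq1 hg).1.2 Ψ
  have h1 : (LinearEquiv.ofBijective _ (relM_bijective hq0 hq1 hg).1).symm Ψ = p := by
    rw [LinearEquiv.symm_apply_eq]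
    exact hp.symm
  have h2 : symM hq0 hq1 hg Ψ = p.1.2 := by
    unfold symM
    rw [LinearEquiv.trans_apply, h1]
    rfl
  rw [h2, ← hp]
  exact p.2

theorem symM_symm_mem_relM (hq0 : 0 < q) (hq1 : q < 1) {g : ℝ} (hg : 0 < g) (Φ : Sym12) :
    ((symM hq0 hq1 hg).symm Φ, Φ) ∈ relM q g hq0 := by
  have h := symM_mem_relM hq0 hq1 hg ((symM hq0 hq1 hg).symm Φ)
  rwa [LinearEquiv.apply_symm_apply] at h

theorem symM_eq_of_mem_relM (hq0 : 0 < q) (hq1 : q < 1) {g : ℝ} (hg : 0 < g) {Ψ Φ : Sym12}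
    (h : (Ψ, Φ) ∈ relM q g hq0) : symM hq0 hq1 hg Ψ = Φ := by
  have h1 := (relM_bijective hq0 hq1 hg).1.1
    (a₁ := ⟨_, symM_mem_relM hq0 hq1 hg Ψ⟩) (a₂ := ⟨_, h⟩) rfl
  exact congrArg (fun p => p.1.2) h1

/-! ### Integral formulas for `M` and its inverse -/

/-- `M` on the lines `(y₊y₋, y₊/y₋, x)`, as a value of `M_{g,2g}^r` and as an integral. -/
theorem symM_integral (hq0 : 0 < q) (hq1 : q < 1) {g : ℝ} (hg : 0 < g)
    (Ψ : Sym12) {x yp ym : ℂ} (hx : x ≠ 0) (hyp : yp ≠ 0) (hym : ym ≠ 0) :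
    (∃ ψ : Ref,
      (∀ tm : ℂ, tm ≠ 0 → ev ψ tm =
        ev3 Ψ (ellPow q g (3 / 2) * x * yp * tm) (ellPow q g (3 / 2) * x * yp * tm⁻¹) x) ∧
      ev3 (symM hq0 hq1 hg Ψ) (yp * ym) (yp * ym⁻¹) x =
        ev (opM q g (2 * g) (yp * ellPow q g (3 / 2)) ψ) ym) ∧
    (Generic q g (2 * g) (yp * ellPow q g (3 / 2)) ym →
      ∀ᶠ ε in 𝓝[>] (0 : ℝ),
        ev3 (symM hq0 hq1 hg Ψ) (yp * ym) (yp * ym⁻¹) x =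
          cycleInt q g (2 * g) (yp * ellPow q g (3 / 2)) ym ε fun tm =>
            kernelM q g yp ym tm *
              ev3 Ψ (ellPow q g (3 / 2) * x * yp * tm)
                (ellPow q g (3 / 2) * x * yp * tm⁻¹) x) := by
  have h := symM_mem_relM hq0 hq1 hg Ψ (Units.mk0 x hx) (Units.mk0 yp hyp) (Units.mk0 ym hym)
  simp only [Units.val_mk0] at h
  obtain ⟨ψ, hψ⟩ : ∃ ψ, ψ = lineRef (ellUnit q g (3 / 2) hq0 * Units.mk0 x hx * Units.mk0 yp hyp)
    (Units.mk0 x hx) Ψ := ⟨_, rfl⟩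
  rw [← hψ] at h
  have hev : ∀ tm : ℂ, tm ≠ 0 → ev ψ tm =
      ev3 Ψ (ellPow q g (3 / 2) * x * yp * tm) (ellPow q g (3 / 2) * x * yp * tm⁻¹) x :=
    fun tm htm => by rw [hψ, ev_lineRef _ _ _ htm]; rfl
  refine ⟨⟨ψ, hev, h⟩, fun hgen => ?_⟩
  simp only [kernelM_eq hq0, h]
  exact ev_opM_eventually_eq hq0 hq1 hgen ψ hev

/-- `M⁻¹` on the lines `(t₊t₋t₃, t₊t₃/t₋, t₃)`, as a value of `M_{-g,3g}^r` and as an integral. -/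
theorem symM_symm_integral (hq0 : 0 < q) (hq1 : q < 1) {g : ℝ} (hg : 0 < g)
    (Φ : Sym12) {t₃ tp tm : ℂ} (ht₃ : t₃ ≠ 0) (htp : tp ≠ 0) (htm : tm ≠ 0) :
    (∃ φ : Ref,
      (∀ ym : ℂ, ym ≠ 0 → ev φ ym =
        ev3 Φ (ellPow q g (-(3 / 2)) * tp * ym) (ellPow q g (-(3 / 2)) * tp * ym⁻¹) t₃) ∧
      ev3 ((symM hq0 hq1 hg).symm Φ) (tp * tm * t₃) (tp * tm⁻¹ * t₃) t₃ =
        ev (opM q (-g) (3 * g) tp φ) tm) ∧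
    (Generic q (-g) (3 * g) tp tm →
      ∀ᶠ ε in 𝓝[>] (0 : ℝ),
        ev3 ((symM hq0 hq1 hg).symm Φ) (tp * tm * t₃) (tp * tm⁻¹ * t₃) t₃ =
          cycleInt q (-g) (3 * g) tp tm ε fun ym =>
            kernelMInv q g tp tm ym *
              ev3 Φ (ellPow q g (-(3 / 2)) * tp * ym)
                (ellPow q g (-(3 / 2)) * tp * ym⁻¹) t₃) := by
  have h := relM_inv hq0 hq1 hg (symM_symm_mem_relM hq0 hq1 hg Φ)
    (Units.mk0 t₃ ht₃) (Units.mk0 tp htp) (Units.mk0 tm htm)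
  simp only [Units.val_mk0] at h
  obtain ⟨φ, hφ⟩ : ∃ φ, φ = lineRef (ellUnit q g (-(3 / 2)) hq0 * Units.mk0 tp htp)
    (Units.mk0 t₃ ht₃) Φ := ⟨_, rfl⟩
  rw [← hφ] at h
  have hev : ∀ ym : ℂ, ym ≠ 0 → ev φ ym =
      ev3 Φ (ellPow q g (-(3 / 2)) * tp * ym) (ellPow q g (-(3 / 2)) * tp * ym⁻¹) t₃ :=
    fun ym hym => by rw [hφ, ev_lineRef _ _ _ hym]; rfl
  refine ⟨⟨φ, hev, h⟩, fun hgen => ?_⟩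
  simp only [kernelMInv_eq hq0, h]
  exact ev_opM_eventually_eq hq0 hq1 hgen φ hev

/-- The inverse of `M_{αβ}^r` is the operator with parameters `-α`, `α + β`, with its integral
representation. -/
theorem opM_inverse (hq0 : 0 < q) (hq1 : q < 1) {α β r : ℂ} (hr : r ≠ 0)
    (hβ : ∀ n : ℕ, (q : ℂ) ^ β * (q : ℂ) ^ n ≠ 1)
    (hαβ : ∀ n : ℕ, (q : ℂ) ^ (α + β) * (q : ℂ) ^ n ≠ 1) :
    (opM q (-α) (α + β) r ∘ₗ opM q α β r = LinearMap.id ∧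
      opM q α β r ∘ₗ opM q (-α) (α + β) r = LinearMap.id) ∧
    ∀ (F : Ref) (t : ℂ), Generic q (-α) (α + β) r t →
      ∀ᶠ ε in 𝓝[>] (0 : ℝ),
        ev (opM q (-α) (α + β) r F) t =
          cycleInt q (-α) (α + β) r t ε fun s => kernelInv q α β r t s * ev F s := by
  refine ⟨⟨opM_comp hq0 hr hβ hαβ, ?_⟩, fun F t hgen => ?_⟩
  · have h := opM_comp (α := -α) (β := α + β) hq0 hr hαβ (by simpa using hβ)
    simpa using h
  · simp only [kernelInv_eq]
    exact ev_opM_eventually_eq hq0 hq1 hgen F fun _ _ => rfl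

/-! ### A summation formula -/

/-- The first factor of the weights of the summation formula. -/
def nodeF (q : ℝ) (D E z : ℂ) (j : ℕ) : ℂ :=
  ∏ r ∈ Finset.range j, ((1 - D * (q : ℂ) ^ r) * (E * (1 - z * (q : ℂ) ^ r)) /
    ((1 - (q : ℂ) ^ (r + 1)) * (E - z * (q : ℂ) ^ (r + 1))))

/-- The second factor of the weights of the summation formula. -/
def nodeG (q : ℝ) (D E z : ℂ) (i : ℕ) : ℂ :=
  ∏ r ∈ Finset.range i, ((1 - E * (q : ℂ) ^ r) * (D * E * (q : ℂ) ^ r - z) /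
    ((1 - (q : ℂ) ^ (r + 1)) * (E * (q : ℂ) ^ (r + 1) - z)))

/-- The weights of the summation formula. -/
def nodeW (q : ℝ) (D E z : ℂ) (j i : ℕ) : ℂ :=
  nodeF q D E z j * nodeG q D E z i * (E * (q : ℂ) ^ i - z * (q : ℂ) ^ j)

theorem nodeF_succ (q : ℝ) (D E z : ℂ) (j : ℕ) : nodeF q D E z (j + 1) = nodeF q D E z j *
    ((1 - D * (q : ℂ) ^ j) * (E * (1 - z * (q : ℂ) ^ j)) /
      ((1 - (q : ℂ) ^ (j + 1)) * (E - z * (q : ℂ) ^ (j + 1)))) :=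
  Finset.prod_range_succ _ _

theorem nodeG_succ (q : ℝ) (D E z : ℂ) (i : ℕ) : nodeG q D E z (i + 1) = nodeG q D E z i *
    ((1 - E * (q : ℂ) ^ i) * (D * E * (q : ℂ) ^ i - z) /
      ((1 - (q : ℂ) ^ (i + 1)) * (E * (q : ℂ) ^ (i + 1) - z))) :=
  Finset.prod_range_succ _ _

/-- `E q^i ≠ z q^j` for all `i, j`. -/
def NodeGeneric (q : ℝ) (E z : ℂ) : Prop := ∀ i j : ℕ, E * (q : ℂ) ^ i - z * (q : ℂ) ^ j ≠ 0

theorem NodeGeneric.shift_right {E z : ℂ} (h : NodeGeneric q E z) : NodeGeneric q E (z * q) :=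
  fun i j => by have := h i (j + 1); rwa [pow_succ', ← mul_assoc] at this

theorem NodeGeneric.shift_left {E z : ℂ} (h : NodeGeneric q E z) : NodeGeneric q (E * q) z :=
  fun i j => by have := h (i + 1) j; rwa [pow_succ', ← mul_assoc] at this

theorem nodeF_shift (hq0 : 0 < q) (hq1 : q < 1) (D : ℂ) {E z : ℂ} (h : NodeGeneric q E z) (j : ℕ) :
    nodeF q D E z (j + 1) * ((1 - (q : ℂ) ^ (j + 1)) * (E - z * q)) =
      nodeF q (D * q) E (z * q) j * ((1 - D) * (1 - z) * E) := by
  have h1 : E - z * q ≠ 0 := by simpa using h 0 1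
  induction j with
  | zero =>
    have h2 : (1 : ℂ) - q ≠ 0 := by simpa using qpow_ne_one hq0 hq1 0
    simp only [nodeF, zero_add, Finset.prod_range_one, Finset.prod_range_zero, pow_one, pow_zero,
      mul_one]
    field_simp
  | succ j ih =>
    have h2 := qpow_ne_one hq0 hq1 j
    have h3 := qpow_ne_one hq0 hq1 (j + 1)
    have h4 : E - z * (q : ℂ) ^ (j + 1 + 1) ≠ 0 := by simpa using h 0 (j + 2)
    rw [nodeF_succ, nodeF_succ (D := D * q),
      show z * (q : ℂ) * (q : ℂ) ^ (j + 1) = z * (q : ℂ) ^ (j + 1 + 1) by ring,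
      show D * (q : ℂ) * (q : ℂ) ^ j = D * (q : ℂ) ^ (j + 1) by ring,
      show z * (q : ℂ) * (q : ℂ) ^ j = z * (q : ℂ) ^ (j + 1) by ring, mul_div_assoc', div_mul_eq_mul_div,
      mul_div_assoc', div_mul_eq_mul_div, div_eq_div_iff (mul_ne_zero h3 h4) (mul_ne_zero h2 h4)]
    linear_combination ((1 - D * (q : ℂ) ^ (j + 1)) * (E * (1 - z * (q : ℂ) ^ (j + 1))) *
      (1 - (q : ℂ) ^ (j + 1 + 1)) * (E - z * (q : ℂ) ^ (j + 1 + 1))) * ih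

theorem nodeG_shift (hq0 : 0 < q) (hq1 : q < 1) (D : ℂ) {E z : ℂ} (h : NodeGeneric q E z) (i : ℕ) :
    nodeG q D E z i * (E * (q : ℂ) ^ i - z) = nodeG q (D * q) E (z * q) i * (E - z) := by
  induction i with
  | zero => simp [nodeG]
  | succ i ih =>
    have hqc : (q : ℂ) ≠ 0 := ofReal_ne_zero_of_pos hq0
    have h2 := qpow_ne_one hq0 hq1 i
    have h3 : E * (q : ℂ) ^ (i + 1) - z ≠ 0 := by simpa using h (i + 1) 0
    have h4 : E * (q : ℂ) ^ i - z ≠ 0 := by simpa using h i 0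
    have e1 : D * q * E * (q : ℂ) ^ i - z * q = (D * E * (q : ℂ) ^ i - z) * q := by ring
    have e2 : E * (q : ℂ) ^ (i + 1) - z * q = (E * (q : ℂ) ^ i - z) * q := by ring
    rw [nodeG_succ, nodeG_succ (D := D * q), e1, e2, mul_div_assoc', div_mul_eq_mul_div,
      mul_div_assoc', div_mul_eq_mul_div, div_eq_div_iff (mul_ne_zero h2 h3)
        (mul_ne_zero h2 (mul_ne_zero h4 hqc))]
    linear_combination ((1 - E * (q : ℂ) ^ i) * (D * E * (q : ℂ) ^ i - z) *
      (1 - (q : ℂ) ^ (i + 1)) * (E * (q : ℂ) ^ (i + 1) - z) * q) * ih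

theorem nodeF_shift' (hq0 : 0 < q) (hq1 : q < 1) (D : ℂ) {E z : ℂ} (h : NodeGeneric q E z) (j : ℕ) :
    nodeF q D E z j * (E - z * (q : ℂ) ^ j) = nodeF q D (E * q) z j * (E - z) := by
  induction j with
  | zero => simp [nodeF]
  | succ j ih =>
    have hqc : (q : ℂ) ≠ 0 := ofReal_ne_zero_of_pos hq0
    have h2 := qpow_ne_one hq0 hq1 j
    have h3 : E - z * (q : ℂ) ^ (j + 1) ≠ 0 := by simpa using h 0 (j + 1)
    have h4 : E - z * (q : ℂ) ^ j ≠ 0 := by simpa using h 0 j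
    have e2 : E * q - z * (q : ℂ) ^ (j + 1) = (E - z * (q : ℂ) ^ j) * q := by ring
    rw [nodeF_succ, nodeF_succ (E := E * q), e2, mul_div_assoc', div_mul_eq_mul_div,
      mul_div_assoc', div_mul_eq_mul_div, div_eq_div_iff (mul_ne_zero h2 h3)
        (mul_ne_zero h2 (mul_ne_zero h4 hqc))]
    linear_combination ((1 - D * (q : ℂ) ^ j) * (E * (1 - z * (q : ℂ) ^ j)) *
      (1 - (q : ℂ) ^ (j + 1)) * (E - z * (q : ℂ) ^ (j + 1)) * q) * ih

theorem nodeG_shift' (hq0 : 0 < q) (hq1 : q < 1) (D : ℂ) {E z : ℂ} (h : NodeGeneric q E z) (i : ℕ) :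
    nodeG q D E z (i + 1) * ((1 - (q : ℂ) ^ (i + 1)) * (E * q - z)) =
      nodeG q D (E * q) z i * ((1 - E) * (D * E - z)) := by
  have h1 : E * q - z ≠ 0 := by simpa using h 1 0
  induction i with
  | zero =>
    have h2 : (1 : ℂ) - q ≠ 0 := by simpa using qpow_ne_one hq0 hq1 0
    simp only [nodeG, zero_add, Finset.prod_range_one, Finset.prod_range_zero, pow_one, pow_zero,
      mul_one]
    field_simp
  | succ i ih =>
    have h2 := qpow_ne_one hq0 hq1 i
    have h3 := qpow_ne_one hq0 hq1 (i + 1)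
    have h4 : E * (q : ℂ) ^ (i + 1 + 1) - z ≠ 0 := by simpa using h (i + 2) 0
    rw [nodeG_succ, nodeG_succ (E := E * q),
      show E * (q : ℂ) * (q : ℂ) ^ (i + 1) = E * (q : ℂ) ^ (i + 1 + 1) by ring,
      show E * (q : ℂ) * (q : ℂ) ^ i = E * (q : ℂ) ^ (i + 1) by ring,
      show D * (E * (q : ℂ)) * (q : ℂ) ^ i = D * E * (q : ℂ) ^ (i + 1) by ring, mul_div_assoc',
      div_mul_eq_mul_div,
      mul_div_assoc', div_mul_eq_mul_div, div_eq_div_iff (mul_ne_zero h3 h4) (mul_ne_zero h2 h4)]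
    linear_combination ((1 - E * (q : ℂ) ^ (i + 1)) * (D * E * (q : ℂ) ^ (i + 1) - z) *
      (1 - (q : ℂ) ^ (i + 1 + 1)) * (E * (q : ℂ) ^ (i + 1 + 1) - z)) * ih

theorem nodeW_shift (hq0 : 0 < q) (hq1 : q < 1) (D : ℂ) {E z : ℂ} (hE : E ≠ 0)
    (h : NodeGeneric q E z) {m j i : ℕ} (hm : j + i = m) :
    nodeW q D E z (j + 1) i * ((1 - ((q : ℂ) ^ (j + 1))⁻¹) * (1 - z * ((q : ℂ) ^ i)⁻¹ / E)) =
      -((q : ℂ) ^ (m + 1))⁻¹ * ((1 - D) * (1 - z) * (E - z)) / (E - z * q) *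
        nodeW q (D * q) E (z * q) j i := by
  have hqc : (q : ℂ) ≠ 0 := ofReal_ne_zero_of_pos hq0
  have h1 := nodeF_shift hq0 hq1 D h j
  have h2 := nodeG_shift hq0 hq1 D h i
  have h3 : E - z * q ≠ 0 := by simpa using h 0 1
  have hj : (q : ℂ) ^ (j + 1) ≠ 0 := pow_ne_zero _ hqc
  have hi : (q : ℂ) ^ i ≠ 0 := pow_ne_zero _ hqc
  have e1 : (q : ℂ) ^ (m + 1) = (q : ℂ) ^ (j + 1) * (q : ℂ) ^ i := by rw [← hm]; ring
  have e2 : z * (q : ℂ) * (q : ℂ) ^ j = z * (q : ℂ) ^ (j + 1) := by ring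
  unfold nodeW
  rw [e1, e2]
  generalize (q : ℂ) ^ (j + 1) = a at *
  generalize (q : ℂ) ^ i = b at *
  generalize nodeF q D E z (j + 1) = f at *
  generalize nodeF q (D * q) E (z * q) j = f' at *
  generalize nodeG q D E z i = g at *
  generalize nodeG q (D * q) E (z * q) i = g' at *
  have e3 : (1 - a⁻¹) * (1 - z * b⁻¹ / E) = -((1 - a) * (E * b - z)) / (a * b * E) := by
    field_simp; ring
  rw [e3, mul_div_assoc', div_mul_eq_mul_div, div_eq_div_iff
    (mul_ne_zero (mul_ne_zero hj hi) hE) h3]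
  have e4 : (a * b)⁻¹ * (a * b) = 1 := inv_mul_cancel₀ (mul_ne_zero hj hi)
  linear_combination (-(E * b - z * a) * g * (E * b - z)) * h1 - ((E * b - z * a) * f' *
    ((1 - D) * (1 - z) * E)) * h2 + ((1 - D) * (1 - z) * (E - z) * f' * g' * (E * b - z * a) * E) * e4

theorem nodeW_shift' (hq0 : 0 < q) (hq1 : q < 1) (D : ℂ) {E z : ℂ} (hz : z ≠ 0)
    (h : NodeGeneric q E z) {m j i : ℕ} (hm : j + i = m) :
    nodeW q D E z j (i + 1) * ((1 - ((q : ℂ) ^ (i + 1))⁻¹) * (1 - E * ((q : ℂ) ^ j)⁻¹ / z)) =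
      ((q : ℂ) ^ (m + 1))⁻¹ * ((1 - E) * (D * E - z) * (E - z)) / (z * (E * q - z)) *
        nodeW q D (E * q) z j i := by
  have hqc : (q : ℂ) ≠ 0 := ofReal_ne_zero_of_pos hq0
  have h1 := nodeF_shift' hq0 hq1 D h j
  have h2 := nodeG_shift' hq0 hq1 D h i
  have h3 : E * q - z ≠ 0 := by simpa using h 1 0
  have hj : (q : ℂ) ^ j ≠ 0 := pow_ne_zero _ hqc
  have hi : (q : ℂ) ^ (i + 1) ≠ 0 := pow_ne_zero _ hqc
  have e1 : (q : ℂ) ^ (m + 1) = (q : ℂ) ^ j * (q : ℂ) ^ (i + 1) := by rw [← hm]; ring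
  have e2 : E * (q : ℂ) * (q : ℂ) ^ i = E * (q : ℂ) ^ (i + 1) := by ring
  unfold nodeW
  rw [e1, e2]
  generalize (q : ℂ) ^ j = a at *
  generalize (q : ℂ) ^ (i + 1) = b at *
  generalize nodeF q D E z j = f at *
  generalize nodeF q D (E * q) z j = f' at *
  generalize nodeG q D E z (i + 1) = g at *
  generalize nodeG q D (E * q) z i = g' at *
  have e3 : (1 - b⁻¹) * (1 - E * a⁻¹ / z) = ((1 - b) * (E - z * a)) / (a * b * z) := by
    field_simp; ring
  rw [e3, mul_div_assoc', div_mul_eq_mul_div, div_eq_div_iff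
    (mul_ne_zero (mul_ne_zero hj hi) hz) (mul_ne_zero hz h3)]
  have e4 : (a * b)⁻¹ * (a * b) = 1 := inv_mul_cancel₀ (mul_ne_zero hj hi)
  linear_combination (z * f * (E * b - z * a) * (E - z * a)) * h2 + (z * (E * b - z * a) * g' *
    ((1 - E) * (D * E - z))) * h1 - ((1 - E) * (D * E - z) * (E - z) * f' * g' *
    (E * b - z * a) * z) * e4

/-- The summation formula behind the discrete form of `M`. The proof is by induction on `m`: a factor
which vanishes at `p.1 = 0` shifts the sum to the one for `m - 1` and `(Dq, E, zq)`, which settles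
the case of positive `n`; for `n = 0` such a factor is produced from the sum by writing it as a
combination of one which vanishes at `p.1 = 0` and one which vanishes at `p.2 = 0`. -/
theorem sum_nodeW (hq0 : 0 < q) (hq1 : q < 1) (m : ℕ) : ∀ (n : ℕ) {D E z : ℂ}, E ≠ 0 → z ≠ 0 →
    NodeGeneric q E z → (∀ k : ℕ, D * E * (q : ℂ) ^ k ≠ 1) →
    ∑ p ∈ Finset.HasAntidiagonal.antidiagonal m, nodeW q D E z p.1 p.2 *
        (qPoch q ((q : ℂ) ^ p.1)⁻¹ n * qPoch q (z * ((q : ℂ) ^ p.2)⁻¹ / E) n) =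
      (E - z) * (qPoch q (D * E) m / qPoch q q m) *
        (qPoch q D n / qPoch q (D * E) n * (qPoch q ((q : ℂ) ^ m)⁻¹ n * qPoch q z n)) := by
  have hqc : (q : ℂ) ≠ 0 := ofReal_ne_zero_of_pos hq0
  induction m with
  | zero =>
    intro n D E z hE hz h hDE
    cases n with
    | zero => simp [nodeW, nodeF, nodeG, qPoch_zero]
    | succ n => simp [qPoch_succ']
  | succ m ih =>
    have hM : (q : ℂ) ^ (m + 1) ≠ 0 := pow_ne_zero _ hqc
    have hM1 := qpow_ne_one hq0 hq1 m
    have hqm := qPoch_self_ne_zero hq0 hq1 m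
    -- the sums with a factor vanishing at `p.1 = 0`, which are shifted sums for `m`
    have hX : ∀ (n : ℕ) {D E z : ℂ}, E ≠ 0 → z ≠ 0 → NodeGeneric q E z →
        (∀ k : ℕ, D * E * (q : ℂ) ^ k ≠ 1) →
        ∑ p ∈ Finset.HasAntidiagonal.antidiagonal (m + 1), nodeW q D E z p.1 p.2 *
          (qPoch q ((q : ℂ) ^ p.1)⁻¹ (n + 1) * qPoch q (z * ((q : ℂ) ^ p.2)⁻¹ / E) (n + 1)) =
        -((q : ℂ) ^ (m + 1))⁻¹ * ((1 - D) * (1 - z) * (E - z)) *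
          ((qPoch q (D * E * q) m / qPoch q q m) *
          (qPoch q (D * q) n / qPoch q (D * E * q) n *
            (qPoch q ((q : ℂ) ^ m)⁻¹ n * qPoch q (z * q) n))) := by
      intro n D E z hE hz h hDE
      have h3 : E - z * q ≠ 0 := by simpa using h 0 1
      have hih := ih n (D := D * q) hE (mul_ne_zero hz hqc) h.shift_right (fun k => by
        have := hDE (k + 1)
        rwa [pow_succ', ← mul_assoc, mul_right_comm D E] at this)
      rw [Finset.Nat.sum_antidiagonal_succ]
      simp only [pow_zero, inv_one, qPoch_succ' q 1, sub_self, zero_mul, mul_zero, zero_add]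
      have e : ∀ p ∈ Finset.HasAntidiagonal.antidiagonal m, nodeW q D E z (p.1 + 1) p.2 *
          (qPoch q ((q : ℂ) ^ (p.1 + 1))⁻¹ (n + 1) *
            qPoch q (z * ((q : ℂ) ^ p.2)⁻¹ / E) (n + 1)) =
          -((q : ℂ) ^ (m + 1))⁻¹ * ((1 - D) * (1 - z) * (E - z)) / (E - z * q) *
          (nodeW q (D * q) E (z * q) p.1 p.2 *
          (qPoch q ((q : ℂ) ^ p.1)⁻¹ n * qPoch q (z * q * ((q : ℂ) ^ p.2)⁻¹ / E) n)) := by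
        intro p hp
        have h1 := nodeW_shift hq0 hq1 D hE h (Finset.HasAntidiagonal.mem_antidiagonal.1 hp)
        have e1 : ((q : ℂ) ^ (p.1 + 1))⁻¹ * q = ((q : ℂ) ^ p.1)⁻¹ := by
          rw [pow_succ, mul_inv, mul_assoc, inv_mul_cancel₀ hqc, mul_one]
        rw [qPoch_succ', qPoch_succ', e1,
          show z * ((q : ℂ) ^ p.2)⁻¹ / E * q = z * q * ((q : ℂ) ^ p.2)⁻¹ / E by ring]
        linear_combination (qPoch q ((q : ℂ) ^ p.1)⁻¹ n *
          qPoch q (z * q * ((q : ℂ) ^ p.2)⁻¹ / E) n) * h1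
      rw [Finset.sum_congr rfl e, ← Finset.mul_sum, hih, mul_right_comm D (q : ℂ) E]
      field_simp
    intro n D E z hE hz h hDE
    have hDE' : ∀ k : ℕ, D * (E * q) * (q : ℂ) ^ k ≠ 1 := fun k => by
      have := hDE (k + 1)
      rwa [pow_succ', ← mul_assoc, mul_assoc D E] at this
    have hEz : E - z ≠ 0 := by simpa using h 0 0
    have hDE0 : 1 - D * E ≠ 0 := sub_ne_zero.2 fun h0 => hDE 0 (by rw [pow_zero, mul_one, ← h0])
    cases n with
    | succ n =>
      rw [hX n hE hz h hDE, qPoch_succ' q (D * E), qPoch_succ' q (D * E), qPoch_succ' q D,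
        qPoch_succ' q _ n, qPoch_succ' q z, qPoch_succ q q m]
      have e1 : ((q : ℂ) ^ (m + 1))⁻¹ * q = ((q : ℂ) ^ m)⁻¹ := by
        rw [pow_succ, mul_inv, mul_assoc, inv_mul_cancel₀ hqc, mul_one]
      have hn : qPoch q (D * E * q) n ≠ 0 := by
        refine qPoch_ne_zero (fun k => ?_) n
        simpa [mul_assoc] using hDE' k
      rw [e1, ← pow_succ']
      field_simp
      ring
    | zero =>
      have hX0 := hX 0 hE hz h hDE
      -- the sum with a factor vanishing at `p.2 = 0` shifts to the one for `m` and `(D, Eq, z)`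
      have hY : ∑ p ∈ Finset.HasAntidiagonal.antidiagonal (m + 1), nodeW q D E z p.1 p.2 *
          ((1 - ((q : ℂ) ^ p.2)⁻¹) * (1 - E * ((q : ℂ) ^ p.1)⁻¹ / z)) =
          ((q : ℂ) ^ (m + 1))⁻¹ * ((1 - E) * (D * E - z) * (E - z)) / z *
            (qPoch q (D * E * q) m / qPoch q q m) := by
        have h3 : E * q - z ≠ 0 := by simpa using h 1 0
        have hih := ih 0 (D := D) (mul_ne_zero hE hqc) hz h.shift_left hDE'
        rw [Finset.Nat.sum_antidiagonal_succ']
        simp only [pow_zero, inv_one, sub_self, zero_mul, mul_zero, zero_add]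
        rw [Finset.sum_congr rfl fun p hp =>
          nodeW_shift' hq0 hq1 D hz h (Finset.HasAntidiagonal.mem_antidiagonal.1 hp), ← Finset.mul_sum]
        simp only [qPoch_zero, mul_one, div_one] at hih
        rw [hih, ← mul_assoc D E]
        field_simp
      -- from `E(1 - a⁻¹)(1 - zb⁻¹/E) - z(1 - b⁻¹)(1 - Ea⁻¹/z) = (E - z)(1 - (ab)⁻¹)` with
      -- `a = q^{p.1}`, `b = q^{p.2}`
      have key : (E - z) * (1 - ((q : ℂ) ^ (m + 1))⁻¹) *
          ∑ p ∈ Finset.HasAntidiagonal.antidiagonal (m + 1), nodeW q D E z p.1 p.2 =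
          E * ∑ p ∈ Finset.HasAntidiagonal.antidiagonal (m + 1), nodeW q D E z p.1 p.2 *
            (qPoch q ((q : ℂ) ^ p.1)⁻¹ (0 + 1) * qPoch q (z * ((q : ℂ) ^ p.2)⁻¹ / E) (0 + 1)) -
          z * ∑ p ∈ Finset.HasAntidiagonal.antidiagonal (m + 1), nodeW q D E z p.1 p.2 *
            ((1 - ((q : ℂ) ^ p.2)⁻¹) * (1 - E * ((q : ℂ) ^ p.1)⁻¹ / z)) := by
        rw [Finset.mul_sum, Finset.mul_sum, Finset.mul_sum, ← Finset.sum_sub_distrib]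
        refine Finset.sum_congr rfl fun p hp => ?_
        rw [← Finset.HasAntidiagonal.mem_antidiagonal.1 hp, pow_add]
        simp only [zero_add, qPoch_succ', qPoch_zero, mul_one]
        have ha : (q : ℂ) ^ p.1 ≠ 0 := pow_ne_zero _ hqc
        have hb : (q : ℂ) ^ p.2 ≠ 0 := pow_ne_zero _ hqc
        field_simp
        ring
      rw [hX0, hY] at key
      simp only [qPoch_zero, mul_one, div_one] at key ⊢
      rw [qPoch_succ' q (D * E), qPoch_succ q q m, ← pow_succ']
      have hM2 : 1 - ((q : ℂ) ^ (m + 1))⁻¹ ≠ 0 := by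
        intro h0
        apply hM1
        field_simp at h0
        linear_combination -h0
      refine mul_left_cancel₀ (mul_ne_zero hEz hM2) (key.trans ?_)
      field_simp
      ring

/-! ### The discrete form of `M` -/

/-- `ℓ⁻¹` as a complex number. -/
def ellInv (q g : ℝ) : ℂ := (ell q g : ℂ)⁻¹

theorem ellInv_eq (q g : ℝ) : ellInv q g = ellPow q g (-1) := by
  have h := ellPow_intCast (q := q) g (-1)
  rw [zpow_neg_one] at h
  rw [ellInv, ← h]
  norm_num

theorem ell_eq_inv (q g : ℝ) : (ell q g : ℂ) = (ellInv q g)⁻¹ := by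
  rw [ellInv, inv_inv]

theorem ellPow_neg_natCast (q g : ℝ) (n : ℕ) : ellPow q g (-n) = ellInv q g ^ n := by
  have h := ellPow_intCast (q := q) g (-n)
  rw [zpow_neg, zpow_natCast, ← inv_pow] at h
  rw [ellInv, ← h]
  norm_num

theorem ellInv_ne_zero (hq0 : 0 < q) (g : ℝ) : ellInv q g ≠ 0 := by
  rw [ellInv_eq]; exact ellPow_ne_zero hq0 _ _

theorem norm_ellInv_lt_one (hq0 : 0 < q) (hq1 : q < 1) {g : ℝ} (hg : 0 < g) :
    ‖ellInv q g‖ < 1 := by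
  rw [ellInv_eq, ellPow_eq_cpow hq0]
  simpa using norm_cpow_lt_one hq0 hq1 hg

theorem ellInv_pow_mul_pow_ne_one (hq0 : 0 < q) (hq1 : q < 1) {g : ℝ} (hg : 0 < g) (k n : ℕ) :
    ellInv q g ^ (k + 1) * (q : ℂ) ^ n ≠ 1 := by
  refine mul_pow_ne_one_of_norm_lt hq0 hq1 ?_ n
  rw [norm_pow]
  exact pow_lt_one₀ (norm_nonneg _) (norm_ellInv_lt_one hq0 hq1 hg) (by omega)

/-- The values of `M F` at `y₁ = q^{-m}` in terms of the values of `F` at finitely many points, the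
nodes. By linearity it suffices to check this on the basis elements, where it is `sum_nodeW`. -/
theorem symM_discrete (hq0 : 0 < q) (hq1 : q < 1) {g : ℝ} (hg : 0 < g) {e : ℂ}
    (he : e = ellInv q g) (F : Sym12) (m : ℕ) {x z : ℂ} (hx : x ≠ 0) (hz : z ≠ 0)
    (hgen : NodeGeneric q e z) :
    (e - z) * (qPoch q (e ^ 3) m / qPoch q q m) *
        ev3 (symM hq0 hq1 hg F) ((q : ℂ) ^ m)⁻¹ z x =
      ∑ p ∈ Finset.HasAntidiagonal.antidiagonal m, nodeW q (e ^ 2) e z p.1 p.2 *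
        ev3 F (x / (e * (q : ℂ) ^ p.1)) (z * x / (e ^ 2 * (q : ℂ) ^ p.2)) x := by
  have hqc : (q : ℂ) ≠ 0 := ofReal_ne_zero_of_pos hq0
  have he0 : e ≠ 0 := he ▸ ellInv_ne_zero hq0 g
  have hqn : ∀ n : ℕ, (q : ℂ) ^ n ≠ 0 := fun n => pow_ne_zero n hqc
  have h1 : ∀ n : ℕ, x / (e * (q : ℂ) ^ n) ≠ 0 := fun n => div_ne_zero hx (mul_ne_zero he0 (hqn n))
  have h2 : ∀ n : ℕ, z * x / (e ^ 2 * (q : ℂ) ^ n) ≠ 0 := fun n =>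
    div_ne_zero (mul_ne_zero hz hx) (mul_ne_zero (pow_ne_zero 2 he0) (hqn n))
  have hu := inv_ne_zero (hqn m)
  let W : Submodule ℂ Sym12 :=
    { carrier := {F | (e - z) * (qPoch q (e ^ 3) m / qPoch q q m) *
        ev3 (symM hq0 hq1 hg F) ((q : ℂ) ^ m)⁻¹ z x =
      ∑ p ∈ Finset.HasAntidiagonal.antidiagonal m, nodeW q (e ^ 2) e z p.1 p.2 *
        ev3 F (x / (e * (q : ℂ) ^ p.1)) (z * x / (e ^ 2 * (q : ℂ) ^ p.2)) x}
      add_mem' := by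
        intro F G hF hG
        simp only [Set.mem_ofPred_eq, map_add, Submodule.coe_add] at hF hG ⊢
        simp only [ev3_add _ _ hu hz hx, ev3_add _ _ (h1 _) (h2 _) hx, mul_add,
          Finset.sum_add_distrib, hF, hG]
      zero_mem' := by simp [ev3_zero]
      smul_mem' := by
        intro c F hF
        simp only [Set.mem_ofPred_eq, map_smul, Submodule.coe_smul] at hF ⊢
        simp only [ev3_smul _ _ hu hz hx, ev3_smul _ _ (h1 _) (h2 _) hx, mul_left_comm _ c,
          ← Finset.mul_sum, hF] }
  have hW : W = ⊤ := by
    refine Sym12_induction hq0 (ellPow_ne_zero hq0 g (-1)) (-1) W fun k n j => ?_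
    change _ = _
    rw [symM_eq_of_mem_relM hq0 hq1 hg (symBasis_mem_relM hq0 g k n j), Submodule.coe_smul,
      ev3_smul _ _ hu hz hx, ev3_symBasis _ _ _ _ _ _ hu hz hx]
    have hsum := sum_nodeW hq0 hq1 m n (D := e ^ 2) he0 hz hgen (fun k => by
      rw [← pow_succ, he]; exact ellInv_pow_mul_pow_ne_one hq0 hq1 hg 2 k)
    rw [← pow_succ] at hsum
    have e2 : ellPow q g (-2) = e ^ 2 := by
      have := ellPow_neg_natCast q g 2
      rw [he, ← this]; norm_num
    have e3 : ellPow q g (-3) = e ^ 3 := by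
      have := ellPow_neg_natCast q g 3
      rw [he, ← this]; norm_num
    have e3' : ellPow q g 3 = (e ^ 3)⁻¹ := by
      rw [← e3]
      refine eq_inv_of_mul_eq_one_left ?_
      rw [← ellPow_add hq0, add_neg_cancel, ellPow_zero]
    have hterm : ∀ p ∈ Finset.HasAntidiagonal.antidiagonal m, nodeW q (e ^ 2) e z p.1 p.2 *
        ev3 (symBasis q (ellPow q g (-1)) (-1) k n j) (x / (e * (q : ℂ) ^ p.1))
          (z * x / (e ^ 2 * (q : ℂ) ^ p.2)) x =
        ((e ^ 3 * (q : ℂ) ^ m)⁻¹ * z * x ^ 2) ^ k * x ^ j * (nodeW q (e ^ 2) e z p.1 p.2 *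
          (qPoch q ((q : ℂ) ^ p.1)⁻¹ n * qPoch q (z * ((q : ℂ) ^ p.2)⁻¹ / e) n)) := by
      intro p hp
      rw [ev3_symBasis _ _ _ _ _ _ (h1 _) (h2 _) hx, ← ellInv_eq, ← he,
        ← Finset.HasAntidiagonal.mem_antidiagonal.1 hp]
      have := hqn p.1
      have := hqn p.2
      have i1 : e * (x / (e * (q : ℂ) ^ p.1) * x ^ (-1 : ℤ)) = ((q : ℂ) ^ p.1)⁻¹ := by
        rw [zpow_neg_one]; field_simp
      have i2 : e * (z * x / (e ^ 2 * (q : ℂ) ^ p.2) * x ^ (-1 : ℤ)) =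
          z * ((q : ℂ) ^ p.2)⁻¹ / e := by
        rw [zpow_neg_one]; field_simp
      have i3 : x / (e * (q : ℂ) ^ p.1) * (z * x / (e ^ 2 * (q : ℂ) ^ p.2)) =
          (e ^ 3 * (q : ℂ) ^ (p.1 + p.2))⁻¹ * z * x ^ 2 := by
        rw [pow_add]; field_simp
      rw [i1, i2, i3]
      ring
    change _ = ∑ p ∈ Finset.HasAntidiagonal.antidiagonal m, nodeW q (e ^ 2) e z p.1 p.2 *
        ev3 (symBasis q (ellPow q g (-1)) (-1) k n j) (x / (e * (q : ℂ) ^ p.1))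
          (z * x / (e ^ 2 * (q : ℂ) ^ p.2)) x
    rw [Finset.sum_congr rfl hterm, ← Finset.mul_sum, hsum, e2, e3, e3', zpow_zero, mul_one, one_mul,
      mul_one, one_mul, zpow_add₀ hx, zpow_mul, mul_zpow (_ * z), mul_inv, mul_zpow (_ * _), mul_zpow,
      mul_zpow]
    norm_num
    ring
  have h3 : F ∈ W := hW ▸ Submodule.mem_top
  exact h3

/-! ### The recurrence for the values at `q^{-m}` -/

theorem hamiltonian_one_apply (q g : ℝ) (f : ℂ → ℂ → ℂ → ℂ) (t : Fin 3 → ℂ) :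
    hamiltonian q g 1 (fun u => f (u 0) (u 1) (u 2)) t =
      vCoef q g t 0 1 * vCoef q g t 0 2 * f (q * t 0) (t 1) (t 2) +
      vCoef q g t 1 0 * vCoef q g t 1 2 * f (t 0) (q * t 1) (t 2) +
      vCoef q g t 2 0 * vCoef q g t 2 1 * f (t 0) (t 1) (q * t 2) := by
  have h : Finset.powersetCard 1 (Finset.univ : Finset (Fin 3)) = {{0}, {1}, {2}} := by decide
  have h0 : ({0} : Finset (Fin 3))ᶜ = {1, 2} := by decide
  have h1 : ({1} : Finset (Fin 3))ᶜ = {0, 2} := by decide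
  have h2 : ({2} : Finset (Fin 3))ᶜ = {0, 1} := by decide
  unfold hamiltonian
  rw [h, Finset.sum_insert (by decide), Finset.sum_insert (by decide), Finset.sum_singleton]
  simp [h0, h1, h2, add_assoc]

theorem hamiltonian_one (q g : ℝ) (P : Laurent3) (t : Fin 3 → ℂ) :
    hamiltonian q g 1 (fun u => ev3 P (u 0) (u 1) (u 2)) t =
      vCoef q g t 0 1 * vCoef q g t 0 2 * ev3 P (q * t 0) (t 1) (t 2) +
      vCoef q g t 1 0 * vCoef q g t 1 2 * ev3 P (t 0) (q * t 1) (t 2) +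
      vCoef q g t 2 0 * vCoef q g t 2 1 * ev3 P (t 0) (t 1) (q * t 2) :=
  hamiltonian_one_apply q g (ev3 P) t

theorem hamiltonian_two_apply (q g : ℝ) (f : ℂ → ℂ → ℂ → ℂ) (t : Fin 3 → ℂ) :
    hamiltonian q g 2 (fun u => f (u 0) (u 1) (u 2)) t =
      vCoef q g t 0 2 * vCoef q g t 1 2 * f (q * t 0) (q * t 1) (t 2) +
      vCoef q g t 0 1 * vCoef q g t 2 1 * f (q * t 0) (t 1) (q * t 2) +
      vCoef q g t 1 0 * vCoef q g t 2 0 * f (t 0) (q * t 1) (q * t 2) := by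
  have h : Finset.powersetCard 2 (Finset.univ : Finset (Fin 3)) = {{0, 1}, {0, 2}, {1, 2}} := by
    decide
  have h0 : ({0, 1} : Finset (Fin 3))ᶜ = {2} := by decide
  have h1 : ({0, 2} : Finset (Fin 3))ᶜ = {1} := by decide
  have h2 : ({1, 2} : Finset (Fin 3))ᶜ = {0} := by decide
  unfold hamiltonian
  rw [h, Finset.sum_insert (by decide), Finset.sum_insert (by decide), Finset.sum_singleton]
  simp [h0, h1, h2, add_assoc]

theorem hamiltonian_two (q g : ℝ) (P : Laurent3) (t : Fin 3 → ℂ) :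
    hamiltonian q g 2 (fun u => ev3 P (u 0) (u 1) (u 2)) t =
      vCoef q g t 0 2 * vCoef q g t 1 2 * ev3 P (q * t 0) (q * t 1) (t 2) +
      vCoef q g t 0 1 * vCoef q g t 2 1 * ev3 P (q * t 0) (t 1) (q * t 2) +
      vCoef q g t 1 0 * vCoef q g t 2 0 * ev3 P (t 0) (q * t 1) (q * t 2) :=
  hamiltonian_two_apply q g (ev3 P) t

theorem hamiltonian_three_apply (q g : ℝ) (f : ℂ → ℂ → ℂ → ℂ) (t : Fin 3 → ℂ) :
    hamiltonian q g 3 (fun u => f (u 0) (u 1) (u 2)) t =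
      f (q * t 0) (q * t 1) (q * t 2) := by
  have h : Finset.powersetCard 3 (Finset.univ : Finset (Fin 3)) = {Finset.univ} := by decide
  unfold hamiltonian
  rw [h, Finset.sum_singleton]
  simp

theorem hamiltonian_three (q g : ℝ) (P : Laurent3) (t : Fin 3 → ℂ) :
    hamiltonian q g 3 (fun u => ev3 P (u 0) (u 1) (u 2)) t =
      ev3 P (q * t 0) (q * t 1) (q * t 2) :=
  hamiltonian_three_apply q g (ev3 P) t

theorem vCoef_mul (hq0 : 0 < q) {g : ℝ} {e : ℂ} (he : e = ellInv q g) (t : Fin 3 → ℂ)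
    (i j k l : Fin 3) : vCoef q g t i j * vCoef q g t k l =
      e * ((t i - e⁻¹ * t j) * (t k - e⁻¹ * t l)) / ((t i - t j) * (t k - t l)) := by
  have h0 : e⁻¹ = ellPow q g 1 := by
    rw [he, ← ell_eq_inv]
    simp [ellPow]
  have h1 : ellPow q g (1 / 2) = ellPow q g (-(1 / 2)) * e⁻¹ := by
    rw [h0, ← ellPow_add hq0]; norm_num
  have h2 : ellPow q g (-(1 / 2)) * ellPow q g (-(1 / 2)) = e := by
    rw [he, ellInv_eq, ← ellPow_add hq0]; norm_num
  unfold vCoef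
  rw [h1, div_mul_div_comm, ← h2]
  congr 1
  ring

/-- The conditions on `y₂ = z` under which the nodes are in general position. -/
def NodeRegular (q : ℝ) (e z : ℂ) : Prop :=
  z ≠ 0 ∧ NodeGeneric q e z ∧ ∀ i : ℕ, z - e ^ 2 * (q : ℂ) ^ i ≠ 0

/-- The eigenvalue equations at the nodes `(x/(eq^j), zx/(e²q^i), x)`, where `e = ℓ⁻¹`. -/
theorem hamiltonian_node (hq0 : 0 < q) (hq1 : q < 1) {g : ℝ} (hg : 0 < g) {e : ℂ}
    (he : e = ellInv q g) {x z : ℂ} (hx : x ≠ 0) (hz : NodeRegular q e z) (P : Laurent3)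
    {h : ℕ → ℂ}
    (hP : ∀ i : ℕ, 1 ≤ i → i ≤ 3 → ∀ t : Fin 3 → ℂ, (∀ j, t j ≠ 0) → Function.Injective t →
      hamiltonian q g i (fun u => ev3 P (u 0) (u 1) (u 2)) t = h i * ev3 P (t 0) (t 1) (t 2))
    (j i : ℕ) {u v : ℂ} (hu : u = (q : ℂ) ^ j) (hv : v = (q : ℂ) ^ i) :
    (h 1 * ev3 P (x / (e * u)) (z * x / (e ^ 2 * v)) x =
      (e ^ 2 * v - z * u) * (1 - u) / ((e * v - z * u) * (1 - e * u)) *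
        ev3 P (q * (x / (e * u))) (z * x / (e ^ 2 * v)) x +
      e * (z * u - v) * (z - e * v) / ((z * u - e * v) * (z - e ^ 2 * v)) *
        ev3 P (x / (e * u)) (q * (z * x / (e ^ 2 * v))) x +
      (e ^ 2 * u - 1) * (e ^ 3 * v - z) / (e * (e * u - 1) * (e ^ 2 * v - z)) *
        ev3 P (x / (e * u)) (z * x / (e ^ 2 * v)) (q * x)) ∧
    (h 2 * ev3 P (x / (e * u)) (z * x / (e ^ 2 * v)) x =
      e * (1 - u) * (z - e * v) / ((1 - e * u) * (z - e ^ 2 * v)) *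
        ev3 P (q * (x / (e * u))) (q * (z * x / (e ^ 2 * v))) x +
      (e ^ 2 * v - z * u) * (e ^ 3 * v - z) / (e * (e * v - z * u) * (e ^ 2 * v - z)) *
        ev3 P (q * (x / (e * u))) (z * x / (e ^ 2 * v)) (q * x) +
      (z * u - v) * (e ^ 2 * u - 1) / ((z * u - e * v) * (e * u - 1)) *
        ev3 P (x / (e * u)) (q * (z * x / (e ^ 2 * v))) (q * x)) ∧
    h 3 * ev3 P (x / (e * u)) (z * x / (e ^ 2 * v)) x =
      ev3 P (q * (x / (e * u))) (q * (z * x / (e ^ 2 * v))) (q * x) := by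
  have hqc : (q : ℂ) ≠ 0 := ofReal_ne_zero_of_pos hq0
  have he0 : e ≠ 0 := he ▸ ellInv_ne_zero hq0 g
  have hz0 := hz.1
  have hu0 : u ≠ 0 := hu ▸ pow_ne_zero j hqc
  have hv0 : v ≠ 0 := hv ▸ pow_ne_zero i hqc
  have d1 : e * v - z * u ≠ 0 := by rw [hu, hv]; exact hz.2.1 i j
  have d2 : 1 - e * u ≠ 0 := sub_ne_zero.2 fun h0 => by
    have := ellInv_pow_mul_pow_ne_one hq0 hq1 hg 0 j
    rw [zero_add, pow_one, ← he, ← hu] at this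
    exact this h0.symm
  have d3 : z - e ^ 2 * v ≠ 0 := by rw [hv]; exact hz.2.2 i
  have d1' : z * u - e * v ≠ 0 := fun h0 => d1 (by linear_combination -h0)
  have d2' : e * u - 1 ≠ 0 := fun h0 => d2 (by linear_combination -h0)
  have d3' : e ^ 2 * v - z ≠ 0 := fun h0 => d3 (by linear_combination -h0)
  have s01 : x / (e * u) - z * x / (e ^ 2 * v) = x * (e * v - z * u) / (e ^ 2 * u * v) := by
    field_simp
  have s02 : x / (e * u) - x = x * (1 - e * u) / (e * u) := by field_simp
  have s12 : z * x / (e ^ 2 * v) - x = x * (z - e ^ 2 * v) / (e ^ 2 * v) := by field_simp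
  have n01 : x / (e * u) - z * x / (e ^ 2 * v) ≠ 0 := by
    rw [s01]; exact div_ne_zero (mul_ne_zero hx d1) (by positivity)
  have n02 : x / (e * u) - x ≠ 0 := by
    rw [s02]; exact div_ne_zero (mul_ne_zero hx d2) (by positivity)
  have n12 : z * x / (e ^ 2 * v) - x ≠ 0 := by
    rw [s12]; exact div_ne_zero (mul_ne_zero hx d3) (by positivity)
  have ht0 : ∀ k, (![x / (e * u), z * x / (e ^ 2 * v), x] : Fin 3 → ℂ) k ≠ 0 := by
    intro k
    fin_cases k
    · exact div_ne_zero hx (mul_ne_zero he0 hu0)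
    · exact div_ne_zero (mul_ne_zero hz0 hx) (mul_ne_zero (pow_ne_zero 2 he0) hv0)
    · exact hx
  have hti : Function.Injective (![x / (e * u), z * x / (e ^ 2 * v), x] : Fin 3 → ℂ) := by
    intro k l hkl
    fin_cases k <;> fin_cases l <;> first
      | rfl
      | exact absurd (sub_eq_zero.2 hkl) n01
      | exact absurd (sub_eq_zero.2 hkl.symm) n01
      | exact absurd (sub_eq_zero.2 hkl) n02
      | exact absurd (sub_eq_zero.2 hkl.symm) n02
      | exact absurd (sub_eq_zero.2 hkl) n12
      | exact absurd (sub_eq_zero.2 hkl.symm) n12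
  have h1 := hP 1 le_rfl (by norm_num) _ ht0 hti
  have h2 := hP 2 (by norm_num) (by norm_num) _ ht0 hti
  have h3 := hP 3 (by norm_num) le_rfl _ ht0 hti
  rw [hamiltonian_one, vCoef_mul hq0 he, vCoef_mul hq0 he, vCoef_mul hq0 he] at h1
  rw [hamiltonian_two, vCoef_mul hq0 he, vCoef_mul hq0 he, vCoef_mul hq0 he] at h2
  rw [hamiltonian_three] at h3
  simp only [Matrix.cons_val] at h1 h2 h3
  have s10 : z * x / (e ^ 2 * v) - x / (e * u) = x * (z * u - e * v) / (e ^ 2 * u * v) := by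
    field_simp
  have s20 : x - x / (e * u) = x * (e * u - 1) / (e * u) := by field_simp
  have s21 : x - z * x / (e ^ 2 * v) = x * (e ^ 2 * v - z) / (e ^ 2 * v) := by field_simp
  have m01 : x / (e * u) - e⁻¹ * (z * x / (e ^ 2 * v)) =
      x * (e ^ 2 * v - z * u) / (e ^ 3 * u * v) := by field_simp
  have m02 : x / (e * u) - e⁻¹ * x = x * (1 - u) / (e * u) := by field_simp
  have m12 : z * x / (e ^ 2 * v) - e⁻¹ * x = x * (z - e * v) / (e ^ 2 * v) := by field_simp
  have m10 : z * x / (e ^ 2 * v) - e⁻¹ * (x / (e * u)) = x * (z * u - v) / (e ^ 2 * u * v) := by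
    field_simp
  have m20 : x - e⁻¹ * (x / (e * u)) = x * (e ^ 2 * u - 1) / (e ^ 2 * u) := by field_simp
  have m21 : x - e⁻¹ * (z * x / (e ^ 2 * v)) = x * (e ^ 3 * v - z) / (e ^ 3 * v) := by field_simp
  refine ⟨?_, ?_, h3.symm⟩
  · rw [← h1, s01, s02, s12, s10, s20, s21, m01, m02, m12, m10, m20, m21]
    congr 1
    · congr 1
      · congr 1; field_simp
      · congr 1; field_simp
    · congr 1; field_simp
  · rw [← h2, s01, s02, s12, s10, s20, s21, m01, m02, m12, m10, m20, m21]
    congr 1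
    · congr 1
      · congr 1; field_simp
      · congr 1; field_simp
    · congr 1; field_simp

/-! ### Cancellation in the eigenvalue equations at the nodes -/

/-- A function on `ℕ × ℕ` shifted by `(1,1)` and extended by zero. -/
def hat (f : ℕ → ℕ → ℂ) : ℕ → ℕ → ℂ
  | a + 1, b + 1 => f a b
  | _, _ => 0

theorem hat_succ_succ (f : ℕ → ℕ → ℂ) (a b : ℕ) : hat f (a + 1) (b + 1) = f a b := rfl

theorem hat_zero_left (f : ℕ → ℕ → ℂ) (b : ℕ) : hat f 0 b = 0 := by simp [hat]

theorem hat_zero_right (f : ℕ → ℕ → ℂ) (a : ℕ) : hat f a 0 = 0 := by simp [hat]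

theorem sum_hat_left (f : ℕ → ℕ → ℂ) (φ : ℕ → ℕ → ℂ) (N : ℕ) :
    ∑ p ∈ Finset.HasAntidiagonal.antidiagonal (N + 1), hat f p.1 p.2 * φ p.1 p.2 =
      ∑ p ∈ Finset.HasAntidiagonal.antidiagonal N, hat f (p.1 + 1) p.2 * φ (p.1 + 1) p.2 := by
  rw [Finset.Nat.sum_antidiagonal_succ, hat_zero_left, zero_mul, zero_add]

theorem sum_hat_right (f : ℕ → ℕ → ℂ) (φ : ℕ → ℕ → ℂ) (N : ℕ) :
    ∑ p ∈ Finset.HasAntidiagonal.antidiagonal (N + 1), hat f p.1 p.2 * φ p.1 p.2 =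
      ∑ p ∈ Finset.HasAntidiagonal.antidiagonal N, hat f p.1 (p.2 + 1) * φ p.1 (p.2 + 1) := by
  rw [Finset.Nat.sum_antidiagonal_succ', hat_zero_right, zero_mul, zero_add]

theorem sum_hat_both (f : ℕ → ℕ → ℂ) (φ : ℕ → ℕ → ℂ) (N : ℕ) :
    ∑ p ∈ Finset.HasAntidiagonal.antidiagonal (N + 2), hat f p.1 p.2 * φ p.1 p.2 =
      ∑ p ∈ Finset.HasAntidiagonal.antidiagonal N, f p.1 p.2 * φ (p.1 + 1) (p.2 + 1) := by
  rw [sum_hat_left, Finset.Nat.sum_antidiagonal_succ', hat_zero_right, zero_mul, zero_add]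
  rfl

/-- The coefficients of the recurrence, up to the eigenvalues. -/
def recW (q : ℝ) (e Q : ℂ) (k : ℕ) : ℂ :=
  (-(e ^ 2) / q) ^ k * (1 - (q : ℂ) ^ k * Q / e ^ k)

/-- The cancellation between the coefficients at the points with the third coordinate shifted. -/
theorem bracket_shifted (hq0 : 0 < q) (hq1 : q < 1) {g : ℝ} (hg : 0 < g) {e z : ℂ}
    (he : e = ellInv q g) (hz : NodeRegular q e z) (a b : ℕ) :
    recW q e ((q : ℂ) ^ (a + b))⁻¹ 0 * hat (nodeW q (e ^ 2) e z) (a + 1) (b + 1) +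
      recW q e ((q : ℂ) ^ (a + b))⁻¹ 1 *
        (hat (fun j i => nodeW q (e ^ 2) e z j i *
          ((e ^ 2 * (q : ℂ) ^ i - z * (q : ℂ) ^ j) * (e ^ 3 * (q : ℂ) ^ i - z) /
            (e * (e * (q : ℂ) ^ i - z * (q : ℂ) ^ j) * (e ^ 2 * (q : ℂ) ^ i - z)))) (a + 1) b +
        hat (fun j i => nodeW q (e ^ 2) e z j i *
          ((z * (q : ℂ) ^ j - (q : ℂ) ^ i) * (e ^ 2 * (q : ℂ) ^ j - 1) /
            ((z * (q : ℂ) ^ j - e * (q : ℂ) ^ i) * (e * (q : ℂ) ^ j - 1)))) a (b + 1)) +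
      recW q e ((q : ℂ) ^ (a + b))⁻¹ 2 *
        hat (fun j i => nodeW q (e ^ 2) e z j i *
          ((e ^ 2 * (q : ℂ) ^ j - 1) * (e ^ 3 * (q : ℂ) ^ i - z) /
            (e * (e * (q : ℂ) ^ j - 1) * (e ^ 2 * (q : ℂ) ^ i - z)))) a b = 0 := by
  have hqc : (q : ℂ) ≠ 0 := ofReal_ne_zero_of_pos hq0
  have he0 : e ≠ 0 := he ▸ ellInv_ne_zero hq0 g
  have d1 : ∀ i j : ℕ, e * (q : ℂ) ^ i - z * (q : ℂ) ^ j ≠ 0 := hz.2.1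
  have d1' : ∀ i j : ℕ, z * (q : ℂ) ^ j - e * (q : ℂ) ^ i ≠ 0 := fun i j h0 =>
    d1 i j (by linear_combination -h0)
  have d2 : ∀ j : ℕ, e * (q : ℂ) ^ j - 1 ≠ 0 := fun j => sub_ne_zero.2 <| by
    have := ellInv_pow_mul_pow_ne_one hq0 hq1 hg 0 j
    rwa [zero_add, pow_one, ← he] at this
  have d3 : ∀ i : ℕ, e ^ 2 * (q : ℂ) ^ i - z ≠ 0 := fun i h0 =>
    hz.2.2 i (by linear_combination -h0)
  have hqn := fun n => qpow_ne_one hq0 hq1 n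
  rcases a with _ | j <;> rcases b with _ | i
  · simp [hat_zero_left, hat_zero_right, recW]
  · simp only [hat_succ_succ, hat_zero_left, zero_add, mul_zero, add_zero]
    unfold nodeW recW
    rw [nodeG_succ]
    have f3 := d1 (i + 1) 0
    have f1 := d1 i 0
    have f7 := d3 i
    have f9 := hqn i
    have hi0 : (q : ℂ) ^ i ≠ 0 := pow_ne_zero _ hqc
    rw [pow_succ (q : ℂ) i] at f3 f9 ⊢
    simp only [pow_zero, mul_one] at f1 f3 ⊢
    generalize nodeF q (e ^ 2) e z 0 = F
    generalize nodeG q (e ^ 2) e z i = G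
    generalize (q : ℂ) ^ i = v at *
    clear he d1 d1' d2 d3 hqn
    generalize (q : ℂ) = p at *
    obtain ⟨a3, h3⟩ : ∃ w, w = e * (v * p) - z := ⟨_, rfl⟩
    obtain ⟨a1, h1⟩ : ∃ w, w = e * v - z := ⟨_, rfl⟩
    obtain ⟨a7, h7⟩ : ∃ w, w = e ^ 2 * v - z := ⟨_, rfl⟩
    obtain ⟨a9, h9⟩ : ∃ w, w = 1 - v * p := ⟨_, rfl⟩
    rw [← h3] at f3 ⊢
    rw [← h1] at f1 ⊢
    rw [← h7] at f7 ⊢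
    rw [← h9] at f9 ⊢
    field_simp
    rw [h9]
    ring
  · simp only [hat_succ_succ, hat_zero_right, mul_zero, zero_add, add_zero]
    unfold nodeW recW
    rw [nodeF_succ]
    have f3 := d1 0 (j + 1)
    have f1 := d1' 0 j
    have f7 := d2 j
    have f9 := hqn j
    have hi0 : (q : ℂ) ^ j ≠ 0 := pow_ne_zero _ hqc
    rw [pow_succ (q : ℂ) j] at f3 f9 ⊢
    simp only [pow_zero, mul_one] at f1 f3 ⊢
    generalize nodeF q (e ^ 2) e z j = F
    generalize nodeG q (e ^ 2) e z 0 = G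
    generalize (q : ℂ) ^ j = u at *
    clear he d1 d1' d2 d3 hqn
    generalize (q : ℂ) = p at *
    obtain ⟨a3, h3⟩ : ∃ w, w = e - z * (u * p) := ⟨_, rfl⟩
    obtain ⟨a1, h1⟩ : ∃ w, w = z * u - e := ⟨_, rfl⟩
    obtain ⟨a7, h7⟩ : ∃ w, w = e * u - 1 := ⟨_, rfl⟩
    obtain ⟨a9, h9⟩ : ∃ w, w = 1 - u * p := ⟨_, rfl⟩
    rw [← h3] at f3 ⊢
    rw [← h1] at f1 ⊢
    rw [← h7] at f7 ⊢
    rw [← h9] at f9 ⊢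
    field_simp
    rw [h9, h7, h1]
    ring
  · simp only [hat_succ_succ]
    unfold nodeW
    rw [nodeF_succ, nodeG_succ]
    have f1 := d1 i j
    have f2 := d1 i (j + 1)
    have f3 := d1 (i + 1) j
    have f4 := d1 0 (j + 1)
    have f5 := d1 (i + 1) 0
    have f1' := d1' i j
    have f2' := d1' i (j + 1)
    have f3' := d1' (i + 1) j
    have f6 := d2 j
    have f7 := d3 i
    have f8 := hqn j
    have f9 := hqn i
    unfold recW
    have hj0 : (q : ℂ) ^ j ≠ 0 := pow_ne_zero _ hqc
    have hi0 : (q : ℂ) ^ i ≠ 0 := pow_ne_zero _ hqc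
    have ee : (q : ℂ) ^ (j + 1 + (i + 1)) = (q : ℂ) ^ j * (q : ℂ) ^ i * q ^ 2 := by ring
    rw [ee]
    rw [pow_succ (q : ℂ) j] at f2 f4 f2' f8 ⊢
    rw [pow_succ (q : ℂ) i] at f3 f5 f3' f9 ⊢
    rw [pow_zero, mul_one] at f4 f5
    generalize nodeF q (e ^ 2) e z j = F
    generalize nodeG q (e ^ 2) e z i = G
    generalize (q : ℂ) ^ j = u at *
    generalize (q : ℂ) ^ i = v at *
    clear he d1 d1' d2 d3 hqn
    generalize (q : ℂ) = p at *
    obtain ⟨a2, h2⟩ : ∃ w, w = e * v - z * (u * p) := ⟨_, rfl⟩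
    obtain ⟨a3, h3⟩ : ∃ w, w = z * u - e * (v * p) := ⟨_, rfl⟩
    obtain ⟨a4, h4⟩ : ∃ w, w = e - z * (u * p) := ⟨_, rfl⟩
    obtain ⟨a5, h5⟩ : ∃ w, w = e * (v * p) - z := ⟨_, rfl⟩
    obtain ⟨a6, h6⟩ : ∃ w, w = e * u - 1 := ⟨_, rfl⟩
    obtain ⟨a7, h7⟩ : ∃ w, w = e ^ 2 * v - z := ⟨_, rfl⟩
    obtain ⟨a8, h8⟩ : ∃ w, w = 1 - u * p := ⟨_, rfl⟩
    obtain ⟨a9, h9⟩ : ∃ w, w = 1 - v * p := ⟨_, rfl⟩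
    rw [← h2] at f2 ⊢
    rw [← h3] at f3' ⊢
    rw [← h4] at f4 ⊢
    rw [← h5] at f5 ⊢
    rw [← h6] at f6 ⊢
    rw [← h7] at f7 ⊢
    rw [← h8] at f8 ⊢
    rw [← h9] at f9 ⊢
    field_simp
    rw [h3, h4, h5, h6, h7, h8, h9]
    ring

set_option maxRecDepth 4000 in
/-- The cancellation between the coefficients at the points with the third coordinate not
shifted. -/
theorem bracket_unshifted (hq0 : 0 < q) (hq1 : q < 1) {g : ℝ} (hg : 0 < g) {e z : ℂ}
    (he : e = ellInv q g) (hz : NodeRegular q e z) (a b : ℕ) :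
    recW q e ((q : ℂ) ^ (a + b + 1))⁻¹ 1 *
      hat (fun j i => nodeW q (e ^ 2) e z j i *
        (e * (1 - (q : ℂ) ^ j) * (z - e * (q : ℂ) ^ i) /
          ((1 - e * (q : ℂ) ^ j) * (z - e ^ 2 * (q : ℂ) ^ i)))) (a + 1) (b + 1) +
      recW q e ((q : ℂ) ^ (a + b + 1))⁻¹ 2 *
        (hat (fun j i => nodeW q (e ^ 2) e z j i *
          ((e ^ 2 * (q : ℂ) ^ i - z * (q : ℂ) ^ j) * (1 - (q : ℂ) ^ j) /
            ((e * (q : ℂ) ^ i - z * (q : ℂ) ^ j) * (1 - e * (q : ℂ) ^ j)))) (a + 1) b +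
        hat (fun j i => nodeW q (e ^ 2) e z j i *
          (e * (z * (q : ℂ) ^ j - (q : ℂ) ^ i) * (z - e * (q : ℂ) ^ i) /
            ((z * (q : ℂ) ^ j - e * (q : ℂ) ^ i) * (z - e ^ 2 * (q : ℂ) ^ i)))) a (b + 1)) +
      recW q e ((q : ℂ) ^ (a + b + 1))⁻¹ 3 * hat (nodeW q (e ^ 2) e z) a b = 0 := by
  have hqc : (q : ℂ) ≠ 0 := ofReal_ne_zero_of_pos hq0
  have he0 : e ≠ 0 := he ▸ ellInv_ne_zero hq0 g
  have d1 : ∀ i j : ℕ, e * (q : ℂ) ^ i - z * (q : ℂ) ^ j ≠ 0 := hz.2.1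
  have d1' : ∀ i j : ℕ, z * (q : ℂ) ^ j - e * (q : ℂ) ^ i ≠ 0 := fun i j h0 =>
    d1 i j (by linear_combination -h0)
  have d2 : ∀ j : ℕ, 1 - e * (q : ℂ) ^ j ≠ 0 := fun j => sub_ne_zero.2 <| by
    have := ellInv_pow_mul_pow_ne_one hq0 hq1 hg 0 j
    rw [zero_add, pow_one, ← he] at this
    exact this.symm
  have d3 : ∀ i : ℕ, z - e ^ 2 * (q : ℂ) ^ i ≠ 0 := hz.2.2
  have hqn := fun n => qpow_ne_one hq0 hq1 n
  rcases a with _ | j <;> rcases b with _ | i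
  · simp [hat_zero_left, hat_zero_right, hat_succ_succ]
  · simp [hat_succ_succ, hat_zero_left]
  · simp only [hat_succ_succ, hat_zero_right, mul_zero, zero_add, add_zero]
    unfold nodeW recW
    rw [nodeF_succ]
    have f4 := d1 0 (j + 1)
    have f1 := d1' 0 j
    have f6 := d2 (j + 1)
    have f7 := d3 0
    have f8 := hqn j
    have hj0 : (q : ℂ) ^ j ≠ 0 := pow_ne_zero _ hqc
    have ee : (q : ℂ) ^ (j + 1 + 1) = (q : ℂ) ^ j * q ^ 2 := by ring
    rw [ee]
    rw [pow_succ (q : ℂ) j] at f4 f6 f8 ⊢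
    simp only [pow_zero, mul_one] at f1 f4 f7 ⊢
    generalize nodeF q (e ^ 2) e z j = F
    generalize nodeG q (e ^ 2) e z 0 = G
    generalize (q : ℂ) ^ j = u at *
    clear he d1 d1' d2 d3 hqn
    generalize (q : ℂ) = p at *
    obtain ⟨a1, h1⟩ : ∃ w, w = z * u - e := ⟨_, rfl⟩
    obtain ⟨a4, h4⟩ : ∃ w, w = e - z * (u * p) := ⟨_, rfl⟩
    obtain ⟨a6, h6⟩ : ∃ w, w = 1 - e * (u * p) := ⟨_, rfl⟩
    obtain ⟨a7, h7⟩ : ∃ w, w = z - e ^ 2 := ⟨_, rfl⟩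
    obtain ⟨a8, h8⟩ : ∃ w, w = 1 - u * p := ⟨_, rfl⟩
    rw [← h1] at f1 ⊢
    rw [← h4] at f4 ⊢
    rw [← h6] at f6 ⊢
    rw [← h7] at f7 ⊢
    rw [← h8] at f8 ⊢
    field_simp
    rw [h1, h6]
    ring
  · simp only [hat_succ_succ]
    unfold nodeW
    rw [nodeF_succ, nodeG_succ]
    have f1 := d1 i j
    have f2 := d1 i (j + 1)
    have f4 := d1 0 (j + 1)
    have f5 := d1 (i + 1) 0
    have f3 := d1' (i + 1) j
    have f6 := d2 (j + 1)
    have f7 := d3 (i + 1)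
    have f8 := hqn j
    have f9 := hqn i
    unfold recW
    have hj0 : (q : ℂ) ^ j ≠ 0 := pow_ne_zero _ hqc
    have hi0 : (q : ℂ) ^ i ≠ 0 := pow_ne_zero _ hqc
    have ee : (q : ℂ) ^ (j + 1 + (i + 1) + 1) = (q : ℂ) ^ j * (q : ℂ) ^ i * q ^ 3 := by ring
    rw [ee]
    rw [pow_succ (q : ℂ) j] at f2 f4 f6 f8 ⊢
    rw [pow_succ (q : ℂ) i] at f3 f5 f7 f9 ⊢
    rw [pow_zero, mul_one] at f4 f5
    generalize nodeF q (e ^ 2) e z j = F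
    generalize nodeG q (e ^ 2) e z i = G
    generalize (q : ℂ) ^ j = u at *
    generalize (q : ℂ) ^ i = v at *
    clear he d1 d1' d2 d3 hqn
    generalize (q : ℂ) = p at *
    obtain ⟨a2, h2⟩ : ∃ w, w = e * v - z * (u * p) := ⟨_, rfl⟩
    obtain ⟨a3, h3⟩ : ∃ w, w = z * u - e * (v * p) := ⟨_, rfl⟩
    obtain ⟨a4, h4⟩ : ∃ w, w = e - z * (u * p) := ⟨_, rfl⟩
    obtain ⟨a5, h5⟩ : ∃ w, w = e * (v * p) - z := ⟨_, rfl⟩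
    obtain ⟨a6, h6⟩ : ∃ w, w = 1 - e * (u * p) := ⟨_, rfl⟩
    obtain ⟨a7, h7⟩ : ∃ w, w = z - e ^ 2 * (v * p) := ⟨_, rfl⟩
    obtain ⟨a8, h8⟩ : ∃ w, w = 1 - u * p := ⟨_, rfl⟩
    obtain ⟨a9, h9⟩ : ∃ w, w = 1 - v * p := ⟨_, rfl⟩
    rw [← h2] at f2 ⊢
    rw [← h3] at f3 ⊢
    rw [← h4] at f4 ⊢
    rw [← h5] at f5 ⊢
    rw [← h6] at f6 ⊢
    rw [← h7] at f7 ⊢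
    rw [← h8] at f8 ⊢
    rw [← h9] at f9 ⊢
    field_simp
    subst h2 h3 h4 h5 h6 h7 h8 h9
    ring

/-! ### The recurrence for the values at the nodes -/

/-- The values of a Laurent polynomial at the nodes, which are indexed so that the first and the
second `q`-shift decrease the corresponding index by one. -/
def nodeVal (q : ℝ) (e z x : ℂ) (P : Laurent3) (c : ℂ) (a b : ℕ) : ℂ :=
  ev3 P (q * x / (e * (q : ℂ) ^ a)) (q * (z * x) / (e ^ 2 * (q : ℂ) ^ b)) c

/-- The sum over the nodes of level `N - 2`, that is those which enter `M P` at `q^{-(N-2)}`; it is zero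
for `N = 0, 1`. -/
def nodeSum (q : ℝ) (e z x : ℂ) (P : Laurent3) (N : ℕ) : ℂ :=
  ∑ p ∈ Finset.HasAntidiagonal.antidiagonal N,
    hat (nodeW q (e ^ 2) e z) p.1 p.2 * nodeVal q e z x P x p.1 p.2

theorem nodeVal_succ_succ (hq0 : 0 < q) {e z x c : ℂ} (P : Laurent3) (j i : ℕ) :
    nodeVal q e z x P c (j + 1) (i + 1) =
      ev3 P (x / (e * (q : ℂ) ^ j)) (z * x / (e ^ 2 * (q : ℂ) ^ i)) c := by
  have hqc : (q : ℂ) ≠ 0 := ofReal_ne_zero_of_pos hq0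
  unfold nodeVal
  congr 1
  · rw [pow_succ', mul_left_comm, mul_div_mul_left _ _ hqc]
  · rw [pow_succ' (q : ℂ), mul_left_comm (e ^ 2), mul_div_mul_left _ _ hqc]

theorem nodeSum_add_two (hq0 : 0 < q) (e z x : ℂ) (P : Laurent3) (m : ℕ) :
    nodeSum q e z x P (m + 2) =
      ∑ p ∈ Finset.HasAntidiagonal.antidiagonal m, nodeW q (e ^ 2) e z p.1 p.2 *
        ev3 P (x / (e * (q : ℂ) ^ p.1)) (z * x / (e ^ 2 * (q : ℂ) ^ p.2)) x := by
  unfold nodeSum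
  rw [sum_hat_both]
  exact Finset.sum_congr rfl fun p _ => by rw [nodeVal_succ_succ hq0]

theorem nodeSum_zero (e z x : ℂ) (P : Laurent3) : nodeSum q e z x P 0 = 0 := by
  simp [nodeSum, hat_zero_left]

theorem nodeSum_one (e z x : ℂ) (P : Laurent3) : nodeSum q e z x P 1 = 0 := by
  simp [nodeSum, Finset.Nat.antidiagonal_succ, hat_zero_left, hat_zero_right]

/-- A sum of the eigenvalue equations at the nodes in which all values but those of `nodeSum`
cancel. -/
theorem nodeSum_recurrence (hq0 : 0 < q) (hq1 : q < 1) {g : ℝ} (hg : 0 < g) {e : ℂ}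
    (he : e = ellInv q g) {x z : ℂ} (hx : x ≠ 0) (hz : NodeRegular q e z) (P : Laurent3)
    {h : ℕ → ℂ}
    (hP : ∀ i : ℕ, 1 ≤ i → i ≤ 3 → ∀ t : Fin 3 → ℂ, (∀ j, t j ≠ 0) → Function.Injective t →
      hamiltonian q g i (fun u => ev3 P (u 0) (u 1) (u 2)) t = h i * ev3 P (t 0) (t 1) (t 2))
    (M : ℕ) :
    recW q e ((q : ℂ) ^ (M + 1))⁻¹ 0 * h 3 * nodeSum q e z x P (M + 3) +
      recW q e ((q : ℂ) ^ (M + 1))⁻¹ 1 * h 2 * nodeSum q e z x P (M + 2) +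
      recW q e ((q : ℂ) ^ (M + 1))⁻¹ 2 * h 1 * nodeSum q e z x P (M + 1) +
      recW q e ((q : ℂ) ^ (M + 1))⁻¹ 3 * nodeSum q e z x P M = 0 := by
  have key := fun j i => hamiltonian_node hq0 hq1 hg he hx hz P hP j i rfl rfl
  have s1 : ∀ j : ℕ, (q : ℂ) * (x / (e * (q : ℂ) ^ j)) = q * x / (e * (q : ℂ) ^ j) :=
    fun j => (mul_div_assoc _ _ _).symm
  have s2 : ∀ i : ℕ, (q : ℂ) * (z * x / (e ^ 2 * (q : ℂ) ^ i)) =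
      q * (z * x) / (e ^ 2 * (q : ℂ) ^ i) := fun i => (mul_div_assoc _ _ _).symm
  have t1 : ∀ j : ℕ, x / (e * (q : ℂ) ^ j) = q * x / (e * (q : ℂ) ^ (j + 1)) := fun j => by
    have hqc : (q : ℂ) ≠ 0 := ofReal_ne_zero_of_pos hq0
    rw [pow_succ', mul_left_comm, mul_div_mul_left _ _ hqc]
  have t2 : ∀ i : ℕ, z * x / (e ^ 2 * (q : ℂ) ^ i) =
      q * (z * x) / (e ^ 2 * (q : ℂ) ^ (i + 1)) := fun i => by
    have hqc : (q : ℂ) ≠ 0 := ofReal_ne_zero_of_pos hq0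
    rw [pow_succ' (q : ℂ), mul_left_comm (e ^ 2), mul_div_mul_left _ _ hqc]
  simp only [s1, s2] at key
  simp only [t1, t2] at key
  obtain ⟨W, hW⟩ : ∃ W, W = nodeW q (e ^ 2) e z := ⟨_, rfl⟩
  have b1 := fun a b => bracket_shifted hq0 hq1 hg he hz a b
  have b0 := fun a b => bracket_unshifted hq0 hq1 hg he hz a b
  rw [← hW] at b0 b1
  -- the coefficients of the eigenvalue equations, where the indices tell which of the three coordinates
  -- are shifted
  obtain ⟨V101, h101⟩ : ∃ V : ℕ → ℕ → ℂ, ∀ j i, V j i =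
    (e ^ 2 * (q : ℂ) ^ i - z * (q : ℂ) ^ j) * (e ^ 3 * (q : ℂ) ^ i - z) /
      (e * (e * (q : ℂ) ^ i - z * (q : ℂ) ^ j) * (e ^ 2 * (q : ℂ) ^ i - z)) :=
    ⟨_, fun _ _ => rfl⟩
  obtain ⟨V011, h011⟩ : ∃ V : ℕ → ℕ → ℂ, ∀ j i, V j i =
    (z * (q : ℂ) ^ j - (q : ℂ) ^ i) * (e ^ 2 * (q : ℂ) ^ j - 1) /
      ((z * (q : ℂ) ^ j - e * (q : ℂ) ^ i) * (e * (q : ℂ) ^ j - 1)) :=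
    ⟨_, fun _ _ => rfl⟩
  obtain ⟨V001, h001⟩ : ∃ V : ℕ → ℕ → ℂ, ∀ j i, V j i =
    (e ^ 2 * (q : ℂ) ^ j - 1) * (e ^ 3 * (q : ℂ) ^ i - z) /
      (e * (e * (q : ℂ) ^ j - 1) * (e ^ 2 * (q : ℂ) ^ i - z)) :=
    ⟨_, fun _ _ => rfl⟩
  obtain ⟨V110, h110⟩ : ∃ V : ℕ → ℕ → ℂ, ∀ j i, V j i =
    e * (1 - (q : ℂ) ^ j) * (z - e * (q : ℂ) ^ i) /
      ((1 - e * (q : ℂ) ^ j) * (z - e ^ 2 * (q : ℂ) ^ i)) :=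
    ⟨_, fun _ _ => rfl⟩
  obtain ⟨V100, h100⟩ : ∃ V : ℕ → ℕ → ℂ, ∀ j i, V j i =
    (e ^ 2 * (q : ℂ) ^ i - z * (q : ℂ) ^ j) * (1 - (q : ℂ) ^ j) /
      ((e * (q : ℂ) ^ i - z * (q : ℂ) ^ j) * (1 - e * (q : ℂ) ^ j)) :=
    ⟨_, fun _ _ => rfl⟩
  obtain ⟨V010, h010⟩ : ∃ V : ℕ → ℕ → ℂ, ∀ j i, V j i =
    e * (z * (q : ℂ) ^ j - (q : ℂ) ^ i) * (z - e * (q : ℂ) ^ i) /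
      ((z * (q : ℂ) ^ j - e * (q : ℂ) ^ i) * (z - e ^ 2 * (q : ℂ) ^ i)) :=
    ⟨_, fun _ _ => rfl⟩
  simp only [← h101, ← h011, ← h001] at b1
  simp only [← h110, ← h100, ← h010] at b0
  simp only [← h101, ← h011, ← h001, ← h110, ← h100, ← h010] at key
  -- the values with third coordinate `x` and `qx`
  obtain ⟨p, hp⟩ : ∃ p : ℕ → ℕ → ℂ, p = nodeVal q e z x P x := ⟨_, rfl⟩
  obtain ⟨p', hp'⟩ : ∃ p : ℕ → ℕ → ℂ, p = nodeVal q e z x P (q * x) := ⟨_, rfl⟩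
  have pe : ∀ a b, ev3 P (q * x / (e * (q : ℂ) ^ a)) (q * (z * x) / (e ^ 2 * (q : ℂ) ^ b)) x =
      p a b := fun a b => by rw [hp]; rfl
  have pe' : ∀ a b, ev3 P (q * x / (e * (q : ℂ) ^ a)) (q * (z * x) / (e ^ 2 * (q : ℂ) ^ b))
      (q * x) = p' a b := fun a b => by rw [hp']; rfl
  simp only [pe, pe'] at key
  -- the sums of the eigenvalue equations over all nodes of one level, sorted by the points of evaluation
  have S3 : ∀ N, h 3 * nodeSum q e z x P (N + 2) =
      ∑ r ∈ Finset.HasAntidiagonal.antidiagonal N,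
        hat W (r.1 + 1) (r.2 + 1) * p' r.1 r.2 := by
    intro N
    unfold nodeSum
    rw [sum_hat_both, Finset.mul_sum]
    refine Finset.sum_congr rfl fun r _ => ?_
    rw [hat_succ_succ, ← hp, ← hW, mul_left_comm, (key r.1 r.2).2.2]
  have hat_mul : ∀ (V : ℕ → ℕ → ℂ) a b, hat (fun j i => W j i * V j i) (a + 1) (b + 1) =
      W a b * V a b := fun V a b => rfl
  have S2 : ∀ N, h 2 * nodeSum q e z x P (N + 2) =
      ∑ r ∈ Finset.HasAntidiagonal.antidiagonal N,
        hat (fun j i => W j i * V110 j i) (r.1 + 1) (r.2 + 1) * p r.1 r.2 +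
      ∑ r ∈ Finset.HasAntidiagonal.antidiagonal (N + 1),
        (hat (fun j i => W j i * V101 j i) (r.1 + 1) r.2 +
          hat (fun j i => W j i * V011 j i) r.1 (r.2 + 1)) * p' r.1 r.2 := by
    intro N
    unfold nodeSum
    rw [← hW, ← hp]
    simp only [add_mul, Finset.sum_add_distrib]
    have e1 := sum_hat_left (fun j i => W j i * V101 j i) (fun a b => p' (a - 1) b) (N + 1)
    have e2 := sum_hat_right (fun j i => W j i * V011 j i) (fun a b => p' a (b - 1)) (N + 1)
    have e3 := e1.symm.trans (sum_hat_both _ (fun a b => p' (a - 1) b) N)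
    have e4 := e2.symm.trans (sum_hat_both _ (fun a b => p' a (b - 1)) N)
    simp only [Nat.add_sub_cancel] at e3 e4
    rw [e3, e4, sum_hat_both, Finset.mul_sum, ← Finset.sum_add_distrib,
      ← Finset.sum_add_distrib]
    refine Finset.sum_congr rfl fun r _ => ?_
    rw [hat_mul]
    linear_combination W r.1 r.2 * (key r.1 r.2).2.1
  have S1 : ∀ N, h 1 * nodeSum q e z x P (N + 1) =
      ∑ r ∈ Finset.HasAntidiagonal.antidiagonal N,
        (hat (fun j i => W j i * V100 j i) (r.1 + 1) r.2 +
          hat (fun j i => W j i * V010 j i) r.1 (r.2 + 1)) * p r.1 r.2 +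
      ∑ r ∈ Finset.HasAntidiagonal.antidiagonal (N + 1),
        hat (fun j i => W j i * V001 j i) r.1 r.2 * p' r.1 r.2 := by
    intro N
    unfold nodeSum
    rw [← hW, ← hp]
    simp only [add_mul, Finset.sum_add_distrib]
    have e1 := sum_hat_left (fun j i => W j i * V100 j i) (fun a b => p (a - 1) b) N
    have e2 := sum_hat_right (fun j i => W j i * V010 j i) (fun a b => p a (b - 1)) N
    simp only [Nat.add_sub_cancel] at e1 e2
    rw [← e1, ← e2, Finset.mul_sum, ← Finset.sum_add_distrib, ← Finset.sum_add_distrib]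
    refine Finset.sum_congr rfl fun r _ => ?_
    rcases r with ⟨_ | a, _ | b⟩
    · simp [hat_zero_left]
    · simp [hat_zero_left]
    · simp [hat_zero_right]
    · simp only [hat_succ_succ, Nat.add_sub_cancel]
      linear_combination W a b * (key a b).1
  rw [mul_assoc, S3, mul_assoc, S2, mul_assoc, S1]
  have hS0 : nodeSum q e z x P M = ∑ r ∈ Finset.HasAntidiagonal.antidiagonal M,
      hat W r.1 r.2 * p r.1 r.2 := by rw [hW, hp]; rfl
  rw [hS0]
  -- in the combination of these sums the coefficients at each point cancel
  have c1 : ∑ r ∈ Finset.HasAntidiagonal.antidiagonal (M + 1),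
      (recW q e ((q : ℂ) ^ (M + 1))⁻¹ 0 * hat W (r.1 + 1) (r.2 + 1) +
        recW q e ((q : ℂ) ^ (M + 1))⁻¹ 1 * (hat (fun j i => W j i * V101 j i) (r.1 + 1) r.2 +
          hat (fun j i => W j i * V011 j i) r.1 (r.2 + 1)) +
        recW q e ((q : ℂ) ^ (M + 1))⁻¹ 2 * hat (fun j i => W j i * V001 j i) r.1 r.2) *
          p' r.1 r.2 = 0 := by
    refine Finset.sum_eq_zero fun r hr => ?_
    rw [← Finset.HasAntidiagonal.mem_antidiagonal.1 hr, b1, zero_mul]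
  have c0 : ∑ r ∈ Finset.HasAntidiagonal.antidiagonal M,
      (recW q e ((q : ℂ) ^ (M + 1))⁻¹ 1 *
          hat (fun j i => W j i * V110 j i) (r.1 + 1) (r.2 + 1) +
        recW q e ((q : ℂ) ^ (M + 1))⁻¹ 2 * (hat (fun j i => W j i * V100 j i) (r.1 + 1) r.2 +
          hat (fun j i => W j i * V010 j i) r.1 (r.2 + 1)) +
        recW q e ((q : ℂ) ^ (M + 1))⁻¹ 3 * hat W r.1 r.2) * p r.1 r.2 = 0 := by
    refine Finset.sum_eq_zero fun r hr => ?_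
    rw [← Finset.HasAntidiagonal.mem_antidiagonal.1 hr, b0, zero_mul]
  simp only [add_mul, mul_assoc, Finset.sum_add_distrib, ← Finset.mul_sum] at c0 c1
  simp only [add_mul, Finset.sum_add_distrib]
  linear_combination c0 + c1

/-! ### The difference equation of a terminating factor times a `q`-hypergeometric series -/

open Polynomial in
/-- The polynomial `(aX; q)_n`. -/
def pochX (q : ℝ) (a : ℂ) (n : ℕ) : ℂ[X] := ∏ i ∈ Finset.range n, (1 - C (a * (q : ℂ) ^ i) * X)

theorem eval_pochX (q : ℝ) (a y : ℂ) (n : ℕ) : (pochX q a n).eval y = qPoch q (a * y) n := by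
  unfold pochX qPoch
  rw [Polynomial.eval_prod]
  refine Finset.prod_congr rfl fun i _ => ?_
  simp
  ring

open Polynomial in
/-- The polynomial `∑ rᵢ (y;q)_i (a qⁱ y; q)_{N-i}`, where `R = ∑ rᵢ Xⁱ` has degree at
most `N`. -/
def sepX (q : ℝ) (a : ℂ) (N : ℕ) (R : ℂ[X]) : ℂ[X] :=
  ∑ i ∈ Finset.range (N + 1), C (R.coeff i) * (pochX q 1 i * pochX q (a * (q : ℂ) ^ i) (N - i))

theorem eval_sepX (q : ℝ) (a y : ℂ) (N : ℕ) (R : Polynomial ℂ) : (sepX q a N R).eval y =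
    ∑ i ∈ Finset.range (N + 1),
      R.coeff i * (qPoch q y i * qPoch q (a * (q : ℂ) ^ i * y) (N - i)) := by
  unfold sepX
  rw [Polynomial.eval_finsetSum]
  refine Finset.sum_congr rfl fun i _ => ?_
  simp [eval_pochX]

theorem hasSum_sepX (hq0 : 0 < q) (hq1 : q < 1) (a : ℂ) {N : ℕ} {R : Polynomial ℂ}
    (hR : R.natDegree ≤ N) {y : ℂ} (hy : ‖y‖ < 1) :
    HasSum (fun k : ℕ => qPoch q a k / qPoch q q k * R.eval ((q : ℂ) ^ k) * y ^ k)
      ((sepX q a N R).eval y * (qInf q (a * (q : ℂ) ^ N * y) / qInf q y)) := by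
  have hz : ∀ i : ℕ, ‖(q : ℂ) ^ i * y‖ < 1 := fun i => by
    rw [norm_mul, norm_pow]
    calc ‖(q : ℂ)‖ ^ i * ‖y‖ ≤ 1 * ‖y‖ := by
          gcongr; exact pow_le_one₀ (norm_nonneg _) (norm_ofReal_lt_one hq0 hq1).le
      _ < 1 := by rwa [one_mul]
  have h1 : HasSum (fun k : ℕ => ∑ i ∈ Finset.range (N + 1), R.coeff i *
      (qPoch q a k / qPoch q q k * ((q : ℂ) ^ i * y) ^ k))
      (∑ i ∈ Finset.range (N + 1), R.coeff i *
        (qInf q (a * ((q : ℂ) ^ i * y)) / qInf q ((q : ℂ) ^ i * y))) := by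
    refine hasSum_sum fun i _ => HasSum.mul_left _ ?_
    rw [← qBinomial hq0 hq1 a (hz i)]
    exact (summable_qBinomial hq0 hq1 a (hz i)).of_norm.hasSum
  have hy0 : qInf q y ≠ 0 := by
    rw [Ne, qInf_eq_zero_iff hq0 hq1]
    rintro ⟨k, hk⟩
    have := hz k
    rw [mul_comm, hk] at this
    simp at this
  convert h1 using 1
  · funext k
    rw [Polynomial.eval_eq_sum_range' (Nat.lt_succ_of_le hR), Finset.mul_sum, Finset.sum_mul]
    refine Finset.sum_congr rfl fun i _ => ?_
    rw [mul_pow, ← pow_mul, ← pow_mul, mul_comm i k]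
    ring
  · rw [eval_sepX, Finset.sum_mul]
    refine Finset.sum_congr rfl fun i hi => ?_
    have hiN : i ≤ N := Nat.lt_succ_iff.1 (Finset.mem_range.1 hi)
    rw [qInf_eq_qPoch_mul hq0 hq1 y i] at hy0 ⊢
    rw [qInf_eq_qPoch_mul hq0 hq1 (a * ((q : ℂ) ^ i * y)) (N - i)]
    have e1 : a * ((q : ℂ) ^ i * y) * (q : ℂ) ^ (N - i) = a * (q : ℂ) ^ N * y := by
      rw [← Nat.add_sub_of_le hiN, pow_add, Nat.add_sub_cancel_left]; ring
    have e2 : a * (q : ℂ) ^ i * y = a * ((q : ℂ) ^ i * y) := by ring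
    rw [e1, e2, mul_comm ((q : ℂ) ^ i) y]
    have := left_ne_zero_of_mul hy0
    have := right_ne_zero_of_mul hy0
    field_simp

/-- The polynomial `(1 - X)(1 - b₁X/q)(1 - b₂X/q) - y (1 - a₁X)(1 - a₂X)(1 - a₃X)`, given by its
coefficients; it is the symbol of the `q`-difference equation of `₃φ₂`. -/
def symb (q : ℝ) (b₁ b₂ a₁ a₂ a₃ y : ℂ) : ℕ → ℂ
  | 0 => 1 - y
  | 1 => -(1 + (b₁ + b₂) / q) + y * (a₁ + a₂ + a₃)
  | 2 => (b₁ + b₂) / q + b₁ * b₂ / q ^ 2 - y * (a₁ * a₂ + a₁ * a₃ + a₂ * a₃)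
  | _ => -(b₁ * b₂ / q ^ 2) + y * (a₁ * a₂ * a₃)

/-- The `q`-difference equation for the series with coefficients `f`. -/
theorem symb_series (hq0 : 0 < q) {b₁ b₂ a₁ a₂ a₃ : ℂ} {f : ℕ → ℂ}
    (hf : ∀ k, f (k + 1) * ((1 - (q : ℂ) ^ (k + 1)) * (1 - b₁ * (q : ℂ) ^ k) *
      (1 - b₂ * (q : ℂ) ^ k)) =
      f k * ((1 - a₁ * (q : ℂ) ^ k) * (1 - a₂ * (q : ℂ) ^ k) * (1 - a₃ * (q : ℂ) ^ k)))
    {y : ℂ} {F : ℕ → ℂ} (hF : ∀ j, HasSum (fun k => f k * ((q : ℂ) ^ j * y) ^ k) (F j)) :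
    symb q b₁ b₂ a₁ a₂ a₃ y 0 * F 0 + symb q b₁ b₂ a₁ a₂ a₃ y 1 * F 1 +
      symb q b₁ b₂ a₁ a₂ a₃ y 2 * F 2 + symb q b₁ b₂ a₁ a₂ a₃ y 3 * F 3 = 0 := by
  have hqc : (q : ℂ) ≠ 0 := ofReal_ne_zero_of_pos hq0
  have hL := ((((hF 0).mul_left 1).add ((hF 1).mul_left (-(1 + (b₁ + b₂) / q)))).add
    ((hF 2).mul_left ((b₁ + b₂) / q + b₁ * b₂ / q ^ 2))).add
    ((hF 3).mul_left (-(b₁ * b₂ / q ^ 2)))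
  have hR := (((((hF 0).mul_left 1).add ((hF 1).mul_left (-(a₁ + a₂ + a₃)))).add
    ((hF 2).mul_left (a₁ * a₂ + a₁ * a₃ + a₂ * a₃))).add
    ((hF 3).mul_left (-(a₁ * a₂ * a₃)))).mul_left y
  have h0 := (hasSum_nat_add_iff' 1).2 hL
  simp only [Finset.sum_range_one, pow_zero, mul_one] at h0
  have hz : 1 * f 0 + -(1 + (b₁ + b₂) / q) * f 0 + ((b₁ + b₂) / q + b₁ * b₂ / q ^ 2) * f 0 +
      -(b₁ * b₂ / q ^ 2) * f 0 = 0 := by ring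
  rw [hz, sub_zero] at h0
  -- both sides are sums over the same terms, shifted by one, since the symbol vanishes at `k = 0`
  have heq := h0.unique ((congrArg (fun φ => HasSum φ _) (funext fun k => by
    have e : ∀ j : ℕ, ((q : ℂ) ^ j * y) ^ k = ((q : ℂ) ^ k) ^ j * y ^ k := fun j => by
      rw [mul_pow, ← pow_mul, ← pow_mul, mul_comm j k]
    have e' : ∀ j : ℕ, ((q : ℂ) ^ j * y) ^ (k + 1) =
        ((q : ℂ) ^ k) ^ j * y ^ k * ((q : ℂ) ^ j * y) := fun j => by
      rw [pow_succ, e]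
    simp only [e, e']
    have h := hf k
    rw [pow_succ (q : ℂ) k] at h
    generalize (q : ℂ) ^ k = X at *
    have h2 : (1 - X * q) * (1 - b₁ * X) * (1 - b₂ * X) =
        1 + -(1 + (b₁ + b₂) / q) * (X * q) + ((b₁ + b₂) / q + b₁ * b₂ / q ^ 2) * (X * q) ^ 2 +
          -(b₁ * b₂ / q ^ 2) * (X * q) ^ 3 := by
      field_simp; ring
    rw [h2] at h
    linear_combination (y ^ k * y) * h)).mpr hR)
  simp only [symb]
  linear_combination heq

/-- The `q`-difference equation of `sepX`: it is obtained from the one of the series by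
pulling out the quotient of infinite products. -/
theorem sepX_difference (hq0 : 0 < q) (hq1 : q < 1) {a b₁ b₂ a₂ a₃ : ℂ} {N : ℕ}
    {R : Polynomial ℂ} (hR : R.natDegree ≤ N)
    (hrec : ∀ k : ℕ, R.eval ((q : ℂ) ^ (k + 1)) * ((1 - b₁ * (q : ℂ) ^ k) *
      (1 - b₂ * (q : ℂ) ^ k)) =
      R.eval ((q : ℂ) ^ k) * ((1 - a₂ * (q : ℂ) ^ k) * (1 - a₃ * (q : ℂ) ^ k)))
    {B : ℂ} (hB : B = a * (q : ℂ) ^ N) (y : ℂ) :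
    symb q b₁ b₂ a a₂ a₃ y 0 * ((sepX q a N R).eval y *
        ((1 - B * y) * (1 - B * q * y) * (1 - B * q ^ 2 * y))) +
      symb q b₁ b₂ a a₂ a₃ y 1 * ((sepX q a N R).eval (q * y) *
        ((1 - y) * (1 - B * q * y) * (1 - B * q ^ 2 * y))) +
      symb q b₁ b₂ a a₂ a₃ y 2 * ((sepX q a N R).eval (q ^ 2 * y) *
        ((1 - y) * (1 - q * y) * (1 - B * q ^ 2 * y))) +
      symb q b₁ b₂ a a₂ a₃ y 3 * ((sepX q a N R).eval (q ^ 3 * y) *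
        ((1 - y) * (1 - q * y) * (1 - q ^ 2 * y))) = 0 := by
  obtain ⟨S, hS⟩ : ∃ S, S = sepX q a N R := ⟨_, rfl⟩
  rw [← hS]
  obtain ⟨f, hf⟩ : ∃ f : ℂ → ℂ, ∀ y, f y = symb q b₁ b₂ a a₂ a₃ y 0 * (S.eval y *
        ((1 - B * y) * (1 - B * q * y) * (1 - B * q ^ 2 * y))) +
      symb q b₁ b₂ a a₂ a₃ y 1 * (S.eval (q * y) *
        ((1 - y) * (1 - B * q * y) * (1 - B * q ^ 2 * y))) +
      symb q b₁ b₂ a a₂ a₃ y 2 * (S.eval (q ^ 2 * y) *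
        ((1 - y) * (1 - q * y) * (1 - B * q ^ 2 * y))) +
      symb q b₁ b₂ a a₂ a₃ y 3 * (S.eval (q ^ 3 * y) *
        ((1 - y) * (1 - q * y) * (1 - q ^ 2 * y))) := ⟨_, fun _ => rfl⟩
  rw [← hf]
  -- near the origin the series converges; the identity theorem extends the equation to all `y`
  have hsmall : ∀ᶠ y in 𝓝 (0 : ℂ), f y = 0 := by
    have c1 : ∀ᶠ y in 𝓝 (0 : ℂ), ‖y‖ < 1 := by
      have : Continuous fun y : ℂ => ‖y‖ := continuous_norm
      exact this.continuousAt.eventually_lt continuousAt_const (by simp)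
    have c2 : ∀ᶠ y in 𝓝 (0 : ℂ), ‖B * y‖ < 1 := by
      have : Continuous fun y : ℂ => ‖B * y‖ := by fun_prop
      exact this.continuousAt.eventually_lt continuousAt_const (by simp)
    filter_upwards [c1, c2] with y h1 h2
    have hn : ∀ (j : ℕ) {y : ℂ}, ‖y‖ < 1 → ‖(q : ℂ) ^ j * y‖ < 1 := fun j y hy => by
      rw [norm_mul, norm_pow]
      calc ‖(q : ℂ)‖ ^ j * ‖y‖ ≤ 1 * ‖y‖ := by
            gcongr; exact pow_le_one₀ (norm_nonneg _) (norm_ofReal_lt_one hq0 hq1).le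
        _ < 1 := by rwa [one_mul]
    have hne : ∀ {y : ℂ}, ‖y‖ < 1 → qInf q y ≠ 0 := fun {y} hy => by
      rw [Ne, qInf_eq_zero_iff hq0 hq1]
      rintro ⟨k, hk⟩
      have := hn k hy
      rw [mul_comm, hk] at this
      simp at this
    have hF := fun j : ℕ => hasSum_sepX hq0 hq1 a hR (hn j h1)
    rw [← hB, ← hS] at hF
    have hs := symb_series (b₁ := b₁) (b₂ := b₂) (a₁ := a) (a₂ := a₂) (a₃ := a₃) hq0 (fun k => by
      have h3 := qPoch_self_ne_zero hq0 hq1 k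
      have h4 := qPoch_self_ne_zero hq0 hq1 (k + 1)
      have h5 := hrec k
      rw [qPoch_succ q a, qPoch_succ q (q : ℂ)] at *
      have h6 : 1 - (q : ℂ) ^ (k + 1) ≠ 0 := qpow_ne_one hq0 hq1 k
      have h7 : 1 - (q : ℂ) * q ^ k = 1 - (q : ℂ) ^ (k + 1) := by rw [pow_succ']
      rw [h7] at *
      have h8 : qPoch q a k * (1 - a * (q : ℂ) ^ k) / (qPoch q q k * (1 - (q : ℂ) ^ (k + 1))) *
          R.eval ((q : ℂ) ^ (k + 1)) * ((1 - (q : ℂ) ^ (k + 1)) * (1 - b₁ * (q : ℂ) ^ k) *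
          (1 - b₂ * (q : ℂ) ^ k)) = qPoch q a k / qPoch q q k * (1 - a * (q : ℂ) ^ k) *
          (R.eval ((q : ℂ) ^ (k + 1)) * ((1 - b₁ * (q : ℂ) ^ k) * (1 - b₂ * (q : ℂ) ^ k))) := by
        field_simp
      rw [h8, h5]
      ring) hF
    have n0 := hne h1
    have k0 := hne h2
    rw [hf]
    simp only [pow_zero, pow_one, one_mul] at hs
    have g0 := qInf_step hq0 hq1 y
    have g1 := qInf_step hq0 hq1 (y * q)
    have g2 := qInf_step hq0 hq1 (y * q * q)
    have l0 := qInf_step hq0 hq1 (B * y)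
    have l1 := qInf_step hq0 hq1 (B * y * q)
    have l2 := qInf_step hq0 hq1 (B * y * q * q)
    have e1 : y * q = q * y := mul_comm _ _
    have e2 : q * y * q = q ^ 2 * y := by ring
    have e3 : q ^ 2 * y * q = q ^ 3 * y := by ring
    have e4 : B * y * q = B * (q * y) := by ring
    have e5 : B * (q * y) * q = B * (q ^ 2 * y) := by ring
    have e6 : B * (q ^ 2 * y) * q = B * (q ^ 3 * y) := by ring
    rw [e1] at g0 g1 g2
    rw [e2] at g1 g2
    rw [e3] at g2
    rw [e4] at l0 l1 l2
    rw [e5] at l1 l2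
    rw [e6] at l2
    rw [l0, l1, l2, g0, g1, g2] at hs
    rw [l0, l1, l2] at k0
    rw [g0, g1, g2] at n0
    generalize qInf q (B * (q ^ 3 * y)) = K at *
    generalize qInf q (q ^ 3 * y) = L at *
    generalize symb q b₁ b₂ a a₂ a₃ y 0 = s0 at *
    generalize symb q b₁ b₂ a a₂ a₃ y 1 = s1 at *
    generalize symb q b₁ b₂ a a₂ a₃ y 2 = s2 at *
    generalize symb q b₁ b₂ a a₂ a₃ y 3 = s3 at *
    generalize S.eval y = S0 at *
    generalize S.eval (q * y) = S1 at *
    generalize S.eval (q ^ 2 * y) = S2 at *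
    generalize S.eval (q ^ 3 * y) = S3 at *
    simp only [mul_ne_zero_iff] at k0 n0
    obtain ⟨x1, x2, x3, hK⟩ := k0
    obtain ⟨y1, y2, y3, hL⟩ := n0
    have key := congrArg (· * (L / K * ((1 - y) * (1 - q * y) * (1 - q ^ 2 * y)))) hs
    simp only [zero_mul] at key
    rw [← key]
    clear key hs g0 g1 g2 l0 l1 l2 e1 e2 e3 e4 e5 e6
    obtain ⟨d1, h1⟩ : ∃ d, d = 1 - y := ⟨_, rfl⟩
    obtain ⟨d2, h2⟩ : ∃ d, d = 1 - q * y := ⟨_, rfl⟩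
    obtain ⟨d3, h3⟩ : ∃ d, d = 1 - q ^ 2 * y := ⟨_, rfl⟩
    rw [← h1] at y1 ⊢
    rw [← h2] at y2 ⊢
    rw [← h3] at y3 ⊢
    field_simp
  have hdiff : Differentiable ℂ f := by
    have hf' : f = _ := funext hf
    rw [hf']
    simp only [symb]
    have hp : Differentiable ℂ fun y => S.eval y := S.differentiable
    have hp1 : Differentiable ℂ fun y => S.eval ((q : ℂ) * y) := hp.comp (by fun_prop)
    have hp2 : Differentiable ℂ fun y => S.eval ((q : ℂ) ^ 2 * y) := hp.comp (by fun_prop)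
    have hp3 : Differentiable ℂ fun y => S.eval ((q : ℂ) ^ 3 * y) := hp.comp (by fun_prop)
    fun_prop
  have han : AnalyticOnNhd ℂ f Set.univ := hdiff.differentiableOn.analyticOnNhd isOpen_univ
  have := han.eq_of_eventuallyEq (g := fun _ => 0) analyticOnNhd_const hsmall
  exact congrFun this y

/-- The values of `sepX` at the points `q^{-m}`, normalized and shifted so that the sequence
starts with two zeros. -/
def sepSeq (q : ℝ) (a : ℂ) (N : ℕ) (R : Polynomial ℂ) : ℕ → ℂ
  | 0 => 0
  | 1 => 0
  | m + 2 => qPoch q (q / (a * (q : ℂ) ^ N)) m / qPoch q q m *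
      (sepX q a N R).eval ((q : ℂ) ^ m)⁻¹

theorem continuousAt_sepSeq (hq0 : 0 < q) (N : ℕ) (R : Polynomial ℂ) {a : ℂ}
    (ha : a ≠ 0) (m : ℕ) : ContinuousAt (fun a => sepSeq q a N R m) a := by
  have hqc : (q : ℂ) ≠ 0 := ofReal_ne_zero_of_pos hq0
  rcases m with _ | _ | m
  · exact continuousAt_const
  · exact continuousAt_const
  · simp only [sepSeq, eval_sepX]
    refine ContinuousAt.mul (ContinuousAt.div_const ?_ _) ?_
    · refine ContinuousAt.comp (g := fun b => qPoch q b m) (continuous_qPoch q m).continuousAt ?_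
      exact ContinuousAt.div continuousAt_const (by fun_prop)
        (mul_ne_zero ha (pow_ne_zero _ hqc))
    · refine Continuous.continuousAt (continuous_finsetSum _ fun i _ => ?_)
      have := (continuous_qPoch q (N - i)).comp
        (f := fun a : ℂ => a * (q : ℂ) ^ i * ((q : ℂ) ^ m)⁻¹) (by fun_prop)
      exact continuous_const.mul (continuous_const.mul this)

/-- The recurrence of the normalized values. The factors lost at the special values of `a` are
recovered by continuity in `a`. -/
theorem sepSeq_recurrence (hq0 : 0 < q) (hq1 : q < 1) {a b₁ b₂ a₂ a₃ : ℂ} (ha : a ≠ 0) {N : ℕ}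
    {R : Polynomial ℂ} (hR : R.natDegree ≤ N)
    (hrec : ∀ k : ℕ, R.eval ((q : ℂ) ^ (k + 1)) * ((1 - b₁ * (q : ℂ) ^ k) *
      (1 - b₂ * (q : ℂ) ^ k)) =
      R.eval ((q : ℂ) ^ k) * ((1 - a₂ * (q : ℂ) ^ k) * (1 - a₃ * (q : ℂ) ^ k))) (M : ℕ) :
    symb q b₁ b₂ a a₂ a₃ ((q : ℂ) ^ (M + 1))⁻¹ 0 * sepSeq q a N R (M + 3) +
      symb q b₁ b₂ a a₂ a₃ ((q : ℂ) ^ (M + 1))⁻¹ 1 / (a * (q : ℂ) ^ N) *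
        sepSeq q a N R (M + 2) +
      symb q b₁ b₂ a a₂ a₃ ((q : ℂ) ^ (M + 1))⁻¹ 2 / (a * (q : ℂ) ^ N) ^ 2 *
        sepSeq q a N R (M + 1) +
      symb q b₁ b₂ a a₂ a₃ ((q : ℂ) ^ (M + 1))⁻¹ 3 / (a * (q : ℂ) ^ N) ^ 3 *
        sepSeq q a N R M = 0 := by
  have hqc : (q : ℂ) ≠ 0 := ofReal_ne_zero_of_pos hq0
  have hqn : ∀ n : ℕ, (q : ℂ) ^ n ≠ 0 := fun n => pow_ne_zero n hqc
  obtain ⟨E, hE⟩ : ∃ E : ℂ → ℂ, ∀ a, E a =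
      symb q b₁ b₂ a a₂ a₃ ((q : ℂ) ^ (M + 1))⁻¹ 0 * sepSeq q a N R (M + 3) +
      symb q b₁ b₂ a a₂ a₃ ((q : ℂ) ^ (M + 1))⁻¹ 1 / (a * (q : ℂ) ^ N) *
        sepSeq q a N R (M + 2) +
      symb q b₁ b₂ a a₂ a₃ ((q : ℂ) ^ (M + 1))⁻¹ 2 / (a * (q : ℂ) ^ N) ^ 2 *
        sepSeq q a N R (M + 1) +
      symb q b₁ b₂ a a₂ a₃ ((q : ℂ) ^ (M + 1))⁻¹ 3 / (a * (q : ℂ) ^ N) ^ 3 *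
        sepSeq q a N R M := ⟨_, fun _ => rfl⟩
  rw [← hE]
  have hcont : ContinuousAt E a := by
    have hE' : E = _ := funext hE
    rw [hE']
    have haN : a * (q : ℂ) ^ N ≠ 0 := mul_ne_zero ha (hqn N)
    have hc := continuousAt_sepSeq hq0 N R ha
    have c0 := hc (M + 3)
    have c1 := hc (M + 2)
    have c2 := hc (M + 1)
    have c3 := hc M
    simp only [symb]
    have d1 : ContinuousAt (fun a => a * (q : ℂ) ^ N) a := by fun_prop
    refine (((ContinuousAt.mul ?_ c0).add (.mul (.div ?_ d1 haN) c1)).add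
      (.mul (.div ?_ (d1.pow 2) (pow_ne_zero 2 haN)) c2)).add
      (.mul (.div ?_ (d1.pow 3) (pow_ne_zero 3 haN)) c3) <;>
    fun_prop
  -- away from three values of `a` the normalizing factors can be cancelled in the difference equation
  -- at `y = q^{-(M+1)}`; the cases `M = 0` and `M = 1` involve values beyond `q^0`, which drop out
  have hgen : ∀ a : ℂ, a ≠ 0 → (∀ i : Fin 3, a ≠ (q : ℂ) ^ (M + 1) / (q : ℂ) ^ (N + (i : ℕ))) →
      E a = 0 := by
    intro a ha hi
    have hd := sepX_difference hq0 hq1 hR hrec (a := a) rfl ((q : ℂ) ^ (M + 1))⁻¹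
    rw [hE]
    obtain ⟨B, hB⟩ : ∃ B, B = a * (q : ℂ) ^ N := ⟨_, rfl⟩
    have hB0 : B ≠ 0 := hB ▸ mul_ne_zero ha (hqn N)
    rw [← hB] at hd ⊢
    have x0 : (q : ℂ) ^ (M + 1) - B ≠ 0 := fun h0 => hi 0 <| by
      rw [eq_div_iff (hqn _), Fin.val_zero, add_zero, ← hB, ← sub_eq_zero.1 h0]
    have x1 : (q : ℂ) ^ (M + 1) - B * q ≠ 0 := fun h0 => hi 1 <| by
      rw [eq_div_iff (hqn _), Fin.val_one, pow_succ _ N, ← mul_assoc, ← hB, ← sub_eq_zero.1 h0]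
    have x2 : (q : ℂ) ^ (M + 1) - B * q ^ 2 ≠ 0 := fun h0 => hi 2 <| by
      rw [eq_div_iff (hqn _), Fin.val_two, pow_add _ N, ← mul_assoc, ← hB, ← sub_eq_zero.1 h0]
    generalize symb q b₁ b₂ a a₂ a₃ ((q : ℂ) ^ (M + 1))⁻¹ 0 = s0 at *
    generalize symb q b₁ b₂ a a₂ a₃ ((q : ℂ) ^ (M + 1))⁻¹ 1 = s1 at *
    generalize symb q b₁ b₂ a a₂ a₃ ((q : ℂ) ^ (M + 1))⁻¹ 2 = s2 at *
    generalize symb q b₁ b₂ a a₂ a₃ ((q : ℂ) ^ (M + 1))⁻¹ 3 = s3 at *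
    have p1 : 1 - (q : ℂ) ≠ 0 := by simpa using qpow_ne_one hq0 hq1 0
    have p2 : 1 - (q : ℂ) ^ 2 ≠ 0 := qpow_ne_one hq0 hq1 1
    obtain ⟨S, hS⟩ : ∃ S : ℕ → ℂ, ∀ n, S n = (sepX q a N R).eval ((q : ℂ) ^ n)⁻¹ :=
      ⟨_, fun _ => rfl⟩
    have t : ∀ m, sepSeq q a N R (m + 2) = qPoch q (q / B) m / qPoch q q m * S m := fun m => by
      rw [hS, hB]; rfl
    have u0 : sepSeq q a N R 0 = 0 := rfl
    have u1 : sepSeq q a N R 1 = 0 := rfl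
    obtain ⟨y, hy⟩ : ∃ y : ℂ, y = ((q : ℂ) ^ (M + 1))⁻¹ := ⟨_, rfl⟩
    have v : ∀ j ≤ M + 1, (sepX q a N R).eval ((q : ℂ) ^ j * y) = S (M + 1 - j) := by
      intro j hj
      rw [hS, hy]
      congr 1
      obtain ⟨k, hk⟩ := Nat.exists_eq_add_of_le hj
      rw [hk, Nat.add_sub_cancel_left, pow_add]
      have := hqn j
      field_simp
    rw [← hy] at hd
    have v0 := v 0 (Nat.zero_le _)
    rw [pow_zero, one_mul] at v0
    have v1 := v 1 (by omega)
    rw [pow_one] at v1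
    rw [v0, v1] at hd
    generalize hT2 : (sepX q a N R).eval ((q : ℂ) ^ 2 * y) = T2 at hd
    generalize hT3 : (sepX q a N R).eval ((q : ℂ) ^ 3 * y) = T3 at hd
    clear hcont hE hrec v0 v1 hi
    rcases M with _ | _ | M
    · rw [zero_add, u0, u1, t 1, t 0]
      simp only [Nat.sub_zero, zero_add, Nat.sub_self, pow_one] at hd hy x0 x1 x2
      rw [qPoch_succ, qPoch_succ, qPoch_zero, qPoch_zero, pow_zero]
      clear t v hS hT2 hT3 u0 u1 hqn
      generalize (q : ℂ) = p at *
      have y1 : 1 - B ≠ 0 := fun h => x1 (by linear_combination p * h)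
      have y2 : 1 - B * p ≠ 0 := fun h => x2 (by linear_combination p * h)
      rw [hy] at hd
      field_simp at hd ⊢
      refine mul_left_cancel₀ (mul_ne_zero y1 y2) ?_
      linear_combination -B ^ 2 * hd
    · rw [show 0 + 1 + 3 = 2 + 2 from rfl, show 0 + 1 + 2 = 1 + 2 from rfl,
        show 0 + 1 + 1 = 0 + 2 from rfl, show 0 + 1 = 1 from rfl, u1, t 2, t 1, t 0]
      have hT2' := v 2 (by omega)
      rw [hT2] at hT2'
      rw [hT2'] at hd
      simp only [Nat.sub_zero, zero_add, Nat.sub_self,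
        one_add_one_eq_two] at hd hy x0 x1 x2
      rw [qPoch_succ, qPoch_succ, qPoch_succ, qPoch_succ, qPoch_zero, qPoch_zero, pow_zero,
        pow_one]
      clear t v hS hT2 hT3 u0 u1 hqn hT2'
      generalize (q : ℂ) = p at *
      have y1 : p - B ≠ 0 := fun h => x1 (by linear_combination p * h)
      have y2 : 1 - B ≠ 0 := fun h => x2 (by linear_combination p ^ 2 * h)
      have p2' : 1 - p * p ≠ 0 := by rwa [← pow_two]
      rw [hy] at hd
      field_simp at hd ⊢
      refine mul_left_cancel₀ y2 ?_
      linear_combination B * hd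
    · rw [show M + 1 + 1 + 3 = (M + 3) + 2 from rfl, show M + 1 + 1 + 2 = (M + 2) + 2 from rfl,
        show M + 1 + 1 + 1 = (M + 1) + 2 from rfl, show M + 1 + 1 = M + 2 from rfl, t, t, t, t]
      have hT2' := v 2 (by omega)
      rw [hT2] at hT2'
      rw [hT2'] at hd
      have hT3' := v 3 (by omega)
      rw [hT3] at hT3'
      rw [hT3'] at hd
      simp only [Nat.sub_zero, Nat.add_sub_cancel] at hd
      rw [show M + 1 + 1 + 1 - 2 = M + 1 by omega, show M + 1 + 1 + 1 - 3 = M by omega,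
        show M + 1 + 1 + 1 = M + 3 from rfl, show M + 1 + 1 = M + 2 from rfl] at hd
      rw [qPoch_succ _ _ (M + 2), qPoch_succ _ _ (M + 1), qPoch_succ _ _ M,
        qPoch_succ _ _ (M + 2), qPoch_succ _ _ (M + 1), qPoch_succ _ _ M]
      have c0 := qPoch_self_ne_zero hq0 hq1 M
      have c1 := qpow_ne_one hq0 hq1 M
      have c2 := qpow_ne_one hq0 hq1 (M + 1)
      have c3 := qpow_ne_one hq0 hq1 (M + 2)
      clear v t hT2 hT3 hT2' hT3' hS u0 u1
      have hX := hqn M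
      simp only [pow_succ (q : ℂ) M, pow_succ (q : ℂ) (M + 1), pow_succ (q : ℂ) (M + 2)] at *
      clear hqn
      generalize (q : ℂ) ^ M = X at *
      generalize (q : ℂ) = p at *
      rw [hy] at hd
      have c2' : 1 - X * p ^ 2 ≠ 0 := by rwa [pow_two, ← mul_assoc]
      have c3' : 1 - X * p ^ 3 ≠ 0 := by rwa [pow_succ, pow_two, ← mul_assoc, ← mul_assoc]
      field_simp at hd ⊢
      linear_combination -qPoch q (p / B) M * hd
  -- the exceptional values of `a` are isolated
  have hfin : ∀ᶠ c in 𝓝[≠] a, E c = 0 := by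
    have h1 : ∀ᶠ c in 𝓝 a, c ≠ 0 := continuousAt_id.eventually_ne ha
    have h2 : ∀ i : Fin 3, ∀ᶠ c in 𝓝[≠] a, c ≠ (q : ℂ) ^ (M + 1) / (q : ℂ) ^ (N + (i : ℕ)) := by
      intro i
      by_cases h : a = (q : ℂ) ^ (M + 1) / (q : ℂ) ^ (N + (i : ℕ))
      · rw [← h]; exact self_mem_nhdsWithin
      · exact nhdsWithin_le_nhds (continuousAt_id.eventually_ne h)
    filter_upwards [nhdsWithin_le_nhds h1, eventually_all.2 h2] with c hc hc'
    exact hgen c hc hc'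
  refine tendsto_nhds_unique (l := 𝓝[≠] a) (hcont.tendsto.mono_left nhdsWithin_le_nhds)
    (tendsto_const_nhds.congr' ?_)
  filter_upwards [hfin] with c hc
  exact hc.symm

/-! ### The separated polynomials -/

/-- The recurrence satisfied by the normalized values at `q^{-m}`, with two leading zeros. -/
structure IsNodeRec (q : ℝ) (e : ℂ) (h : ℕ → ℂ) (s : ℕ → ℂ) : Prop where
  zero : s 0 = 0
  one : s 1 = 0
  step : ∀ M : ℕ, recW q e ((q : ℂ) ^ (M + 1))⁻¹ 0 * h 3 * s (M + 3) +
    recW q e ((q : ℂ) ^ (M + 1))⁻¹ 1 * h 2 * s (M + 2) +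
    recW q e ((q : ℂ) ^ (M + 1))⁻¹ 2 * h 1 * s (M + 1) +
    recW q e ((q : ℂ) ^ (M + 1))⁻¹ 3 * s M = 0

/-- The recurrence determines a sequence up to a constant factor. -/
theorem IsNodeRec.proportional (hq0 : 0 < q) (hq1 : q < 1) {e : ℂ} {h s t : ℕ → ℂ}
    (hs : IsNodeRec q e h s) (ht : IsNodeRec q e h t) (h3 : h 3 ≠ 0) (n : ℕ) :
    s n * t 2 = t n * s 2 := by
  induction n using Nat.strong_induction_on with
  | _ n ih =>
    rcases n with _ | _ | _ | M
    · rw [hs.zero, ht.zero, zero_mul, zero_mul]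
    · rw [zero_add, hs.one, ht.one, zero_mul, zero_mul]
    · rw [zero_add, one_add_one_eq_two, mul_comm]
    · have h0 : recW q e ((q : ℂ) ^ (M + 1))⁻¹ 0 ≠ 0 := by
        have h1 := qpow_ne_one hq0 hq1 M
        have h2 : (q : ℂ) ^ (M + 1) ≠ 0 := pow_ne_zero _ (ofReal_ne_zero_of_pos hq0)
        simp only [recW, pow_zero, one_mul, div_one]
        intro h4
        refine h1 ?_
        field_simp at h4
        linear_combination -h4
      refine mul_left_cancel₀ (mul_ne_zero h0 h3) ?_
      have a2 := ih (M + 2) (by omega)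
      have a1 := ih (M + 1) (by omega)
      have a0 := ih M (by omega)
      linear_combination t 2 * hs.step M - s 2 * ht.step M -
        recW q e ((q : ℂ) ^ (M + 1))⁻¹ 1 * h 2 * a2 -
        recW q e ((q : ℂ) ^ (M + 1))⁻¹ 2 * h 1 * a1 - recW q e ((q : ℂ) ^ (M + 1))⁻¹ 3 * a0

open Polynomial in
/-- The polynomial with the values `pochRatio q b ν k` at `q^k`. -/
def ratioX (q : ℝ) (b : ℂ) (ν : ℕ) : ℂ[X] := C (qPoch q b ν)⁻¹ * pochX q b ν

theorem eval_ratioX (b y : ℂ) (ν : ℕ) :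
    (ratioX q b ν).eval y = qPoch q (b * y) ν / qPoch q b ν := by
  simp [ratioX, eval_pochX]
  ring

theorem natDegree_ratioX_le (b : ℂ) (ν : ℕ) : (ratioX q b ν).natDegree ≤ ν := by
  unfold ratioX pochX
  refine (Polynomial.natDegree_C_mul_le _ _).trans ?_
  refine (Polynomial.natDegree_prod_le _ _).trans ?_
  refine (Finset.sum_le_sum fun i _ => (?_ : _ ≤ 1)).trans (by simp)
  compute_degree

theorem eval_ratioX_succ (b : ℂ) (ν k : ℕ) :
    (ratioX q b ν).eval ((q : ℂ) ^ (k + 1)) * (1 - b * (q : ℂ) ^ k) =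
      (ratioX q b ν).eval ((q : ℂ) ^ k) * (1 - b * (q : ℂ) ^ ν * (q : ℂ) ^ k) := by
  rw [eval_ratioX, eval_ratioX]
  have h1 := qPoch_succ q (b * (q : ℂ) ^ k) ν
  rw [qPoch_succ', mul_assoc b, ← pow_succ] at h1
  linear_combination (qPoch q b ν)⁻¹ * h1

/-- The product of the two ratios in the coefficients of `S_λ`, as a polynomial in `q^k`. -/
def sepR (q g : ℝ) (lam : Fin 3 → ℤ) : Polynomial ℂ :=
  ratioX q (sepB₁ q g lam) (lam 2 - lam 1).toNat * ratioX q (sepB₂ q g lam) (lam 1 - lam 0).toNat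

/-- The polynomial `y^{-λ₁} S_λ(y)`. -/
def sepCore (q g : ℝ) (lam : Fin 3 → ℤ) : Polynomial ℂ :=
  sepX q (sepA₁ q g lam) (lam 2 - lam 0).toNat (sepR q g lam)

/-- The Laurent polynomial `S_λ`. -/
def sepLaurent (q g : ℝ) (lam : Fin 3 → ℤ) : ℂ[T;T⁻¹] :=
  LaurentPolynomial.T (lam 0) * Polynomial.toLaurent (sepCore q g lam)

theorem ev_sepLaurent (g : ℝ) (lam : Fin 3 → ℤ) {y : ℂ} (hy : y ≠ 0) :
    ev (sepLaurent q g lam) y = y ^ lam 0 * (sepCore q g lam).eval y := by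
  rw [sepLaurent, ev_mul _ _ hy, ev_T, ev_toLaurent _ hy]

theorem natDegree_sepR_le (g : ℝ) {lam : Fin 3 → ℤ} (hlam : Monotone lam) :
    (sepR q g lam).natDegree ≤ (lam 2 - lam 0).toNat := by
  have e₁ : lam 1 ≤ lam 2 := hlam (by decide)
  have e₀ : lam 0 ≤ lam 1 := hlam (by decide)
  refine Polynomial.natDegree_mul_le.trans ?_
  have h1 := natDegree_ratioX_le (q := q) (sepB₁ q g lam) (lam 2 - lam 1).toNat
  have h2 := natDegree_ratioX_le (q := q) (sepB₂ q g lam) (lam 1 - lam 0).toNat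
  omega

theorem sepA₁_mul (hq0 : 0 < q) (g : ℝ) {lam : Fin 3 → ℤ} (hlam : Monotone lam) :
    sepA₁ q g lam * (q : ℂ) ^ (lam 2 - lam 0).toNat = (ell q g : ℂ) ^ 3 * q := by
  have hqc : (q : ℂ) ≠ 0 := ofReal_ne_zero_of_pos hq0
  have e₁ : lam 0 ≤ lam 2 := hlam (by decide)
  rw [sepA₁, mul_assoc, ← zpow_natCast (q : ℂ), ← zpow_add₀ hqc]
  congr 1
  rw [show 1 - (lam 2 - lam 0) + (((lam 2 - lam 0).toNat : ℕ) : ℤ) = 1 by omega, zpow_one]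

theorem ell_cube_mul (hq0 : 0 < q) (g : ℝ) :
    (ell q g : ℂ) ^ 3 * q = (q : ℂ) ^ (1 - 3 * g : ℂ) := by
  have hqc : (q : ℂ) ≠ 0 := ofReal_ne_zero_of_pos hq0
  have h1 := ellPow_intCast (q := q) g 3
  rw [ellPow_eq_cpow hq0] at h1
  rw [show (ell q g : ℂ) ^ 3 = (ell q g : ℂ) ^ (3 : ℤ) from rfl, ← h1, sub_eq_add_neg,
    Complex.cpow_add _ _ hqc, Complex.cpow_one, mul_comm]
  congr 2
  push_cast
  ring

theorem one_le_norm_ell_mul {g : ℝ} (hq0 : 0 < q) (hq1 : q < 1) (hg : 0 < g) {k : ℕ}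
    {n : ℤ} (hn : n ≤ 0) : (ell q g : ℂ) ^ (k + 1) * (q : ℂ) ^ n ≠ 1 := by
  intro h
  have h1 : 1 < ell q g := by
    rw [ell]; exact Real.one_lt_rpow_of_pos_of_lt_one_of_neg hq0 hq1 (by linarith)
  have h2 := congrArg norm h
  rw [norm_mul, norm_pow, norm_zpow, Complex.norm_real, Complex.norm_real, norm_one,
    Real.norm_of_nonneg hq0.le, Real.norm_of_nonneg (zero_le_one.trans h1.le)] at h2
  have h3 : 1 < ell q g ^ (k + 1) := one_lt_pow₀ h1 (by omega)
  have h4 : 1 ≤ q ^ n := one_le_zpow_of_nonpos₀ hq0 hq1.le hn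
  nlinarith

theorem qPoch_sep_ne_zero (hq0 : 0 < q) (hq1 : q < 1) {g : ℝ} (hg : 0 < g) (k : ℕ) {d : ℤ} {n : ℕ}
    (hn : (n : ℤ) ≤ d) : qPoch q ((ell q g : ℂ) ^ (k + 1) * (q : ℂ) ^ (1 - d)) n ≠ 0 := by
  have hqc : (q : ℂ) ≠ 0 := ofReal_ne_zero_of_pos hq0
  unfold qPoch
  refine Finset.prod_ne_zero_iff.2 fun i hi => sub_ne_zero.2 ?_
  rw [mul_assoc, ← zpow_natCast (q : ℂ) i, ← zpow_add₀ hqc]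
  have := Finset.mem_range.1 hi
  exact (one_le_norm_ell_mul hq0 hq1 hg (by omega)).symm

section
variable {g : ℝ} {lam : Fin 3 → ℤ}

theorem qPoch_sepB₁_ne_zero (hq0 : 0 < q) (hq1 : q < 1) (hg : 0 < g) (hlam : Monotone lam) :
    qPoch q (sepB₁ q g lam) (lam 2 - lam 1).toNat ≠ 0 := by
  have e₁ : lam 1 ≤ lam 2 := hlam (by decide)
  have e₀ : lam 0 ≤ lam 1 := hlam (by decide)
  exact qPoch_sep_ne_zero hq0 hq1 hg 1 (by omega)

theorem qPoch_sepB₂_ne_zero (hq0 : 0 < q) (hq1 : q < 1) (hg : 0 < g) (hlam : Monotone lam) :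
    qPoch q (sepB₂ q g lam) (lam 1 - lam 0).toNat ≠ 0 := by
  have e₀ : lam 0 ≤ lam 1 := hlam (by decide)
  have := qPoch_sep_ne_zero hq0 hq1 hg 0 (d := lam 1 - lam 0) (n := (lam 1 - lam 0).toNat)
    (by omega)
  rwa [zero_add, pow_one] at this

theorem isSepPoly_sepLaurent (hq0 : 0 < q) (hq1 : q < 1) (g : ℝ) (hlam : Monotone lam) :
    IsSepPoly q g lam (sepLaurent q g lam) := by
  intro y hy hy1 hne
  have h := (hasSum_sepX hq0 hq1 (sepA₁ q g lam) (natDegree_sepR_le (q := q) g hlam) hy1).tsum_eq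
  rw [sepA₁_mul hq0 g hlam, ell_cube_mul hq0] at h
  have hs : sepSeries q g lam y = ∑' k : ℕ, qPoch q (sepA₁ q g lam) k / qPoch q q k *
      (sepR q g lam).eval ((q : ℂ) ^ k) * y ^ k := by
    unfold sepSeries
    refine tsum_congr fun k => ?_
    rw [sepR, Polynomial.eval_mul, eval_ratioX, eval_ratioX]
    rfl
  have hy0 : qInf q y ≠ 0 := by
    rw [Ne, qInf_eq_zero_iff hq0 hq1]
    rintro ⟨k, hk⟩
    exact mul_pow_ne_one_of_norm_lt hq0 hq1 hy1 k hk
  rw [hs, h, ev_sepLaurent g lam hy, qPochC, sepCore]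
  field_simp

/-- Uniqueness of `S_λ`: the points `-q^{n+1}` satisfy the conditions under which its values are
prescribed, whatever `g` is. -/
theorem eq_of_isSepPoly (hq0 : 0 < q) (hq1 : q < 1) {S S' : ℂ[T;T⁻¹]} (hS : IsSepPoly q g lam S)
    (hS' : IsSepPoly q g lam S') : S = S' := by
  have hinj : Function.Injective fun n : ℕ => -((q : ℂ) ^ (n + 1)) := by
    intro m n h
    have h1 : (q : ℂ) ^ (m + 1) = (q : ℂ) ^ (n + 1) := neg_injective h
    have h2 : q ^ (m + 1) = q ^ (n + 1) := by exact_mod_cast h1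
    have := pow_right_injective₀ hq0 hq1.ne h2
    omega
  refine ev_injOn (Set.infinite_range_of_injective hinj) ?_
  rintro _ ⟨n, rfl⟩ hz
  have h1 : ‖-((q : ℂ) ^ (n + 1))‖ < 1 := by
    rw [norm_neg, norm_pow]
    exact pow_lt_one₀ (norm_nonneg _) (norm_ofReal_lt_one hq0 hq1) (by omega)
  have h2 : qInf q ((q : ℂ) ^ (1 - 3 * g : ℂ) * -((q : ℂ) ^ (n + 1))) ≠ 0 := by
    rw [Ne, qInf_eq_zero_iff hq0 hq1]
    rintro ⟨k, hk⟩
    rw [← ell_cube_mul hq0] at hk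
    have h3 : ell q g ^ 3 * q * -(q ^ (n + 1)) * q ^ k = 1 := by exact_mod_cast hk
    have h4 := ell_pos hq0 g
    have h5 : 0 < ell q g ^ 3 * q * q ^ (n + 1) * q ^ k := by positivity
    linarith
  rw [hS _ hz h1 h2, hS' _ hz h1 h2]

/-- The normalized values of `S_λ` at the points `q^{-m}`. -/
def sepNode (q g : ℝ) (lam : Fin 3 → ℤ) : ℕ → ℂ
  | 0 => 0
  | 1 => 0
  | m + 2 => qPoch q (ellInv q g ^ 3) m / qPoch q q m * ev (sepLaurent q g lam) ((q : ℂ) ^ m)⁻¹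

theorem eigenvalue_one (q g : ℝ) (lam : Fin 3 → ℤ) : eigenvalue q g 1 lam =
    (q : ℂ) ^ lam 0 * ell q g + (q : ℂ) ^ lam 1 + (q : ℂ) ^ lam 2 * (ell q g : ℂ)⁻¹ := by
  have h : Finset.powersetCard 1 (Finset.univ : Finset (Fin 3)) = {{0}, {1}, {2}} := by decide
  unfold eigenvalue
  rw [h, Finset.sum_insert (by decide), Finset.sum_insert (by decide), Finset.sum_singleton]
  simp only [Finset.prod_singleton]
  rw [show (1 : ℤ) - (((0 : Fin 3) : ℕ) : ℤ) = 1 by decide,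
    show (1 : ℤ) - (((1 : Fin 3) : ℕ) : ℤ) = 0 by decide,
    show (1 : ℤ) - (((2 : Fin 3) : ℕ) : ℤ) = -1 by decide, zpow_one, zpow_zero, zpow_neg_one]
  ring

theorem eigenvalue_two (hq0 : 0 < q) (g : ℝ) (lam : Fin 3 → ℤ) : eigenvalue q g 2 lam =
    (q : ℂ) ^ lam 0 * (q : ℂ) ^ lam 1 * ell q g + (q : ℂ) ^ lam 0 * (q : ℂ) ^ lam 2 +
      (q : ℂ) ^ lam 1 * (q : ℂ) ^ lam 2 * (ell q g : ℂ)⁻¹ := by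
  have h : Finset.powersetCard 2 (Finset.univ : Finset (Fin 3)) = {{0, 1}, {0, 2}, {1, 2}} := by
    decide
  have h0 : (ell q g : ℂ) ≠ 0 := by exact_mod_cast (ell_pos hq0 g).ne'
  unfold eigenvalue
  rw [h, Finset.sum_insert (by decide), Finset.sum_insert (by decide), Finset.sum_singleton,
    Finset.prod_pair (by decide), Finset.prod_pair (by decide), Finset.prod_pair (by decide)]
  rw [show (1 : ℤ) - (((0 : Fin 3) : ℕ) : ℤ) = 1 by decide,
    show (1 : ℤ) - (((1 : Fin 3) : ℕ) : ℤ) = 0 by decide,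
    show (1 : ℤ) - (((2 : Fin 3) : ℕ) : ℤ) = -1 by decide, zpow_one, zpow_zero, zpow_neg_one]
  field_simp
  ring

theorem eigenvalue_three (hq0 : 0 < q) (g : ℝ) (lam : Fin 3 → ℤ) : eigenvalue q g 3 lam =
    (q : ℂ) ^ lam 0 * (q : ℂ) ^ lam 1 * (q : ℂ) ^ lam 2 := by
  have h : Finset.powersetCard 3 (Finset.univ : Finset (Fin 3)) = {Finset.univ} := by decide
  have h0 : (ell q g : ℂ) ≠ 0 := by exact_mod_cast (ell_pos hq0 g).ne'
  unfold eigenvalue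
  rw [h, Finset.sum_singleton, Fin.prod_univ_three]
  rw [show (1 : ℤ) - (((0 : Fin 3) : ℕ) : ℤ) = 1 by decide,
    show (1 : ℤ) - (((1 : Fin 3) : ℕ) : ℤ) = 0 by decide,
    show (1 : ℤ) - (((2 : Fin 3) : ℕ) : ℤ) = -1 by decide, zpow_one, zpow_zero, zpow_neg_one]
  field_simp

/-- The values of `S_λ` satisfy the recurrence of the node sums: its coefficients are those of the
`q`-difference equation of the `₃φ₂`, once the powers `q^{λ₁ m}` are taken into account. -/
theorem isNodeRec_sepNode (hq0 : 0 < q) (hq1 : q < 1) (g : ℝ) (hlam : Monotone lam) :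
    IsNodeRec q (ellInv q g) (fun i => eigenvalue q g i lam) (sepNode q g lam) := by
  have hqc : (q : ℂ) ≠ 0 := ofReal_ne_zero_of_pos hq0
  have e₁ : lam 1 ≤ lam 2 := hlam (by decide)
  have e₀ : lam 0 ≤ lam 1 := hlam (by decide)
  have hL : (ell q g : ℂ) ≠ 0 := by exact_mod_cast (ell_pos hq0 g).ne'
  have ha : sepA₁ q g lam ≠ 0 := mul_ne_zero (pow_ne_zero _ hL) (zpow_ne_zero _ hqc)
  refine ⟨rfl, rfl, fun M => ?_⟩
  have key := sepSeq_recurrence (N := (lam 2 - lam 0).toNat) hq0 hq1 ha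
    (natDegree_sepR_le g hlam) (b₁ := sepB₁ q g lam)
    (b₂ := sepB₂ q g lam) (a₂ := sepB₁ q g lam * (q : ℂ) ^ (lam 2 - lam 1).toNat)
    (a₃ := sepB₂ q g lam * (q : ℂ) ^ (lam 1 - lam 0).toNat) (fun k => by
      rw [sepR, Polynomial.eval_mul, Polynomial.eval_mul]
      have h1 := eval_ratioX_succ (q := q) (sepB₁ q g lam) (lam 2 - lam 1).toNat k
      have h2 := eval_ratioX_succ (q := q) (sepB₂ q g lam) (lam 1 - lam 0).toNat k
      rw [mul_mul_mul_comm, h1, h2]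
      ring) M
  have hA : (q : ℂ) ^ lam 0 ≠ 0 := zpow_ne_zero _ hqc
  have hs : ∀ n, sepNode q g lam n = ((q : ℂ) ^ lam 0) ^ 2 / ((q : ℂ) ^ lam 0) ^ n *
      sepSeq q (sepA₁ q g lam) (lam 2 - lam 0).toNat (sepR q g lam) n := by
    intro n
    rcases n with _ | _ | n
    · simp [sepNode, sepSeq]
    · simp [sepNode, sepSeq]
    · have e1 : (q : ℂ) / ((ell q g : ℂ) ^ 3 * q) = ellInv q g ^ 3 := by
        rw [ellInv]; field_simp
      have e2 : (((q : ℂ) ^ n)⁻¹) ^ lam 0 = (((q : ℂ) ^ lam 0) ^ n)⁻¹ := by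
        rw [inv_zpow, ← zpow_natCast, ← zpow_natCast, ← zpow_mul, ← zpow_mul, mul_comm]
      rw [sepNode, sepSeq, ev_sepLaurent g lam (inv_ne_zero (pow_ne_zero n hqc)),
        sepA₁_mul hq0 g hlam, e1, e2, sepCore]
      field_simp
      ring
  rw [hs, hs, hs, hs]
  have b1 : sepB₁ q g lam = (ell q g : ℂ) ^ 2 * q * (q : ℂ) ^ lam 0 / (q : ℂ) ^ lam 2 := by
    rw [sepB₁, zpow_sub₀ hqc, zpow_sub₀ hqc, zpow_one]; field_simp
  have b2 : sepB₂ q g lam = (ell q g : ℂ) * q * (q : ℂ) ^ lam 0 / (q : ℂ) ^ lam 1 := by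
    rw [sepB₂, zpow_sub₀ hqc, zpow_sub₀ hqc, zpow_one]; field_simp
  have a1 : sepA₁ q g lam = (ell q g : ℂ) ^ 3 * q * (q : ℂ) ^ lam 0 / (q : ℂ) ^ lam 2 := by
    rw [sepA₁, zpow_sub₀ hqc, zpow_sub₀ hqc, zpow_one]; field_simp
  have hB1 : (q : ℂ) ^ lam 1 ≠ 0 := zpow_ne_zero _ hqc
  have hC : (q : ℂ) ^ lam 2 ≠ 0 := zpow_ne_zero _ hqc
  have a2 : sepB₁ q g lam * (q : ℂ) ^ (lam 2 - lam 1).toNat =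
      (ell q g : ℂ) ^ 2 * q * (q : ℂ) ^ lam 0 / (q : ℂ) ^ lam 1 := by
    rw [b1, ← zpow_natCast (q : ℂ), Int.toNat_of_nonneg (by omega), zpow_sub₀ hqc]; field_simp
  have a3 : sepB₂ q g lam * (q : ℂ) ^ (lam 1 - lam 0).toNat = (ell q g : ℂ) * q := by
    rw [b2, ← zpow_natCast (q : ℂ), Int.toNat_of_nonneg (by omega), zpow_sub₀ hqc]; field_simp
  rw [sepA₁_mul hq0 g hlam, a2, a3] at key
  generalize sepSeq q (sepA₁ q g lam) (lam 2 - lam 0).toNat (sepR q g lam) = s at *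
  rw [b1, b2, a1] at key
  rw [eigenvalue_one, eigenvalue_two hq0, eigenvalue_three hq0, ellInv]
  simp only [recW, symb] at key ⊢
  generalize ((q : ℂ) ^ (M + 1))⁻¹ = Q at *
  clear hs a2 a3 b1 b2 a1 ha hlam e₀ e₁
  generalize (q : ℂ) ^ lam 0 = A at *
  generalize (q : ℂ) ^ lam 1 = B at *
  generalize (q : ℂ) ^ lam 2 = D at *
  generalize (ell q g : ℂ) = L at *
  generalize (q : ℂ) = p at *
  rw [pow_add A M 3, pow_add A M 2, pow_succ A M]
  have hAM : A ^ M ≠ 0 := pow_ne_zero _ hA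
  generalize A ^ M = X at *
  generalize s (M + 3) = s0 at *
  generalize s (M + 2) = s1 at *
  generalize s (M + 1) = s2 at *
  generalize s M = s3 at *
  field_simp at key ⊢
  linear_combination key

theorem eval_sepCore_one (q g : ℝ) (lam : Fin 3 → ℤ) : (sepCore q g lam).eval 1 =
    qPoch q (sepA₁ q g lam) (lam 2 - lam 0).toNat /
      (qPoch q (sepB₁ q g lam) (lam 2 - lam 1).toNat *
        qPoch q (sepB₂ q g lam) (lam 1 - lam 0).toNat) := by
  have h1 : ∀ b : ℂ, ∀ ν : ℕ, (ratioX q b ν).eval 0 = (qPoch q b ν)⁻¹ := fun b ν => by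
    rw [eval_ratioX, mul_zero]
    simp [qPoch]
  rw [sepCore, eval_sepX, Finset.sum_range_succ', Finset.sum_eq_zero fun i _ => ?_]
  · rw [Polynomial.coeff_zero_eq_eval_zero, sepR, Polynomial.eval_mul, h1, h1, qPoch_zero,
      pow_zero, Nat.sub_zero, mul_one, mul_one, zero_add]
    ring
  · rw [qPoch_succ', sub_self]
    simp

theorem eval_sepCore_zero (hq0 : 0 < q) (hq1 : q < 1) (hg : 0 < g) (hlam : Monotone lam) :
    (sepCore q g lam).eval 0 = 1 := by
  have h0 : ∀ n, qPoch q 0 n = 1 := fun n => by simp [qPoch]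
  have h1 := Polynomial.eval_eq_sum_range' (Nat.lt_succ_of_le (natDegree_sepR_le (q := q) g hlam)) 1
  rw [sepCore, eval_sepX]
  simp only [mul_zero, h0, mul_one, one_pow] at h1 ⊢
  rw [← h1, sepR, Polynomial.eval_mul, eval_ratioX, eval_ratioX, mul_one, mul_one,
    div_self (qPoch_sepB₁_ne_zero hq0 hq1 hg hlam), div_self (qPoch_sepB₂_ne_zero hq0 hq1 hg hlam),
    mul_one]

theorem ev_sepLaurent_one (q g : ℝ) (lam : Fin 3 → ℤ) : ev (sepLaurent q g lam) 1 =
    qPoch q (sepA₁ q g lam) (lam 2 - lam 0).toNat /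
      (qPoch q (sepB₁ q g lam) (lam 2 - lam 1).toNat *
        qPoch q (sepB₂ q g lam) (lam 1 - lam 0).toNat) := by
  rw [ev_sepLaurent g lam one_ne_zero, one_zpow, one_mul, eval_sepCore_one]

theorem ev_sepLaurent_one_ne_zero (hq0 : 0 < q) (hq1 : q < 1) (hg : 0 < g) (hlam : Monotone lam) :
    ev (sepLaurent q g lam) 1 ≠ 0 := by
  rw [ev_sepLaurent_one]
  have e₀ : lam 0 ≤ lam 2 := hlam (by decide)
  exact div_ne_zero (qPoch_sep_ne_zero hq0 hq1 hg 2 (by omega))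
    (mul_ne_zero (qPoch_sepB₁_ne_zero hq0 hq1 hg hlam) (qPoch_sepB₂_ne_zero hq0 hq1 hg hlam))

end

/-! ### Separation of variables -/

theorem infinite_range_neg_pow (hq0 : 0 < q) (hq1 : q < 1) :
    (Set.range fun n : ℕ => -((q : ℂ) ^ (n + 1))).Infinite := by
  refine Set.infinite_range_of_injective fun m n h => ?_
  have h1 : (q : ℂ) ^ (m + 1) = (q : ℂ) ^ (n + 1) := neg_injective h
  have h2 : q ^ (m + 1) = q ^ (n + 1) := by exact_mod_cast h1
  have := pow_right_injective₀ hq0 hq1.ne h2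
  omega

theorem infinite_range_inv_pow (hq0 : 0 < q) (hq1 : q < 1) :
    (Set.range fun n : ℕ => ((q : ℂ) ^ n)⁻¹).Infinite := by
  refine Set.infinite_range_of_injective fun m n h => ?_
  have h1 : (q : ℂ) ^ m = (q : ℂ) ^ n := inv_injective h
  have h2 : q ^ m = q ^ n := by exact_mod_cast h1
  exact pow_right_injective₀ hq0 hq1.ne h2

/-- The exceptional values of `z` are nonnegative reals, so the negative numbers `-q^{n+1}` avoid them. -/
theorem nodeRegular_neg_pow (hq0 : 0 < q) (g : ℝ) (n : ℕ) :
    NodeRegular q (ellInv q g) (-((q : ℂ) ^ (n + 1))) := by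
  have hqc : (q : ℂ) ≠ 0 := ofReal_ne_zero_of_pos hq0
  have hl := ell_pos hq0 g
  have he : ellInv q g = (((ell q g)⁻¹ : ℝ) : ℂ) := by rw [ellInv]; push_cast; rfl
  have he0 : 0 < (ell q g)⁻¹ := inv_pos.2 hl
  refine ⟨neg_ne_zero.2 (pow_ne_zero _ hqc), fun i j h => ?_, fun i h => ?_⟩
  · rw [he] at h
    have h1 : (ell q g)⁻¹ * q ^ i - -(q ^ (n + 1)) * q ^ j = 0 := by exact_mod_cast h
    have : 0 < (ell q g)⁻¹ * q ^ i := by positivity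
    have : 0 < q ^ (n + 1) * q ^ j := by positivity
    linarith
  · rw [he] at h
    have h1 : -(q ^ (n + 1)) - (ell q g)⁻¹ ^ 2 * q ^ i = 0 := by exact_mod_cast h
    have : 0 < (ell q g)⁻¹ ^ 2 * q ^ i := by positivity
    have : 0 < q ^ (n + 1) := by positivity
    linarith

theorem isNodeRec_nodeSum (hq0 : 0 < q) (hq1 : q < 1) {g : ℝ} (hg : 0 < g)
    {x z : ℂ} (hx : x ≠ 0) (hz : NodeRegular q (ellInv q g) z) (P : Laurent3) {h : ℕ → ℂ}
    (hP : ∀ i : ℕ, 1 ≤ i → i ≤ 3 → ∀ t : Fin 3 → ℂ, (∀ j, t j ≠ 0) → Function.Injective t →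
      hamiltonian q g i (fun u => ev3 P (u 0) (u 1) (u 2)) t = h i * ev3 P (t 0) (t 1) (t 2)) :
    IsNodeRec q (ellInv q g) h (nodeSum q (ellInv q g) z x P) :=
  ⟨nodeSum_zero _ _ _ _, nodeSum_one _ _ _ _, nodeSum_recurrence hq0 hq1 hg rfl hx hz P hP⟩

section
variable (hq0 : 0 < q) (hq1 : q < 1) {g : ℝ} (hg : 0 < g) {lam : Fin 3 → ℤ}

/-- The image of an eigenfunction at the points `(q^{-m}, y₂, x)` is proportional to
`S_λ(q^{-m})`, as both satisfy the same recurrence in `m`. -/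
theorem symM_eigen_mul (hlam : Monotone lam) (P : Sym12)
    (hP : ∀ i : ℕ, 1 ≤ i → i ≤ 3 → ∀ t : Fin 3 → ℂ, (∀ j, t j ≠ 0) → Function.Injective t →
      hamiltonian q g i (fun u => ev3 P (u 0) (u 1) (u 2)) t =
        eigenvalue q g i lam * ev3 P (t 0) (t 1) (t 2))
    {y z x : ℂ} (hy : y ≠ 0) (hz : z ≠ 0) (hx : x ≠ 0) :
    ev3 (symM hq0 hq1 hg P) y z x * ev (sepLaurent q g lam) 1 =
      ev (sepLaurent q g lam) y * ev3 (symM hq0 hq1 hg P) 1 z x := by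
  have hqc : (q : ℂ) ≠ 0 := ofReal_ne_zero_of_pos hq0
  obtain ⟨Φ, hΦ⟩ : ∃ Φ, Φ = symM hq0 hq1 hg P := ⟨_, rfl⟩
  rw [← hΦ]
  have h3 : eigenvalue q g 3 lam ≠ 0 := by
    rw [eigenvalue_three hq0]
    exact mul_ne_zero (mul_ne_zero (zpow_ne_zero _ hqc) (zpow_ne_zero _ hqc)) (zpow_ne_zero _ hqc)
  -- the claim at `y = q^{-m}` and `z = -q^{n+1}`, from which it is extended to all `y` and then to all
  -- `z`, since Laurent polynomials are determined by their values on an infinite set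
  have hreg : ∀ (m n : ℕ), ev3 Φ ((q : ℂ) ^ m)⁻¹ (-((q : ℂ) ^ (n + 1))) x *
      ev (sepLaurent q g lam) 1 = ev (sepLaurent q g lam) ((q : ℂ) ^ m)⁻¹ *
        ev3 Φ 1 (-((q : ℂ) ^ (n + 1))) x := by
    intro m n
    have hr := nodeRegular_neg_pow hq0 g n
    obtain ⟨w, hw⟩ : ∃ w, w = -((q : ℂ) ^ (n + 1)) := ⟨_, rfl⟩
    rw [← hw] at hr ⊢
    have hprop := (isNodeRec_nodeSum hq0 hq1 hg hx hr P hP).proportional hq0 hq1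
      (isNodeRec_sepNode hq0 hq1 g hlam) h3 (m + 2)
    have hd := fun m => symM_discrete hq0 hq1 hg rfl P m hx hr.1 hr.2.1
    simp only [← nodeSum_add_two hq0, ← hΦ] at hd
    have hd0 := hd 0
    rw [zero_add] at hd0
    rw [← hd, ← hd0] at hprop
    have e0 : sepNode q g lam 2 = ev (sepLaurent q g lam) 1 := by
      have : sepNode q g lam 2 = qPoch q (ellInv q g ^ 3) 0 / qPoch q q 0 *
        ev (sepLaurent q g lam) ((q : ℂ) ^ 0)⁻¹ := rfl
      rw [this, qPoch_zero, qPoch_zero, pow_zero, inv_one, div_one, one_mul]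
    have em : sepNode q g lam (m + 2) = qPoch q (ellInv q g ^ 3) m / qPoch q q m *
      ev (sepLaurent q g lam) ((q : ℂ) ^ m)⁻¹ := rfl
    have c1 : ellInv q g - w ≠ 0 := by simpa using hr.2.1 0 0
    have c2 : qPoch q (ellInv q g ^ 3) m ≠ 0 :=
      qPoch_ne_zero (fun k => ellInv_pow_mul_pow_ne_one hq0 hq1 hg 2 k) m
    have c3 := qPoch_self_ne_zero hq0 hq1 m
    rw [e0, em, qPoch_zero, qPoch_zero, pow_zero, inv_one] at hprop
    have hc : (ellInv q g - w) * (qPoch q (ellInv q g ^ 3) m / qPoch q q m) ≠ 0 :=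
      mul_ne_zero c1 (div_ne_zero c2 c3)
    refine mul_left_cancel₀ hc ?_
    linear_combination hprop
  have hreg' : ∀ n : ℕ, ev3 Φ y (-((q : ℂ) ^ (n + 1))) x *
      ev (sepLaurent q g lam) 1 = ev (sepLaurent q g lam) y *
        ev3 Φ 1 (-((q : ℂ) ^ (n + 1))) x := by
    intro n
    obtain ⟨w, hw⟩ : ∃ w, w = -((q : ℂ) ^ (n + 1)) := ⟨_, rfl⟩
    have hw0 : w ≠ 0 := hw ▸ neg_ne_zero.2 (pow_ne_zero _ hqc)
    have hr := fun m => hreg m n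
    rw [← hw] at hr ⊢
    have hF := fun (y : ℂ) (hy : y ≠ 0) =>
      ev_substZ 1 (Units.mk0 w hw0) (Units.mk0 x hx) 1 0 0 (Φ : Laurent3) hy
    simp only [Units.val_one, Units.val_mk0, zpow_zero, zpow_one, one_mul, mul_one] at hF
    have := ev_injOn (f := ev (sepLaurent q g lam) 1 •
        substZ 1 (Units.mk0 w hw0) (Units.mk0 x hx) 1 0 0 (Φ : Laurent3))
      (g := ev3 Φ 1 w x • sepLaurent q g lam) (infinite_range_inv_pow hq0 hq1) (by
        rintro _ ⟨m, rfl⟩ hm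
        rw [ev_smul _ _ hm, ev_smul _ _ hm, hF _ hm]
        linear_combination hr m)
    have h4 := congrArg (fun f => ev f y) this
    simp only [ev_smul _ _ hy, hF _ hy] at h4
    linear_combination h4
  have hF := fun (u z : ℂ) (hu : u ≠ 0) (hz : z ≠ 0) =>
    ev_substZ (Units.mk0 u hu) 1 (Units.mk0 x hx) 0 1 0 (Φ : Laurent3) hz
  simp only [Units.val_one, Units.val_mk0, zpow_zero, zpow_one, one_mul, mul_one] at hF
  have := ev_injOn (f := ev (sepLaurent q g lam) 1 •
      substZ (Units.mk0 y hy) 1 (Units.mk0 x hx) 0 1 0 (Φ : Laurent3))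
    (g := ev (sepLaurent q g lam) y •
      substZ (Units.mk0 1 one_ne_zero) 1 (Units.mk0 x hx) 0 1 0 (Φ : Laurent3))
    (infinite_range_neg_pow hq0 hq1) (by
      rintro _ ⟨n, rfl⟩ hm
      rw [ev_smul _ _ hm, ev_smul _ _ hm, hF _ _ hy hm, hF _ _ one_ne_zero hm]
      linear_combination hreg' n)
  have h4 := congrArg (fun f => ev f z) this
  simp only [ev_smul _ _ hz, hF _ _ hy hz, hF _ _ one_ne_zero hz] at h4
  linear_combination h4

/-- `M P` at `y₁ = 1` is a value of `P`: the case `m = 0` of the discrete formula, which has one node. -/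
theorem symM_one (P : Sym12) {z x : ℂ} (hz : z ≠ 0) (hx : x ≠ 0) :
    ev3 (symM hq0 hq1 hg P) 1 z x =
      ev3 P (ell q g * x) ((ell q g : ℂ) ^ 2 * x * z) x := by
  have hl : (ell q g : ℂ) ≠ 0 := by exact_mod_cast (ell_pos hq0 g).ne'
  have a0 : (ell q g : ℂ) * x ≠ 0 := mul_ne_zero hl hx
  have b0 : (ell q g : ℂ) ^ 2 * x ≠ 0 := mul_ne_zero (pow_ne_zero 2 hl) hx
  have hF := fun (z : ℂ) (hz : z ≠ 0) =>
    ev_substZ 1 1 (Units.mk0 x hx) 0 1 0 (symM hq0 hq1 hg P : Laurent3) hz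
  have hG := fun (z : ℂ) (hz : z ≠ 0) =>
    ev_substZ (Units.mk0 _ a0) (Units.mk0 _ b0) (Units.mk0 x hx) 0 1 0 (P : Laurent3) hz
  simp only [Units.val_one, Units.val_mk0, zpow_zero, zpow_one, one_mul, mul_one] at hF hG
  have := ev_injOn (f := substZ 1 1 (Units.mk0 x hx) 0 1 0 (symM hq0 hq1 hg P : Laurent3))
    (g := substZ (Units.mk0 _ a0) (Units.mk0 _ b0) (Units.mk0 x hx) 0 1 0 (P : Laurent3))
    (infinite_range_neg_pow hq0 hq1) (by
      rintro _ ⟨n, rfl⟩ hm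
      rw [hF _ hm, hG _ hm]
      have hr := nodeRegular_neg_pow hq0 g n
      have c1 : ellInv q g - -((q : ℂ) ^ (n + 1)) ≠ 0 := by simpa using hr.2.1 0 0
      have hd := symM_discrete hq0 hq1 hg rfl P 0 hx hm hr.2.1
      simp only [Finset.Nat.antidiagonal_zero, Finset.sum_singleton, qPoch_zero, pow_zero,
        inv_one, div_one, mul_one, nodeW, nodeF, nodeG, Finset.range_zero, Finset.prod_empty,
        one_mul] at hd
      have h1 := mul_left_cancel₀ c1 hd
      rw [h1, ellInv]
      congr 1
      · field_simp
      · field_simp)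
  rw [← hF z hz, ← hG z hz, this]

/-- The restriction of `P` to the line `(ℓ, ℓ²y, 1)` is a multiple of `S_λ`, and `M P` factorizes. -/
theorem symM_eigen (hlam : Monotone lam) (P : Sym12) {d : ℤ}
    (hd : ∀ c u v w : ℂ, c ≠ 0 → u ≠ 0 → v ≠ 0 → w ≠ 0 →
      ev3 P (c * u) (c * v) (c * w) = c ^ d * ev3 P u v w)
    (hP : ∀ i : ℕ, 1 ≤ i → i ≤ 3 → ∀ t : Fin 3 → ℂ, (∀ j, t j ≠ 0) → Function.Injective t →
      hamiltonian q g i (fun u => ev3 P (u 0) (u 1) (u 2)) t =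
        eigenvalue q g i lam * ev3 P (t 0) (t 1) (t 2)) :
    ∃ κ : ℂ, (∀ z : ℂ, z ≠ 0 → ev3 P (ell q g) ((ell q g : ℂ) ^ 2 * z) 1 =
        κ * ev (sepLaurent q g lam) z) ∧
      ∀ y z x : ℂ, y ≠ 0 → z ≠ 0 → x ≠ 0 →
        ev3 (symM hq0 hq1 hg P) y z x = κ / ev (sepLaurent q g lam) 1 * x ^ d *
          (ev (sepLaurent q g lam) y * ev (sepLaurent q g lam) z) := by
  have hl : (ell q g : ℂ) ≠ 0 := by exact_mod_cast (ell_pos hq0 g).ne'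
  have hS1 := ev_sepLaurent_one_ne_zero hq0 hq1 hg hlam
  have hmul := fun {y z x : ℂ} (hy : y ≠ 0) (hz : z ≠ 0) (hx : x ≠ 0) =>
    symM_eigen_mul hq0 hq1 hg hlam P hP hy hz hx
  have hone : ∀ {z x : ℂ}, z ≠ 0 → x ≠ 0 → ev3 (symM hq0 hq1 hg P) 1 z x =
      x ^ d * ev3 P (ell q g) ((ell q g : ℂ) ^ 2 * z) 1 := by
    intro z x hz hx
    rw [symM_one hq0 hq1 hg P hz hx, ← hd x _ _ _ hx hl (mul_ne_zero (pow_ne_zero 2 hl) hz)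
      one_ne_zero, mul_one, mul_comm _ x, mul_comm _ x, mul_assoc]
  have hsym := mem_Sym12_iff_ev3.1 (symM hq0 hq1 hg P).2
  -- the symmetry of `M P` in `y` and `z` turns the proportionality in `y` into one in `z`
  have hs : ∀ z : ℂ, z ≠ 0 → ev3 P (ell q g) ((ell q g : ℂ) ^ 2 * z) 1 =
      ev3 P (ell q g) ((ell q g : ℂ) ^ 2 * 1) 1 / ev (sepLaurent q g lam) 1 *
        ev (sepLaurent q g lam) z := by
    intro z hz
    have h1 := hmul hz one_ne_zero one_ne_zero
    rw [hsym _ _ _ one_ne_zero hz one_ne_zero, hone hz one_ne_zero,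
      hone one_ne_zero one_ne_zero, one_zpow, one_mul, one_mul] at h1
    rw [div_mul_eq_mul_div, eq_div_iff hS1]
    linear_combination h1
  refine ⟨_, hs, fun y z x hy hz hx => ?_⟩
  have h1 := hmul hy hz hx
  rw [hone hz hx, hs z hz] at h1
  refine mul_right_cancel₀ hS1 (h1.trans ?_)
  field_simp

end

/-! ### Coefficients of Macdonald polynomials -/

theorem coeff_monomialSym (μ n : Fin 3 → ℤ) : (monomialSym μ).coeff n =
    if ∃ σ : Equiv.Perm (Fin 3), μ ∘ σ = n then 1 else 0 := by
  unfold monomialSym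
  rw [AddMonoidAlgebra.coeff_sum, Finsupp.finsetSum_apply]
  simp only [AddMonoidAlgebra.coeff_single, Finsupp.single_apply]
  rw [Finset.sum_ite_eq']
  simp

theorem coeff_monomialSym_comp (μ n : Fin 3 → ℤ) (σ : Equiv.Perm (Fin 3)) :
    (monomialSym μ).coeff (n ∘ σ) = (monomialSym μ).coeff n := by
  rw [coeff_monomialSym, coeff_monomialSym]
  congr 1
  refine propext ⟨fun ⟨τ, hτ⟩ => ⟨σ⁻¹.trans τ, ?_⟩, fun ⟨τ, hτ⟩ => ⟨σ.trans τ, ?_⟩⟩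
  · funext i
    have := congrFun hτ (σ⁻¹ i)
    simpa using this
  · funext i
    have := congrFun hτ (σ i)
    simpa using this

theorem DomLE.le {μ lam : Fin 3 → ℤ} (h : DomLE μ lam) (hμ : Monotone μ) (i : Fin 3) :
    lam 0 ≤ μ i ∧ μ i ≤ lam 2 := by
  obtain ⟨h1, h2⟩ := h
  have a1 := h2 1
  have a2 := h2 2
  have e1 : Finset.Ici (1 : Fin 3) = {1, 2} := by decide
  have e2 : Finset.Ici (2 : Fin 3) = {2} := by decide
  rw [e1, Finset.sum_pair (by decide), Finset.sum_pair (by decide)] at a1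
  rw [e2, Finset.sum_singleton, Finset.sum_singleton] at a2
  rw [Fin.sum_univ_three, Fin.sum_univ_three] at h1
  have m0 : μ 0 ≤ μ i := hμ (Fin.zero_le i)
  have m2 : μ i ≤ μ 2 := hμ (Fin.le_last i)
  constructor <;> linarith

section
variable {g : ℝ} {lam : Fin 3 → ℤ} {P : Laurent3}

theorem IsMacdonald.coeff_comp (hP : IsMacdonald q g lam P) (n : Fin 3 → ℤ)
    (σ : Equiv.Perm (Fin 3)) : P.coeff (n ∘ σ) = P.coeff n := by
  obtain ⟨κ, -, -, rfl⟩ := hP.triangular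
  unfold Finsupp.sum
  simp [coeff_monomialSym_comp]

theorem IsMacdonald.mem_Sym12 (hP : IsMacdonald q g lam P) : P ∈ Sym12 :=
  fun n => hP.coeff_comp n (Equiv.swap 0 1)

theorem IsMacdonald.of_coeff_ne_zero (hP : IsMacdonald q g lam P) {n : Fin 3 → ℤ}
    (hn : P.coeff n ≠ 0) : ∑ j, n j = ∑ j, lam j ∧ ∀ i, lam 0 ≤ n i ∧ n i ≤ lam 2 := by
  obtain ⟨κ, hκ, -, rfl⟩ := hP.triangular
  unfold Finsupp.sum at hn
  rw [AddMonoidAlgebra.coeff_sum, Finsupp.finsetSum_apply] at hn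
  obtain ⟨μ, hμ, h1⟩ := Finset.exists_ne_zero_of_sum_ne_zero hn
  rw [AddMonoidAlgebra.coeff_smul, Finsupp.smul_apply, coeff_monomialSym] at h1
  obtain ⟨hm, hd⟩ := hκ μ hμ
  by_cases h2 : ∃ σ : Equiv.Perm (Fin 3), μ ∘ σ = n
  · obtain ⟨σ, rfl⟩ := h2
    refine ⟨?_, fun i => hd.le hm _⟩
    rw [← hd.1]
    exact Equiv.sum_comp σ μ
  · rw [if_neg h2] at h1
    simp at h1

theorem IsMacdonald.coeff_lam (hP : IsMacdonald q g lam P) (hlam : Monotone lam) :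
    P.coeff lam = 1 := by
  obtain ⟨κ, hκ, h1, rfl⟩ := hP.triangular
  unfold Finsupp.sum
  rw [AddMonoidAlgebra.coeff_sum, Finsupp.finsetSum_apply, Finset.sum_eq_single lam]
  · rw [AddMonoidAlgebra.coeff_smul, Finsupp.smul_apply, coeff_monomialSym,
      if_pos ⟨1, rfl⟩, h1, smul_eq_mul, mul_one]
  · intro μ hμ hne
    rw [AddMonoidAlgebra.coeff_smul, Finsupp.smul_apply, coeff_monomialSym, if_neg, smul_zero]
    rintro ⟨σ, hσ⟩
    refine hne ?_
    have := Tuple.unique_monotone (f := μ) (σ := 1) (τ := σ) (hκ μ hμ).1 (by rwa [hσ])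
    rw [hσ] at this
    exact this
  · intro h
    rw [Finsupp.mem_support_iff, not_not] at h
    simp [h]

theorem IsMacdonald.homogeneous (hP : IsMacdonald q g lam P) {c u v w : ℂ} (hc : c ≠ 0) :
    ev3 P (c * u) (c * v) (c * w) = c ^ (∑ j, lam j) * ev3 P u v w := by
  unfold ev3 Finsupp.sum
  rw [Finset.mul_sum]
  refine Finset.sum_congr rfl fun n hn => ?_
  have h := (hP.of_coeff_ne_zero (Finsupp.mem_support_iff.1 hn)).1
  dsimp only
  rw [← h, Fin.sum_univ_three, zpow_add₀ hc, zpow_add₀ hc, mul_zpow, mul_zpow, mul_zpow]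
  ring

end

/-- The `q`-Vandermonde sum. -/
theorem qVandermonde (hq0 : 0 < q) (hq1 : q < 1) (D E : ℂ) (n : ℕ) :
    ∑ p ∈ Finset.HasAntidiagonal.antidiagonal n, qPoch q E p.1 / qPoch q q p.1 *
      (qPoch q D p.2 / qPoch q q p.2) * E ^ p.2 = qPoch q (D * E) n / qPoch q q n := by
  induction n with
  | zero => simp [qPoch_zero]
  | succ n ih =>
    obtain ⟨A, hA⟩ : ∃ A : ℕ → ℂ, ∀ j, A j = qPoch q E j / qPoch q q j := ⟨_, fun _ => rfl⟩
    obtain ⟨B, hB⟩ : ∃ B : ℕ → ℂ, ∀ j, B j = qPoch q D j / qPoch q q j := ⟨_, fun _ => rfl⟩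
    have step : ∀ (a : ℂ) (j : ℕ), (1 - (q : ℂ) ^ (j + 1)) * (qPoch q a (j + 1) /
        qPoch q q (j + 1)) = (1 - a * (q : ℂ) ^ j) * (qPoch q a j / qPoch q q j) := by
      intro a j
      have h1 := qPoch_self_ne_zero hq0 hq1 j
      have h2 := qpow_ne_one hq0 hq1 j
      rw [qPoch_succ, qPoch_succ, ← pow_succ']
      field_simp
    have sA := fun j => step E j
    have sB := fun j => step D j
    simp only [← hA, ← hB] at sA sB ih ⊢
    have h3 := qpow_ne_one hq0 hq1 n
    refine mul_left_cancel₀ h3 ?_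
    rw [step, ← ih]
    -- `1 - q^{n+1}` is split as `(1 - q^i) + q^i (1 - q^j)`, `i + j = n + 1`
    have e1 : ∀ p ∈ Finset.HasAntidiagonal.antidiagonal (n + 1),
        (1 - (q : ℂ) ^ (n + 1)) * (A p.1 * B p.2 * E ^ p.2) =
        (1 - (q : ℂ) ^ p.1) * A p.1 * (B p.2 * E ^ p.2) +
          (q : ℂ) ^ p.1 * A p.1 * ((1 - (q : ℂ) ^ p.2) * B p.2 * E ^ p.2) := by
      intro p hp
      rw [← Finset.HasAntidiagonal.mem_antidiagonal.1 hp, pow_add]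
      ring
    rw [Finset.mul_sum, Finset.sum_congr rfl e1, Finset.sum_add_distrib,
      Finset.Nat.sum_antidiagonal_succ, Finset.Nat.sum_antidiagonal_succ', pow_zero, sub_self,
      zero_mul, zero_mul, zero_add, zero_mul, zero_mul, mul_zero, zero_add, Finset.mul_sum,
      ← Finset.sum_add_distrib]
    refine Finset.sum_congr rfl fun p hp => ?_
    rw [sA, sB, ← Finset.HasAntidiagonal.mem_antidiagonal.1 hp, pow_add, pow_succ]
    ring

/-! ### The leading term in the second variable -/

/-- The lowest power of `t₂` in `P` dominates as `t₂ → 0`. -/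
theorem tendsto_lead {P : Laurent3} {a : ℤ} (h : ∀ n, P.coeff n ≠ 0 → a ≤ n 1) (u c w : ℂ) :
    Tendsto (fun ε : ℂ => ε ^ (-a) * ev3 P u (c * ε) w) (𝓝[≠] 0)
      (𝓝 (∑ n ∈ P.coeff.support with n 1 = a, P.coeff n * (u ^ n 0 * c ^ a * w ^ n 2))) := by
  unfold ev3 Finsupp.sum
  simp only [Finset.mul_sum]
  rw [Finset.sum_filter]
  refine tendsto_finsetSum _ fun n hn => ?_
  obtain ⟨k, hk⟩ := Int.eq_ofNat_of_zero_le (sub_nonneg.2 (h n (Finsupp.mem_support_iff.1 hn)))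
  have hn1 : n 1 = a + k := by omega
  have h1 : Tendsto (fun ε : ℂ => P.coeff n * (u ^ n 0 * c ^ n 1 * w ^ n 2) * ε ^ k) (𝓝[≠] 0)
      (𝓝 (P.coeff n * (u ^ n 0 * c ^ n 1 * w ^ n 2) * 0 ^ k)) := by
    have : Continuous fun ε : ℂ => P.coeff n * (u ^ n 0 * c ^ n 1 * w ^ n 2) * ε ^ k := by fun_prop
    exact (this.tendsto 0).mono_left nhdsWithin_le_nhds
  have h2 : P.coeff n * (u ^ n 0 * c ^ n 1 * w ^ n 2) * 0 ^ k =
      if n 1 = a then P.coeff n * (u ^ n 0 * c ^ a * w ^ n 2) else 0 := by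
    rcases k with _ | k
    · have : n 1 = a := by simpa using hn1
      rw [if_pos this, this, pow_zero, mul_one]
    · rw [if_neg (by omega), zero_pow (by omega), mul_zero]
  rw [← h2]
  refine h1.congr' ?_
  filter_upwards [self_mem_nhdsWithin] with ε hε
  have hε : ε ≠ 0 := hε
  rw [mul_zpow, hn1, zpow_add₀ hε, zpow_neg, zpow_natCast]
  field_simp

section
variable {g : ℝ} {lam : Fin 3 → ℤ} {P : Laurent3}

/-- The coefficients of the lowest power of `t₂` in a Macdonald polynomial. -/
def leadCoeff (lam : Fin 3 → ℤ) (P : Laurent3) (j : ℕ) : ℂ :=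
  P.coeff ![lam 1 + j, lam 0, lam 2 - j]

/-- The terms of lowest degree in `t₂` of `P_λ` are `t₁^{λ₂+j} t₂^{λ₁} t₃^{λ₃-j}`, `0 ≤ j ≤ λ₃ - λ₂`. -/
theorem IsMacdonald.tendsto (hP : IsMacdonald q g lam P) (hlam : Monotone lam) (u c w : ℂ) :
    Tendsto (fun ε : ℂ => ε ^ (-lam 0) * ev3 P u (c * ε) w) (𝓝[≠] 0)
      (𝓝 (∑ j ∈ Finset.range ((lam 2 - lam 1).toNat + 1),
        leadCoeff lam P j * (u ^ (lam 1 + j) * c ^ lam 0 * w ^ (lam 2 - j)))) := by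
  have e₁ : lam 1 ≤ lam 2 := hlam (by decide)
  have h := tendsto_lead (P := P) (a := lam 0) (fun n hn => ((hP.of_coeff_ne_zero hn).2 1).1) u c w
  have hinj : Function.Injective fun j : ℕ => (![lam 1 + j, lam 0, lam 2 - j] : Fin 3 → ℤ) := by
    intro i j hij
    have := congrFun hij 0
    simpa using this
  have h1 := Finset.sum_image (s := Finset.range ((lam 2 - lam 1).toNat + 1))
    (f := fun n : Fin 3 → ℤ => P.coeff n * (u ^ n 0 * c ^ lam 0 * w ^ n 2)) hinj.injOn
  simp only [Matrix.cons_val] at h1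
  unfold leadCoeff
  rw [← h1]
  refine Tendsto.congr (fun _ => rfl) ?_
  convert h using 2
  symm
  refine Finset.sum_subset (fun n hn => ?_) fun n hn hn' => ?_
  · obtain ⟨hn1, hn2⟩ := Finset.mem_filter.1 hn
    obtain ⟨hs, hb⟩ := hP.of_coeff_ne_zero (Finsupp.mem_support_iff.1 hn1)
    rw [Fin.sum_univ_three, Fin.sum_univ_three] at hs
    have b0 := (hb 0).2
    have b2 := (hb 2).2
    refine Finset.mem_image.2 ⟨(n 0 - lam 1).toNat, Finset.mem_range.2 (by omega), ?_⟩
    funext i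
    fin_cases i
    · simp; omega
    · simp; omega
    · simp; omega
  · have : P.coeff n = 0 := by
      by_contra h0
      refine hn' (Finset.mem_filter.2 ⟨Finsupp.mem_support_iff.2 h0, ?_⟩)
      obtain ⟨j, -, rfl⟩ := Finset.mem_image.1 hn
      rfl
    rw [this, zero_mul]

/-- The difference equation of the leading term, which is the limit of the eigenvalue equation of
the first Hamiltonian. -/
theorem IsMacdonald.lead_equation (hq0 : 0 < q) (hP : IsMacdonald q g lam P) (hlam : Monotone lam)
    {e : ℂ} (he : e = ellInv q g) {X : ℂ} (hX : X ≠ 0) (hX1 : X ≠ 1) :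
    ∑ j ∈ Finset.range ((lam 2 - lam 1).toNat + 1), leadCoeff lam P j *
      (((e * X - 1) * (q : ℂ) ^ (lam 1 + j) - (e - X) * (q : ℂ) ^ (lam 2 - j) -
        ((q : ℂ) ^ lam 1 + e * (q : ℂ) ^ lam 2) * (X - 1)) * X ^ (lam 1 + j)) = 0 := by
  have hqc : (q : ℂ) ≠ 0 := ofReal_ne_zero_of_pos hq0
  have he0 : e ≠ 0 := he ▸ ellInv_ne_zero hq0 g
  have hl : (ell q g : ℂ) = e⁻¹ := by rw [he, ellInv, inv_inv]
  have T1 := hP.tendsto hlam (q * X) 1 1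
  have T2 := hP.tendsto hlam X q 1
  have T3 := hP.tendsto hlam X 1 q
  have T0 := hP.tendsto hlam X 1 1
  have hcont : ∀ f : ℂ → ℂ, ContinuousAt f 0 → Tendsto f (𝓝[≠] 0) (𝓝 (f 0)) := fun f hf =>
    hf.tendsto.mono_left nhdsWithin_le_nhds
  have hX1' : X - 1 ≠ 0 := sub_ne_zero.2 hX1
  have hX1'' : 1 - X ≠ 0 := sub_ne_zero.2 hX1.symm
  -- the limits of the coefficients as `t₂ = ε → 0`
  have c1 := hcont (fun ε => e * ((X - e⁻¹ * ε) * (X - e⁻¹ * 1)) / ((X - ε) * (X - 1)))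
    (ContinuousAt.div (by fun_prop) (by fun_prop) (by
      simpa using ⟨hX, hX1'⟩))
  have c2 := hcont (fun ε => e * ((ε - e⁻¹ * X) * (ε - e⁻¹ * 1)) / ((ε - X) * (ε - 1)))
    (ContinuousAt.div (by fun_prop) (by fun_prop) (by simpa using hX))
  have c3 := hcont (fun ε => e * ((1 - e⁻¹ * X) * (1 - e⁻¹ * ε)) / ((1 - X) * (1 - ε)))
    (ContinuousAt.div (by fun_prop) (by fun_prop) (by simpa using hX1''))
  have hlim := ((c1.mul T1).add (c2.mul T2)).add (c3.mul T3)
  have hlim' := T0.const_mul (eigenvalue q g 1 lam)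
  have heq := tendsto_nhds_unique (hlim.congr' ?_) hlim'
  · rw [eigenvalue_one, hl] at heq
    have hz : ∀ j : ℕ, (q * X) ^ (lam 1 + (j : ℤ)) = (q : ℂ) ^ (lam 1 + (j : ℤ)) *
      X ^ (lam 1 + (j : ℤ)) := fun j => mul_zpow _ _ _
    simp only [hz, one_zpow, mul_one] at heq
    rw [← sub_eq_zero, Finset.mul_sum, Finset.mul_sum, Finset.mul_sum, Finset.mul_sum,
      ← Finset.sum_add_distrib, ← Finset.sum_add_distrib, ← Finset.sum_sub_distrib] at heq
    rw [← mul_zero (X - 1), ← heq, Finset.mul_sum]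
    refine Finset.sum_congr rfl fun j _ => ?_
    simp only [mul_zero, sub_zero, zero_sub, mul_one]
    field_simp
    ring
  · have n1 : ∀ᶠ ε : ℂ in 𝓝[≠] 0, ε ≠ X := nhdsWithin_le_nhds
      (continuousAt_id.eventually_ne hX.symm)
    have n2 : ∀ᶠ ε : ℂ in 𝓝[≠] 0, ε ≠ 1 := nhdsWithin_le_nhds
      (continuousAt_id.eventually_ne zero_ne_one)
    filter_upwards [n1, n2, self_mem_nhdsWithin] with ε h1 h2 h0
    have h0 : ε ≠ 0 := h0
    have hH := hP.eigen 1 le_rfl (by norm_num) ![X, ε, 1] (by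
      intro k; fin_cases k
      · exact hX
      · exact h0
      · exact one_ne_zero) (by
      intro k l hkl
      fin_cases k <;> fin_cases l <;> first
        | rfl
        | exact absurd hkl hX1
        | exact absurd hkl.symm hX1
        | exact absurd hkl h2
        | exact absurd hkl.symm h2
        | exact absurd hkl h1
        | exact absurd hkl.symm h1)
    rw [hamiltonian_one, vCoef_mul hq0 he, vCoef_mul hq0 he, vCoef_mul hq0 he] at hH
    simp only [Matrix.cons_val] at hH
    simp only [one_mul, mul_one] at hH ⊢
    linear_combination ε ^ (-lam 0) * hH

end

/-! ### The normalization -/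

section
variable {g : ℝ} {lam : Fin 3 → ℤ} {P : Laurent3}

theorem IsMacdonald.leadCoeff_zero (hP : IsMacdonald q g lam P) (hlam : Monotone lam) :
    leadCoeff lam P 0 = 1 := by
  rw [← hP.coeff_lam hlam, ← hP.coeff_comp lam (Equiv.swap 0 1), leadCoeff]
  congr 1
  funext i
  fin_cases i <;> simp [Equiv.swap_apply_of_ne_of_ne]

/-- The two-term recurrence obtained by comparing coefficients in `IsMacdonald.lead_equation`. -/
theorem IsMacdonald.leadCoeff_succ (hq0 : 0 < q) (hP : IsMacdonald q g lam P)
    (hlam : Monotone lam) {e : ℂ} (he : e = ellInv q g) {n : ℕ} (hn : n = (lam 2 - lam 1).toNat)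
    {k m : ℕ} (hk : k + 1 + m = n) :
    leadCoeff lam P (k + 1) * ((1 - (q : ℂ) ^ (k + 1)) * (1 - e * (q : ℂ) ^ m)) =
      leadCoeff lam P k * ((1 - e * (q : ℂ) ^ k) * (1 - (q : ℂ) ^ (m + 1))) := by
  have hqc : (q : ℂ) ≠ 0 := ofReal_ne_zero_of_pos hq0
  have e₁ : lam 1 ≤ lam 2 := hlam (by decide)
  obtain ⟨r, hr⟩ : ∃ r, r = leadCoeff lam P := ⟨_, rfl⟩
  rw [← hr]
  obtain ⟨A, hA⟩ : ∃ A : ℕ → ℂ, ∀ j, A j = e * (q : ℂ) ^ (lam 1 + j) + (q : ℂ) ^ (lam 2 - j) -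
    ((q : ℂ) ^ lam 1 + e * (q : ℂ) ^ lam 2) := ⟨_, fun _ => rfl⟩
  obtain ⟨B, hB⟩ : ∃ B : ℕ → ℂ, ∀ j, B j = (q : ℂ) ^ (lam 1 + j) + e * (q : ℂ) ^ (lam 2 - j) -
    ((q : ℂ) ^ lam 1 + e * (q : ℂ) ^ lam 2) := ⟨_, fun _ => rfl⟩
  have hpoly : ∑ j ∈ Finset.range (n + 1), (Polynomial.C (r j * A j) * Polynomial.X ^ (j + 1) -
      Polynomial.C (r j * B j) * Polynomial.X ^ j) = 0 := by
    refine Polynomial.eq_of_infinite_eval_eq _ _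
      (((Set.finite_singleton (1 : ℂ)).insert 0).infinite_compl.mono fun X hX => ?_)
    simp only [Set.mem_compl_iff, Set.mem_insert_iff, Set.mem_singleton_iff, not_or] at hX
    have h := hP.lead_equation hq0 hlam he hX.1 hX.2
    rw [← hn] at h
    rw [Set.mem_ofPred_eq, Polynomial.eval_finsetSum, Polynomial.eval_zero]
    refine mul_left_cancel₀ (zpow_ne_zero (lam 1) hX.1) ?_
    rw [mul_zero, ← h, Finset.mul_sum]
    refine Finset.sum_congr rfl fun j _ => ?_
    rw [zpow_add₀ hX.1, zpow_natCast, ← hr]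
    simp [hA, hB]
    ring
  have hc := congrArg (fun p => Polynomial.coeff p (k + 1)) hpoly
  simp only [Polynomial.finsetSum_coeff, Polynomial.coeff_sub, Polynomial.coeff_C_mul_X_pow,
    Finset.sum_sub_distrib, Polynomial.coeff_zero, add_left_inj, Finset.sum_ite_eq,
    Finset.mem_range] at hc
  rw [if_pos (by omega), if_pos (by omega)] at hc
  have e2 : (q : ℂ) ^ lam 2 = (q : ℂ) ^ lam 1 * ((q : ℂ) ^ k * q * (q : ℂ) ^ m) := by
    rw [← pow_succ, ← pow_add, hk, ← zpow_natCast, ← zpow_add₀ hqc]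
    congr 1
    omega
  have e3 : (q : ℂ) ^ (lam 2 - (k : ℤ)) = (q : ℂ) ^ lam 1 * (q * (q : ℂ) ^ m) := by
    rw [← pow_succ', ← zpow_natCast, ← zpow_add₀ hqc]
    congr 1
    omega
  have e4 : (q : ℂ) ^ (lam 2 - ((k + 1 : ℕ) : ℤ)) = (q : ℂ) ^ lam 1 * (q : ℂ) ^ m := by
    rw [← zpow_natCast, ← zpow_add₀ hqc]
    congr 1
    omega
  have e5 : (q : ℂ) ^ (lam 1 + (k : ℤ)) = (q : ℂ) ^ lam 1 * (q : ℂ) ^ k := by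
    rw [zpow_add₀ hqc, zpow_natCast]
  have e6 : (q : ℂ) ^ (lam 1 + ((k + 1 : ℕ) : ℤ)) = (q : ℂ) ^ lam 1 * ((q : ℂ) ^ k * q) := by
    rw [zpow_add₀ hqc, zpow_natCast, pow_succ]
  rw [hA, hB, e2, e3, e4, e5, e6] at hc
  have h1 : (q : ℂ) ^ lam 1 ≠ 0 := zpow_ne_zero _ hqc
  refine mul_left_cancel₀ h1 ?_
  rw [pow_succ, pow_succ]
  linear_combination hc

/-- The leading term is a Rogers polynomial: its coefficients are products of ratios `(e; q)_k / (q; q)_k`. -/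
theorem IsMacdonald.leadCoeff_eq (hq0 : 0 < q) (hq1 : q < 1) (hg : 0 < g)
    (hP : IsMacdonald q g lam P) (hlam : Monotone lam) {e : ℂ} (he : e = ellInv q g) {n : ℕ}
    (hn : n = (lam 2 - lam 1).toNat) (k m : ℕ) (hk : k + m = n) :
    leadCoeff lam P k = qPoch q q n / qPoch q e n *
      (qPoch q e k / qPoch q q k * (qPoch q e m / qPoch q q m)) := by
  have hen : ∀ n, 1 - e * (q : ℂ) ^ n ≠ 0 := fun n => sub_ne_zero.2 <| by
    have := ellInv_pow_mul_pow_ne_one hq0 hq1 hg 0 n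
    rw [zero_add, pow_one, ← he] at this
    exact this.symm
  have he' : ∀ n, qPoch q e n ≠ 0 := qPoch_ne_zero fun n => (sub_ne_zero.1 (hen n)).symm
  have hq' := qPoch_self_ne_zero hq0 hq1
  induction k generalizing m with
  | zero =>
    rw [zero_add] at hk
    have h1 := he' n
    have h2 := hq' n
    rw [hP.leadCoeff_zero hlam, hk, qPoch_zero, qPoch_zero]
    field_simp
  | succ k ih =>
    have h1 := ih (m + 1) (by omega)
    have h2 := hP.leadCoeff_succ hq0 hlam he hn hk
    have a1 := he' n
    have a2 := hq' n
    have a3 := hq' k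
    have a4 := hq' m
    have a5 := qpow_ne_one hq0 hq1 k
    have a6 := qpow_ne_one hq0 hq1 m
    have a7 := hen m
    refine mul_right_cancel₀ (mul_ne_zero a5 a7) (h2.trans ?_)
    rw [h1, qPoch_succ q e m, qPoch_succ q e k, qPoch_succ q (q : ℂ) m, qPoch_succ q (q : ℂ) k,
      ← pow_succ', ← pow_succ']
    field_simp

/-- The leading coefficient of `P_λ` on the line `(ℓ, ℓ²z, 1)`, by the `q`-Vandermonde sum. -/
theorem IsMacdonald.sum_leadCoeff (hq0 : 0 < q) (hq1 : q < 1) (hg : 0 < g)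
    (hP : IsMacdonald q g lam P) (hlam : Monotone lam) {e : ℂ} (he : e = ellInv q g) {n : ℕ}
    (hn : n = (lam 2 - lam 1).toNat) :
    ∑ j ∈ Finset.range (n + 1), leadCoeff lam P j * (e ^ j)⁻¹ =
      qPoch q (e ^ 2) n / qPoch q e n * (e ^ n)⁻¹ := by
  have he0 : e ≠ 0 := he ▸ ellInv_ne_zero hq0 g
  have he' : qPoch q e n ≠ 0 := qPoch_ne_zero (fun n => by
    have := ellInv_pow_mul_pow_ne_one hq0 hq1 hg 0 n
    rwa [zero_add, pow_one, ← he] at this) n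
  have hq' := qPoch_self_ne_zero hq0 hq1 n
  have hv := qVandermonde hq0 hq1 e e n
  rw [← pow_two, Finset.Nat.sum_antidiagonal_eq_sum_range_succ_mk] at hv
  have h1 : qPoch q (e ^ 2) n = qPoch q q n * (qPoch q (e ^ 2) n / qPoch q q n) := by field_simp
  rw [h1, ← hv, Finset.mul_sum, Finset.sum_div, Finset.sum_mul]
  refine Finset.sum_congr rfl fun j hj => ?_
  have hjn : j + (n - j) = n := Nat.add_sub_of_le (Nat.lt_succ_iff.1 (Finset.mem_range.1 hj))
  rw [hP.leadCoeff_eq hq0 hq1 hg hlam he hn j (n - j) hjn]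
  have h2 : e ^ n = e ^ j * e ^ (n - j) := by rw [← pow_add, hjn]
  rw [h2]
  have := pow_ne_zero j he0
  have := pow_ne_zero (n - j) he0
  field_simp

/-- The factor of proportionality between `P_λ(ℓ, ℓ²z, 1)` and `S_λ(z)`, from the behaviour of both as
`z → 0`. -/
theorem IsMacdonald.line_factor (hq0 : 0 < q) (hq1 : q < 1) (hg : 0 < g)
    (hP : IsMacdonald q g lam P) (hlam : Monotone lam) {κ : ℂ}
    (hκ : ∀ z : ℂ, z ≠ 0 → ev3 P (ell q g) ((ell q g : ℂ) ^ 2 * z) 1 =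
        κ * ev (sepLaurent q g lam) z) :
    κ = (ell q g : ℂ) ^ (2 * lam 0 + lam 2) * (qPoch q (ellInv q g ^ 2) (lam 2 - lam 1).toNat /
      qPoch q (ellInv q g) (lam 2 - lam 1).toNat) := by
  have e₁ : lam 1 ≤ lam 2 := hlam (by decide)
  have hl : (ell q g : ℂ) ≠ 0 := by exact_mod_cast (ell_pos hq0 g).ne'
  have h1 := hP.tendsto hlam (ell q g) ((ell q g : ℂ) ^ 2) 1
  have h2 : Tendsto (fun z : ℂ => κ * (sepCore q g lam).eval z) (𝓝[≠] 0) (𝓝 κ) := by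
    have : Continuous fun z : ℂ => κ * (sepCore q g lam).eval z :=
      continuous_const.mul (sepCore q g lam).continuous
    have h := this.tendsto 0
    rw [eval_sepCore_zero hq0 hq1 hg hlam, mul_one] at h
    exact h.mono_left nhdsWithin_le_nhds
  have h3 := tendsto_nhds_unique (h2.congr' ?_) h1
  · rw [h3]
    have hs := hP.sum_leadCoeff hq0 hq1 hg hlam rfl rfl
    have hlen : ∀ j : ℕ, (ellInv q g ^ j)⁻¹ = (ell q g : ℂ) ^ j := fun j => by
      rw [ellInv, inv_pow, inv_inv]
    simp only [hlen] at hs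
    have h4 : (ell q g : ℂ) ^ (2 * lam 0 + lam 2) = (ell q g : ℂ) ^ (2 * lam 0 + lam 1) *
        (ell q g : ℂ) ^ (lam 2 - lam 1).toNat := by
      rw [← zpow_natCast, ← zpow_add₀ hl]
      congr 1
      omega
    rw [h4, mul_assoc, mul_comm ((ell q g : ℂ) ^ (lam 2 - lam 1).toNat), ← hs, Finset.mul_sum]
    refine Finset.sum_congr rfl fun j _ => ?_
    rw [one_zpow, mul_one, zpow_add₀ hl, zpow_add₀ hl, zpow_mul, zpow_natCast]
    rw [show (ell q g : ℂ) ^ (2 : ℤ) = (ell q g : ℂ) ^ 2 from zpow_ofNat _ 2]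
    ring
  · filter_upwards [self_mem_nhdsWithin] with z hz
    have hz : z ≠ 0 := hz
    rw [hκ z hz, ev_sepLaurent g lam hz, zpow_neg]
    have := zpow_ne_zero (lam 0) hz
    field_simp

/-- Reversal of a finite `q`-shifted factorial. -/
theorem qPoch_reverse (hq0 : 0 < q) {L : ℂ} (hL : L ≠ 0) (n : ℕ) :
    qPoch q (L * (q : ℂ) ^ (1 - n : ℤ)) n =
      (-L) ^ n * (∏ k ∈ Finset.range n, ((q : ℂ) ^ k)⁻¹) * qPoch q L⁻¹ n := by
  have hqc : (q : ℂ) ≠ 0 := ofReal_ne_zero_of_pos hq0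
  unfold qPoch
  rw [← Finset.prod_range_reflect, ← Finset.card_range n, ← Finset.prod_const, Finset.card_range,
    ← Finset.prod_mul_distrib, ← Finset.prod_mul_distrib]
  refine Finset.prod_congr rfl fun i hi => ?_
  have hi := Finset.mem_range.1 hi
  have h1 : (q : ℂ) ^ (1 - n : ℤ) * (q : ℂ) ^ (n - 1 - i) = ((q : ℂ) ^ i)⁻¹ := by
    rw [← zpow_natCast, ← zpow_add₀ hqc, ← zpow_natCast, ← zpow_neg]
    congr 1
    omega
  rw [mul_assoc, h1]
  have := pow_ne_zero i hqc
  field_simp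
  ring

/-- The coefficient `c_λ` in terms of the value of `S_λ` at `1`. -/
theorem cCoef_eq (hq0 : 0 < q) (hq1 : q < 1) (hg : 0 < g) (hlam : Monotone lam) :
    cCoef q g lam = (ell q g : ℂ) ^ (2 * lam 0 + lam 2) *
      (qPoch q (ellInv q g ^ 2) (lam 2 - lam 1).toNat /
        qPoch q (ellInv q g) (lam 2 - lam 1).toNat) / ev (sepLaurent q g lam) 1 := by
  have hqc : (q : ℂ) ≠ 0 := ofReal_ne_zero_of_pos hq0
  have e₁ : lam 1 ≤ lam 2 := hlam (by decide)
  have e₀ : lam 0 ≤ lam 1 := hlam (by decide)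
  have hl : (ell q g : ℂ) ≠ 0 := by exact_mod_cast (ell_pos hq0 g).ne'
  obtain ⟨N, hN⟩ : ∃ N, N = (lam 2 - lam 0).toNat := ⟨_, rfl⟩
  obtain ⟨a, ha⟩ : ∃ a, a = (lam 2 - lam 1).toNat := ⟨_, rfl⟩
  obtain ⟨b, hb⟩ : ∃ b, b = (lam 1 - lam 0).toNat := ⟨_, rfl⟩
  have hab : N = a + b := by omega
  have p1 := ellPow_neg_natCast q g 1
  have p2 := ellPow_neg_natCast q g 2
  have p3 := ellPow_neg_natCast q g 3
  rw [pow_one] at p1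
  push_cast at p1 p2 p3
  rw [cCoef, ev_sepLaurent_one, p1, p2, p3, ← hN, ← ha, ← hb]
  have r1 := qPoch_reverse hq0 (pow_ne_zero 3 hl) N
  have r2 := qPoch_reverse hq0 (pow_ne_zero 2 hl) N
  have r3 := qPoch_reverse hq0 (pow_ne_zero 2 hl) b
  have r4 := qPoch_reverse hq0 hl b
  have i3 : ((ell q g : ℂ) ^ 3)⁻¹ = ellInv q g ^ 3 := by rw [ellInv, inv_pow]
  have i2 : ((ell q g : ℂ) ^ 2)⁻¹ = ellInv q g ^ 2 := by rw [ellInv, inv_pow]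
  have i1 : (ell q g : ℂ)⁻¹ = ellInv q g := rfl
  have hA : sepA₁ q g lam = (ell q g : ℂ) ^ 3 * (q : ℂ) ^ (1 - N : ℤ) := by
    rw [sepA₁, hN, Int.toNat_of_nonneg (by omega)]
  have hB1 : sepB₁ q g lam = (ell q g : ℂ) ^ 2 * (q : ℂ) ^ (1 - N : ℤ) := by
    rw [sepB₁, hN, Int.toNat_of_nonneg (by omega)]
  have hB2 : sepB₂ q g lam = (ell q g : ℂ) * (q : ℂ) ^ (1 - b : ℤ) := by
    rw [sepB₂, hb, Int.toNat_of_nonneg (by omega)]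
  have hB1' : (ell q g : ℂ) ^ 2 * (q : ℂ) ^ (1 - N : ℤ) * (q : ℂ) ^ a =
      (ell q g : ℂ) ^ 2 * (q : ℂ) ^ (1 - b : ℤ) := by
    rw [mul_assoc, ← zpow_natCast (q : ℂ) a, ← zpow_add₀ hqc]
    congr 2
    omega
  have n1 : qPoch q (sepB₁ q g lam) a ≠ 0 := ha ▸ qPoch_sepB₁_ne_zero hq0 hq1 hg hlam
  have n2 : qPoch q (sepB₂ q g lam) b ≠ 0 := hb ▸ qPoch_sepB₂_ne_zero hq0 hq1 hg hlam
  have n3 := qPoch_ne_zero (fun n => ellInv_pow_mul_pow_ne_one hq0 hq1 hg 1 n) b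
  have n4 := qPoch_ne_zero (fun n => ellInv_pow_mul_pow_ne_one hq0 hq1 hg 2 n) N
  have n5 : ∏ k ∈ Finset.range N, ((q : ℂ) ^ k)⁻¹ ≠ 0 :=
    Finset.prod_ne_zero_iff.2 fun i _ => inv_ne_zero (pow_ne_zero _ hqc)
  have n6 : ∏ k ∈ Finset.range b, ((q : ℂ) ^ k)⁻¹ ≠ 0 :=
    Finset.prod_ne_zero_iff.2 fun i _ => inv_ne_zero (pow_ne_zero _ hqc)
  have r5 : qPoch q (sepB₁ q g lam) N =
      qPoch q (sepB₁ q g lam) a * qPoch q ((ell q g : ℂ) ^ 2 * (q : ℂ) ^ (1 - b : ℤ)) b := by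
    rw [hab, qPoch_add, hB1, hab]
    rw [hab] at hB1'
    rw [hB1']
  rw [← hA, i3] at r1
  rw [← hB1, i2, r5, r3, i2] at r2
  rw [← hB2, i1] at r4
  have n7 := qPoch_ne_zero (fun n => by
    have := ellInv_pow_mul_pow_ne_one hq0 hq1 hg 0 n
    rwa [zero_add, pow_one] at this) a
  have hpow : (ell q g : ℂ) ^ (4 * lam 0 - lam 1) * (ell q g : ℂ) ^ (3 * N) =
      (ell q g : ℂ) ^ (2 * lam 0 + lam 2) * (ell q g : ℂ) ^ (2 * a + b) := by
    rw [← zpow_natCast, ← zpow_natCast, ← zpow_add₀ hl, ← zpow_add₀ hl]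
    congr 1
    push_cast
    omega
  have hkey : (ell q g : ℂ) ^ (4 * lam 0 - lam 1) *
      ((-(ell q g : ℂ) ^ 3) ^ N * (-(ell q g : ℂ) ^ 2) ^ b) =
      (ell q g : ℂ) ^ (2 * lam 0 + lam 2) *
        ((-(ell q g : ℂ) ^ 2) ^ N * (-(ell q g : ℂ)) ^ b) := by
    rw [neg_pow (_ ^ 3), neg_pow (_ ^ 2) b, neg_pow (_ ^ 2) N, neg_pow (ell q g : ℂ) b, ← pow_mul, ← pow_mul, ← pow_mul]
    rw [hab, pow_add, mul_add, pow_add] at hpow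
    rw [hab, mul_add, mul_add, pow_add _ (3 * a), pow_add _ (2 * a)]
    linear_combination (-1) ^ (a + b) * (-1) ^ b * (ell q g : ℂ) ^ (2 * b) * hpow
  have z1 : (-(ell q g : ℂ) ^ 3) ^ N ≠ 0 := pow_ne_zero _ (neg_ne_zero.2 (pow_ne_zero _ hl))
  have z2 : (-(ell q g : ℂ) ^ 2) ^ b ≠ 0 := pow_ne_zero _ (neg_ne_zero.2 (pow_ne_zero _ hl))
  rw [r1]
  rw [r4] at n2 ⊢
  have r6 := eq_div_of_mul_eq (mul_ne_zero (mul_ne_zero z2 n6) n3) r2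
  rw [r6] at n1 ⊢
  generalize (-(ell q g : ℂ) ^ 3) ^ N = Z1 at *
  generalize (-(ell q g : ℂ) ^ 2) ^ b = Z2 at *
  generalize (-(ell q g : ℂ) ^ 2) ^ N = Z3 at *
  generalize (-(ell q g : ℂ)) ^ b = Z4 at *
  generalize (ell q g : ℂ) ^ (4 * lam 0 - lam 1) = W1 at *
  generalize (ell q g : ℂ) ^ (2 * lam 0 + lam 2) = W2 at *
  generalize ∏ k ∈ Finset.range N, ((q : ℂ) ^ k)⁻¹ = Y1 at *
  generalize ∏ k ∈ Finset.range b, ((q : ℂ) ^ k)⁻¹ = Y2 at *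
  generalize qPoch q (ellInv q g ^ (2 + 1)) N = T1 at *
  clear r1 r2 r3 r4 r5 r6 hpow
  field_simp
  linear_combination qPoch q (ellInv q g ^ 2) N * qPoch q (ellInv q g ^ 2) a *
    qPoch q (ellInv q g) b * hkey

end

/-! ### Orbit sums and alternating sums -/

/-- The sum of the monomials `t^{μ ∘ σ}` over all permutations `σ`. -/
def symSum (μ : Fin 3 → ℤ) : Laurent3 :=
  ∑ σ : Equiv.Perm (Fin 3), AddMonoidAlgebra.single (μ ∘ σ) 1

/-- The alternating sum of the monomials `t^{ρ ∘ σ}` over all permutations `σ`. -/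
def altSum (ρ : Fin 3 → ℤ) : Laurent3 :=
  ∑ σ : Equiv.Perm (Fin 3), AddMonoidAlgebra.single (ρ ∘ σ) ((Equiv.Perm.sign σ : ℤ) : ℂ)

/-- Half the sum of the positive roots. -/
def rho : Fin 3 → ℤ := ![-1, 0, 1]

/-- A sum over the six permutations written out: the identity, the three transpositions and the two
3-cycles. -/
theorem sum_perm_fin_three {A : Type*} [AddCommMonoid A] (f : ℤ → (Fin 3 → Fin 3) → A) :
    ∑ σ : Equiv.Perm (Fin 3), f (Equiv.Perm.sign σ : ℤ) σ =
      f 1 ![0, 1, 2] + (f (-1) ![1, 0, 2] + (f (-1) ![2, 1, 0] + (f (-1) ![0, 2, 1] +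
        (f 1 ![1, 2, 0] + f 1 ![2, 0, 1])))) := by
  have h : (Finset.univ : Finset (Equiv.Perm (Fin 3))) = {1, Equiv.swap 0 1, Equiv.swap 0 2,
      Equiv.swap 1 2, finRotate 3, (finRotate 3)⁻¹} := by decide
  rw [h, Finset.sum_insert (by decide), Finset.sum_insert (by decide),
    Finset.sum_insert (by decide), Finset.sum_insert (by decide), Finset.sum_insert (by decide),
    Finset.sum_singleton]
  have a0 : ((1 : Equiv.Perm (Fin 3)) : Fin 3 → Fin 3) = ![0, 1, 2] := by decide
  have a1 : (Equiv.swap 0 1 : Fin 3 → Fin 3) = ![1, 0, 2] := by decide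
  have a2 : (Equiv.swap 0 2 : Fin 3 → Fin 3) = ![2, 1, 0] := by decide
  have a3 : (Equiv.swap 1 2 : Fin 3 → Fin 3) = ![0, 2, 1] := by decide
  have a4 : (finRotate 3 : Fin 3 → Fin 3) = ![1, 2, 0] := by decide
  have a5 : ((finRotate 3)⁻¹ : Equiv.Perm (Fin 3)) = (![2, 0, 1] : Fin 3 → Fin 3) := by decide
  have s4 : ((Equiv.Perm.sign (finRotate 3) : ℤˣ) : ℤ) = 1 := by decide
  have s5 : ((Equiv.Perm.sign (finRotate 3)⁻¹ : ℤˣ) : ℤ) = 1 := by decide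
  have s1 : ((Equiv.Perm.sign (Equiv.swap (0 : Fin 3) 1) : ℤˣ) : ℤ) = -1 := by decide
  have s2 : ((Equiv.Perm.sign (Equiv.swap (0 : Fin 3) 2) : ℤˣ) : ℤ) = -1 := by decide
  have s3 : ((Equiv.Perm.sign (Equiv.swap (1 : Fin 3) 2) : ℤˣ) : ℤ) = -1 := by decide
  have s0 : ((Equiv.Perm.sign (1 : Equiv.Perm (Fin 3)) : ℤˣ) : ℤ) = 1 := by decide
  rw [s0, s1, s2, s3, s4, s5, a0, a1, a2, a3, a4, a5]

theorem ev3_symSum (μ : Fin 3 → ℤ) {u v w : ℂ} (hu : u ≠ 0) (hv : v ≠ 0) (hw : w ≠ 0) :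
    ev3 (symSum μ) u v w =
      u ^ μ 0 * v ^ μ 1 * w ^ μ 2 + u ^ μ 1 * v ^ μ 0 * w ^ μ 2 + u ^ μ 2 * v ^ μ 1 * w ^ μ 0 +
      u ^ μ 0 * v ^ μ 2 * w ^ μ 1 + u ^ μ 1 * v ^ μ 2 * w ^ μ 0 + u ^ μ 2 * v ^ μ 0 * w ^ μ 1 := by
  rw [symSum, ev3_sum _ _ hu hv hw]
  simp only [ev3_single]
  have h := sum_perm_fin_three (fun _ σ => (1 : ℂ) * (u ^ (μ ∘ σ) 0 * v ^ (μ ∘ σ) 1 * w ^ (μ ∘ σ) 2))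
  rw [h]
  simp only [Function.comp_apply, Matrix.cons_val]
  ring

theorem ev3_altSum (ρ : Fin 3 → ℤ) {u v w : ℂ} (hu : u ≠ 0) (hv : v ≠ 0) (hw : w ≠ 0) :
    ev3 (altSum ρ) u v w =
      u ^ ρ 0 * v ^ ρ 1 * w ^ ρ 2 - u ^ ρ 1 * v ^ ρ 0 * w ^ ρ 2 - u ^ ρ 2 * v ^ ρ 1 * w ^ ρ 0 -
      u ^ ρ 0 * v ^ ρ 2 * w ^ ρ 1 + u ^ ρ 1 * v ^ ρ 2 * w ^ ρ 0 + u ^ ρ 2 * v ^ ρ 0 * w ^ ρ 1 := by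
  rw [altSum, ev3_sum _ _ hu hv hw]
  simp only [ev3_single]
  have h := sum_perm_fin_three (fun s σ => (s : ℂ) * (u ^ (ρ ∘ σ) 0 * v ^ (ρ ∘ σ) 1 * w ^ (ρ ∘ σ) 2))
  rw [h]
  simp only [Function.comp_apply, Matrix.cons_val]
  push_cast
  ring

theorem altSum_comp (ρ : Fin 3 → ℤ) (τ : Equiv.Perm (Fin 3)) :
    altSum (ρ ∘ τ) = ((Equiv.Perm.sign τ : ℤ) : ℂ) • altSum ρ := by
  unfold altSum
  rw [Finset.smul_sum]
  refine Fintype.sum_equiv (Equiv.mulLeft τ) _ _ fun σ => ?_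
  have h : ((Equiv.Perm.sign τ : ℤ) : ℂ) * ((Equiv.Perm.sign τ : ℤ) : ℂ) = 1 := by
    rcases Int.units_eq_one_or (Equiv.Perm.sign τ) with h | h <;> simp [h]
  rw [AddMonoidAlgebra.smul_single, Equiv.coe_mulLeft, Equiv.Perm.sign_mul]
  push_cast
  rw [smul_eq_mul, ← mul_assoc, h, one_mul]
  rfl

theorem altSum_eq_zero {ρ : Fin 3 → ℤ} (h : ¬ Function.Injective ρ) : altSum ρ = 0 := by
  simp only [Function.Injective, not_forall] at h
  obtain ⟨i, j, hij, hne⟩ := h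
  have h1 : ρ ∘ Equiv.swap i j = ρ := by
    funext k
    rcases Equiv.swap_apply_eq_iff.1 (rfl : Equiv.swap i j k = _) with _
    by_cases hi : k = i
    · simp [hi, hij]
    · by_cases hj : k = j
      · simp [hj, hij]
      · simp [Equiv.swap_apply_of_ne_of_ne hi hj]
  have h2 := altSum_comp ρ (Equiv.swap i j)
  rw [h1, Equiv.Perm.sign_swap hne] at h2
  have h3 : (2 : ℂ) • altSum ρ = 0 := by
    rw [two_smul]
    nth_rewrite 1 [h2]
    simp
  exact (smul_eq_zero.1 h3).resolve_left two_ne_zero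

/-- The product of the denominator with an orbit sum. -/
theorem altSum_rho_mul (μ : Fin 3 → ℤ) : altSum rho * symSum μ =
    ∑ σ : Equiv.Perm (Fin 3), altSum (rho + μ ∘ σ) := by
  have h := sum_perm_fin_three (fun _ σ => altSum (rho + μ ∘ σ))
  rw [h]
  refine ev3_inj fun u v w hu hv hw => ?_
  rw [ev3_mul _ _ hu hv hw]
  simp only [ev3_add _ _ hu hv hw, ev3_symSum _ hu hv hw, ev3_altSum _ hu hv hw]
  simp only [rho, Pi.add_apply, Function.comp_apply, Matrix.cons_val, zpow_add₀ hu, zpow_add₀ hv,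
    zpow_add₀ hw, zpow_one, zpow_zero, zpow_neg]
  ring

theorem ev3_altSum_rho {u v w : ℂ} (hu : u ≠ 0) (hv : v ≠ 0) (hw : w ≠ 0) :
    ev3 (altSum rho) u v w = (v - u) * (w - u) * (w - v) / (u * v * w) := by
  rw [ev3_altSum _ hu hv hw]
  simp only [rho, Matrix.cons_val, zpow_one, zpow_zero, zpow_neg]
  field_simp
  ring

theorem ev3_sum_altSum (c : (Fin 3 → ℤ) → ℂ) (μ : Fin 3 → ℤ) {u v w : ℂ} (hu : u ≠ 0) (hv : v ≠ 0)
    (hw : w ≠ 0) : ev3 (∑ σ : Equiv.Perm (Fin 3), c (μ ∘ σ) • altSum (rho + μ ∘ σ)) u v w =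
      c ![μ 0, μ 1, μ 2] * ev3 (altSum (rho + ![μ 0, μ 1, μ 2])) u v w +
      c ![μ 1, μ 0, μ 2] * ev3 (altSum (rho + ![μ 1, μ 0, μ 2])) u v w +
      c ![μ 2, μ 1, μ 0] * ev3 (altSum (rho + ![μ 2, μ 1, μ 0])) u v w +
      c ![μ 0, μ 2, μ 1] * ev3 (altSum (rho + ![μ 0, μ 2, μ 1])) u v w +
      c ![μ 1, μ 2, μ 0] * ev3 (altSum (rho + ![μ 1, μ 2, μ 0])) u v w +
      c ![μ 2, μ 0, μ 1] * ev3 (altSum (rho + ![μ 2, μ 0, μ 1])) u v w := by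
  have h := sum_perm_fin_three (fun _ σ => c (μ ∘ σ) • altSum (rho + μ ∘ σ))
  have e : ∀ a b d : Fin 3, μ ∘ ![a, b, d] = ![μ a, μ b, μ d] := fun a b d => by
    funext i; fin_cases i <;> rfl
  rw [h]
  simp only [ev3_add _ _ hu hv hw, ev3_smul _ _ hu hv hw, e]
  ring

/-- The first Hamiltonian on an orbit sum, cleared of the denominator `altSum rho`: each term of
`altSum_rho_mul` is multiplied by the eigenvalue of the permuted weight. -/
theorem hamiltonian_one_symSum (hq0 : 0 < q) (g : ℝ) (μ : Fin 3 → ℤ) {t : Fin 3 → ℂ}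
    (ht : ∀ j, t j ≠ 0) (hinj : Function.Injective t) :
    ev3 (altSum rho) (t 0) (t 1) (t 2) *
        hamiltonian q g 1 (fun u => ev3 (symSum μ) (u 0) (u 1) (u 2)) t =
      ev3 (∑ σ : Equiv.Perm (Fin 3), eigenvalue q g 1 (μ ∘ σ) • altSum (rho + μ ∘ σ))
        (t 0) (t 1) (t 2) := by
  have hqc : (q : ℂ) ≠ 0 := ofReal_ne_zero_of_pos hq0
  rw [ev3_sum_altSum (fun ν => eigenvalue q g 1 ν) μ (ht 0) (ht 1) (ht 2), hamiltonian_one,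
    vCoef_mul hq0 rfl, vCoef_mul hq0 rfl, vCoef_mul hq0 rfl,
    ev3_altSum_rho (ht 0) (ht 1) (ht 2)]
  have h01 : t 0 - t 1 ≠ 0 := sub_ne_zero.2 (hinj.ne (by decide))
  have h02 : t 0 - t 2 ≠ 0 := sub_ne_zero.2 (hinj.ne (by decide))
  have h12 : t 1 - t 2 ≠ 0 := sub_ne_zero.2 (hinj.ne (by decide))
  have h10 : t 1 - t 0 ≠ 0 := sub_ne_zero.2 (hinj.ne (by decide))
  have h20 : t 2 - t 0 ≠ 0 := sub_ne_zero.2 (hinj.ne (by decide))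
  have h21 : t 2 - t 1 ≠ 0 := sub_ne_zero.2 (hinj.ne (by decide))
  have a0 := ht 0
  have a1 := ht 1
  have a2 := ht 2
  have he := ellInv_ne_zero hq0 g
  clear ht hinj
  generalize t 0 = x at *
  generalize t 1 = y at *
  generalize t 2 = z at *
  simp only [eigenvalue_one, ell_eq_inv, inv_inv, Matrix.cons_val]
  simp only [ev3_symSum _ (mul_ne_zero hqc a0) a1 a2, ev3_symSum _ a0 (mul_ne_zero hqc a1) a2,
    ev3_symSum _ a0 a1 (mul_ne_zero hqc a2), ev3_altSum _ a0 a1 a2, rho, Pi.add_apply,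
    Matrix.cons_val, zpow_add₀ a0, zpow_add₀ a1, zpow_add₀ a2, zpow_one, zpow_zero, zpow_neg,
    mul_zpow]
  generalize ellInv q g = e at *
  generalize (q : ℂ) ^ μ 0 = Q0 at *
  generalize (q : ℂ) ^ μ 1 = Q1 at *
  generalize (q : ℂ) ^ μ 2 = Q2 at *
  generalize x ^ μ 0 = x0 at *
  generalize x ^ μ 1 = x1 at *
  generalize x ^ μ 2 = x2 at *
  generalize y ^ μ 0 = y0 at *
  generalize y ^ μ 1 = y1 at *
  generalize y ^ μ 2 = y2 at *
  generalize z ^ μ 0 = z0 at *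
  generalize z ^ μ 1 = z1 at *
  generalize z ^ μ 2 = z2 at *
  rw [← neg_sub x y, ← neg_sub x z, ← neg_sub y z]
  field_simp
  ring

/-- The second Hamiltonian on an orbit sum, cleared of the denominator. -/
theorem hamiltonian_two_symSum (hq0 : 0 < q) (g : ℝ) (μ : Fin 3 → ℤ) {t : Fin 3 → ℂ}
    (ht : ∀ j, t j ≠ 0) (hinj : Function.Injective t) :
    ev3 (altSum rho) (t 0) (t 1) (t 2) *
        hamiltonian q g 2 (fun u => ev3 (symSum μ) (u 0) (u 1) (u 2)) t =
      ev3 (∑ σ : Equiv.Perm (Fin 3), eigenvalue q g 2 (μ ∘ σ) • altSum (rho + μ ∘ σ))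
        (t 0) (t 1) (t 2) := by
  have hqc : (q : ℂ) ≠ 0 := ofReal_ne_zero_of_pos hq0
  rw [ev3_sum_altSum (fun ν => eigenvalue q g 2 ν) μ (ht 0) (ht 1) (ht 2), hamiltonian_two,
    vCoef_mul hq0 rfl, vCoef_mul hq0 rfl, vCoef_mul hq0 rfl,
    ev3_altSum_rho (ht 0) (ht 1) (ht 2)]
  have h01 : t 0 - t 1 ≠ 0 := sub_ne_zero.2 (hinj.ne (by decide))
  have h02 : t 0 - t 2 ≠ 0 := sub_ne_zero.2 (hinj.ne (by decide))
  have h12 : t 1 - t 2 ≠ 0 := sub_ne_zero.2 (hinj.ne (by decide))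
  have h10 : t 1 - t 0 ≠ 0 := sub_ne_zero.2 (hinj.ne (by decide))
  have h20 : t 2 - t 0 ≠ 0 := sub_ne_zero.2 (hinj.ne (by decide))
  have h21 : t 2 - t 1 ≠ 0 := sub_ne_zero.2 (hinj.ne (by decide))
  have a0 := ht 0
  have a1 := ht 1
  have a2 := ht 2
  have he := ellInv_ne_zero hq0 g
  clear ht hinj
  generalize t 0 = x at *
  generalize t 1 = y at *
  generalize t 2 = z at *
  simp only [eigenvalue_two hq0, ell_eq_inv, inv_inv, Matrix.cons_val]
  simp only [ev3_symSum _ (mul_ne_zero hqc a0) (mul_ne_zero hqc a1) a2,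
    ev3_symSum _ (mul_ne_zero hqc a0) a1 (mul_ne_zero hqc a2),
    ev3_symSum _ a0 (mul_ne_zero hqc a1) (mul_ne_zero hqc a2), ev3_altSum _ a0 a1 a2, rho, Pi.add_apply,
    Matrix.cons_val, zpow_add₀ a0, zpow_add₀ a1, zpow_add₀ a2, zpow_one, zpow_zero, zpow_neg,
    mul_zpow]
  generalize ellInv q g = e at *
  generalize (q : ℂ) ^ μ 0 = Q0 at *
  generalize (q : ℂ) ^ μ 1 = Q1 at *
  generalize (q : ℂ) ^ μ 2 = Q2 at *
  generalize x ^ μ 0 = x0 at *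
  generalize x ^ μ 1 = x1 at *
  generalize x ^ μ 2 = x2 at *
  generalize y ^ μ 0 = y0 at *
  generalize y ^ μ 1 = y1 at *
  generalize y ^ μ 2 = y2 at *
  generalize z ^ μ 0 = z0 at *
  generalize z ^ μ 1 = z1 at *
  generalize z ^ μ 2 = z2 at *
  rw [← neg_sub x y, ← neg_sub x z, ← neg_sub y z]
  field_simp
  ring

/-! ### Triangularity of the Hamiltonians -/

theorem domLE_iff {κ μ : Fin 3 → ℤ} : DomLE κ μ ↔
    κ 0 + κ 1 + κ 2 = μ 0 + μ 1 + μ 2 ∧ μ 0 ≤ κ 0 ∧ κ 2 ≤ μ 2 := by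
  have e0 : ∀ f : Fin 3 → ℤ, ∑ j ∈ Finset.Ici 0, f j = f 0 + f 1 + f 2 := fun f => by
    rw [show Finset.Ici (0 : Fin 3) = Finset.univ by decide, Fin.sum_univ_three]
  have e1 : ∀ f : Fin 3 → ℤ, ∑ j ∈ Finset.Ici 1, f j = f 1 + f 2 := fun f => by
    rw [show Finset.Ici (1 : Fin 3) = {1, 2} by decide, Finset.sum_pair (by decide)]
  have e2 : ∀ f : Fin 3 → ℤ, ∑ j ∈ Finset.Ici 2, f j = f 2 := fun f => by
    rw [show Finset.Ici (2 : Fin 3) = {2} by decide, Finset.sum_singleton]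
  unfold DomLE
  rw [Fin.sum_univ_three, Fin.sum_univ_three, Fin.forall_fin_succ, Fin.forall_fin_two]
  simp only [Fin.succ_zero_eq_one, Fin.succ_one_eq_two, e0, e1, e2]
  omega

/-- The dominant weights strictly below `μ` in the dominance order. -/
def lowerWeights (μ : Fin 3 → ℤ) : Set (Fin 3 → ℤ) := {κ | Monotone κ ∧ DomLE κ μ ∧ κ ≠ μ}

/-- The span of the orbit sums of the dominant weights strictly below `μ`. -/
def lowerSpan (μ : Fin 3 → ℤ) : Submodule ℂ Laurent3 :=
  Submodule.span ℂ (symSum '' lowerWeights μ)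

theorem finite_lowerWeights (μ : Fin 3 → ℤ) : (lowerWeights μ).Finite := by
  refine (Set.finite_Icc (fun _ => μ 0) (fun _ => μ 2)).subset ?_
  rintro κ ⟨h1, h2, -⟩
  exact ⟨fun i => (h2.le h1 i).1, fun i => (h2.le h1 i).2⟩

theorem spread_lt {κ μ : Fin 3 → ℤ} (h : κ ∈ lowerWeights μ) : κ 2 - κ 0 < μ 2 - μ 0 := by
  obtain ⟨-, h2, h3⟩ := h
  obtain ⟨a, b, c⟩ := domLE_iff.1 h2
  by_contra! hc
  refine h3 (funext fun i => ?_)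
  fin_cases i
  · show κ 0 = μ 0; omega
  · show κ 1 = μ 1; omega
  · show κ 2 = μ 2; omega

theorem lowerWeights_subset {κ μ : Fin 3 → ℤ} (h : κ ∈ lowerWeights μ) :
    lowerWeights κ ⊆ lowerWeights μ := by
  intro ν hν
  have s1 := spread_lt h
  have s2 := spread_lt hν
  obtain ⟨a, b, c⟩ := domLE_iff.1 h.2.1
  obtain ⟨a', b', c'⟩ := domLE_iff.1 hν.2.1
  refine ⟨hν.1, domLE_iff.2 (by omega), ?_⟩
  rintro rfl
  omega

theorem symSum_mem_lowerSpan {κ μ : Fin 3 → ℤ} (h : κ ∈ lowerWeights μ) :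
    symSum κ ∈ lowerSpan μ :=
  Submodule.subset_span ⟨κ, h, rfl⟩

theorem lowerSpan_le {κ μ : Fin 3 → ℤ} (h : κ ∈ lowerWeights μ) : lowerSpan κ ≤ lowerSpan μ :=
  Submodule.span_mono (Set.image_mono (lowerWeights_subset h))

/-- Straightening: a permutation of `μ` which is not `μ` itself contributes only lower terms. If
`ρ + μ ∘ σ` has distinct entries, sorting them gives `ρ + κ` with `κ` strictly below `μ`. -/
theorem exists_lower_of_comp_ne (n : ℕ) : ∀ {μ : Fin 3 → ℤ}, Monotone μ → (μ 2 - μ 0).toNat = n →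
    ∀ σ : Equiv.Perm (Fin 3), μ ∘ σ ≠ μ →
      ∃ s ∈ lowerSpan μ, altSum rho * s = altSum (rho + μ ∘ σ) := by
  induction n using Nat.strong_induction_on with
  | _ n ih =>
    intro μ hμ hn σ hσ
    by_cases hinj : Function.Injective (rho + μ ∘ σ)
    swap
    · exact ⟨0, Submodule.zero_mem _, by rw [altSum_eq_zero hinj, mul_zero]⟩
    obtain ⟨ν, hν⟩ : ∃ ν, ν = rho + μ ∘ σ := ⟨_, rfl⟩
    rw [← hν] at hinj ⊢
    -- sort the exponents `ν`; the sorted vector is `ρ + κ`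
    obtain ⟨τ, hτ⟩ : ∃ τ : Equiv.Perm (Fin 3), StrictMono (ν ∘ τ) :=
      ⟨Tuple.sort ν, (Tuple.monotone_sort ν).strictMono_of_injective
        (hinj.comp (Tuple.sort ν).injective)⟩
    obtain ⟨κ, hκ⟩ : ∃ κ, κ = ν ∘ τ - rho := ⟨_, rfl⟩
    have r0 : rho 0 = -1 := rfl
    have r1 : rho 1 = 0 := rfl
    have r2 : rho 2 = 1 := rfl
    have hk : ∀ i, κ i = ν (τ i) - rho i := fun i => by rw [hκ]; rfl
    have hvi : ∀ i, ν i = rho i + μ (σ i) := fun i => by rw [hν]; rfl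
    have l01 : ν (τ 0) < ν (τ 1) := hτ (by decide)
    have l12 : ν (τ 1) < ν (τ 2) := hτ (by decide)
    have k0 := hk 0
    have k1 := hk 1
    have k2 := hk 2
    have hrho : ∀ i, (i = 0 ∧ rho i = -1) ∨ (i = 1 ∧ rho i = 0) ∨ (i = 2 ∧ rho i = 1) := by
      decide
    have hb : ∀ i, μ 0 ≤ μ i ∧ μ i ≤ μ 2 := fun i => ⟨hμ (Fin.zero_le i), hμ (Fin.le_last i)⟩
    have hsum : ν (τ 0) + ν (τ 1) + ν (τ 2) = μ 0 + μ 1 + μ 2 := by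
      have e1 := Equiv.sum_comp τ ν
      have e2 := Equiv.sum_comp σ μ
      rw [Fin.sum_univ_three, Fin.sum_univ_three] at e1 e2
      rw [e1, ← e2, hvi, hvi, hvi, r0, r1, r2]
      ring
    have v0 := hvi (τ 0)
    have v2 := hvi (τ 2)
    have b0 := hb (σ (τ 0))
    have b2 := hb (σ (τ 2))
    have hmem : κ ∈ lowerWeights μ := by
      refine ⟨?_, domLE_iff.2 ?_, ?_⟩
      · rw [Fin.monotone_iff_le_succ, Fin.forall_fin_two]
        refine ⟨?_, ?_⟩
        · show κ 0 ≤ κ 1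
          omega
        · show κ 1 ≤ κ 2
          omega
      · rcases hrho (τ 0) with h | h | h <;> rcases hrho (τ 2) with h' | h' | h' <;> omega
      · intro heq
        rw [heq] at k0 k2
        have t2 : τ 2 = 2 := by
          rcases hrho (τ 2) with h' | h' | h' <;> omega
        have t0 : τ 0 = 0 := by
          rcases hrho (τ 0) with h' | h' | h' <;> omega
        rw [t0] at k0 v0 b0
        rw [t2] at k2 v2 b2
        have e2 := Equiv.sum_comp σ μ
        rw [Fin.sum_univ_three, Fin.sum_univ_three] at e2
        refine hσ (funext fun i => ?_)
        fin_cases i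
        · show μ (σ 0) = μ 0
          omega
        · show μ (σ 1) = μ 1
          omega
        · show μ (σ 2) = μ 2
          omega
    have hsp := spread_lt hmem
    have hAκ := ih (κ 2 - κ 0).toNat (by omega) hmem.1 rfl
    choose! s hs1 hs2 using hAκ
    -- solve `altSum_rho_mul` for `altSum (ρ + κ)`: the permutations in the stabilizer `A` of `κ` all
    -- give this term, and the others are lower by induction
    obtain ⟨A, hA⟩ : ∃ A, A = Finset.univ.filter fun σ : Equiv.Perm (Fin 3) => κ ∘ σ = κ :=
      ⟨_, rfl⟩
    have hmul := altSum_rho_mul κ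
    rw [← Finset.sum_filter_add_sum_filter_not _ (fun σ : Equiv.Perm (Fin 3) => κ ∘ σ = κ),
      ← hA, Finset.sum_congr (s₁ := A) (g := fun _ => altSum (rho + κ)) rfl (fun σ hσ => by
        rw [hA] at hσ; rw [(Finset.mem_filter.1 hσ).2]), Finset.sum_const,
      ← Finset.sum_congr rfl (fun σ hσ => hs2 σ (Finset.mem_filter.1 hσ).2),
      ← Finset.mul_sum, ← sub_eq_iff_eq_add, ← mul_sub] at hmul
    have hcard : (A.card : ℂ) ≠ 0 := by
      rw [Nat.cast_ne_zero, Finset.card_ne_zero, hA]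
      exact ⟨1, Finset.mem_filter.2 ⟨Finset.mem_univ _, rfl⟩⟩
    have hα : altSum (rho + κ) = altSum (ν ∘ τ) := by rw [hκ]; congr 1; abel
    have hsq : ((Equiv.Perm.sign τ : ℤ) : ℂ) * ((Equiv.Perm.sign τ : ℤ) : ℂ) = 1 := by
      rcases Int.units_eq_one_or (Equiv.Perm.sign τ) with h | h <;> simp [h]
    have hW := Submodule.sub_mem _ (symSum_mem_lowerSpan hmem)
      (Submodule.sum_mem (t := Finset.univ.filter fun σ : Equiv.Perm (Fin 3) => ¬κ ∘ σ = κ) _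
        fun σ hσ => lowerSpan_le hmem (hs1 σ (Finset.mem_filter.1 hσ).2))
    refine ⟨((Equiv.Perm.sign τ : ℤ) : ℂ) • (A.card : ℂ)⁻¹ • _, Submodule.smul_mem _ _
      (Submodule.smul_mem _ _ hW), ?_⟩
    rw [mul_smul_comm, mul_smul_comm, hmul, ← Nat.cast_smul_eq_nsmul ℂ, smul_smul (A.card : ℂ)⁻¹,
      inv_mul_cancel₀ hcard, one_smul, hα, altSum_comp, smul_smul, hsq, one_smul]

/-- After subtracting `c μ` times `altSum_rho_mul`, only permutations which move `μ` are left, and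
these contribute lower terms. -/
theorem exists_lower_sum {μ : Fin 3 → ℤ} (hμ : Monotone μ) (c : (Fin 3 → ℤ) → ℂ) :
    ∃ s ∈ lowerSpan μ, altSum rho * (c μ • symSum μ + s) =
      ∑ σ : Equiv.Perm (Fin 3), c (μ ∘ σ) • altSum (rho + μ ∘ σ) := by
  have hA := exists_lower_of_comp_ne _ hμ rfl
  choose! s hs1 hs2 using hA
  refine ⟨∑ σ : Equiv.Perm (Fin 3), if μ ∘ σ = μ then 0 else (c (μ ∘ σ) - c μ) • s σ,
    Submodule.sum_mem _ fun σ _ => ?_, ?_⟩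
  · split_ifs with h
    · exact Submodule.zero_mem _
    · exact Submodule.smul_mem _ _ (hs1 σ h)
  · rw [mul_add, mul_smul_comm, altSum_rho_mul, Finset.smul_sum, Finset.mul_sum,
      ← Finset.sum_add_distrib]
    refine Finset.sum_congr rfl fun σ _ => ?_
    split_ifs with h
    · rw [h, mul_zero, add_zero]
    · rw [mul_smul_comm, hs2 σ h, ← add_smul]
      congr 1
      ring

/-- `H_i F = G` as functions on the points with distinct nonzero coordinates. -/
def HamAct (q g : ℝ) (i : ℕ) (F G : Laurent3) : Prop :=
  ∀ t : Fin 3 → ℂ, (∀ j, t j ≠ 0) → Function.Injective t →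
    hamiltonian q g i (fun u => ev3 F (u 0) (u 1) (u 2)) t = ev3 G (t 0) (t 1) (t 2)

/-- Triangularity: `H_i` maps the orbit sum of `μ` to its eigenvalue times itself plus lower terms. -/
theorem hamAct_symSum (hq0 : 0 < q) (g : ℝ) {i : ℕ} (hi : i = 1 ∨ i = 2) {μ : Fin 3 → ℤ}
    (hμ : Monotone μ) :
    ∃ s ∈ lowerSpan μ, HamAct q g i (symSum μ) (eigenvalue q g i μ • symSum μ + s) := by
  obtain ⟨s, hs, h⟩ := exists_lower_sum hμ (eigenvalue q g i)
  refine ⟨s, hs, fun t ht hinj => ?_⟩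
  have hD : ev3 (altSum rho) (t 0) (t 1) (t 2) ≠ 0 := by
    rw [ev3_altSum_rho (ht 0) (ht 1) (ht 2)]
    exact div_ne_zero (mul_ne_zero (mul_ne_zero (sub_ne_zero.2 (hinj.ne (by decide)))
      (sub_ne_zero.2 (hinj.ne (by decide)))) (sub_ne_zero.2 (hinj.ne (by decide))))
      (mul_ne_zero (mul_ne_zero (ht 0) (ht 1)) (ht 2))
  refine mul_left_cancel₀ hD ?_
  rw [← ev3_mul _ _ (ht 0) (ht 1) (ht 2), h]
  rcases hi with rfl | rfl
  · exact hamiltonian_one_symSum hq0 g μ ht hinj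
  · exact hamiltonian_two_symSum hq0 g μ ht hinj

section
variable {g : ℝ} {i : ℕ} {F G F' G' : Laurent3}

theorem hamiltonian_ev3_add (hq0 : 0 < q) (g : ℝ) (i : ℕ) (F F' : Laurent3) {t : Fin 3 → ℂ}
    (ht : ∀ j, t j ≠ 0) :
    hamiltonian q g i (fun u => ev3 (F + F') (u 0) (u 1) (u 2)) t =
      hamiltonian q g i (fun u => ev3 F (u 0) (u 1) (u 2)) t +
      hamiltonian q g i (fun u => ev3 F' (u 0) (u 1) (u 2)) t := by
  have hqc : (q : ℂ) ≠ 0 := ofReal_ne_zero_of_pos hq0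
  unfold hamiltonian
  rw [← Finset.sum_add_distrib]
  refine Finset.sum_congr rfl fun J _ => ?_
  have h : ∀ j, (if j ∈ J then (q : ℂ) * t j else t j) ≠ 0 := fun j => by
    split_ifs
    · exact mul_ne_zero hqc (ht j)
    · exact ht j
  dsimp only
  rw [ev3_add _ _ (h 0) (h 1) (h 2), mul_add]

theorem hamiltonian_ev3_smul (hq0 : 0 < q) (g : ℝ) (i : ℕ) (c : ℂ) (F : Laurent3) {t : Fin 3 → ℂ}
    (ht : ∀ j, t j ≠ 0) :
    hamiltonian q g i (fun u => ev3 (c • F) (u 0) (u 1) (u 2)) t =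
      c * hamiltonian q g i (fun u => ev3 F (u 0) (u 1) (u 2)) t := by
  have hqc : (q : ℂ) ≠ 0 := ofReal_ne_zero_of_pos hq0
  unfold hamiltonian
  rw [Finset.mul_sum]
  refine Finset.sum_congr rfl fun J _ => ?_
  have h : ∀ j, (if j ∈ J then (q : ℂ) * t j else t j) ≠ 0 := fun j => by
    split_ifs
    · exact mul_ne_zero hqc (ht j)
    · exact ht j
  dsimp only
  rw [ev3_smul _ _ (h 0) (h 1) (h 2)]
  ring

theorem HamAct.add (hq0 : 0 < q) (h : HamAct q g i F G) (h' : HamAct q g i F' G') :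
    HamAct q g i (F + F') (G + G') := fun t ht hinj => by
  rw [hamiltonian_ev3_add hq0 g i F F' ht, h t ht hinj, h' t ht hinj,
    ev3_add _ _ (ht 0) (ht 1) (ht 2)]

theorem HamAct.smul (hq0 : 0 < q) (c : ℂ) (h : HamAct q g i F G) :
    HamAct q g i (c • F) (c • G) := fun t ht hinj => by
  rw [hamiltonian_ev3_smul hq0 g i c F ht, h t ht hinj, ev3_smul _ _ (ht 0) (ht 1) (ht 2)]

theorem HamAct.sub (hq0 : 0 < q) (h : HamAct q g i F G) (h' : HamAct q g i F' G') :
    HamAct q g i (F - F') (G - G') := by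
  rw [sub_eq_add_neg, sub_eq_add_neg, ← neg_one_smul ℂ F', ← neg_one_smul ℂ G']
  exact h.add hq0 (h'.smul hq0 _)

end

/-- A Laurent polynomial is determined by its values at points with pairwise different
`q`-shifts of the coordinates. -/
theorem eq_of_ev3_eq_generic (hq0 : 0 < q) {F G : Laurent3}
    (h : ∀ t : Fin 3 → ℂ, (∀ j, t j ≠ 0) → Function.Injective t →
      (∀ j k, j ≠ k → q * t j ≠ t k) → ev3 F (t 0) (t 1) (t 2) = ev3 G (t 0) (t 1) (t 2)) :
    F = G := by
  have hqc : (q : ℂ) ≠ 0 := ofReal_ne_zero_of_pos hq0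
  obtain ⟨X, hX⟩ : ∃ X : Fin 3 → Laurent3, ∀ (j : Fin 3) (t : Fin 3 → ℂ), (∀ j, t j ≠ 0) →
      ev3 (X j) (t 0) (t 1) (t 2) = t j := by
    refine ⟨fun j => AddMonoidAlgebra.single (Pi.single j 1) 1, fun j t ht => ?_⟩
    rw [ev3_single]
    fin_cases j <;> simp
  have hX0 : ∀ (c : ℂ) (j k : Fin 3), j ≠ k → c ≠ 0 → c • X j - X k ≠ 0 := by
    intro c j k hjk hc h0
    have := congrArg (fun F => ev3 F ((if j = 0 then 2 * c⁻¹ else 1 : ℂ))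
      (if j = 1 then 2 * c⁻¹ else 1 : ℂ) (if j = 2 then 2 * c⁻¹ else 1 : ℂ)) h0
    have hc' : 2 * c⁻¹ ≠ 0 := mul_ne_zero two_ne_zero (inv_ne_zero hc)
    have ht : ∀ i, (fun i : Fin 3 => if j = i then 2 * c⁻¹ else (1 : ℂ)) i ≠ 0 := fun i => by
      dsimp only
      split_ifs
      · exact hc'
      · exact one_ne_zero
    have h1 := hX j _ ht
    have h2 := hX k _ ht
    rw [ev3_sub _ _ (ht 0) (ht 1) (ht 2), ev3_smul _ _ (ht 0) (ht 1) (ht 2), h1, h2, if_pos rfl,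
      if_neg hjk, ev3_zero] at this
    field_simp at this
    norm_num at this
  obtain ⟨D, hD⟩ : ∃ D : Laurent3, D = ∏ j, ∏ k, if j = k then 1 else
      ((1 : ℂ) • X j - X k) * ((q : ℂ) • X j - X k) := ⟨_, rfl⟩
  have hD0 : D ≠ 0 := by
    rw [hD]
    refine Finset.prod_ne_zero_iff.2 fun j _ => Finset.prod_ne_zero_iff.2 fun k _ => ?_
    split_ifs with hjk
    · exact one_ne_zero
    · exact mul_ne_zero (hX0 _ _ _ hjk one_ne_zero) (hX0 _ _ _ hjk hqc)
  refine mul_left_cancel₀ hD0 (ev3_inj fun u v w hu hv hw => ?_)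
  obtain ⟨t, ht0, ht1, ht2⟩ : ∃ t : Fin 3 → ℂ, t 0 = u ∧ t 1 = v ∧ t 2 = w :=
    ⟨![u, v, w], rfl, rfl, rfl⟩
  have ht : ∀ j, t j ≠ 0 := fun j => by
    fin_cases j
    · exact ht0 ▸ hu
    · exact ht1 ▸ hv
    · exact ht2 ▸ hw
  rw [ev3_mul _ _ hu hv hw, ev3_mul _ _ hu hv hw, ← ht0, ← ht1, ← ht2]
  by_cases hg : Function.Injective t ∧ ∀ j k, j ≠ k → q * t j ≠ t k
  · rw [h t ht hg.1 hg.2]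
  · have hz : ∃ j k, j ≠ k ∧ (t j - t k) * (q * t j - t k) = 0 := by
      by_contra! hc
      refine hg ⟨fun j k hjk => ?_, fun j k hjk h0 => ?_⟩
      · by_contra hne
        exact hc j k hne (by rw [hjk, sub_self, zero_mul])
      · exact hc j k hjk (by rw [h0, sub_self, mul_zero])
    obtain ⟨j, k, hjk, h0⟩ := hz
    have hDz : ev3 D (t 0) (t 1) (t 2) = 0 := by
      rw [hD, ← Finset.mul_prod_erase _ _ (Finset.mem_univ j), ev3_mul _ _ (ht 0) (ht 1) (ht 2),
        ← Finset.mul_prod_erase _ _ (Finset.mem_univ k), ev3_mul _ _ (ht 0) (ht 1) (ht 2),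
        if_neg hjk, ev3_mul _ _ (ht 0) (ht 1) (ht 2), ev3_sub _ _ (ht 0) (ht 1) (ht 2),
        ev3_sub _ _ (ht 0) (ht 1) (ht 2), ev3_smul _ _ (ht 0) (ht 1) (ht 2),
        ev3_smul _ _ (ht 0) (ht 1) (ht 2), hX _ _ ht, hX _ _ ht, one_mul, h0, zero_mul, zero_mul]
    rw [hDz, zero_mul, zero_mul]

/-! ### Commutativity of the Hamiltonians -/

/-- The identity behind the commutativity of the first two Hamiltonians. -/
theorem commutator_identity {a b p x y z : ℂ} (h1 : x - y ≠ 0) (h2 : x - z ≠ 0) (h3 : y - z ≠ 0)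
    (k1 : y - p * x ≠ 0) (k2 : z - p * x ≠ 0) (k3 : x - p * y ≠ 0) (k4 : z - p * y ≠ 0)
    (k5 : x - p * z ≠ 0) (k6 : y - p * z ≠ 0) :
    (a * x - b * y) / (x - y) * ((a * x - b * z) / (x - z)) *
        ((a * y - b * (p * x)) / (y - p * x)) * ((a * z - b * (p * x)) / (z - p * x)) +
      (a * y - b * x) / (y - x) * ((a * y - b * z) / (y - z)) *
        ((a * x - b * (p * y)) / (x - p * y)) * ((a * z - b * (p * y)) / (z - p * y)) +
      (a * z - b * x) / (z - x) * ((a * z - b * y) / (z - y)) *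
        ((a * x - b * (p * z)) / (x - p * z)) * ((a * y - b * (p * z)) / (y - p * z)) =
    (a * y - b * x) / (y - x) * ((a * z - b * x) / (z - x)) *
        ((a * x - b * (p * y)) / (x - p * y)) * ((a * x - b * (p * z)) / (x - p * z)) +
      (a * x - b * y) / (x - y) * ((a * z - b * y) / (z - y)) *
        ((a * y - b * (p * x)) / (y - p * x)) * ((a * y - b * (p * z)) / (y - p * z)) +
      (a * x - b * z) / (x - z) * ((a * y - b * z) / (y - z)) *
        ((a * z - b * (p * x)) / (z - p * x)) * ((a * z - b * (p * y)) / (z - p * y)) := by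
  rw [← neg_sub x y, ← neg_sub x z, ← neg_sub y z]
  obtain ⟨d1, e1⟩ : ∃ d, d = x - y := ⟨_, rfl⟩
  obtain ⟨d2, e2⟩ : ∃ d, d = x - z := ⟨_, rfl⟩
  obtain ⟨d3, e3⟩ : ∃ d, d = y - z := ⟨_, rfl⟩
  obtain ⟨c1, f1⟩ : ∃ d, d = y - p * x := ⟨_, rfl⟩
  obtain ⟨c2, f2⟩ : ∃ d, d = z - p * x := ⟨_, rfl⟩
  obtain ⟨c3, f3⟩ : ∃ d, d = x - p * y := ⟨_, rfl⟩
  obtain ⟨c4, f4⟩ : ∃ d, d = z - p * y := ⟨_, rfl⟩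
  obtain ⟨c5, f5⟩ : ∃ d, d = x - p * z := ⟨_, rfl⟩
  obtain ⟨c6, f6⟩ : ∃ d, d = y - p * z := ⟨_, rfl⟩
  rw [← e1] at h1 ⊢
  rw [← e2] at h2 ⊢
  rw [← e3] at h3 ⊢
  rw [← f1] at k1 ⊢
  rw [← f2] at k2 ⊢
  rw [← f3] at k3 ⊢
  rw [← f4] at k4 ⊢
  rw [← f5] at k5 ⊢
  rw [← f6] at k6 ⊢
  field_simp
  subst e1 e2 e3 f1 f2 f3 f4 f5 f6
  ring

section
variable {g : ℝ} {F G F₁ F₂ A B : Laurent3}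

/-- The coefficient `v_{jk}` as a function of `t_j` and `t_k`. -/
def vFun (q g : ℝ) (a b : ℂ) : ℂ := (ellPow q g (-(1 / 2)) * a - ellPow q g (1 / 2) * b) / (a - b)

theorem vFun_mul_mul (hq0 : 0 < q) (g : ℝ) (a b : ℂ) :
    vFun q g (q * a) (q * b) = vFun q g a b := by
  have hqc : (q : ℂ) ≠ 0 := ofReal_ne_zero_of_pos hq0
  unfold vFun
  rw [← mul_sub, mul_left_comm, mul_left_comm _ (q : ℂ) b, ← mul_sub, mul_div_mul_left _ _ hqc]

theorem injective_of_pairwise {x y z : ℂ} (h1 : x ≠ y) (h2 : x ≠ z) (h3 : y ≠ z) :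
    Function.Injective ![x, y, z] := by
  intro i j hij
  fin_cases i <;> fin_cases j <;> simp_all

theorem HamAct.one (h : HamAct q g 1 F G) {x y z : ℂ} (hx : x ≠ 0) (hy : y ≠ 0) (hz : z ≠ 0)
    (h1 : x ≠ y) (h2 : x ≠ z) (h3 : y ≠ z) : ev3 G x y z =
      vFun q g x y * vFun q g x z * ev3 F (q * x) y z +
      vFun q g y x * vFun q g y z * ev3 F x (q * y) z +
      vFun q g z x * vFun q g z y * ev3 F x y (q * z) := by
  have := h ![x, y, z] (by intro j; fin_cases j; exacts [hx, hy, hz])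
    (injective_of_pairwise h1 h2 h3)
  rw [hamiltonian_one] at this
  exact this.symm

theorem HamAct.two (h : HamAct q g 2 F G) {x y z : ℂ} (hx : x ≠ 0) (hy : y ≠ 0) (hz : z ≠ 0)
    (h1 : x ≠ y) (h2 : x ≠ z) (h3 : y ≠ z) : ev3 G x y z =
      vFun q g x z * vFun q g y z * ev3 F (q * x) (q * y) z +
      vFun q g x y * vFun q g z y * ev3 F (q * x) y (q * z) +
      vFun q g y x * vFun q g z x * ev3 F x (q * y) (q * z) := by
  have := h ![x, y, z] (by intro j; fin_cases j; exacts [hx, hy, hz])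
    (injective_of_pairwise h1 h2 h3)
  rw [hamiltonian_two] at this
  exact this.symm

/-- The first two Hamiltonians commute. -/
theorem HamAct.comm (hq0 : 0 < q) (h₁ : HamAct q g 1 F F₁) (h₂ : HamAct q g 2 F F₂)
    (h₁₂ : HamAct q g 1 F₂ A) (h₂₁ : HamAct q g 2 F₁ B) : A = B := by
  have hqc : (q : ℂ) ≠ 0 := ofReal_ne_zero_of_pos hq0
  refine eq_of_ev3_eq_generic hq0 fun t ht hinj hgen => ?_
  have d01 : t 0 ≠ t 1 := hinj.ne (by decide)
  have d02 : t 0 ≠ t 2 := hinj.ne (by decide)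
  have d12 : t 1 ≠ t 2 := hinj.ne (by decide)
  have g01 := hgen 0 1 (by decide)
  have g02 := hgen 0 2 (by decide)
  have g10 := hgen 1 0 (by decide)
  have g12 := hgen 1 2 (by decide)
  have g20 := hgen 2 0 (by decide)
  have g21 := hgen 2 1 (by decide)
  have a0 := ht 0
  have a1 := ht 1
  have a2 := ht 2
  clear ht hinj hgen
  generalize t 0 = x at *
  generalize t 1 = y at *
  generalize t 2 = z at *
  have b0 := mul_ne_zero hqc a0
  have b1 := mul_ne_zero hqc a1
  have b2 := mul_ne_zero hqc a2
  have e01 : (q : ℂ) * x ≠ q * y := fun h => d01 (mul_left_cancel₀ hqc h)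
  have e02 : (q : ℂ) * x ≠ q * z := fun h => d02 (mul_left_cancel₀ hqc h)
  have e12 : (q : ℂ) * y ≠ q * z := fun h => d12 (mul_left_cancel₀ hqc h)
  rw [h₁₂.one a0 a1 a2 d01 d02 d12, h₂.two b0 a1 a2 g01 g02 d12,
    h₂.two a0 b1 a2 g10.symm d02 g12, h₂.two a0 a1 b2 d01 g20.symm g21.symm,
    h₂₁.two a0 a1 a2 d01 d02 d12, h₁.one b0 b1 a2 e01 g02 g12,
    h₁.one b0 a1 b2 g01 e02 g21.symm, h₁.one a0 b1 b2 g10.symm g20.symm e12]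
  have key := commutator_identity (a := ellPow q g (-(1 / 2))) (b := ellPow q g (1 / 2)) (p := q)
    (sub_ne_zero.2 d01) (sub_ne_zero.2 d02) (sub_ne_zero.2 d12) (sub_ne_zero.2 g01.symm)
    (sub_ne_zero.2 g02.symm) (sub_ne_zero.2 g10.symm) (sub_ne_zero.2 g12.symm)
    (sub_ne_zero.2 g20.symm) (sub_ne_zero.2 g21.symm)
  simp only [vFun_mul_mul hq0]
  have hv : ∀ a b, (ellPow q g (-(1 / 2)) * a - ellPow q g (1 / 2) * b) / (a - b) =
    vFun q g a b := fun _ _ => rfl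
  simp only [hv] at key
  linear_combination ev3 F (q * x) (q * y) (q * z) * key

end

/-! ### Joint eigenvectors -/

/-- The first eigenvalue strictly decreases under going down in the dominance order. Here `(p, r, s)`
are the powers of `q` for the lower weight and `(p / A, r A / B, s B)` those for the upper one. -/
theorem eigenvalue_lt_aux {L p r s A B : ℝ} (hL : 1 < L) (hpr : r ≤ p) (hrs : s ≤ r) (hs : 0 < s)
    (hA : 0 < A) (hA1 : A ≤ 1) (hB : 0 < B) (hB1 : B ≤ 1) (hAB : A < 1 ∨ B < 1) :
    p * L + r + s * L⁻¹ < p / A * L + r * A / B + s * B * L⁻¹ := by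
  have hr : 0 < r := hs.trans_le hrs
  have hp : 0 < p := hr.trans_le hpr
  have hL0 : 0 < L := one_pos.trans hL
  have hL1 : L⁻¹ < 1 := inv_lt_one_of_one_lt₀ hL
  have hL1' : 0 < L⁻¹ := inv_pos.2 hL0
  have a1 : 1 ≤ 1 / A := (one_le_div hA).2 hA1
  -- the arithmetic-geometric mean inequality
  have amgm : 3 ≤ 1 / A + A / B + B := by
    have : 1 / A + A / B + B - 3 = ((A - B) ^ 2 + B * (1 - B) * (1 - A)) / (A * B) := by
      field_simp
      ring
    have h2 : 0 ≤ ((A - B) ^ 2 + B * (1 - B) * (1 - A)) / (A * B) :=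
      div_nonneg (add_nonneg (sq_nonneg _) (mul_nonneg (mul_nonneg hB.le (sub_nonneg.2 hB1))
        (sub_nonneg.2 hA1))) (mul_nonneg hA.le hB.le)
    linarith
  have i1 : r * (1 / A - 1) ≤ p * (1 / A - 1) := mul_le_mul_of_nonneg_right hpr (by linarith)
  have i2 : p * (1 / A - 1) ≤ p * (1 / A - 1) * L :=
    le_mul_of_one_le_right (mul_nonneg hp.le (by linarith)) hL.le
  have i3 : s * (1 - B) ≤ r * (1 - B) := mul_le_mul_of_nonneg_right hrs (by linarith)
  have i4 : s * (1 - B) * L⁻¹ ≤ s * (1 - B) :=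
    mul_le_of_le_one_right (mul_nonneg hs.le (by linarith)) hL1.le
  have i5 : 0 ≤ r * (1 / A + A / B + B - 3) := mul_nonneg hr.le (by linarith)
  have e1 : p / A * L + r * A / B + s * B * L⁻¹ - (p * L + r + s * L⁻¹) =
      p * (1 / A - 1) * L + r * (A / B - 1) - s * (1 - B) * L⁻¹ := by
    ring
  have e2 : r * (1 / A + A / B + B - 3) = r * (1 / A - 1) + r * (A / B - 1) - r * (1 - B) := by
    ring
  rcases hAB with h | h
  · have i2' : p * (1 / A - 1) < p * (1 / A - 1) * L :=
      lt_mul_of_one_lt_right (mul_pos hp (by have := (one_lt_div hA).2 h; linarith)) hL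
    linarith
  · have i4' : s * (1 - B) * L⁻¹ < s * (1 - B) :=
      mul_lt_of_lt_one_right (mul_pos hs (by linarith)) hL1
    linarith

/-- The first eigenvalue separates a dominant weight from those below it. -/
theorem eigenvalue_one_ne (hq0 : 0 < q) (hq1 : q < 1) {g : ℝ} (hg : 0 < g) {κ μ : Fin 3 → ℤ}
    (h : κ ∈ lowerWeights μ) : eigenvalue q g 1 κ ≠ eigenvalue q g 1 μ := by
  obtain ⟨hm, hd, -⟩ := id h
  obtain ⟨hsum, h0, h2⟩ := domLE_iff.1 hd
  have hL : 1 < ell q g := Real.one_lt_rpow_of_pos_of_lt_one_of_neg hq0 hq1 (by linarith)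
  have hle : ∀ {a b : ℤ}, a ≤ b → q ^ b ≤ q ^ a := fun hab =>
    zpow_le_zpow_right_of_le_one₀ hq0 hq1.le hab
  have hlt : ∀ {a b : ℤ}, a < b → q ^ b < q ^ a := fun hab =>
    zpow_lt_zpow_right_of_lt_one₀ hq0 hq1 hab
  have m01 : κ 0 ≤ κ 1 := hm (by decide)
  have m12 : κ 1 ≤ κ 2 := hm (by decide)
  have hsp := spread_lt h
  have hA : 0 < q ^ (κ 0 - μ 0) := zpow_pos hq0 _
  have hB : 0 < q ^ (μ 2 - κ 2) := zpow_pos hq0 _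
  have key := eigenvalue_lt_aux hL (hle m01) (hle m12) (zpow_pos hq0 _) hA
    (by rw [← zpow_zero q]; exact hle (by omega)) hB
    (by rw [← zpow_zero q]; exact hle (by omega)) (by
      rcases lt_or_ge (μ 0) (κ 0) with h' | h'
      · exact Or.inl (by rw [← zpow_zero q]; exact hlt (by omega))
      · exact Or.inr (by rw [← zpow_zero q]; exact hlt (by omega)))
  have e0 : q ^ κ 0 / q ^ (κ 0 - μ 0) = q ^ μ 0 := by
    rw [← zpow_sub₀ hq0.ne']; congr 1; omega
  have e1 : q ^ κ 1 * q ^ (κ 0 - μ 0) / q ^ (μ 2 - κ 2) = q ^ μ 1 := by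
    rw [← zpow_add₀ hq0.ne', ← zpow_sub₀ hq0.ne']; congr 1; omega
  have e2 : q ^ κ 2 * q ^ (μ 2 - κ 2) = q ^ μ 2 := by
    rw [← zpow_add₀ hq0.ne']; congr 1; omega
  rw [e0, e1, e2] at key
  rw [eigenvalue_one, eigenvalue_one]
  exact_mod_cast key.ne

section
variable {g : ℝ} {μ lam : Fin 3 → ℤ}

theorem HamAct.unique (hq0 : 0 < q) {i : ℕ} {F G G' : Laurent3} (h : HamAct q g i F G)
    (h' : HamAct q g i F G') : G = G' :=
  eq_of_ev3_eq_generic hq0 fun t ht hinj _ => (h t ht hinj).symm.trans (h' t ht hinj)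

theorem hamAct_zero (hq0 : 0 < q) (i : ℕ) : HamAct q g i 0 0 := by
  intro t ht hinj
  have := hamiltonian_ev3_smul hq0 g i 0 0 ht
  rw [zero_mul, smul_zero] at this
  rw [this, ev3_zero]

theorem exists_hamAct_mem (hq0 : 0 < q) {i : ℕ} (hi : i = 1 ∨ i = 2) {U : Laurent3}
    (hU : U ∈ lowerSpan lam) : ∃ G ∈ lowerSpan lam, HamAct q g i U G := by
  induction hU using Submodule.span_induction with
  | mem U h =>
    obtain ⟨κ, hκ, rfl⟩ := h
    obtain ⟨s, hs, h⟩ := hamAct_symSum hq0 g hi hκ.1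
    exact ⟨_, Submodule.add_mem _ (Submodule.smul_mem _ _ (symSum_mem_lowerSpan hκ))
      (lowerSpan_le hκ hs), h⟩
  | zero => exact ⟨0, Submodule.zero_mem _, hamAct_zero hq0 i⟩
  | add x y _ _ hx hy =>
    obtain ⟨G, hG, h⟩ := hx
    obtain ⟨G', hG', h'⟩ := hy
    exact ⟨_, Submodule.add_mem _ hG hG', h.add hq0 h'⟩
  | smul a x _ hx =>
    obtain ⟨G, hG, h⟩ := hx
    exact ⟨_, Submodule.smul_mem _ a hG, h.smul hq0 a⟩

/-- Solvability of `(H₁ - c) G = U` on the span of a set of orbit sums follows from the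
solvability for these. -/
theorem exists_solve_of_span (hq0 : 0 < q) {c : ℂ} {S : Set (Fin 3 → ℤ)}
    (hS : ∀ κ ∈ S, ∃ G ∈ lowerSpan lam, HamAct q g 1 G (c • G + symSum κ)) {U : Laurent3}
    (hU : U ∈ Submodule.span ℂ (symSum '' S)) :
    ∃ G ∈ lowerSpan lam, HamAct q g 1 G (c • G + U) := by
  induction hU using Submodule.span_induction with
  | mem U h =>
    obtain ⟨κ, hκ, rfl⟩ := h
    exact hS κ hκ
  | zero => exact ⟨0, Submodule.zero_mem _, by simpa using hamAct_zero hq0 1⟩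
  | add x y _ _ hx hy =>
    obtain ⟨G, hG, h⟩ := hx
    obtain ⟨G', hG', h'⟩ := hy
    refine ⟨_, Submodule.add_mem _ hG hG', ?_⟩
    convert h.add hq0 h' using 1
    module
  | smul a x _ hx =>
    obtain ⟨G, hG, h⟩ := hx
    refine ⟨_, Submodule.smul_mem _ a hG, ?_⟩
    convert h.smul hq0 a using 1
    module

theorem exists_solve_symSum (hq0 : 0 < q) (hq1 : q < 1) (hg : 0 < g) (n : ℕ) :
    ∀ κ ∈ lowerWeights lam, (κ 2 - κ 0).toNat = n →
      ∃ G ∈ lowerSpan lam, HamAct q g 1 G (eigenvalue q g 1 lam • G + symSum κ) := by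
  induction n using Nat.strong_induction_on with
  | _ n ih =>
    intro κ hκ hn
    obtain ⟨s, hs, h⟩ := hamAct_symSum hq0 g (Or.inl rfl : 1 = 1 ∨ 1 = 2) hκ.1
    obtain ⟨G, hG, h'⟩ := exists_solve_of_span hq0 (fun ν hν => ih _ (by
      have := spread_lt hν
      have : ν 0 ≤ ν 2 := hν.1 (by decide)
      omega) ν (lowerWeights_subset hκ hν) rfl) hs
    have hne := sub_ne_zero.2 (eigenvalue_one_ne hq0 hq1 hg hκ)
    refine ⟨_, Submodule.smul_mem _ (eigenvalue q g 1 κ - eigenvalue q g 1 lam)⁻¹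
      (Submodule.sub_mem _ (symSum_mem_lowerSpan hκ) hG), ?_⟩
    convert (h.sub hq0 h').smul hq0 (eigenvalue q g 1 κ - eigenvalue q g 1 lam)⁻¹ using 1
    have e : symSum κ = (eigenvalue q g 1 κ - eigenvalue q g 1 lam)⁻¹ •
        (eigenvalue q g 1 κ - eigenvalue q g 1 lam) • symSum κ := by
      rw [smul_smul, inv_mul_cancel₀ hne, one_smul]
    nth_rewrite 2 [e]
    module

/-- `H₁ - h₁(λ)` maps the span of the lower orbit sums onto itself. -/
theorem exists_solve (hq0 : 0 < q) (hq1 : q < 1) (hg : 0 < g) {U : Laurent3}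
    (hU : U ∈ lowerSpan lam) :
    ∃ G ∈ lowerSpan lam, HamAct q g 1 G (eigenvalue q g 1 lam • G + U) :=
  exists_solve_of_span hq0 (fun κ hκ => exists_solve_symSum hq0 hq1 hg _ κ hκ rfl) hU

/-- `H₁ - h₁(λ)` is injective on the span of the lower orbit sums, which is finite-dimensional. -/
theorem eq_zero_of_hamAct (hq0 : 0 < q) (hq1 : q < 1) (hg : 0 < g) {U : Laurent3}
    (hU : U ∈ lowerSpan lam) (h : HamAct q g 1 U (eigenvalue q g 1 lam • U)) : U = 0 := by
  have hex : ∀ U : lowerSpan lam, ∃ G : lowerSpan lam, HamAct q g 1 (U : Laurent3) G := fun U => by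
    obtain ⟨G, hG, h⟩ := exists_hamAct_mem (g := g) hq0 (Or.inl rfl : 1 = 1 ∨ 1 = 2) U.2
    exact ⟨⟨G, hG⟩, h⟩
  choose f hf using hex
  let L : lowerSpan lam →ₗ[ℂ] lowerSpan lam :=
    { toFun := fun U => f U - eigenvalue q g 1 lam • U
      map_add' := fun U V => by
        have : f (U + V) = f U + f V :=
          Subtype.ext ((hf (U + V)).unique hq0 ((hf U).add hq0 (hf V)))
        rw [this]
        module
      map_smul' := fun a U => by
        have : f (a • U) = a • f U := Subtype.ext ((hf (a • U)).unique hq0 ((hf U).smul hq0 a))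
        rw [this, RingHom.id_apply]
        module }
  have : Module.Finite ℂ (lowerSpan lam) :=
    Module.Finite.span_of_finite ℂ ((finite_lowerWeights lam).image _)
  have hsurj : Function.Surjective L := fun V => by
    obtain ⟨G, hG, hGV⟩ := exists_solve hq0 hq1 hg V.2
    refine ⟨⟨G, hG⟩, Subtype.ext ?_⟩
    have := (hf ⟨G, hG⟩).unique hq0 hGV
    show (f ⟨G, hG⟩ : Laurent3) - eigenvalue q g 1 lam • G = V
    rw [this]
    module
  have hinj := LinearMap.injective_iff_surjective.2 hsurj
  have h0 : L ⟨U, hU⟩ = 0 := Subtype.ext (by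
    show (f ⟨U, hU⟩ : Laurent3) - eigenvalue q g 1 lam • U = 0
    rw [(hf ⟨U, hU⟩).unique hq0 h, sub_self])
  exact congrArg Subtype.val (hinj (h0.trans (map_zero L).symm))

theorem hamAct_three (hq0 : 0 < q) (κ : Fin 3 → ℤ) :
    HamAct q g 3 (symSum κ) (((q : ℂ) ^ (κ 0 + κ 1 + κ 2)) • symSum κ) := by
  have hqc : (q : ℂ) ≠ 0 := ofReal_ne_zero_of_pos hq0
  intro t ht hinj
  rw [hamiltonian_three, ev3_smul _ _ (ht 0) (ht 1) (ht 2), ev3_symSum _ (ht 0) (ht 1) (ht 2),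
    ev3_symSum _ (mul_ne_zero hqc (ht 0)) (mul_ne_zero hqc (ht 1)) (mul_ne_zero hqc (ht 2)),
    zpow_add₀ hqc, zpow_add₀ hqc]
  simp only [mul_zpow]
  ring

theorem hamAct_three_of_mem (hq0 : 0 < q) {U : Laurent3} (hU : U ∈ lowerSpan lam) :
    HamAct q g 3 U (((q : ℂ) ^ (lam 0 + lam 1 + lam 2)) • U) := by
  induction hU using Submodule.span_induction with
  | mem U h =>
    obtain ⟨κ, hκ, rfl⟩ := h
    rw [← (domLE_iff.1 hκ.2.1).1]
    exact hamAct_three hq0 κ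
  | zero => simpa using hamAct_zero hq0 3
  | add x y _ _ hx hy => rw [smul_add]; exact hx.add hq0 hy
  | smul a x _ hx => rw [smul_comm]; exact hx.smul hq0 a

/-- The joint eigenvector with leading term `symSum λ`. The eigenvector of `H₁` is found by
triangularity; `H₂` preserves it since it commutes with `H₁` and no lower eigenvector of `H₁` has the
same eigenvalue. -/
theorem exists_joint_eigenvector (hq0 : 0 < q) (hq1 : q < 1) (hg : 0 < g) (hlam : Monotone lam) :
    ∃ U ∈ lowerSpan lam, ∀ i : ℕ, 1 ≤ i → i ≤ 3 →
      HamAct q g i (symSum lam - U) (eigenvalue q g i lam • (symSum lam - U)) := by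
  have hqc : (q : ℂ) ≠ 0 := ofReal_ne_zero_of_pos hq0
  obtain ⟨s, hs, h⟩ := hamAct_symSum hq0 g (Or.inl rfl : 1 = 1 ∨ 1 = 2) hlam
  obtain ⟨U, hU, hU1⟩ := exists_solve hq0 hq1 hg hs
  have h1 : HamAct q g 1 (symSum lam - U) (eigenvalue q g 1 lam • (symSum lam - U)) := by
    convert h.sub hq0 hU1 using 1
    module
  obtain ⟨s', hs', h'⟩ := hamAct_symSum hq0 g (Or.inr rfl : 2 = 1 ∨ 2 = 2) hlam
  obtain ⟨G, hG, hG2⟩ := exists_hamAct_mem (g := g) hq0 (Or.inr rfl : 2 = 1 ∨ 2 = 2) hU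
  -- `H₂` maps the eigenvector to `h₂(λ)` times itself plus a lower eigenvector `w` of `H₁`
  obtain ⟨w, hw⟩ : ∃ w, w = eigenvalue q g 2 lam • U + s' - G := ⟨_, rfl⟩
  have hwm : w ∈ lowerSpan lam := hw ▸ Submodule.sub_mem _ (Submodule.add_mem _
    (Submodule.smul_mem _ _ hU) hs') hG
  have h2 : HamAct q g 2 (symSum lam - U) (eigenvalue q g 2 lam • (symSum lam - U) + w) := by
    convert h'.sub hq0 hG2 using 1
    rw [hw]
    module
  obtain ⟨w1, -, hw1⟩ := exists_hamAct_mem (g := g) hq0 (Or.inl rfl : 1 = 1 ∨ 1 = 2) hwm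
  have hc := h1.comm hq0 h2 ((h1.smul hq0 _).add hq0 hw1) (h2.smul hq0 _)
  have hw2 : w1 = eigenvalue q g 1 lam • w := by
    rw [smul_add, smul_comm] at hc
    exact add_left_cancel hc
  have hw0 : w = 0 := eq_zero_of_hamAct hq0 hq1 hg hwm (hw2 ▸ hw1)
  rw [hw0, add_zero] at h2
  refine ⟨U, hU, fun i hi1 hi3 => ?_⟩
  interval_cases i
  · exact h1
  · exact h2
  · rw [eigenvalue_three hq0, ← zpow_add₀ hqc, ← zpow_add₀ hqc, smul_sub]
    exact (hamAct_three hq0 lam).sub hq0 (hamAct_three_of_mem hq0 hU)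

theorem exists_symSum_eq_smul (μ : Fin 3 → ℤ) :
    ∃ N : ℂ, N ≠ 0 ∧ symSum μ = N • monomialSym μ := by
  refine ⟨((Finset.univ.filter fun σ : Equiv.Perm (Fin 3) => μ ∘ σ = μ).card : ℂ), ?_, ?_⟩
  · rw [Nat.cast_ne_zero, Finset.card_ne_zero]
    exact ⟨1, Finset.mem_filter.2 ⟨Finset.mem_univ _, rfl⟩⟩
  · unfold symSum monomialSym
    rw [Finset.sum_comp (fun ν : Fin 3 → ℤ => (AddMonoidAlgebra.single ν 1 : Laurent3))
      (fun σ : Equiv.Perm (Fin 3) => μ ∘ (σ : Fin 3 → Fin 3)), Finset.smul_sum]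
    refine Finset.sum_congr rfl fun ν hν => ?_
    obtain ⟨τ, -, rfl⟩ := Finset.mem_image.1 hν
    rw [← Nat.cast_smul_eq_nsmul ℂ]
    congr 2
    refine Finset.card_equiv (Equiv.mulRight τ⁻¹) fun σ => ?_
    simp only [Finset.mem_filter, Finset.mem_univ, true_and, Equiv.coe_mulRight]
    refine ⟨fun h => ?_, fun h => ?_⟩
    · funext i
      have := congrFun h (τ⁻¹ i)
      simpa using this
    · funext i
      have := congrFun h (τ i)
      simpa using this

/-- A Macdonald polynomial is obtained by normalizing the joint eigenvector, since orbit sums are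
nonzero multiples of monomial symmetric functions. -/
theorem exists_isMacdonald (hq0 : 0 < q) (hq1 : q < 1) (hg : 0 < g) (hlam : Monotone lam) :
    ∃ P : Laurent3, IsMacdonald q g lam P := by
  obtain ⟨U, hU, hE⟩ := exists_joint_eigenvector hq0 hq1 hg hlam
  obtain ⟨N, hN, hNs⟩ := exists_symSum_eq_smul lam
  have hle : lowerSpan lam ≤ Submodule.span ℂ (monomialSym '' lowerWeights lam) := by
    refine Submodule.span_le.2 ?_
    rintro _ ⟨κ, hκ, rfl⟩
    obtain ⟨N, -, h⟩ := exists_symSum_eq_smul κ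
    rw [h]
    exact Submodule.smul_mem _ _ (Submodule.subset_span ⟨κ, hκ, rfl⟩)
  obtain ⟨l, hl, hlU⟩ := (Finsupp.mem_span_image_iff_linearCombination ℂ).1
    (hle (Submodule.smul_mem _ (-N⁻¹) hU))
  have hl' : ∀ κ ∈ l.support, κ ∈ lowerWeights lam := fun κ hκ => hl hκ
  have hl0 : l lam = 0 := by
    by_contra h
    exact (hl' lam (Finsupp.mem_support_iff.2 h)).2.2 rfl
  refine ⟨N⁻¹ • (symSum lam - U), ⟨l + Finsupp.single lam 1, fun κ hκ => ?_, by simp [hl0], ?_⟩,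
    fun i hi1 hi3 t ht hinj => ?_⟩
  · by_cases h : κ = lam
    · rw [h]
      exact ⟨hlam, domLE_iff.2 ⟨rfl, le_rfl, le_rfl⟩⟩
    · have : κ ∈ l.support := by
        rw [Finsupp.mem_support_iff] at hκ ⊢
        rwa [Finsupp.add_apply, Finsupp.single_eq_of_ne (by tauto), add_zero] at hκ
      exact ⟨(hl' κ this).1, (hl' κ this).2.1⟩
  · have e : (l + Finsupp.single lam 1).sum (fun μ a => a • monomialSym μ) =
        Finsupp.linearCombination ℂ monomialSym (l + Finsupp.single lam 1) := rfl
    rw [e, map_add, hlU, Finsupp.linearCombination_single, hNs, smul_sub, smul_smul,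
      inv_mul_cancel₀ hN]
    module
  · rw [((hE i hi1 hi3).smul hq0 N⁻¹) t ht hinj, smul_comm, ev3_smul _ _ (ht 0) (ht 1) (ht 2)]

end

/-! ### The integral representation of the Macdonald polynomials -/

section
variable {g : ℝ} {lam : Fin 3 → ℤ} {P : Laurent3}

/-- `M` maps the Macdonald polynomial to the product of separated polynomials. -/
theorem IsMacdonald.ev3_symM (hq0 : 0 < q) (hq1 : q < 1) (hg : 0 < g)
    (hP : IsMacdonald q g lam P) (hlam : Monotone lam) {x y₁ y₂ : ℂ} (hx : x ≠ 0) (hy₁ : y₁ ≠ 0)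
    (hy₂ : y₂ ≠ 0) : ev3 (symM hq0 hq1 hg ⟨P, hP.mem_Sym12⟩) y₁ y₂ x =
      cCoef q g lam * x ^ (∑ j, lam j) *
        (ev (sepLaurent q g lam) y₁ * ev (sepLaurent q g lam) y₂) := by
  obtain ⟨κ, h1, h2⟩ := symM_eigen hq0 hq1 hg hlam ⟨P, hP.mem_Sym12⟩ (d := ∑ j, lam j)
    (fun c u v w hc _ _ _ => hP.homogeneous hc) hP.eigen
  rw [h2 y₁ y₂ x hy₁ hy₂ hx, hP.line_factor hq0 hq1 hg hlam h1, cCoef_eq hq0 hq1 hg hlam]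

/-- The Macdonald polynomial is the image of the separated product under the inverse of `M`. It is
unique because `M` is injective and maps all Macdonald polynomials of weight `λ` to that product. -/
theorem isMacdonald_iff_eq_symM_symm (hq0 : 0 < q) (hq1 : q < 1) (hg : 0 < g)
    (hlam : Monotone lam) : ∃ Φ : Sym12,
      (∀ x y₁ y₂ : ℂ, x ≠ 0 → y₁ ≠ 0 → y₂ ≠ 0 →
        ev3 Φ y₁ y₂ x = cCoef q g lam * x ^ (∑ j, lam j) *
          (ev (sepLaurent q g lam) y₁ * ev (sepLaurent q g lam) y₂)) ∧
      ∀ P : Laurent3, IsMacdonald q g lam P ↔ P = (symM hq0 hq1 hg).symm Φ := by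
  obtain ⟨P₀, hP₀⟩ := exists_isMacdonald hq0 hq1 hg hlam
  refine ⟨symM hq0 hq1 hg ⟨P₀, hP₀.mem_Sym12⟩, fun x y₁ y₂ hx hy₁ hy₂ =>
    hP₀.ev3_symM hq0 hq1 hg hlam hx hy₁ hy₂, fun P => ?_⟩
  rw [LinearEquiv.symm_apply_apply]
  refine ⟨fun hP => ?_, fun h => h ▸ hP₀⟩
  have h : symM hq0 hq1 hg ⟨P, hP.mem_Sym12⟩ = symM hq0 hq1 hg ⟨P₀, hP₀.mem_Sym12⟩ :=
    Subtype.ext (ev3_inj fun u v w hu hv hw => by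
      rw [hP.ev3_symM hq0 hq1 hg hlam hw hu hv, hP₀.ev3_symM hq0 hq1 hg hlam hw hu hv])
  exact congrArg Subtype.val ((symM hq0 hq1 hg).injective h)

theorem macdonald_integral (hq0 : 0 < q) (hq1 : q < 1) (hg : 0 < g) (hlam : Monotone lam)
    (hP : IsMacdonald q g lam P) {t₃ tp tm : ℂ} (ht₃ : t₃ ≠ 0)
    (h : Generic q (-g) (3 * g) tp tm) :
    ∀ᶠ ε in 𝓝[>] (0 : ℝ), ev3 P (tp * tm * t₃) (tp * tm⁻¹ * t₃) t₃ =
      cycleInt q (-g) (3 * g) tp tm ε fun ym => kernelMInv q g tp tm ym *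
        (cCoef q g lam * t₃ ^ (∑ j, lam j) *
          (ev (sepLaurent q g lam) (ellPow q g (-(3 / 2)) * tp * ym) *
            ev (sepLaurent q g lam) (ellPow q g (-(3 / 2)) * tp * ym⁻¹))) := by
  obtain ⟨Φ, hΦ, hM⟩ := isMacdonald_iff_eq_symM_symm hq0 hq1 hg hlam
  have htp : tp ≠ 0 := h.1
  have he : ellPow q g (-(3 / 2)) ≠ 0 := ellPow_ne_zero hq0 g _
  obtain ⟨φ, hφ, hev⟩ := (symM_symm_integral hq0 hq1 hg Φ ht₃ htp h.2.1).1
  rw [(hM P).1 hP, hev]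
  simp only [kernelMInv_eq hq0]
  refine ev_opM_eventually_eq hq0 hq1 h φ fun ym hym => ?_
  rw [hφ ym hym, hΦ _ _ _ ht₃ (mul_ne_zero (mul_ne_zero he htp) hym)
    (mul_ne_zero (mul_ne_zero he htp) (inv_ne_zero hym))]

end

end

end MacdonaldSoV

theorem mainTheorem3 (q : ℝ) (hq0 : 0 < q) (hq1 : q < 1) :
    ∃ M : ℂ → ℂ → ℂ → (Ref →ₗ[ℂ] Ref), IsOperatorM q M ∧
      -- the inversion formula `(M_{αβ}^r)⁻¹ = M_{-α,α+β}^r`, and the kernel of the inverse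
      (∀ α β r : ℂ, r ≠ 0 →
        (∀ n : ℕ, (q : ℂ) ^ β * (q : ℂ) ^ n ≠ 1) →
        (∀ n : ℕ, (q : ℂ) ^ (α + β) * (q : ℂ) ^ n ≠ 1) →
        (M (-α) (α + β) r ∘ₗ M α β r = LinearMap.id ∧
          M α β r ∘ₗ M (-α) (α + β) r = LinearMap.id) ∧
        ∀ (F : Ref) (t : ℂ), Generic q (-α) (α + β) r t →
          ∀ᶠ ε in 𝓝[>] (0 : ℝ),
            ev (M (-α) (α + β) r F) t =
              cycleInt q (-α) (α + β) r t ε fun s => kernelInv q α β r t s * ev F s) ∧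
      -- the specialization `α = g`, `β = 2g`
      (∀ g : ℝ, 0 < g → ∃ MM : Sym12 ≃ₗ[ℂ] Sym12,
        -- the operator `M`
        (∀ (Ψ : Sym12) (x yp ym : ℂ), x ≠ 0 → yp ≠ 0 → ym ≠ 0 →
          (∃ ψ : Ref,
            (∀ tm : ℂ, tm ≠ 0 → ev ψ tm =
              ev3 Ψ (ellPow q g (3 / 2) * x * yp * tm) (ellPow q g (3 / 2) * x * yp * tm⁻¹) x) ∧
            ev3 (MM Ψ) (yp * ym) (yp * ym⁻¹) x =
              ev (M g (2 * g) (yp * ellPow q g (3 / 2)) ψ) ym) ∧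
          (Generic q g (2 * g) (yp * ellPow q g (3 / 2)) ym →
            ∀ᶠ ε in 𝓝[>] (0 : ℝ),
              ev3 (MM Ψ) (yp * ym) (yp * ym⁻¹) x =
                cycleInt q g (2 * g) (yp * ellPow q g (3 / 2)) ym ε fun tm =>
                  kernelM q g yp ym tm *
                    ev3 Ψ (ellPow q g (3 / 2) * x * yp * tm)
                      (ellPow q g (3 / 2) * x * yp * tm⁻¹) x)) ∧
        -- the operator `M⁻¹`
        (∀ (Φ : Sym12) (t₃ tp tm : ℂ), t₃ ≠ 0 → tp ≠ 0 → tm ≠ 0 →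
          (∃ φ : Ref,
            (∀ ym : ℂ, ym ≠ 0 → ev φ ym =
              ev3 Φ (ellPow q g (-(3 / 2)) * tp * ym) (ellPow q g (-(3 / 2)) * tp * ym⁻¹) t₃) ∧
            ev3 (MM.symm Φ) (tp * tm * t₃) (tp * tm⁻¹ * t₃) t₃ =
              ev (M (-g) (3 * g) tp φ) tm) ∧
          (Generic q (-g) (3 * g) tp tm →
            ∀ᶠ ε in 𝓝[>] (0 : ℝ),
              ev3 (MM.symm Φ) (tp * tm * t₃) (tp * tm⁻¹ * t₃) t₃ =
                cycleInt q (-g) (3 * g) tp tm ε fun ym =>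
                  kernelMInv q g tp tm ym *
                    ev3 Φ (ellPow q g (-(3 / 2)) * tp * ym)
                      (ellPow q g (-(3 / 2)) * tp * ym⁻¹) t₃)) ∧
        -- the integral representation of the Macdonald polynomials
        (∀ lam : Fin 3 → ℤ, Monotone lam →
          (∃! S : ℂ[T;T⁻¹], IsSepPoly q g lam S) ∧
          ∀ S : ℂ[T;T⁻¹], IsSepPoly q g lam S →
            (∃ Φ : Sym12,
              (∀ x y₁ y₂ : ℂ, x ≠ 0 → y₁ ≠ 0 → y₂ ≠ 0 →
                ev3 Φ y₁ y₂ x = cCoef q g lam * x ^ (∑ j, lam j) * (ev S y₁ * ev S y₂)) ∧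
              ∀ P : Laurent3, IsMacdonald q g lam P ↔ P = MM.symm Φ) ∧
            ∀ P : Laurent3, IsMacdonald q g lam P →
              ∀ t₃ tp tm : ℂ, t₃ ≠ 0 → Generic q (-g) (3 * g) tp tm →
                ∀ᶠ ε in 𝓝[>] (0 : ℝ),
                  ev3 P (tp * tm * t₃) (tp * tm⁻¹ * t₃) t₃ =
                    cycleInt q (-g) (3 * g) tp tm ε fun ym =>
                      kernelMInv q g tp tm ym *
                        (cCoef q g lam * t₃ ^ (∑ j, lam j) *
                          (ev S (ellPow q g (-(3 / 2)) * tp * ym) *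
                            ev S (ellPow q g (-(3 / 2)) * tp * ym⁻¹))))) := by
  refine ⟨opM q, isOperatorM_opM hq0 hq1,
    fun α β r hr hβ hαβ => opM_inverse hq0 hq1 hr hβ hαβ, fun g hg =>
    ⟨symM hq0 hq1 hg, fun Ψ x yp ym hx hyp hym => symM_integral hq0 hq1 hg Ψ hx hyp hym,
      fun Φ t₃ tp tm ht₃ htp htm => symM_symm_integral hq0 hq1 hg Φ ht₃ htp htm, ?_⟩⟩
  intro lam hlam
  have hS := isSepPoly_sepLaurent hq0 hq1 g hlam
  refine ⟨⟨sepLaurent q g lam, hS, fun S' hS' => eq_of_isSepPoly hq0 hq1 hS' hS⟩,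
    fun S hS' => ?_⟩
  rw [eq_of_isSepPoly hq0 hq1 hS' hS]
  exact ⟨isMacdonald_iff_eq_symM_symm hq0 hq1 hg hlam, fun P hP t₃ tp tm ht₃ hgen =>
    macdonald_integral hq0 hq1 hg hlam hP ht₃ hgen⟩
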